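/- **Setting.** Let $G$ be a semisimple algebraic group of adjoint type over $\mathbb C$ with Cartan subgroup $H$, opposite Borel subgroups $B^\pm=HU^\pm$ with unipotent radicals $U^\pm$, and root homomorphisms $x_s,y_s$ ($s\in S$ the simple roots) which for each $s$ come from a homomorphism $\varphi_s:SL_2\to G$. Let $g\mapsto g^{\mathsf T}$ be the anti-automorphism of $G$ with $x_s(t)^{\mathsf T}=y_s(t)$, $y_s(t)^{\mathsf T}=x_s(t)$, $h^{\mathsf T}=h$ for $h\in H$. Put $\overline{r}_s=\varphi_s\begin{pmatrix}0&-1\\1&0\end{pmatrix}$ and $\overline{w_0}=\overline r_{s_1}\cdots\overline r_{s_N}$ for a reduced word $(s_1,\dots,s_N)$ of the longest element $w_0$ of the Weyl group, $w_0(h)=\overline{w_0}h\overline{w_0}^{-1}$ for $h\in H$, and $g^*=\overline{w_0}(g^{-1})^{\mathsf T}\overline{w_0}^{-1}$ for $g\in G$. Write $X^*(H)$ for the character lattice, $h^\mu$ for the value of $\mu\in X^*(H)$ at $h\in H$, $\mu^*$ for the character with $h^{\mu^*}=(h^*)^\mu$, and $X^*(H)_+$ for the set of dominant characters. For $g\in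 G_0=U^-HU^+$ write $g=[g]_-[g]_0[g]_+$ with $[g]_\pm\in U^\pm$, $[g]_0\in H$. Let $U^\pm_*=U^\pm\cap B^\mp\overline{w_0}B^\mp$, let $\mathcal O(U_*^+)_\beta$ ($\beta\in X^*(H)$) be the space of $F\in\mathcal O(U^+_*)$ with $F(huh^{-1})=h^\beta F(u)$ for all $h\in H$, and let $$\eta_{w_0}:U^+_*\to U^+_*,\qquad u\mapsto[\overline{w_0}u^{\mathsf T}]_+ .$$ For $\lambda\in X^*(H)_+$ let $V(\lambda)$ be the irreducible representation of highest weight $\lambda$, with highest weight vector $v_\lambda$ and the symmetric bilinear form with $(v_\lambda,v_\lambda)=1$ and $(gx,y)=(x,g^{\mathsf T}y)$; put $\Delta_{\lambda,w_0\lambda}(g)=(v_\lambda,g\overline{w_0}v_\lambda)$. For $\xi\in X^*(H)$ let $\Delta^+_{w_0,\xi}=(\Delta_{\lambda_1,w_0\lambda_1})^{-1}\Delta_{\lambda_2,w_0\lambda_2}\in\mathcal O(U_*^+)$, restricted to $U^+_*$, for any $\lambda_1,\lambda_2\in X^*(H)_+$ with $-\lambda_1+\lambda_2=\xi$; it does not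 depend on the choice of $\lambda_1,\lambda_2$. $G$ acts on the flag variety $G/B^+$; write $B^+$ for its base point and $B^-=\overline{w_0}.B^+$. A pair of flags is generic if it lies in the $G$-orbit of $(B^+,B^-)$. A pinning over a generic pair $(B_1,B_2)$ is a point of $G/U^+$ over $B_1$; the standard pinning $p_{\rm std}$ over $(B^+,B^-)$ is the base point of $G/U^+$. $\mathrm{Conf}_3\mathcal P_G$ is the space of $G$-orbits $[B_1,B_2,B_3;p_{12},p_{23},p_{31}]$ of triples of flags with pinnings $p_{ij}$ over the generic pairs $(B_i,B_j)$, and $\mathcal S_3$ is the cyclic shift $[p_{12},p_{23},p_{31}]\mapsto[p_{23},p_{31},p_{12}]$. For $u\in U_*^+$ let $\phi'(u)$ be the unique element of $U^-_*$ with $\phi'(u).B^+=u.B^-$. The standard configuration is the isomorphism of varieties $$\mathcal C_3:H\times H\times U^+_*\xrightarrow{\ \sim\ }\mathrm{Conf}_3\mathcal P_G,\quad (h_1,h_2,u)\mapsto[B^+,B^-,u.B^-;\,p_{\rm std},\ \phi'(u)h_1\overline{w_0}.p_{\rm std},\ uh_2\overline{w_0}.p_{\rm std}].$$ For $\mu,\nu\in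 X^*(H)$ and $F\in\mathcal O(U_*^+)$ write $e_1^\mu\otimes e_2^\nu\otimes F$ for the function $(h_1,h_2,u)\mapsto h_1^\mu h_2^\nu F(u)$. For a triangle $T$ (a disk with three marked points on its boundary) let $\mathcal P_{G,T}$ be the moduli space of $G$-local systems on $T$ with a flat flag near each marked point and, over each boundary interval, a pinning over the pair of flags at its end points (in counterclockwise order). For a marked point $m$ let $f_m:\mathcal P_{G,T}\xrightarrow{\sim}\mathrm{Conf}_3\mathcal P_G$ be the identification which lists, at a common base point, the flags and the pinnings counterclockwise, starting from $m$ and from the boundary interval that follows $m$, and let $\mathcal C_{3,m}=f_m^{-1}\circ\mathcal C_3$. **Lemma.** (1) For $(h_1,h_2,u)\in H\times H\times U_*^+$ we have $\mathcal S_3(\mathcal C_3(h_1,h_2,u))=\mathcal C_3(h_1',h_2',u')$ with $$h_1'=h_1^*\,h_2\,w_0([u\overline{w_0}]_0),\qquad h_2'=h_1^*,\qquad u'=h_1^*\,\eta_{w_0}(u)^*\,(h_1^*)^{-1}.$$ (2) For all $\mu,\nu,\beta\in X^*(H)$ and $F\in\mathcal O(U^+_*)_\beta$, $$(\mathcal C_3^{-1}\circ\mathcal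 S_3\circ\mathcal C_3)^*(e_1^\mu\otimes e_2^\nu\otimes F)=e_1^{\mu^*+\nu^*+\beta^*}\otimes e_2^{\mu}\otimes\Delta^+_{w_0,-\mu^*-\beta}\cdot(\eta_{w_0}^*)^4(F).$$ (3) Let $\mathbb F$ be a basis of the vector space $\mathcal O(U_*^+)$ such that (G) every element of $\mathbb F$ lies in some $\mathcal O(U_*^+)_\beta$; (T) $\eta_{w_0}^*(\mathbb F)\subseteq\mathbb F$; (M) $\Delta^+_{w_0,\xi}\cdot F\in\mathbb F$ for all $\xi\in X^*(H)$ and $F\in\mathbb F$. Then for every marked point $m$ of $T$ the set $$\widetilde{\mathbb F}_T=\{(\mathcal C_{3,m}^*)^{-1}(e_1^\mu\otimes e_2^\nu\otimes F)\mid\mu,\nu\in X^*(H),\ F\in\mathbb F\}$$ is a basis of $\mathcal O(\mathcal P_{G,T})$, and it does not depend on $m$. -/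

import Mathlib

/-!
The ground field is `ℂ`. `P` is a reduced crystallographic root pairing with base `b`, its root
system being that of a semisimple algebraic group `G` of adjoint type with a fixed pinning. The group
`G` is realised by its adjoint representation: it is the group of invertible matrices, in a Chevalley
basis of the Lie algebra (indexed by the simple roots, for the Cartan subalgebra, together with the
roots), generated by the one-parameter subgroups `exp (t e_s)`, `exp (t f_s)` of the simple roots and
by the torus `Hom (root lattice, ℂˣ)`. Since a semisimple group of adjoint type is determined by
its root system up to isomorphism of pinned groups, every such group is of this form.
-/

set_option linter.unusedSectionVars false

namespace AdjointPinned

open RootPairing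

variable {ι M N : Type*} [Fintype ι] [DecidableEq ι] [AddCommGroup M] [Module ℂ M]
  [AddCommGroup N] [Module ℂ N] {P : RootPairing ι ℂ M N} [P.IsCrystallographic] [P.IsReduced]

noncomputable section

/-- The exponential of a nilpotent matrix, as an invertible matrix. -/
def expUnit {n : Type*} [Fintype n] [DecidableEq n] (a : Matrix n n ℂ) (ha : IsNilpotent a) :
    (Matrix n n ℂ)ˣ where
  val := IsNilpotent.exp a
  inv := IsNilpotent.exp (-a)
  val_inv := IsNilpotent.exp_mul_exp_neg_self ha
  inv_val := IsNilpotent.exp_neg_mul_exp_self ha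

/-- The ambient general linear group of the Lie algebra, in the Chevalley basis. -/
abbrev GLn (b : P.Base) := (Matrix (b.support ⊕ ι) (b.support ⊕ ι) ℂ)ˣ

variable (b : P.Base)

/-- `exp (t e_s)` in the adjoint representation. -/
def xGL (s : b.support) (t : ℂ) : GLn b :=
  expUnit (t • GeckConstruction.e s) ((GeckConstruction.isNilpotent_e s).smul t)

/-- `exp (t f_s)` in the adjoint representation. -/
def yGL (s : b.support) (t : ℂ) : GLn b :=
  expUnit (t • GeckConstruction.f s) ((GeckConstruction.isNilpotent_f s).smul t)

/-- The weights of the basis vectors: `0` on the Cartan subalgebra, `α` on the root space of `α`. -/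
def wt (b : P.Base) : b.support ⊕ ι → P.rootSpan ℤ := Sum.elim 0 (P.rootSpanMem ℤ)

/-- The torus `Hom (root lattice, ℂˣ)` acting through the weights. -/
def torGL (b : P.Base) : (Multiplicative (P.rootSpan ℤ) →* ℂˣ) →* GLn b where
  toFun χ :=
    { val := Matrix.diagonal fun i => (χ (.ofAdd (wt b i)) : ℂ)
      inv := Matrix.diagonal fun i => ((χ (.ofAdd (wt b i)))⁻¹ : ℂˣ)
      val_inv := by simp
      inv_val := by simp }
  map_one' := by ext1; simp
  map_mul' χ χ' := by ext1; simp

/-- The semisimple group `G` of adjoint type. -/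
def adjointGroup (b : P.Base) : Subgroup (GLn b) :=
  Subgroup.closure ({g | ∃ s t, g = xGL b s t} ∪ {g | ∃ s t, g = yGL b s t} ∪ Set.range (torGL b))

lemma e_apply_ne_zero (s : b.support) {i j : b.support ⊕ ι}
    (h : (GeckConstruction.e s : Matrix _ _ ℂ) i j ≠ 0) :
    wt b i = wt b j + P.rootSpanMem ℤ s := by
  let := P.indexNeg
  rcases i with i | i <;> rcases j with j | j <;>
    simp only [GeckConstruction.e, Matrix.fromBlocks_apply₁₁, Matrix.fromBlocks_apply₁₂,
      Matrix.fromBlocks_apply₂₁, Matrix.fromBlocks_apply₂₂, Matrix.of_apply, Matrix.zero_apply, ne_eq, ite_eq_right_iff, not_forall, not_true_eq_false] at h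
  · obtain ⟨⟨rfl, rfl⟩, -⟩ := h
    ext; simp [wt]
  · obtain ⟨rfl, -⟩ := h
    ext; simp [wt]
  · obtain ⟨h, -⟩ := h
    ext; simp [wt, h, add_comm]

lemma f_apply_ne_zero (s : b.support) {i j : b.support ⊕ ι}
    (h : (GeckConstruction.f s : Matrix _ _ ℂ) i j ≠ 0) :
    wt b j = wt b i + P.rootSpanMem ℤ s := by
  let := P.indexNeg
  rcases i with i | i <;> rcases j with j | j <;>
    simp only [GeckConstruction.f, Matrix.fromBlocks_apply₁₁, Matrix.fromBlocks_apply₁₂,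
      Matrix.fromBlocks_apply₂₁, Matrix.fromBlocks_apply₂₂, Matrix.of_apply, Matrix.zero_apply, ne_eq, ite_eq_right_iff, not_forall, not_true_eq_false] at h
  · obtain ⟨⟨rfl, rfl⟩, -⟩ := h
    ext; simp [wt]
  · obtain ⟨rfl, -⟩ := h
    ext; simp [wt]
  · obtain ⟨h, -⟩ := h
    ext; simp [wt, h]

/-- `exp a * X = (X + Y + Z) * exp a` if `[a, X] = Y`, `[a, Y] = 2 Z` and `[a, Z] = 0`. -/
lemma exp_mul_of_lie {n : Type*} [Fintype n] [DecidableEq n] {a X Y Z : Matrix n n ℂ}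
    (ha : IsNilpotent a) (h1 : a * X = X * a + Y) (h2 : a * Y = Y * a + (2 : ℂ) • Z)
    (h3 : a * Z = Z * a) :
    IsNilpotent.exp a * X = (X + Y + Z) * IsNilpotent.exp a := by
  set L : Module.End ℂ (Matrix n n ℂ) := LinearMap.mulLeft ℂ a
  set R : Module.End ℂ (Matrix n n ℂ) := LinearMap.mulRight ℂ a
  have hL : IsNilpotent L := ha.map (Algebra.lmul ℂ (Matrix n n ℂ))
  have hR : IsNilpotent R := by
    obtain ⟨k, hk⟩ := ha
    exact ⟨k, by rw [LinearMap.pow_mulRight, hk]; simp⟩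
  have hc : Commute L R := LinearMap.commute_mulLeft_right ..
  have hLR : IsNilpotent (L - R) := hc.isNilpotent_sub hL hR
  have key : IsNilpotent.exp L = IsNilpotent.exp R * IsNilpotent.exp (L - R) := by
    rw [← IsNilpotent.exp_add_of_commute _ hR hLR]
    · congr 1; abel
    · exact (hc.symm.sub_right (Commute.refl R))
  have eL : ∀ W, IsNilpotent.exp L W = IsNilpotent.exp a * W := by
    intro W
    have := IsNilpotent.map_exp ha (Algebra.lmul ℂ (Matrix n n ℂ))
    change _ = IsNilpotent.exp L at this
    rw [← this]; rfl
  have eR : ∀ W, IsNilpotent.exp R W = W * IsNilpotent.exp a := by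
    intro W
    obtain ⟨k, hk⟩ := ha
    have hk' : R ^ k = 0 := by rw [LinearMap.pow_mulRight, hk]; simp
    rw [IsNilpotent.exp_eq_sum hk, IsNilpotent.exp_eq_sum hk', Finset.mul_sum,
      LinearMap.sum_apply]
    refine Finset.sum_congr rfl fun i _ => ?_
    rw [LinearMap.smul_apply, LinearMap.pow_mulRight]
    simp
  have d1 : (L - R) X = Y := by simp [L, R, h1]
  have d2 : (L - R) Y = (2 : ℂ) • Z := by simp [L, R, h2]
  have d3 : (L - R) Z = 0 := by simp [L, R, h3]
  have : IsNilpotent.exp (L - R) X = X + Y + Z := by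
    have h0 : ((L - R) ^ 3) • X = 0 := by
      simp [pow_succ, d1, d2, d3, Module.End.mul_apply]
    have := IsNilpotent.exp_smul_eq_sum h0 hLR
    change IsNilpotent.exp (L - R) X = _ at this
    rw [this]
    simp [Finset.sum_range_succ, pow_succ, d1, d2, Module.End.mul_apply, Nat.factorial]
    ext i j
    simp
    rw [Rat.smul_def]
    push_cast
    ring
  rw [← eL, key, Module.End.mul_apply, this, eR]

/-- The root homomorphism `x_s`. -/
def xG (s : b.support) (t : ℂ) : adjointGroup b :=
  ⟨xGL b s t, Subgroup.subset_closure (.inl (.inl ⟨s, t, rfl⟩))⟩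

/-- The root homomorphism `y_s`. -/
def yG (s : b.support) (t : ℂ) : adjointGroup b :=
  ⟨yGL b s t, Subgroup.subset_closure (.inl (.inr ⟨s, t, rfl⟩))⟩

/-- The parametrisation of the Cartan subgroup by `Hom (root lattice, ℂˣ)`. -/
def torG (b : P.Base) : (Multiplicative (P.rootSpan ℤ) →* ℂˣ) →* adjointGroup b :=
  (torGL b).codRestrict _ fun χ => Subgroup.subset_closure (.inr ⟨χ, rfl⟩)

/-- The lift `x_s(-1) y_s(1) x_s(-1)` of the simple reflection `r_s`: the image of the matrix
with rows `(0, -1)` and `(1, 0)` under the homomorphism from `SL₂` attached to `s`. -/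
def nBar (s : b.support) : adjointGroup b := xG b s (-1) * yG b s 1 * xG b s (-1)

/-- The diagonal matrix by which an element of the Cartan subalgebra acts. -/
def dMat (b : P.Base) (φ : Module.Dual ℂ M) : Matrix (b.support ⊕ ι) (b.support ⊕ ι) ℂ :=
  Matrix.diagonal fun i => φ (wt b i : M)

lemma e_mul_dMat (s : b.support) (φ : Module.Dual ℂ M) :
    (GeckConstruction.e s : Matrix _ _ ℂ) * dMat b φ =
      dMat b φ * GeckConstruction.e s - φ (P.root s) • GeckConstruction.e s := by
  ext i j
  by_cases h : (GeckConstruction.e s : Matrix _ _ ℂ) i j = 0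
  · simp [dMat, h]
  · simp [dMat, e_apply_ne_zero b s h]; ring

lemma f_mul_dMat (s : b.support) (φ : Module.Dual ℂ M) :
    (GeckConstruction.f s : Matrix _ _ ℂ) * dMat b φ =
      dMat b φ * GeckConstruction.f s + φ (P.root s) • GeckConstruction.f s := by
  ext i j
  by_cases h : (GeckConstruction.f s : Matrix _ _ ℂ) i j = 0
  · simp [dMat, h]
  · simp [dMat, f_apply_ne_zero b s h]; ring

lemma h_eq_dMat (s : b.support) :
    (GeckConstruction.h s : Matrix _ _ ℂ) = dMat b (P.coroot' s) := by
  rw [GeckConstruction.h_eq_diagonal, dMat]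
  congr 1
  ext (i | i)
  · simp [wt]
  · simpa [wt] using P.algebraMap_pairingIn ℤ i s

lemma nBar_mul_dMat (s : b.support) (φ : Module.Dual ℂ M) :
    ((nBar b s : GLn b) : Matrix _ _ ℂ) * dMat b φ =
      (dMat b φ - φ (P.root s) • GeckConstruction.h s) * ((nBar b s : GLn b) : Matrix _ _ ℂ) := by
  set e : Matrix _ _ ℂ := GeckConstruction.e s with he
  set f : Matrix _ _ ℂ := GeckConstruction.f s with hf
  set h : Matrix _ _ ℂ := GeckConstruction.h s with hh
  set c := φ (P.root s) with hc
  set D := dMat b φ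
  have hn : ((nBar b s : GLn b) : Matrix _ _ ℂ) =
      IsNilpotent.exp (-e) * IsNilpotent.exp f * IsNilpotent.exp (-e) := by
    simp [nBar, xG, yG, xGL, yGL, expUnit, e, f]
  have ne : IsNilpotent (-e) := (GeckConstruction.isNilpotent_e s).neg
  have nf : IsNilpotent f := GeckConstruction.isNilpotent_f s
  have eD : e * D = D * e - c • e := e_mul_dMat b s φ
  have fD : f * D = D * f + c • f := f_mul_dMat b s φ
  have eh : e * h = h * e - (2 : ℂ) • e := by
    rw [hh, h_eq_dMat, e_mul_dMat]; simp [he]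
  have fh : f * h = h * f + (2 : ℂ) • f := by
    rw [hh, h_eq_dMat, f_mul_dMat]; simp [hf]
  have ef : f * e = e * f - h := by
    have := GeckConstruction.lie_e_f_same (R := ℂ) s
    rw [Ring.lie_def] at this
    rw [hh, ← this]; abel
  have A1 : IsNilpotent.exp (-e) * D = (D + c • e + 0) * IsNilpotent.exp (-e) :=
    exp_mul_of_lie ne (by rw [neg_mul, eD]; simp; abel) (by simp) (by simp)
  have A2 : IsNilpotent.exp f * (D + c • e) =
      ((D + c • e) + (c • f - c • h) + (-(c • f))) * IsNilpotent.exp f :=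
    exp_mul_of_lie nf
      (by simp only [mul_add, add_mul, mul_smul_comm, smul_mul_assoc, fD, ef]; module)
      (by simp only [mul_sub, sub_mul, mul_smul_comm, smul_mul_assoc, fh]; module) (by simp)
  have A3 : IsNilpotent.exp (-e) * (D + c • e - c • h) =
      (D + c • e - c • h + (-(c • e)) + 0) * IsNilpotent.exp (-e) :=
    exp_mul_of_lie ne
      (by simp only [mul_add, add_mul, mul_sub, sub_mul, mul_smul_comm, smul_mul_assoc, neg_mul,
            mul_neg, eD, eh]; module)
      (by simp) (by simp)
  have e2 : ((D + c • e) + (c • f - c • h) + (-(c • f))) = D + c • e - c • h := by abel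
  have e3 : (D + c • e - c • h + (-(c • e)) + 0) = D - c • h := by abel
  rw [add_zero] at A1
  rw [e2] at A2
  rw [e3] at A3
  rw [hn, mul_assoc, A1, ← mul_assoc, mul_assoc (IsNilpotent.exp (-e)), A2, ← mul_assoc, A3]
  simp only [mul_assoc]

lemma nBar_apply_ne_zero (s : b.support) {i j : b.support ⊕ ι}
    (hij : ((nBar b s : GLn b) : Matrix _ _ ℂ) i j ≠ 0) :
    wt b j = wt b i - P.coroot'In ℤ s (wt b i) • P.rootSpanMem ℤ s := by
  ext
  rw [← sub_eq_zero, ← Module.forall_dual_apply_eq_zero_iff ℂ]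
  intro φ
  have := congr_fun (congr_fun (nBar_mul_dMat b s φ) i) j
  have h2 := P.algebraMap_coroot'In_apply ℤ s (wt b i)
  rw [h_eq_dMat] at this
  have h3 : dMat b φ - φ (P.root s) • dMat b (P.coroot' s) =
      Matrix.diagonal fun i => φ (wt b i : M) - φ (P.root s) * P.coroot' s (wt b i) := by
    simp [dMat, ← Matrix.diagonal_smul]
  rw [h3, dMat, Matrix.mul_diagonal, Matrix.diagonal_mul, mul_comm] at this
  have := mul_right_cancel₀ hij this
  simp [this, ← h2]
  ring

/-- The action of a simple reflection on the torus. -/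
def reflectHom (s : b.support) (χ : Multiplicative (P.rootSpan ℤ) →* ℂˣ) :
    Multiplicative (P.rootSpan ℤ) →* ℂˣ where
  toFun x := χ x * (χ (.ofAdd (P.rootSpanMem ℤ s))) ^ (-(P.coroot'In ℤ s x.toAdd))
  map_one' := by simp
  map_mul' x y := by
    rw [map_mul, toAdd_mul, map_add, neg_add, zpow_add, mul_mul_mul_comm]

lemma nBar_mul_torG (s : b.support) (χ : Multiplicative (P.rootSpan ℤ) →* ℂˣ) :
    nBar b s * torG b χ = torG b (reflectHom b s χ) * nBar b s := by
  ext i j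
  have e1 : ∀ χ, (((torG b χ : GLn b)) : Matrix (b.support ⊕ ι) (b.support ⊕ ι) ℂ) =
      Matrix.diagonal fun i => (χ (.ofAdd (wt b i)) : ℂ) := fun _ => rfl
  rw [Subgroup.coe_mul, Subgroup.coe_mul, Units.val_mul, Units.val_mul, e1, e1]
  rw [Matrix.mul_diagonal, Matrix.diagonal_mul, mul_comm]
  by_cases h : ((nBar b s : GLn b) : Matrix _ _ ℂ) i j = 0
  · simp [h]
  · congr 1
    rw [nBar_apply_ne_zero b s h, sub_eq_add_neg, ← neg_smul, ofAdd_add, map_mul, ofAdd_zsmul,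
      map_zpow]
    rfl

lemma nBar_conj_torG (s : b.support) (χ : Multiplicative (P.rootSpan ℤ) →* ℂˣ) :
    nBar b s * torG b χ * (nBar b s)⁻¹ = torG b (reflectHom b s χ) := by
  rw [nBar_mul_torG, mul_inv_cancel_right]

/-- The element of the torus taking the value `-1` at all simple roots. -/
def signHom (b : P.Base) : Multiplicative (P.rootSpan ℤ) →* ℂˣ where
  toFun x := (-1) ^ (∑ s, b.toWeightBasisInt.repr x.toAdd s)
  map_one' := by simp
  map_mul' x y := by simp [Finset.sum_add_distrib, zpow_add]

lemma signHom_simple (s : b.support) : signHom b (.ofAdd (P.rootSpanMem ℤ s)) = -1 := by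
  have : P.rootSpanMem ℤ s = b.toWeightBasisInt s := by ext; simp
  simp [signHom, this, Finsupp.single_apply]

/-- The involution of the Lie algebra exchanging `e_s` and `f_s` up to a common sign. -/
def omegaGL (b : P.Base) : GLn b where
  val := GeckConstruction.ω b
  inv := GeckConstruction.ω b
  val_inv := GeckConstruction.ω_mul_ω
  inv_val := GeckConstruction.ω_mul_ω

/-- The Chevalley involution `x_s(t) ↦ y_s(-t)`, `y_s(t) ↦ x_s(-t)`, `h ↦ h⁻¹`
(see `chevalley_xGL`, `chevalley_yGL`, `chevalley_torGL`). -/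
def chevalley (b : P.Base) : GLn b ≃* GLn b := MulAut.conj (omegaGL b * torGL b (signHom b))

lemma conj_exp {n : Type*} [Fintype n] [DecidableEq n] (u : (Matrix n n ℂ)ˣ) {a : Matrix n n ℂ}
    (ha : IsNilpotent a) :
    (u : Matrix n n ℂ) * IsNilpotent.exp a * (u⁻¹ : (Matrix n n ℂ)ˣ) =
      IsNilpotent.exp (u * a * (u⁻¹ : (Matrix n n ℂ)ˣ)) := by
  have := IsNilpotent.exp_smul (ConjAct.toConjAct u) ha
  simpa [ConjAct.units_smul_def] using this.symm

lemma torGL_mul_e (χ : Multiplicative (P.rootSpan ℤ) →* ℂˣ) (s : b.support) :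
    ((torGL b χ : GLn b) : Matrix _ _ ℂ) * GeckConstruction.e s =
      (χ (.ofAdd (P.rootSpanMem ℤ s)) : ℂ) •
        (GeckConstruction.e s * ((torGL b χ : GLn b) : Matrix _ _ ℂ)) := by
  ext i j
  by_cases h : (GeckConstruction.e s : Matrix _ _ ℂ) i j = 0
  · simp [torGL, h]
  · simp [torGL, e_apply_ne_zero b s h]; ring

lemma torGL_mul_f (χ : Multiplicative (P.rootSpan ℤ) →* ℂˣ) (s : b.support) :
    (χ (.ofAdd (P.rootSpanMem ℤ s)) : ℂ) •
      (((torGL b χ : GLn b) : Matrix _ _ ℂ) * GeckConstruction.f s) =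
        (GeckConstruction.f s * ((torGL b χ : GLn b) : Matrix _ _ ℂ)) := by
  ext i j
  by_cases h : (GeckConstruction.f s : Matrix _ _ ℂ) i j = 0
  · simp [torGL, h]
  · simp [torGL, f_apply_ne_zero b s h]; ring

lemma omega_mul_torGL (χ : Multiplicative (P.rootSpan ℤ) →* ℂˣ) :
    omegaGL b * torGL b χ = (torGL b χ)⁻¹ * omegaGL b := by
  let := P.indexNeg
  ext i j
  have e1 : ((torGL b χ : GLn b) : Matrix (b.support ⊕ ι) (b.support ⊕ ι) ℂ) =
      Matrix.diagonal fun i => (χ (.ofAdd (wt b i)) : ℂ) := rfl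
  have e2 : (((torGL b χ)⁻¹ : GLn b) : Matrix (b.support ⊕ ι) (b.support ⊕ ι) ℂ) =
      Matrix.diagonal fun i => (((χ (.ofAdd (wt b i)))⁻¹ : ℂˣ) : ℂ) := rfl
  have e3 : (omegaGL b : Matrix (b.support ⊕ ι) (b.support ⊕ ι) ℂ) = GeckConstruction.ω b := rfl
  rw [Units.val_mul, Units.val_mul, e1, e2, e3]
  rw [Matrix.mul_diagonal, Matrix.diagonal_mul]
  rcases i with i | i <;> rcases j with j | j
  · simp [GeckConstruction.ω, Matrix.one_apply, wt]
  · simp [GeckConstruction.ω]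
  · simp [GeckConstruction.ω]
  · by_cases h : i = -j
    · subst h
      have : P.rootSpanMem ℤ (-j) = - P.rootSpanMem ℤ j := by ext; simp
      simp only [GeckConstruction.ω, wt, Sum.elim_inr, this]
      simp
    · have h' : ¬ i = P.reflectionPerm j j := h
      simp [GeckConstruction.ω, h']

lemma xGL_inv (s : b.support) (t : ℂ) : (xGL b s t)⁻¹ = xGL b s (-t) := by
  ext1; change IsNilpotent.exp _ = IsNilpotent.exp _; simp

lemma yGL_inv (s : b.support) (t : ℂ) : (yGL b s t)⁻¹ = yGL b s (-t) := by
  ext1; change IsNilpotent.exp _ = IsNilpotent.exp _; simp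

lemma chevalley_xGL (s : b.support) (t : ℂ) : chevalley b (xGL b s t) = yGL b s (-t) := by
  have h1 : omegaGL b * torGL b (signHom b) * xGL b s t =
     yGL b s (-t) * (omegaGL b * torGL b (signHom b)) := by
    rw [← mul_inv_eq_iff_eq_mul]
    ext1
    have := conj_exp (omegaGL b * torGL b (signHom b)) ((GeckConstruction.isNilpotent_e s).smul t)
    refine this.trans ?_
    change _ = IsNilpotent.exp _
    congr 1
    rw [Units.mul_inv_eq_iff_eq_mul]
    have h2 := torGL_mul_e b (signHom b) s
    have h3 : (omegaGL b : Matrix _ _ ℂ) * GeckConstruction.e s = GeckConstruction.f s * (omegaGL b : Matrix _ _ ℂ) :=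
      GeckConstruction.ω_mul_e s
    rw [signHom_simple] at h2
    rw [Units.val_mul, mul_assoc, mul_smul_comm, h2, mul_smul_comm, mul_smul_comm, ← mul_assoc, h3]
    simp [mul_assoc]
  rw [chevalley, MulAut.conj_apply, h1, mul_inv_cancel_right]

lemma chevalley_yGL (s : b.support) (t : ℂ) : chevalley b (yGL b s t) = xGL b s (-t) := by
  have h1 : omegaGL b * torGL b (signHom b) * yGL b s t =
     xGL b s (-t) * (omegaGL b * torGL b (signHom b)) := by
    rw [← mul_inv_eq_iff_eq_mul]
    ext1
    have := conj_exp (omegaGL b * torGL b (signHom b)) ((GeckConstruction.isNilpotent_f s).smul t)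
    refine this.trans ?_
    change _ = IsNilpotent.exp _
    congr 1
    rw [Units.mul_inv_eq_iff_eq_mul]
    have h2 := torGL_mul_f b (signHom b) s
    have h3 : (omegaGL b : Matrix _ _ ℂ) * GeckConstruction.f s = GeckConstruction.e s * (omegaGL b : Matrix _ _ ℂ) :=
      GeckConstruction.ω_mul_f s
    rw [signHom_simple] at h2
    simp only [Units.val_neg, Units.val_one, neg_smul, one_smul] at h2
    rw [neg_eq_iff_eq_neg] at h2
    rw [Units.val_mul, mul_assoc, mul_smul_comm, h2, mul_smul_comm, mul_neg, ← mul_assoc, h3]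
    simp [mul_assoc]
  rw [chevalley, MulAut.conj_apply, h1, mul_inv_cancel_right]

lemma chevalley_torGL (χ : Multiplicative (P.rootSpan ℤ) →* ℂˣ) :
    chevalley b (torGL b χ) = (torGL b χ)⁻¹ := by
  rw [chevalley, MulAut.conj_apply, mul_assoc (omegaGL b), ← map_mul, mul_comm (signHom b), map_mul,
    ← mul_assoc, omega_mul_torGL]
  group

lemma chevalley_mem {g : GLn b} (hg : g ∈ adjointGroup b) : chevalley b g ∈ adjointGroup b := by
  suffices adjointGroup b ≤ (adjointGroup b).comap (chevalley b).toMonoidHom from this hg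
  refine (Subgroup.closure_le _).mpr ?_
  rintro g ((⟨s, t, rfl⟩ | ⟨s, t, rfl⟩) | ⟨χ, rfl⟩)
  · change chevalley b _ ∈ adjointGroup b
    exact (chevalley_xGL b s t).symm ▸ (yG b s (-t)).2
  · change chevalley b _ ∈ adjointGroup b
    exact (chevalley_yGL b s t).symm ▸ (xG b s (-t)).2
  · change chevalley b _ ∈ adjointGroup b
    exact (chevalley_torGL b χ).symm ▸ inv_mem (torG b χ).2

/-- The transposition `g ↦ gᵀ`, the involutive anti-automorphism with `x_s(t)ᵀ = y_s(t)`,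
`y_s(t)ᵀ = x_s(t)`, `hᵀ = h`; these properties are proved below. -/
def transpose (g : adjointGroup b) : adjointGroup b :=
  ⟨(chevalley b g)⁻¹, inv_mem (chevalley_mem b g.2)⟩

lemma transpose_mul (g g' : adjointGroup b) : transpose b (g * g') = transpose b g' * transpose b g := by
  ext1; simp [transpose]

lemma transpose_xG (s : b.support) (t : ℂ) : transpose b (xG b s t) = yG b s t := by
  ext1; simp [transpose, xG, yG, chevalley_xGL, yGL_inv]

lemma transpose_yG (s : b.support) (t : ℂ) : transpose b (yG b s t) = xG b s t := by
  ext1; simp [transpose, xG, yG, chevalley_yGL, xGL_inv]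

lemma transpose_torG (χ : Multiplicative (P.rootSpan ℤ) →* ℂˣ) :
    transpose b (torG b χ) = torG b χ := by
  ext1
  change (chevalley b (torGL b χ))⁻¹ = torGL b χ
  rw [chevalley_torGL, inv_inv]

/-- The Cartan subgroup `H`. -/
def cartan (b : P.Base) : Subgroup (adjointGroup b) := (torG b).range

/-- The maximal unipotent subgroup `U⁺`, which is generated by the `x_s`. -/
def unipPos : Subgroup (adjointGroup b) := Subgroup.closure {g | ∃ s t, g = xG b s t}

/-- The maximal unipotent subgroup `U⁻`, which is generated by the `y_s`. -/
def unipNeg : Subgroup (adjointGroup b) := Subgroup.closure {g | ∃ s t, g = yG b s t}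

/-- The Borel subgroup `B⁺ = H U⁺`. -/
def borelPos : Subgroup (adjointGroup b) := cartan b ⊔ unipPos b

/-- The Borel subgroup `B⁻ = H U⁻`. -/
def borelNeg : Subgroup (adjointGroup b) := cartan b ⊔ unipNeg b

/-- The Weyl group element given by a word in the simple reflections. -/
def weylWord {b : P.Base} (w : List b.support) : M ≃ₗ[ℂ] M :=
  (w.map fun s => P.reflection s).prod

/-- A word of minimal length among those with the same value. -/
def IsReducedWord {b : P.Base} (w : List b.support) : Prop :=
  ∀ w' : List b.support, weylWord w' = weylWord w → w.length ≤ w'.length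

/-- A reduced word of the longest element `w₀`. -/
def IsLongestWord {b : P.Base} (w : List b.support) : Prop :=
  IsReducedWord w ∧ ∀ w' : List b.support, IsReducedWord w' → w'.length ≤ w.length

variable {b} (w : List b.support)

/-- The lift of a Weyl group element given by a reduced word; for a reduced word of `w₀` this
is the lift of `w₀`. -/
def wBar : adjointGroup b := (w.map (nBar b)).prod

lemma wBar_conj_mem {h : adjointGroup b} (hh : h ∈ cartan b) :
    wBar w * h * (wBar w)⁻¹ ∈ cartan b := by
  induction w with
  | nil => simpa [wBar] using hh
  | cons s w ih =>
    obtain ⟨χ, hχ⟩ := ih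
    refine ⟨reflectHom b s χ, ?_⟩
    rw [← nBar_conj_torG, hχ]
    simp [wBar, mul_assoc]

/-- The involution `g ↦ g* = w̄₀ (g⁻¹)ᵀ w̄₀⁻¹` of `G`. -/
def starG : adjointGroup b →* adjointGroup b where
  toFun g := wBar w * transpose b g⁻¹ * (wBar w)⁻¹
  map_one' := by simp [transpose]
  map_mul' g g' := by simp [transpose_mul, mul_assoc]

lemma transpose_of_mem_cartan {h : adjointGroup b} (hh : h ∈ cartan b) : transpose b h = h := by
  obtain ⟨χ, rfl⟩ := hh
  exact transpose_torG b χ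

/-- The action `h ↦ w₀(h) = w̄₀ h w̄₀⁻¹` of `w₀` on `H`. -/
def w₀H : cartan b →* cartan b where
  toFun h := ⟨wBar w * h * (wBar w)⁻¹, wBar_conj_mem w h.2⟩
  map_one' := by ext1; simp
  map_mul' h h' := by ext1; simp [mul_assoc]

/-- The involution `h ↦ h*` on `H`. -/
def starH : cartan b →* cartan b where
  toFun h := ⟨starG w h, by
    change wBar w * transpose b (h : adjointGroup b)⁻¹ * (wBar w)⁻¹ ∈ cartan b
    rw [transpose_of_mem_cartan (inv_mem h.2)]
    exact wBar_conj_mem w (inv_mem h.2)⟩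
  map_one' := by ext1; simp
  map_mul' h h' := by ext1; simp

section Regular

open MvPolynomial

variable {Y σ : Type*}

/-- `c` embeds `Y` into an affine space with coordinates indexed by `σ`; `f` is a regular function
on the (locally closed) image, that is, locally a quotient of polynomials in the coordinates. -/
def IsRegular (c : Y → σ → ℂ) (f : Y → ℂ) : Prop :=
  ∀ y, ∃ p q : MvPolynomial σ ℂ, eval (c y) q ≠ 0 ∧
    ∀ z, eval (c z) q ≠ 0 → f z = eval (c z) p / eval (c z) q

lemma IsRegular.eval_comp (c : Y → σ → ℂ) (p : MvPolynomial σ ℂ) :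
    IsRegular c fun y => eval (c y) p :=
  fun _ => ⟨p, 1, by simp, by simp⟩

lemma IsRegular.add {c : Y → σ → ℂ} {f g : Y → ℂ} (hf : IsRegular c f) (hg : IsRegular c g) :
    IsRegular c (f + g) := by
  intro y
  obtain ⟨p, q, h, hp⟩ := hf y
  obtain ⟨p', q', h', hp'⟩ := hg y
  refine ⟨p * q' + p' * q, q * q', by simp [h, h'], fun z hz => ?_⟩
  simp only [map_mul, ne_eq, mul_eq_zero, not_or] at hz
  simp only [Pi.add_apply, hp z hz.1, hp' z hz.2, map_add, map_mul]
  have := hz.1; have := hz.2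
  field_simp

lemma IsRegular.mul {c : Y → σ → ℂ} {f g : Y → ℂ} (hf : IsRegular c f) (hg : IsRegular c g) :
    IsRegular c (f * g) := by
  intro y
  obtain ⟨p, q, h, hp⟩ := hf y
  obtain ⟨p', q', h', hp'⟩ := hg y
  refine ⟨p * p', q * q', by simp [h, h'], fun z hz => ?_⟩
  simp only [map_mul, ne_eq, mul_eq_zero, not_or] at hz
  simp only [Pi.mul_apply, hp z hz.1, hp' z hz.2, map_mul]
  have := hz.1; have := hz.2
  field_simp

lemma IsRegular.div {c : Y → σ → ℂ} {f g : Y → ℂ} (hf : IsRegular c f) (hg : IsRegular c g)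
    (h0 : ∀ y, g y ≠ 0) : IsRegular c (f / g) := by
  intro y
  obtain ⟨p, q, h, hp⟩ := hf y
  obtain ⟨p', q', h', hp'⟩ := hg y
  have h1 : eval (c y) p' ≠ 0 := by
    have := h0 y
    rw [hp' y h'] at this
    exact (div_ne_zero_iff.mp this).1
  refine ⟨p * q' * q', q * p' * q', by simp [h, h', h1], fun z hz => ?_⟩
  simp only [map_mul, ne_eq, mul_eq_zero, not_or] at hz
  simp only [Pi.div_apply, hp z hz.1.1, hp' z hz.2, map_mul]
  have := hz.1.1; have := hz.1.2; have := hz.2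
  field_simp

/-- The algebra of regular functions. -/
def regularFunctions (c : Y → σ → ℂ) : Subalgebra ℂ (Y → ℂ) where
  carrier := {f | IsRegular c f}
  mul_mem' := IsRegular.mul
  add_mem' := IsRegular.add
  algebraMap_mem' r := fun _ => ⟨C r, 1, by simp, by simp [Pi.algebraMap_apply]⟩

lemma eval_mem_of_mem {τ : Type*} {c : Y → σ → ℂ} {d : Y → τ → ℂ}
    (h : ∀ i, IsRegular c fun y => d y i) (p : MvPolynomial τ ℂ) :
    IsRegular c fun y => eval (d y) p := by
  change (fun y => eval (d y) p) ∈ regularFunctions c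
  induction p using MvPolynomial.induction_on with
  | C a =>
    have h0 : (fun y => eval (d y) (C a)) = algebraMap ℂ (Y → ℂ) a := by ext; simp
    exact h0 ▸ (regularFunctions c).algebraMap_mem a
  | add p q hp hq =>
    have h0 : (fun y => eval (d y) (p + q)) =
        (fun y => eval (d y) p) + fun y => eval (d y) q := by ext; simp
    exact h0 ▸ add_mem hp hq
  | mul_X p i hp =>
    have h0 : (fun y => eval (d y) (p * X i)) = (fun y => eval (d y) p) * fun y => d y i := by
      ext; simp
    exact h0 ▸ mul_mem hp (h i)

lemma IsRegular.of_locally_div {c : Y → σ → ℂ} {f : Y → ℂ}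
    (h : ∀ y, ∃ F G, IsRegular c F ∧ IsRegular c G ∧ G y ≠ 0 ∧ ∀ z, G z ≠ 0 → f z = F z / G z) :
    IsRegular c f := by
  intro y
  obtain ⟨F, G, hF, hG, hy, H⟩ := h y
  obtain ⟨p, q, h, hp⟩ := hF y
  obtain ⟨p', q', h', hp'⟩ := hG y
  have h1 : eval (c y) p' ≠ 0 := by
    rw [hp' y h'] at hy
    exact (div_ne_zero_iff.mp hy).1
  refine ⟨p * q' * q', q * p' * q', by simp [h, h', h1], fun z hz => ?_⟩
  simp only [map_mul, ne_eq, mul_eq_zero, not_or] at hz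
  have a1 := hz.1.1; have a2 := hz.1.2; have a3 := hz.2
  have hGz : G z ≠ 0 := by rw [hp' z a3]; exact div_ne_zero a2 a3
  rw [H z hGz, hp z a1, hp' z a3]
  simp only [map_mul]
  field_simp

lemma IsRegular.comp {Z τ : Type*} {c : Y → σ → ℂ} {d : Z → τ → ℂ} {f : Z → ℂ}
    (hf : IsRegular d f) (φ : Y → Z) (h : ∀ i, IsRegular c fun y => d (φ y) i) :
    IsRegular c (f ∘ φ) := by
  refine IsRegular.of_locally_div fun y => ?_
  obtain ⟨p, q, hq, hp⟩ := hf (φ y)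
  exact ⟨_, _, eval_mem_of_mem h p, eval_mem_of_mem h q, hq, fun z hz => hp _ hz⟩

end Regular

/-- The matrix entries, as coordinates on `G`. -/
def entries (g : adjointGroup b) : (b.support ⊕ ι) × (b.support ⊕ ι) → ℂ :=
  fun p => ((g : GLn b) : Matrix (b.support ⊕ ι) (b.support ⊕ ι) ℂ) p.1 p.2

/-- The matrix entries of several elements, as coordinates on a power of `G`. -/
def entriesPi {k : ℕ} (g : Fin k → adjointGroup b) :
    Fin k × (b.support ⊕ ι) × (b.support ⊕ ι) → ℂ :=
  fun p => entries (g p.1) p.2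

variable (b) in
/-- The regular homomorphisms `H → ℂˣ`. -/
def charGroup : Subgroup (cartan b →* ℂˣ) where
  carrier := {χ | IsRegular (fun h : cartan b => entries (h : adjointGroup b)) fun h => (χ h : ℂ)}
  one_mem' := (regularFunctions _).one_mem
  mul_mem' hχ hχ' := hχ.mul hχ'
  inv_mem' {χ} hχ := by
    have h0 : (fun h => ((χ⁻¹ h : ℂˣ) : ℂ)) = 1 / fun h => (χ h : ℂ) := by ext h; simp
    change IsRegular _ fun h => ((χ⁻¹ h : ℂˣ) : ℂ)
    rw [h0]
    exact IsRegular.div (regularFunctions _).one_mem hχ (fun h => (χ h).ne_zero)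

variable (b) in
/-- The character lattice `X^*(H)`, written additively. -/
abbrev CharLattice := Additive (charGroup b)

/-- The value `h^μ`. -/
def ev (μ : CharLattice b) (h : cartan b) : ℂ :=
  ((μ.toMul : cartan b →* ℂˣ) h : ℂ)

lemma isRegular_inv_entries (k l : b.support ⊕ ι) :
    IsRegular (fun h : cartan b => entries (h : adjointGroup b))
      (fun h => entries ((h : adjointGroup b)⁻¹) (k, l)) := by
  by_cases hkl : k = l
  · subst hkl
    have h1 : IsRegular (fun h : cartan b => entries (h : adjointGroup b))
        (fun h : cartan b => entries (h : adjointGroup b) (k, k)) := by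
      simpa using IsRegular.eval_comp (fun h : cartan b => entries (h : adjointGroup b))
        (MvPolynomial.X (k, k))
    have h2 : ∀ h : cartan b, entries (h : adjointGroup b) (k, k) ≠ 0 := by
      rintro ⟨_, χ, rfl⟩
      simp [entries, torG, torGL]
    have h3 : (fun h : cartan b => entries ((h : adjointGroup b)⁻¹) (k, k)) =
        1 / fun h : cartan b => entries (h : adjointGroup b) (k, k) := by
      ext ⟨_, χ, rfl⟩
      rw [← map_inv]
      simp [entries, torG, torGL]
    exact h3 ▸ IsRegular.div (regularFunctions _).one_mem h1 h2
  · have h3 : (fun h : cartan b => entries ((h : adjointGroup b)⁻¹) (k, l)) = 0 := by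
      ext ⟨_, χ, rfl⟩
      rw [← map_inv]
      simp [entries, torG, torGL, hkl]
    exact h3 ▸ (regularFunctions _).zero_mem

lemma isRegular_starH (i) :
    IsRegular (fun h : cartan b => entries (h : adjointGroup b))
      (fun h => entries (starH w h : adjointGroup b) i) := by
  have h0 : (fun h => entries (starH w h : adjointGroup b) i) =
      ∑ l, ∑ k, (entries (wBar w) (i.1, k) * entries (wBar w)⁻¹ (l, i.2)) •
        fun h : cartan b => entries ((h : adjointGroup b)⁻¹) (k, l) := by
    ext h
    have h1 : (starH w h : adjointGroup b) =
        wBar w * (h : adjointGroup b)⁻¹ * (wBar w)⁻¹ := by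
      change wBar w * transpose b (h : adjointGroup b)⁻¹ * (wBar w)⁻¹ = _
      rw [transpose_of_mem_cartan (inv_mem h.2)]
    rw [h1]
    simp only [entries, Subgroup.coe_mul, Units.val_mul, Matrix.mul_apply, Finset.sum_apply,
      Pi.smul_apply, smul_eq_mul, Finset.sum_mul]
    refine Finset.sum_congr rfl fun l _ => Finset.sum_congr rfl fun k _ => ?_
    ring
  rw [h0]
  change _ ∈ regularFunctions _
  exact sum_mem fun l _ => sum_mem fun k _ => Subalgebra.smul_mem _ (isRegular_inv_entries k l) _

/-- The dual character `μ*`, `h ↦ (h*)^μ`; it equals `-w₀ μ`. -/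
def charStar (μ : CharLattice b) : CharLattice b :=
  .ofMul ⟨(μ.toMul : cartan b →* ℂˣ).comp (starH w),
    IsRegular.comp (show IsRegular _ _ from μ.toMul.2) (starH w) (isRegular_starH w)⟩

/-- `g = t₋ t₀ t₊` with `t₋ ∈ U⁻`, `t₀ ∈ H`, `t₊ ∈ U⁺`. -/
def IsTriangular (g : adjointGroup b) (t : unipNeg b × cartan b × unipPos b) : Prop :=
  g = t.1 * t.2.1 * t.2.2

variable (b) in
/-- The open subset `G₀ = U⁻ H U⁺`. -/
def G₀ : Set (adjointGroup b) := {g | ∃ t, IsTriangular g t}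

open Classical in
/-- The triangular decomposition `g = [g]₋ [g]₀ [g]₊` of `g ∈ G₀` (it is unique). -/
def triang (g : adjointGroup b) : unipNeg b × cartan b × unipPos b :=
  if h : g ∈ G₀ b then h.choose else 1

/-- The component `[g]₀`. -/
def bracketZero (g : adjointGroup b) : cartan b := (triang g).2.1

/-- The component `[g]₊`. -/
def bracketPos (g : adjointGroup b) : adjointGroup b := (triang g).2.2

/-- The open unipotent cell `U⁺_* = U⁺ ∩ B⁻ w̄₀ B⁻`. -/
def cellPos : Set (adjointGroup b) :=
  {u | u ∈ unipPos b ∧ ∃ c ∈ borelNeg b, ∃ c' ∈ borelNeg b, u = c * wBar w * c'}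

/-- The open unipotent cell `U⁻_* = U⁻ ∩ B⁺ w̄₀ B⁺`. -/
def cellNeg : Set (adjointGroup b) :=
  {u | u ∈ unipNeg b ∧ ∃ c ∈ borelPos b, ∃ c' ∈ borelPos b, u = c * wBar w * c'}

/-- The coordinate ring `𝒪(U⁺_*)`. -/
def coordCell : Subalgebra ℂ (cellPos w → ℂ) :=
  regularFunctions fun u : cellPos w => entries (u : adjointGroup b)

open Classical in
/-- The twist automorphism `u ↦ [w̄₀ uᵀ]₊` of `U⁺_*`. -/
def twist (u : cellPos w) : cellPos w :=
  if h : bracketPos (wBar w * transpose b u) ∈ cellPos w then ⟨_, h⟩ else u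

/-- The homogeneous component `𝒪(U⁺_*)_β`: regular functions with `F(h u h⁻¹) = h^β F(u)`. -/
def homogeneous (β : CharLattice b) : Set (cellPos w → ℂ) :=
  {F | F ∈ coordCell w ∧ ∀ (h : cartan b) (u u' : cellPos w),
    (u' : adjointGroup b) = h * u * (h : adjointGroup b)⁻¹ → F u' = ev β h * F u}

/-- The cocharacter of a simple coroot, before the embedding into `G`. -/
def corootHom (s : b.support) (t : ℂˣ) : Multiplicative (P.rootSpan ℤ) →* ℂˣ where
  toFun x := t ^ (P.coroot'In ℤ s x.toAdd)
  map_one' := by simp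
  map_mul' x y := by rw [toAdd_mul, map_add, zpow_add]

/-- The cocharacter `t ↦ α_s^∨(t)` of `H`. -/
def coroot (s : b.support) (t : ℂˣ) : cartan b := ⟨torG b (corootHom s t), ⟨_, rfl⟩⟩

/-- Dominance: `⟨α_s^∨, μ⟩ ≥ 0` for all `s`. -/
def IsDominant (μ : CharLattice b) : Prop :=
  ∀ s : b.support, ∃ n : ℕ, ∀ t : ℂˣ, ev μ (coroot s t) = (t : ℂ) ^ n

/-- A realisation of the irreducible rational representation `V(μ)` of `G` of highest weight `μ`,
with a highest weight vector `v` and the symmetric bilinear form normalised by `(v, v) = 1`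
and satisfying `(g x, y) = (x, gᵀ y)`. It exists for dominant `μ` and is unique up to isomorphism. -/
structure HighestWeightModule (μ : CharLattice b) where
  n : ℕ
  ρ : Representation ℂ (adjointGroup b) (Fin n → ℂ)
  rational : ∀ x i, IsRegular entries fun g => ρ g x i
  irreducible : ρ.IsIrreducible
  v : Fin n → ℂ
  weight : ∀ h : cartan b, ρ h v = ev μ h • v
  unip : ∀ u ∈ unipPos b, ρ u v = v
  form : LinearMap.BilinForm ℂ (Fin n → ℂ)
  symm : form.IsSymm
  nondegenerate : form.Nondegenerate
  form_self : form v v = 1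
  contravariant : ∀ g x y, form (ρ g x) y = form x (ρ (transpose b g) y)

/-- The generalised minor `Δ_{μ, w₀ μ}(g) = (v, g w̄₀ v)`. -/
def HighestWeightModule.minor {μ : CharLattice b} (V : HighestWeightModule μ)
    (g : adjointGroup b) : ℂ :=
  V.form V.v (V.ρ g (V.ρ (wBar w) V.v))

/-- `D` is the restriction to `U⁺_*` of `Δ_{μ₁, w₀ μ₁}⁻¹ Δ_{μ₂, w₀ μ₂}` for some dominant `μ₁, μ₂`
with `-μ₁ + μ₂ = ξ`. -/
def IsDelta (ξ : CharLattice b) (D : cellPos w → ℂ) : Prop :=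
  ∃ μ₁ μ₂ : CharLattice b, IsDominant μ₁ ∧ IsDominant μ₂ ∧ -μ₁ + μ₂ = ξ ∧
    ∃ (V₁ : HighestWeightModule μ₁) (V₂ : HighestWeightModule μ₂), ∀ u : cellPos w,
      V₁.minor w u ≠ 0 ∧ D u = (V₁.minor w u)⁻¹ * V₂.minor w u

/-- The function `Δ⁺_{w₀, ξ}`, the only one with the property `IsDelta`. -/
def Delta (ξ : CharLattice b) : cellPos w → ℂ := Classical.epsilon (IsDelta w ξ)

variable (b) in
/-- The decorated flag variety `G / U⁺`. -/
abbrev DecoratedFlag := adjointGroup b ⧸ unipPos b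

variable (b) in
/-- The flag variety `G / B⁺`, whose points are the Borel subgroups `g B⁺ g⁻¹ = g.B⁺`. -/
abbrev Flag := adjointGroup b ⧸ borelPos b

variable (b) in
/-- The projection `G / U⁺ → G / B⁺`. -/
def underlying : DecoratedFlag b → Flag b := Subgroup.quotientMapOfLE le_sup_right

lemma underlying_smul (g : adjointGroup b) (A : DecoratedFlag b) :
    underlying b (g • A) = g • underlying b A := by
  induction A using QuotientGroup.induction_on with
  | H a => rfl

variable (b) in
/-- The point `B⁺` of the flag variety. -/
def flagPos : Flag b := ((1 : adjointGroup b) : Flag b)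

/-- The point `B⁻ = w̄₀.B⁺` of the flag variety. -/
def flagNeg : Flag b := (wBar w : Flag b)

/-- A generic pair of flags: one in the `G`-orbit of `(B⁺, B⁻)`. -/
def GenericPair (B₁ B₂ : Flag b) : Prop :=
  ∃ g : adjointGroup b, g • B₁ = flagPos b ∧ g • B₂ = flagNeg w

/-- A pinning over the generic pair `(underlying b dec, minus)`: a decorated flag over the first
member of the pair. -/
structure Pinning where
  dec : DecoratedFlag b
  minus : Flag b
  generic : GenericPair w (underlying b dec) minus

/-- The first flag of the pair which a pinning lies over. -/
def Pinning.plus {w : List b.support} (p : Pinning w) : Flag b := underlying b p.dec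

/-- The action of `G` on pinnings. -/
instance : SMul (adjointGroup b) (Pinning w) where
  smul g p := ⟨g • p.dec, g • p.minus, by
    obtain ⟨k, h1, h2⟩ := p.generic
    exact ⟨k * g⁻¹, by rw [underlying_smul, smul_smul, inv_mul_cancel_right, h1],
      by rw [smul_smul, inv_mul_cancel_right, h2]⟩⟩

/-- The standard pinning, over `(B⁺, B⁻)`. -/
def pStd : Pinning w where
  dec := ((1 : adjointGroup b) : DecoratedFlag b)
  minus := flagNeg w
  generic := ⟨1, by rw [one_smul]; rfl, one_smul _ _⟩

/-- Three flags `B₁, B₂, B₃`, cyclically indexed, together with pinnings `p₁₂, p₂₃, p₃₁` over the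
(hence generic) pairs of consecutive flags. -/
@[ext]
structure PinnedTriple where
  flag : Fin 3 → Flag b
  pin : Fin 3 → Pinning w
  plus_eq : ∀ i, (pin i).plus = flag i
  minus_eq : ∀ i, (pin i).minus = flag (i + 1)

lemma plus_smul {w : List b.support} (g : adjointGroup b) (p : Pinning w) :
    (g • p).plus = g • p.plus := underlying_smul g p.dec

/-- The diagonal action of `G`. -/
instance : MulAction (adjointGroup b) (PinnedTriple w) where
  smul g d := ⟨fun i => g • d.flag i, fun i => g • d.pin i,
    fun i => by rw [plus_smul, d.plus_eq], fun i => congrArg (g • ·) (d.minus_eq i)⟩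
  one_smul d := by
    have h : ∀ p : Pinning w, (1 : adjointGroup b) • p = p := fun p => by
      cases p; exact (Pinning.mk.injEq ..).mpr ⟨one_smul _ _, one_smul _ _⟩
    exact PinnedTriple.ext (funext fun i => one_smul _ _) (funext fun i => h _)
  mul_smul g g' d := by
    have h : ∀ p : Pinning w, (g * g') • p = g • g' • p := fun p => by
      cases p; exact (Pinning.mk.injEq ..).mpr ⟨mul_smul _ _ _, mul_smul _ _ _⟩
    exact PinnedTriple.ext (funext fun i => mul_smul _ _ _) (funext fun i => h _)

/-- The configuration space `Conf₃ 𝒫_G`, the set of `G`-orbits of triples with pinnings. -/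
def Conf₃ := MulAction.orbitRel.Quotient (adjointGroup b) (PinnedTriple w)

/-- The moduli space `𝒫_{G,T}` of a triangle `T`, with marked points `0, 1, 2` in this
counterclockwise order and boundary intervals `E_i = [i, i + 1]`: isomorphism classes of `G`-local
systems on `T` with a flat section of the associated flag bundle near each marked point and a pinning
over each boundary interval, lying over the pair of flags at its end points. As `T` is simply
connected, the local system is trivial and all sections extend to `T` by parallel transport; the data
are the values at a base point, up to the change of trivialisation by `G`. The flag with index `i`
belongs to the marked point `i`, the pinning with index `i` to the interval `E_i`. -/
def ModuliTriangle := MulAction.orbitRel.Quotient (adjointGroup b) (PinnedTriple w)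

/-- Renumbering cyclically, so that the entry with index `m` comes first. -/
def PinnedTriple.rotate {w : List b.support} (m : Fin 3) : PinnedTriple w ≃ PinnedTriple w where
  toFun d := ⟨fun i => d.flag (m + i), fun i => d.pin (m + i), fun i => d.plus_eq _,
    fun i => by rw [d.minus_eq, add_assoc]⟩
  invFun d := ⟨fun i => d.flag (-m + i), fun i => d.pin (-m + i), fun i => d.plus_eq _,
    fun i => by rw [d.minus_eq, add_assoc]⟩
  left_inv d := by ext i <;> simp
  right_inv d := by ext i <;> simp

lemma PinnedTriple.orbitRel_rotate (m : Fin 3) (d d' : PinnedTriple w) :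
    MulAction.orbitRel (adjointGroup b) _ d d' ↔
      MulAction.orbitRel (adjointGroup b) _ (d.rotate m) (d'.rotate m) := by
  constructor
  · rintro ⟨g, rfl⟩
    exact ⟨g, rfl⟩
  · rintro ⟨g, h⟩
    exact ⟨g, (PinnedTriple.rotate m).injective h⟩

/-- The cyclic shift `[p₁₂, p₂₃, p₃₁] ↦ [p₂₃, p₃₁, p₁₂]`. -/
def S₃ : Conf₃ w ≃ Conf₃ w :=
  Quotient.congr (PinnedTriple.rotate 1) (PinnedTriple.orbitRel_rotate w 1)

/-- The identification `f_m` of the moduli space with the configuration space, given by the choice of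
a marked point `m` (the dot): it lists flags and pinnings counterclockwise, starting from `m` and from
the boundary interval following `m`. -/
def fDot (m : Fin 3) : ModuliTriangle w ≃ Conf₃ w :=
  Quotient.congr (PinnedTriple.rotate m) (PinnedTriple.orbitRel_rotate w m)

/-- The variety of triples of pinnings with matching flags. Since the set of pinnings is a principal
homogeneous space of `G`, it is the locally closed set of the `(g₁, g₂, g₃) ∈ G³` for which the
pinnings `g_i.p_std` match. -/
def PinAtlas := {g : Fin 3 → adjointGroup b //
  ∀ i, (g i • pStd w).minus = (g (i + 1) • pStd w).plus}

/-- The triple of pinnings `g_i.p_std`. -/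
def PinAtlas.toTriple {w : List b.support} (g : PinAtlas w) : PinnedTriple w where
  flag i := (g.1 i • pStd w).plus
  pin i := g.1 i • pStd w
  plus_eq _ := rfl
  minus_eq i := g.2 i

/-- The coordinate ring `𝒪(Conf₃ 𝒫_G)` of the quotient by `G`: functions on the set of orbits whose
pull-back to the variety of triples is regular, i.e. the `G`-invariant regular functions. -/
def coordConf₃ : Subalgebra ℂ (Conf₃ w → ℂ) where
  carrier := {f | IsRegular (fun g : PinAtlas w => entriesPi g.1)
    fun g => f (Quotient.mk _ g.toTriple)}
  mul_mem' hf hg := IsRegular.mul hf hg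
  add_mem' hf hg := IsRegular.add hf hg
  algebraMap_mem' r := (regularFunctions fun g : PinAtlas w => entriesPi g.1).algebraMap_mem r

/-- The coordinate ring `𝒪(𝒫_{G,T})`: the `G`-invariant regular functions of the three
pinnings. -/
def coordTriangle : Subalgebra ℂ (ModuliTriangle w → ℂ) where
  carrier := {f | IsRegular (fun g : PinAtlas w => entriesPi g.1)
    fun g => f (Quotient.mk _ g.toTriple)}
  mul_mem' hf hg := IsRegular.mul hf hg
  add_mem' hf hg := IsRegular.add hf hg
  algebraMap_mem' r := (regularFunctions fun g : PinAtlas w => entriesPi g.1).algebraMap_mem r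

/-- The variety `H × H × U⁺_*`. -/
abbrev HHU := cartan b × cartan b × cellPos w

/-- The coordinate ring `𝒪(H × H × U⁺_*)`. -/
def coordHHU : Subalgebra ℂ (HHU w → ℂ) :=
  regularFunctions fun x : HHU w =>
    entriesPi ![(x.1 : adjointGroup b), (x.2.1 : adjointGroup b), (x.2.2 : adjointGroup b)]

/-- The function `e₁^μ ⊗ e₂^ν ⊗ F`. -/
def tensor (μ ν : CharLattice b) (F : cellPos w → ℂ) : HHU w → ℂ :=
  fun x => ev μ x.1 * ev ν x.2.1 * F x.2.2

/-- `c` is the standard configuration of `(h₁, h₂, u)`, that is, the class of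
`[B⁺, B⁻, u.B⁻; p_std, φ'(u) h₁ w̄₀.p_std, u h₂ w̄₀.p_std]`, where `v = φ'(u)` is the element of
`U⁻_*` with `v.B⁺ = u.B⁻`. -/
def IsStdConf (x : HHU w) (c : Conf₃ w) : Prop :=
  ∃ v ∈ cellNeg w, v • flagPos b = (x.2.2 : adjointGroup b) • flagNeg w ∧
    ∃ d : PinnedTriple w,
      d.flag = ![flagPos b, flagNeg w, (x.2.2 : adjointGroup b) • flagNeg w] ∧
      d.pin = ![pStd w, (v * x.1 * wBar w) • pStd w, ((x.2.2 : adjointGroup b) * x.2.1 * wBar w) • pStd w] ∧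
      c = Quotient.mk _ d

/-- `S` is a vector space basis of the subspace `W`. -/
def IsBasisOf {E : Type*} [AddCommGroup E] [Module ℂ E] (S : Set E) (W : Submodule ℂ E) : Prop :=
  LinearIndepOn ℂ id S ∧ Submodule.span ℂ S = W

/-- The set `{(C_{3,m}^*)⁻¹ (e₁^μ ⊗ e₂^ν ⊗ F)}` of functions on the moduli space of the triangle,
where `C_{3,m} = f_m⁻¹ ∘ C₃`, `μ` and `ν` run over `X^*(H)`, and `F` over `𝔽`. -/
def triangleBasis (C₃ : HHU w ≃ Conf₃ w) (m : Fin 3) (𝔽 : Set (cellPos w → ℂ)) :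
    Set (ModuliTriangle w → ℂ) :=
  {f | ∃ μ ν, ∃ F ∈ 𝔽, f ∘ (fDot w m).symm ∘ C₃ = tensor w μ ν F}

end

end AdjointPinned

open AdjointPinned

/-! The statement rests on one factorisation. For `u` in the open cell write `u w̄₀ = v k n` with `v
∈ U⁻`, `k ∈ H`, `n ∈ U⁺` (`CellData`). Then `v` is `φ'(u)`, `k` is `[u w̄₀]₀`, and the twist of `u`
is `vᵀ`. Transposing the equation gives the same kind of factorisation for `vᵀ`, with `k` replaced
by `k⁻¹` (`CellData.twist`). Iterating it shows that the fourth power of the twist sends `u` to `k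
η(u)* k⁻¹`, where `η(u)` is the twist of `u` (`coe_twist_iterate_four`).

The pinnings form a torsor under `G`, so a pinned triple is a triple `(g₁, g₂, g₃)` of group
elements, and a configuration is such a triple up to a common left translation. Normalising `g₁ = 1`
and factoring the other two elements gives the coordinates `(h₁, h₂, u)` (`exists_stdAtlas`). The
cyclic shift amounts to normalising `g₂ = 1` instead. Comparing triangular factors of the two
descriptions proves the formula on points (`S₃_stdConf`). For functions, `η(u)*` is replaced by `k⁻¹
η⁴(u) k`. Homogeneity turns the conjugation by `k` into a character value, `w₀(k)` contributes
another, and together they form the function `Delta`, because `Delta w ξ` is `u ↦ k^ξ` (`delta_eq`,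
`tensor_comp_shift`).

The products `e₁^μ ⊗ e₂^ν ⊗ F` form a basis because the characters of `H` are a basis of its regular
functions (`mem_span_tensor`, `isBasisOf_tensor`), and the standard configuration identifies the
coordinate rings (`mem_coordConf₃_iff`). The formula on functions shows that the basis attached to
one marked point is contained in the basis attached to the preceding one. Going once around the
triangle turns these inclusions into equalities (`triangleBasis_eq`).

The rest is structure theory of the matrix group. The relation `w̄₀² = 1`
(`IsLongestWord.wBar_mul_self`) is a parity count along root strings; that `w̄₀` exchanges `U⁺` and
`U⁻` follows from the one-dimensionality of the simple root spaces (`mem_span_f_of_hasWeight`).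
Uniqueness of triangular factors comes from grading the adjoint representation by height, and their
regularity from Cramer's rule and the nonvanishing of principal minors on `G₀`. The function `Delta`
also requires irreducible representations to exist: they are spanned by right translates of products
of principal minors (`IsSpherical.nonempty_highestWeightModule`), with density of `G₀` as the main
tool. -/

/-! ### Irreducible components of a root system -/

section Component

open RootPairing Set Module Function

variable {ι K M N : Type*} [Finite ι] [Field K] [CharZero K] [AddCommGroup M] [Module K M]
  [AddCommGroup N] [Module K N]

namespace RootPairing

/-- The smallest Weyl-invariant subspace containing a given root. -/
def component (P : RootPairing ι K M N) (k : ι) : Submodule K M :=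
  sInf {q | q ∈ P.invtRootSubmodule ∧ P.root k ∈ q}

variable (P : RootPairing ι K M N) (k : ι)

lemma component_mem : P.component k ∈ P.invtRootSubmodule := by
  rw [mem_invtRootSubmodule_iff]
  intro i x hx
  simp only [component, Submodule.mem_sInf, Submodule.mem_comap] at hx ⊢
  intro q hq
  exact (P.mem_invtRootSubmodule_iff.mp hq.1 i) (hx q hq)

lemma root_mem_component : P.root k ∈ P.component k := by
  simp only [component, Submodule.mem_sInf]
  exact fun q hq => hq.2

lemma component_le {q : Submodule K M} (hq : q ∈ P.invtRootSubmodule) (hk : P.root k ∈ q) :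
    P.component k ≤ q := sInf_le ⟨hq, hk⟩

variable [P.IsRootSystem] [P.IsCrystallographic] [P.IsReduced]

lemma reflection_mem_component (i : ι) {x : M} (hx : x ∈ P.component k) :
    P.reflection i x ∈ P.component k :=
  P.mem_invtRootSubmodule_iff.mp (P.component_mem k) i hx

lemma finite_of_isRootSystem (P : RootPairing ι K M N) [P.IsRootSystem] : Module.Finite K M :=
  ⟨⟨(Set.finite_range P.root).toFinset, by simp⟩⟩

instance : Module.Finite K (P.component k) :=
  have := P.finite_of_isRootSystem
  inferInstance

/-- The root system formed by the roots in the smallest invariant subspace containing a root. -/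
noncomputable def componentPairing : RootPairing {i // P.root i ∈ P.component k} K (P.component k)
    (Dual K (P.component k)) :=
  RootPairing.mk'' (Dual.eval K (P.component k))
    ⟨fun i => ⟨P.root i, i.2⟩, fun i j h => by
      ext1; exact P.root.injective (congrArg Subtype.val h)⟩
    -- Two roots whose coroots agree on the component pair to 2 with each other in both orders,
    -- hence coincide.
    ⟨fun i => (P.coroot' i).comp (P.component k).subtype, fun i j h => by
      have : Module.IsReflexive K M := .of_isPerfPair P.toLinearMap
      ext1
      rw [← P.pairing_two_two_iff]
      have h1 := LinearMap.congr_fun h ⟨P.root i, i.2⟩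
      have h2 := LinearMap.congr_fun h ⟨P.root j, j.2⟩
      simp at h1 h2
      exact ⟨h1.symm, h2⟩⟩
    (fun i => P.pairing_same i)
    (by
      rintro i _ ⟨j, rfl⟩
      refine ⟨⟨P.reflectionPerm i j, ?_⟩, ?_⟩
      · rw [root_reflectionPerm]
        exact P.reflection_mem_component k i j.2
      · exact Subtype.ext (P.root_reflectionPerm i j))
    (by
      have h := invtRootSubmodule.eq_span_root (P := P) ⟨_, P.component_mem k⟩
      apply Submodule.map_injective_of_injective (P.component k).injective_subtype
      rw [Submodule.map_span, Submodule.map_subtype_top]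
      conv_rhs => rw [show P.component k = _ from h]
      congr 1
      ext x
      simp only [mem_image, mem_range]
      constructor
      · rintro ⟨_, ⟨i, rfl⟩, rfl⟩
        exact ⟨i, i.2, rfl⟩
      · rintro ⟨i, hi, rfl⟩
        exact ⟨_, ⟨⟨i, hi⟩, rfl⟩, rfl⟩)

lemma coe_componentPairing_root (i : {i // P.root i ∈ P.component k}) :
    ((P.componentPairing k).root i : M) = P.root i := rfl

lemma componentPairing_pairing (i j : {i // P.root i ∈ P.component k}) :
    (P.componentPairing k).pairing i j = P.pairing i j := rfl

instance : (P.componentPairing k).IsCrystallographic :=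
  ⟨fun i j => by
    rw [componentPairing_pairing]
    exact ‹P.IsCrystallographic›.exists_value i j⟩

instance : (P.componentPairing k).IsRootSystem :=
  isRootSystem_mk'' fun i j => by
    obtain ⟨z, hz⟩ := ‹P.IsCrystallographic›.exists_value i j
    exact ⟨z, hz⟩

lemma linearIndependent_componentPairing_iff (i j : {i // P.root i ∈ P.component k}) :
    LinearIndependent K ![(P.componentPairing k).root i, (P.componentPairing k).root j] ↔
      LinearIndependent K ![P.root i, P.root j] := by
  rw [LinearIndependent.pair_iff, LinearIndependent.pair_iff]
  refine forall₂_congr fun s t => ?_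
  rw [← Subtype.coe_inj]
  rfl

instance : (P.componentPairing k).IsReduced := ⟨fun i j h => by
  rw [linearIndependent_componentPairing_iff] at h
  rcases IsReduced.eq_or_eq_neg _ _ h with h | h
  · exact .inl (Subtype.ext h)
  · exact .inr (Subtype.ext h)⟩

lemma mem_range_componentPairing_root_iff (x : P.component k) :
    x ∈ range (P.componentPairing k).root ↔ (x : M) ∈ range P.root := by
  constructor
  · rintro ⟨i, rfl⟩
    exact ⟨i, rfl⟩
  · rintro ⟨i, hi⟩
    exact ⟨⟨i, hi ▸ x.2⟩, Subtype.ext hi⟩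

/-- A root string through one root of the component in the direction of another never leaves the
component. The coefficients are therefore read off from the same roots, which is what lets
identities known for irreducible systems be transferred. -/
lemma componentPairing_chainTopCoeff (i j : {i // P.root i ∈ P.component k}) :
    (P.componentPairing k).chainTopCoeff i j = P.chainTopCoeff i j := by
  by_cases h : LinearIndependent K ![P.root i, P.root j]
  · have h' := (P.linearIndependent_componentPairing_iff k i j).mpr h
    refine eq_of_forall_le_iff fun n => ?_
    rw [← root_add_nsmul_mem_range_iff_le_chainTopCoeff h,
      ← root_add_nsmul_mem_range_iff_le_chainTopCoeff h', mem_range_componentPairing_root_iff]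
    rfl
  · rw [chainTopCoeff_of_not_linearIndependent h, chainTopCoeff_of_not_linearIndependent
      (by rwa [linearIndependent_componentPairing_iff])]

lemma componentPairing_chainBotCoeff (i j : {i // P.root i ∈ P.component k}) :
    (P.componentPairing k).chainBotCoeff i j = P.chainBotCoeff i j := by
  by_cases h : LinearIndependent K ![P.root i, P.root j]
  · have h' := (P.linearIndependent_componentPairing_iff k i j).mpr h
    refine eq_of_forall_le_iff fun n => ?_
    rw [← root_sub_nsmul_mem_range_iff_le_chainBotCoeff h,
      ← root_sub_nsmul_mem_range_iff_le_chainBotCoeff h', mem_range_componentPairing_root_iff]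
    rfl
  · rw [chainBotCoeff_of_not_linearIndependent h, chainBotCoeff_of_not_linearIndependent
      (by rwa [linearIndependent_componentPairing_iff])]

/-- The coroot of a root outside an invariant subspace vanishes on that subspace. -/
lemma reflection_eq_self_of_notMem {q : Submodule K M} (hq : q ∈ P.invtRootSubmodule) {i : ι}
    (hi : P.root i ∉ q) {x : M} (hx : x ∈ q) : P.reflection i x = x := by
  have := invtRootSubmodule.le_ker_coroot' ⟨q, hq⟩ hi hx
  rw [LinearMap.mem_ker] at this
  rw [reflection_apply, this]
  simp

/-- Let `q` be a nonzero invariant subspace of the component. If it missed the root `k`, the roots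
of the component outside `q` would be orthogonal to those inside, so their span would be invariant
and contain the root `k`, hence be the whole component. A root in `q` would then be killed by its
own coroot. -/
instance : (P.componentPairing k).IsIrreducible := by
  have : Nontrivial (P.component k) :=
    ⟨⟨P.root k, P.root_mem_component k⟩, 0, fun h => P.ne_zero k (congrArg Subtype.val h)⟩
  refine IsIrreducible.mk' _ fun r hr hr0 => ?_
  have hq : r.map (P.component k).subtype ∈ P.invtRootSubmodule := by
    rw [mem_invtRootSubmodule_iff]
    rintro i _ ⟨x, hx, rfl⟩
    by_cases hi : P.root i ∈ P.component k
    · exact ⟨_, hr ⟨i, hi⟩ hx, rfl⟩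
    · refine ⟨x, hx, ?_⟩
      exact (P.reflection_eq_self_of_notMem (P.component_mem k) hi x.2).symm
  set q := r.map (P.component k).subtype with hq_def
  have hqle : q ≤ P.component k := Submodule.map_subtype_le _ _
  suffices P.root k ∈ q by
    have h1 := P.component_le k hq this
    rw [eq_top_iff]
    rintro x -
    obtain ⟨y, hy, hyx⟩ := h1 x.2
    rwa [← Subtype.ext hyx]
  by_contra hk
  obtain ⟨i, hi⟩ : ∃ i, P.root i ∈ q := by
    by_contra! h
    apply hr0
    have := (invtRootSubmodule.eq_bot_iff (P := P) ⟨q, hq⟩).mpr h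
    have h2 : q = ⊥ := congrArg Subtype.val this
    exact Submodule.map_injective_of_injective (P.component k).injective_subtype (by rw [Submodule.map_bot]; exact h2)
  let S : Set ι := {j | P.root j ∈ P.component k ∧ P.root j ∉ q}
  have hS : ∀ j ∈ S, ∀ l, P.root l ∈ q → P.pairing j l = 0 := fun j hj l hl => by
    rw [P.pairing_eq_zero_iff]
    exact invtRootSubmodule.le_ker_coroot' ⟨q, hq⟩ hj.2 hl
  have hc : P.component k ≤ Submodule.span K (P.root '' S) := by
    refine P.component_le k ?_ (Submodule.subset_span ⟨k, ⟨P.root_mem_component k, hk⟩, rfl⟩)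
    rw [mem_invtRootSubmodule_iff]
    intro l
    rw [End.mem_invtSubmodule, Submodule.span_le]
    rintro _ ⟨j, hj, rfl⟩
    change P.reflection l (P.root j) ∈ Submodule.span K (P.root '' S)
    by_cases hl : P.root l ∈ q
    · rw [reflection_apply_root, hS j hj l hl, zero_smul, sub_zero]
      exact Submodule.subset_span ⟨j, hj, rfl⟩
    · rw [← root_reflectionPerm]
      refine Submodule.subset_span ⟨_, ⟨?_, fun h => hj.2 ?_⟩, rfl⟩
      · rw [root_reflectionPerm]
        exact P.reflection_mem_component k l hj.1
      · have := P.mem_invtRootSubmodule_iff.mp hq l h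
        change P.reflection l (P.root _) ∈ q at this
        rwa [← root_reflectionPerm, reflectionPerm_self] at this
  have : Submodule.span K (P.root '' S) ≤ LinearMap.ker (P.coroot' i) := by
    rw [Submodule.span_le]
    rintro _ ⟨j, hj, rfl⟩
    simpa using hS j hj i hi
  have := this (hc (hqle hi))
  simp at this

/-- The simple roots in a component form a base of it. -/
noncomputable def Base.component {P : RootPairing ι K M N} [P.IsRootSystem] [P.IsCrystallographic] [P.IsReduced]
    (b : P.Base) (k : ι) : (P.componentPairing k).Base :=
  Base.mk' _ {i | (i : ι) ∈ b.support}
    (by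
      have h := b.linearIndepOn_root
      have h1 : LinearIndepOn K (fun i : {i // P.root i ∈ P.component k} => P.root i)
          {i | (i : ι) ∈ b.support} :=
        LinearIndependent.comp h
          (fun i : ({i | (i : ι) ∈ b.support} : Set {i // P.root i ∈ P.component k}) =>
            (⟨i.1, i.2⟩ : b.support)) (fun i j hij => by
              ext; simpa using hij)
      exact LinearIndependent.of_comp (P.component k).subtype h1)
    (by
      have key : ∀ i, b.IsPos i → ∀ hi : P.root i ∈ P.component k,
          (⟨P.root i, hi⟩ : P.component k) ∈ AddSubmonoid.closure
            ((P.componentPairing k).root '' {i | (i : ι) ∈ b.support}) := by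
        have : Module.IsReflexive K M := .of_isPerfPair P.toLinearMap
        have : IsAddTorsionFree M := .of_isTorsionFree K M
        intro i hi
        refine Base.IsPos.induction_on_add (p := fun i => ∀ hi : P.root i ∈ P.component k,
          (⟨P.root i, hi⟩ : P.component k) ∈ AddSubmonoid.closure
            ((P.componentPairing k).root '' {i | (i : ι) ∈ b.support})) hi ?_ ?_
        · exact fun i h hi => AddSubmonoid.subset_closure ⟨⟨i, hi⟩, h, rfl⟩
        · intro i j l hl hi hj hlm
          have h0 : P.root i + P.root j ∈ range P.root := ⟨l, hl⟩
          have h1 := root_mem_submodule_iff_of_add_mem_invtSubmodule ⟨_, P.component_mem k⟩ h0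
          have h2 : P.root i ∈ P.component k := by
            -- If one summand lies outside the component, so does the other. Both are then
            -- orthogonal to their sum `l`, and the pairing of `l` with itself would be 0 instead of
            -- 2.
            by_contra hi'
            have e1 := invtRootSubmodule.le_ker_coroot' ⟨_, P.component_mem k⟩ hi' hlm
            have e2 := invtRootSubmodule.le_ker_coroot' ⟨_, P.component_mem k⟩
              (fun h => hi' (h1.mpr h)) hlm
            have e3 : P.pairing l l = 2 := pairing_same _ _
            have e4 : P.pairing l i = 0 := e1
            have e5 : P.pairing l j = 0 := e2
            rw [P.pairing_eq_zero_iff] at e4 e5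
            rw [pairing_eq_add_of_root_eq_add hl, e4, e5] at e3
            simp at e3
          have h3 := h1.mp h2
          have : (⟨P.root l, hlm⟩ : P.component k) = ⟨P.root i, h2⟩ + ⟨P.root j, h3⟩ :=
            Subtype.ext hl
          rw [this]
          exact add_mem (hi h2) (AddSubmonoid.subset_closure ⟨⟨j, h3⟩, hj, rfl⟩)
      rintro ⟨i, hi⟩
      let := P.indexNeg
      rcases Base.IsPos.or_neg b i with h | h
      · exact .inl (key i h hi)
      · right
        have hi' : P.root (-i) ∈ P.component k := by simpa using hi
        convert key _ h hi'
        simp [coe_componentPairing_root])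

/-- When the sum of two roots is a root, an invariant subspace contains both summands or neither.
All roots involved thus lie in the component of `k`, where the known identity for irreducible
systems applies. -/
lemma chainBotCoeff_mul_chainTopCoeff_of_isRootSystem {b : P.Base} {i j k l m : ι}
    (hi : i ∈ b.support) (hj : j ∈ b.support) (hij : i ≠ j)
    (h₁ : P.root k + P.root i = P.root l)
    (h₂ : P.root k - P.root j = P.root m)
    (h₃ : P.root k + P.root i - P.root j ∈ range P.root) :
    (P.chainBotCoeff i m + 1) * (P.chainTopCoeff j k + 1) =
      (P.chainTopCoeff j l + 1) * (P.chainBotCoeff i k + 1) := by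
  let := P.indexNeg
  have hk := P.root_mem_component k
  have hi' : P.root i ∈ P.component k :=
    (root_mem_submodule_iff_of_add_mem_invtSubmodule ⟨_, P.component_mem k⟩
      ⟨l, h₁.symm⟩).mp hk
  have hj' : P.root j ∈ P.component k := by
    have h := (root_mem_submodule_iff_of_add_mem_invtSubmodule (P := P) (i := k) (j := -j)
      ⟨_, P.component_mem k⟩ ⟨m, by simp [← h₂, sub_eq_add_neg]⟩).mp hk
    simpa using h
  have hl : P.root l ∈ P.component k := h₁ ▸ add_mem hk hi'
  have hm : P.root m ∈ P.component k := h₂ ▸ sub_mem hk hj'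
  have := chainBotCoeff_mul_chainTopCoeff (P := P.componentPairing k) (b := b.component k)
    (i := ⟨i, hi'⟩) (j := ⟨j, hj'⟩) (k := ⟨k, hk⟩) (l := ⟨l, hl⟩) (m := ⟨m, hm⟩)
    (by simpa [Base.component, Base.mk'] using hi) (by simpa [Base.component, Base.mk'] using hj)
    (by simpa using hij) (Subtype.ext h₁) (Subtype.ext h₂)
    (by rw [mem_range_componentPairing_root_iff]; exact h₃)
  simpa only [componentPairing_chainBotCoeff, componentPairing_chainTopCoeff] using this

/-! ### Commutation of raising and lowering operators for distinct simple roots -/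

namespace GeckConstruction

attribute [local simp] Ring.lie_def Matrix.mul_apply Matrix.one_apply Matrix.diagonal_apply

variable {P} {b : P.Base} [Fintype ι] {i j : b.support}

/-- A nonzero entry would exhibit the difference of two simple roots as a root, up to sign. -/
lemma lie_e_f_inl_inr (k : b.support) (l : ι) :
    ⁅e i, f j⁆ (Sum.inl k) (Sum.inr l) = 0 := by
  classical
  let := P.indexNeg
  have aux₁ : ∀ x ∈ Finset.univ, ¬ (P.root x = P.root i + P.root l ∧ k = j ∧ x = j) := by
    rintro x - ⟨hl, -, rfl⟩
    exact b.sub_notMem_range_root i.property j.property ⟨-l, by simp [hl]⟩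
  have aux₂ : ∀ x ∈ Finset.univ, ¬ (P.root x = P.root l - P.root j ∧ k = i ∧ x = -i) := by
    rintro x - ⟨hl, -, rfl⟩
    replace hl : P.root i = P.root j - P.root l := by simpa [neg_eq_iff_eq_neg] using hl
    exact b.sub_notMem_range_root i.property j.property ⟨-l, by simp [hl]⟩
  simp [e, f, -indexNeg_neg, ← ite_and, Finset.sum_ite_of_false aux₁, Finset.sum_ite_of_false aux₂]

/-- On the root vector of `j`, lowering first passes through the Cartan subalgebra and yields the
absolute value of a Cartan integer. Raising first yields the chain coefficient of `i` in the
direction of `j`. The two numbers agree. -/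
lemma lie_e_f_transpose_inr_same (hij : i ≠ j) :
    (⁅e i, f j⁆ : Matrix _ _ K).transpose (Sum.inr j) = 0 := by
  have hij' : (i : ι) ≠ (j : ι) := hij ∘ SetLike.coe_eq_coe.mp
  let := P.indexNeg
  classical
  ext (k | k)
  · rw [Matrix.transpose_apply, lie_e_f_inl_inr, Pi.zero_apply]
  · suffices ((if k = i then ↑|b.cartanMatrix i j| else (0 : K)) -
        ∑ x, if P.root x = P.root i + P.root j ∧ P.root k = P.root x - P.root j then
          (P.chainTopCoeff j x : K) + 1 else 0) = 0 by
      have hij : (j : ι) ≠ -i := by simpa using b.root_ne_neg_of_ne j.property i.property hij'.symm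
      have aux : ∀ x ∈ Finset.univ,
        x ≠ j → (if x = j ∧ k = i then ↑|b.cartanMatrix i x| else 0) = (0 : K) := by aesop
      simpa [e, f, P.ne_zero, hij, -indexNeg_neg, -Finset.univ_eq_attach, ← ite_and,
        Finset.sum_eq_single_of_mem j (Finset.mem_univ _) aux]
    rcases eq_or_ne k i with rfl | hk; swap
    · rw [if_neg (by tauto), Finset.sum_ite_of_false (by aesop)]; simp
    by_cases hij_mem : P.root i + P.root j ∈ range P.root
    · obtain ⟨m, hm⟩ := hij_mem
      rw [Finset.sum_eq_single_of_mem m (Finset.mem_univ _) (by rintro x - hx; simp [← hm, hx]),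
        b.abs_cartanMatrix_apply, Base.cartanMatrix, Base.cartanMatrixIn_def]
      have aux₁ := b.chainTopCoeff_eq_of_ne hij.symm
      have aux₂ := chainTopCoeff_of_add (b.linearIndependent_pair_of_ne hij.symm) hm
      norm_cast
      aesop
    · have aux : ∀ x ∈ Finset.univ,
          ¬ (P.root x = P.root i + P.root j ∧ P.root i = P.root x - P.root j) := by
        rintro x - ⟨hx, -⟩; exact hij_mem ⟨x, hx⟩
      simp [Finset.sum_ite_of_false aux, b.cartanMatrix_apply_eq_zero_iff hij, hij_mem]

/-- The involution `ω` exchanges the root vectors of a simple root and of its negative, and the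
operators `e` and `f`, so the previous lemma applies with `i` and `j` interchanged. -/
lemma lie_e_f_transpose_inr_neg (hij : i ≠ j) :
    letI := P.indexNeg
    (⁅e i, f j⁆ : Matrix _ _ K).transpose (Sum.inr (-i)) = 0 := by
  let := P.indexNeg
  classical
  ext (k | k)
  · rw [Matrix.transpose_apply, lie_e_f_inl_inr, Pi.zero_apply]
  · have aux : ⁅e i, f j⁆ (.inr k) (.inr (-i)) =
        (⁅e i, f j⁆ * ω b : Matrix _ _ K) (.inr k) (.inr i) := by simp [ω]
    rw [Matrix.transpose_apply, aux, lie_e_f_mul_ω, ← (-ω b * ⁅e j, f i⁆).transpose_apply,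
      Matrix.transpose_mul, Matrix.mul_apply', lie_e_f_transpose_inr_same hij.symm]
    simp

/-- `e_i` and `f_j` commute for `i ≠ j`; the root system need not be irreducible. -/
lemma lie_e_f_of_ne (hij : i ≠ j) : (⁅e i, f j⁆ : Matrix _ _ K) = 0 := by
  have hij' : (i : ι) ≠ (j : ι) := hij ∘ SetLike.coe_eq_coe.mp
  let := P.indexNeg
  classical
  ext (k | k) (l | l)
  · rw [ne_comm] at hij
    simp_all [-indexNeg_neg, e, f]
  · exact lie_e_f_inl_inr k l
  · have aux₁ : P.root k ≠ P.root i - P.root j :=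
      fun contra ↦ b.sub_notMem_range_root i.property j.property ⟨k, contra⟩
    simp [e, f, ← sub_eq_add_neg, if_neg aux₁]
  · rcases eq_or_ne l j with rfl | h₃
    · rw [← (⁅e i, f j⁆ : Matrix _ _ K).transpose_apply, lie_e_f_transpose_inr_same hij,
        Pi.zero_apply, Matrix.zero_apply]
    rcases eq_or_ne l (-i) with rfl | h₄
    · rw [← (⁅e i, f j⁆ : Matrix _ _ K).transpose_apply, lie_e_f_transpose_inr_neg hij,
        Pi.zero_apply, Matrix.zero_apply]
    suffices
      (∑ x, if P.root x = P.root l - P.root j ∧ P.root k = P.root i + P.root x then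
          ((P.chainBotCoeff i x : K) + 1) * (P.chainTopCoeff j l + 1) else 0) =
      (∑ x, if P.root x = P.root i + P.root l ∧ P.root k = P.root x - P.root j then
          ((P.chainTopCoeff j x : K) + 1) * (P.chainBotCoeff i l + 1) else 0) by
      have h₁ : ∀ x ∈ Finset.univ, ¬ ((x = i ∧ l = -i) ∧ k = -j) := by
        rintro - - ⟨⟨-, contra⟩, -⟩; contradiction
      have h₂ : ∀ x ∈ Finset.univ, ¬ ((x = j ∧ l = j) ∧ k = i) := by
        rintro - - ⟨⟨-, contra⟩, -⟩; contradiction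
      rw [← sub_eq_zero] at this
      simpa [e, f, ← ite_and, Finset.sum_ite_of_false h₁, Finset.sum_ite_of_false h₂, -indexNeg_neg,
        -Finset.univ_eq_attach]
    by_cases h₅ : P.root l + P.root i - P.root j ∈ range P.root; swap
    · have aux₃ : ∀ x ∈ Finset.univ,
          ¬ (P.root x = P.root i + P.root l ∧ P.root k = P.root x - P.root j) := by
        rintro x - ⟨hx, hx'⟩; exact h₅ ⟨k, by rw [hx', hx]; abel⟩
      have aux₄ : ∀ x ∈ Finset.univ,
          ¬ (P.root x = P.root l - P.root j ∧ P.root k = P.root i + P.root x) := by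
        rintro x - ⟨hx, hx'⟩; exact h₅ ⟨k, by rw [hx', hx]; abel⟩
      simp [Finset.sum_ite_of_false aux₃, Finset.sum_ite_of_false aux₄]
    by_cases h₆ : P.root l + P.root i ∈ range P.root; swap
    · have h₇ : P.root l - P.root j ∉ range P.root := by
        rwa [b.root_sub_mem_iff_root_add_mem i j l hij' i.property j.property h₃ _ h₅]
        simpa
      have aux₃ : ∀ x ∈ Finset.univ,
          ¬ (P.root x = P.root i + P.root l ∧ P.root k = P.root x - P.root j) := by
        rintro x - ⟨hx, -⟩; exact h₆ ⟨x, by rw [hx]; abel⟩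
      have aux₄ : ∀ x ∈ Finset.univ,
          ¬ (P.root x = P.root l - P.root j ∧ P.root k = P.root i + P.root x) := by
        rintro x - ⟨hx, hx'⟩; exact h₇ ⟨x, hx⟩
      simp [Finset.sum_ite_of_false aux₃, Finset.sum_ite_of_false aux₄]
    -- Now `l + i` and `l - j` are both roots, so each sum has a single term, and the equality of
    -- these terms is the product identity for chain coefficients.
    obtain ⟨m, hm : P.root m = P.root l - P.root j⟩ :=
      b.root_sub_root_mem_of_mem_of_mem i j l hij' i.property j.property h₅ h₃ h₆
    obtain ⟨l', hl'⟩ := h₆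
    by_cases hk : P.root k = P.root l + P.root i - P.root j; swap
    · grind
    have aux₃ (x) (hx : x ≠ m) :
      ¬ (P.root x = P.root l - P.root j ∧ P.root k = P.root i + P.root x) := by
        grind [EmbeddingLike.apply_eq_iff_eq]
    have aux₄ (x) (hx : x ≠ l') :
      ¬ (P.root x = P.root i + P.root l ∧ P.root k = P.root x - P.root j) := by
        grind [EmbeddingLike.apply_eq_iff_eq]
    rw [Finset.sum_eq_single_of_mem m (Finset.mem_univ _) (by rintro x - h; rw [if_neg (aux₃ _ h)]),
      Finset.sum_eq_single_of_mem l' (Finset.mem_univ _) (by rintro x - h; rw [if_neg (aux₄ _ h)]),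
      if_pos (⟨hm, by rw [hm, hk]; abel⟩), if_pos ⟨by rw [hl', add_comm], by rw [hl', hk]⟩]
    have := P.chainBotCoeff_mul_chainTopCoeff_of_isRootSystem i.property j.property hij' hl'.symm
      hm.symm h₅
    norm_cast

end GeckConstruction

end RootPairing

end Component

namespace AdjointPinned

open RootPairing

variable {ι M N : Type*} [Fintype ι] [DecidableEq ι] [AddCommGroup M] [Module ℂ M]
  [AddCommGroup N] [Module ℂ N] {P : RootPairing ι ℂ M N} [P.IsCrystallographic] [P.IsReduced]

noncomputable section

variable {b : P.Base}

/-! Shortcuts for type class inference. -/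

local instance : Group (adjointGroup b) := inferInstance

local instance : Monoid (adjointGroup b) := inferInstance

local instance : MulOneClass (adjointGroup b) := inferInstance

local instance : Mul (adjointGroup b) := inferInstance

local instance : Inv (adjointGroup b) := inferInstance

local instance : MulAction (adjointGroup b) (Flag b) := inferInstance

local instance : SMul (adjointGroup b) (Flag b) := inferInstance

local instance : MulAction (adjointGroup b) (DecoratedFlag b) := inferInstance

local instance : SMul (adjointGroup b) (DecoratedFlag b) := inferInstance

/-! ### Reduced words and the longest element -/

section Weyl

instance : IsAddTorsionFree M := .of_isTorsionFree ℂ M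

/-- The permutation of the roots given by a word in the simple reflections. -/
def weylPerm (w : List b.support) : Equiv.Perm ι := (w.map fun s => P.reflectionPerm s).prod

@[simp] lemma weylPerm_nil : weylPerm ([] : List b.support) = 1 := rfl

lemma weylPerm_cons (s : b.support) (w : List b.support) (i : ι) :
    weylPerm (s :: w) i = P.reflectionPerm s (weylPerm w i) := rfl

lemma weylPerm_append (w w' : List b.support) (i : ι) :
    weylPerm (w ++ w') i = weylPerm w (weylPerm w' i) := by
  simp [weylPerm]

@[simp] lemma weylWord_nil : weylWord ([] : List b.support) = 1 := rfl

lemma weylWord_cons (s : b.support) (w : List b.support) :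
    weylWord (s :: w) = P.reflection s * weylWord w := rfl

lemma weylWord_append (w w' : List b.support) :
    weylWord (w ++ w') = weylWord w * weylWord w' := by
  simp [weylWord]

lemma weylWord_reverse (w : List b.support) : weylWord w.reverse = (weylWord w)⁻¹ := by
  induction w with
  | nil => simp
  | cons s w ih => 
    rw [List.reverse_cons, weylWord_append, ih, weylWord_cons, weylWord_cons, weylWord_nil, mul_one,
      mul_inv_rev, reflection_inv]

lemma root_weylPerm (w : List b.support) (i : ι) :
    P.root (weylPerm w i) = weylWord w (P.root i) := by
  induction w with
  | nil => simp
  | cons s w ih => rw [weylPerm_cons, root_reflectionPerm, ih, weylWord_cons]; rfl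

lemma weylPerm_congr {w w' : List b.support} (h : weylWord w = weylWord w') :
    weylPerm w = weylPerm w' := by
  ext i
  apply P.root.injective
  rw [root_weylPerm, root_weylPerm, h]

lemma weylPerm_reverse (w : List b.support) (i : ι) :
    weylPerm w (weylPerm w.reverse i) = i := by
  apply P.root.injective
  rw [root_weylPerm, root_weylPerm, weylWord_reverse]
  exact (weylWord w).apply_symm_apply _

lemma isPos_neg_iff (i : ι) : b.IsPos (P.reflectionPerm i i) ↔ ¬ b.IsPos i :=
  Base.IsPos.neg_iff_not b i

lemma height_neg (i : ι) : b.height (P.reflectionPerm i i) = -b.height i :=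
  b.height_reflectionPerm_self i

lemma root_neg (i : ι) : P.root (P.reflectionPerm i i) = -P.root i := by simp

lemma neg_neg_index (i : ι) :
    P.reflectionPerm (P.reflectionPerm i i) (P.reflectionPerm i i) = i := by
  apply P.root.injective
  rw [root_neg, root_neg, neg_neg]

lemma weylPerm_neg (w : List b.support) (i : ι) :
    weylPerm w (P.reflectionPerm i i) = P.reflectionPerm (weylPerm w i) (weylPerm w i) := by
  apply P.root.injective
  rw [root_weylPerm, root_neg, root_neg, root_weylPerm, map_neg]

lemma isPos_simple (s : b.support) : b.IsPos s := b.isPos_of_mem_support s.2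

lemma weylWord_mul_reflection (w : List b.support) (i : ι) :
    weylWord w * P.reflection i = P.reflection (weylPerm w i) * weylWord w := by
  induction w with
  | nil => simp
  | cons s w ih =>
    rw [weylWord_cons, mul_assoc, ih, weylPerm_cons, reflection_reflectionPerm]
    ext x
    simp

/-- The exchange property. -/
lemma exists_shorter_of_not_isPos (w : List b.support) (s : b.support)
    (h : ¬ b.IsPos (weylPerm w s)) :
    ∃ w' : List b.support, w'.length + 1 = w.length ∧ weylWord w' = weylWord (w ++ [s]) := by
  induction w with
  | nil => exact absurd (isPos_simple s) h
  | cons t v ih =>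
    by_cases hv : b.IsPos (weylPerm v s)
    · have ht : weylPerm v s = t := by
        by_contra hne
        exact h (hv.reflectionPerm t.2 hne)
      refine ⟨v, rfl, ?_⟩
      rw [List.cons_append, weylWord_cons, weylWord_append, weylWord_cons, weylWord_nil, mul_one,
        weylWord_mul_reflection, ht, ← mul_assoc, ← sq, reflection_sq, one_mul]
    · obtain ⟨v', h1, h2⟩ := ih hv
      refine ⟨t :: v', by simp [h1], ?_⟩
      rw [weylWord_cons, h2]
      rfl

/-- A shorter word for the product would send the root of `s` to a negative root. The exchange
property would then delete one more letter and produce a word for `w` shorter than `w`. -/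
lemma IsReducedWord.append_of_isPos {w : List b.support} (hw : IsReducedWord w) {s : b.support}
    (h : b.IsPos (weylPerm w s)) : IsReducedWord (w ++ [s]) := by
  intro w' hw'
  by_contra hlt
  simp only [List.length_append, List.length_cons, List.length_nil] at hlt
  have h1 : ¬ b.IsPos (weylPerm w' s) := by
    rw [weylPerm_congr hw', weylPerm_append, weylPerm_cons, weylPerm_nil, Equiv.Perm.one_apply,
      weylPerm_neg, isPos_neg_iff, not_not]
    exact h
  obtain ⟨w'', h2, h3⟩ := exists_shorter_of_not_isPos w' s h1
  have h4 : weylWord w'' = weylWord w := by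
    rw [h3, weylWord_append, hw', weylWord_append, mul_assoc, ← weylWord_append]
    simp [weylWord_cons, ← sq]
  have := hw w'' h4
  omega

lemma exists_isReducedWord (w : List b.support) :
    ∃ w' : List b.support, IsReducedWord w' ∧ weylWord w' = weylWord w := by
  classical
  have hex : ∃ n, ∃ w' : List b.support, w'.length = n ∧ weylWord w' = weylWord w := ⟨_, w, rfl, rfl⟩
  obtain ⟨w', h1, h2⟩ := Nat.find_spec hex
  exact ⟨w', fun v hv => h1 ▸ Nat.find_min' hex ⟨v, rfl, hv.trans h2⟩, h2⟩

lemma IsReducedWord.isPos_of_append {w : List b.support} {s : b.support}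
    (hw : IsReducedWord (w ++ [s])) : b.IsPos (weylPerm w s) := by
  by_contra h
  obtain ⟨w', h1, h2⟩ := exists_shorter_of_not_isPos w s h
  have := hw w' h2
  simp at this
  omega

lemma IsReducedWord.of_cons {w : List b.support} {s : b.support}
    (hw : IsReducedWord (s :: w)) : IsReducedWord w := by
  intro w' h
  have := hw (s :: w') (by rw [weylWord_cons, weylWord_cons, h])
  simpa using this

lemma IsReducedWord.reverse {w : List b.support} (hw : IsReducedWord w) :
    IsReducedWord w.reverse := by
  intro w' h
  have := hw w'.reverse (by rw [weylWord_reverse, h, weylWord_reverse, inv_inv])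
  simpa using this

lemma IsReducedWord.isPos_of_cons {w : List b.support} {s : b.support}
    (hw : IsReducedWord (s :: w)) : b.IsPos (weylPerm w.reverse s) := by
  refine IsReducedWord.isPos_of_append ?_
  simpa using hw.reverse

variable {w : List b.support}

lemma IsLongestWord.not_isPos_simple (hw : IsLongestWord w) (s : b.support) :
    ¬ b.IsPos (weylPerm w s) := fun h => by
  have := hw.2 _ (hw.1.append_of_isPos h)
  simp at this

lemma root_weylPerm_add (w : List b.support) {i j k : ι} (h : P.root k = P.root i + P.root j) :
    P.root (weylPerm w k) = P.root (weylPerm w i) + P.root (weylPerm w j) := by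
  simp only [root_weylPerm, h, map_add]

lemma height_weylPerm_add (w : List b.support) {i j k : ι} (h : P.root k = P.root i + P.root j) :
    b.height (weylPerm w k) = b.height (weylPerm w i) + b.height (weylPerm w j) :=
  b.height_add (root_weylPerm_add w h)

/-- A positive root is built by adding simple roots. Each addition raises the height by one and
lowers the height of the image by at least one. -/
lemma IsLongestWord.height_le (hw : IsLongestWord w) {i : ι} (hi : b.IsPos i) :
    b.height i ≤ -b.height (weylPerm w i) := by
  refine Base.IsPos.induction_on_add (p := fun i => b.height i ≤ -b.height (weylPerm w i)) hi ?_ ?_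
  · intro i h
    have := hw.not_isPos_simple ⟨i, h⟩
    rw [Base.isPos_iff'] at this
    rw [Base.height_one_of_mem_support h]
    simp only at this
    omega
  · intro i j k hk hi hj
    have := hw.not_isPos_simple ⟨j, hj⟩
    rw [Base.isPos_iff'] at this
    rw [b.height_add hk, height_weylPerm_add w hk, Base.height_one_of_mem_support hj]
    simp only at this
    omega

lemma IsLongestWord.isPos_iff (hw : IsLongestWord w) (i : ι) :
    b.IsPos (weylPerm w i) ↔ ¬ b.IsPos i := by
  have key : ∀ i, b.IsPos i → ¬ b.IsPos (weylPerm w i) := by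
    intro i hi
    have := hw.height_le hi
    rw [Base.isPos_iff] at hi ⊢
    omega
  constructor
  · exact fun h hi => key i hi h
  · intro h
    have := key _ ((isPos_neg_iff i).mpr h)
    rwa [weylPerm_neg, isPos_neg_iff, not_not] at this

variable [P.IsRootSystem]

/-- The square keeps every simple root positive, whereas an element with a nonempty reduced word
makes the simple root of the last letter negative. -/
lemma IsLongestWord.weylWord_mul_self (hw : IsLongestWord w) : weylWord w * weylWord w = 1 := by
  rw [← weylWord_append]
  obtain ⟨v, hv, h⟩ := exists_isReducedWord (w ++ w)
  rw [← h]
  rcases List.eq_nil_or_concat v with rfl | ⟨v', s, rfl⟩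
  · rfl
  · rw [List.concat_eq_append] at hv h
    have h1 := hv.isPos_of_append
    have h2 : b.IsPos (weylPerm (v' ++ [s]) s) := by
      rw [weylPerm_congr h, weylPerm_append, hw.isPos_iff, hw.isPos_iff, not_not]
      exact isPos_simple s
    rw [weylPerm_append, weylPerm_cons, weylPerm_nil, Equiv.Perm.one_apply, weylPerm_neg,
      isPos_neg_iff] at h2
    exact absurd h1 h2

lemma IsLongestWord.weylPerm_weylPerm (hw : IsLongestWord w) (i : ι) :
    weylPerm w (weylPerm w i) = i := by
  apply P.root.injective
  rw [root_weylPerm, root_weylPerm]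
  exact LinearEquiv.congr_fun hw.weylWord_mul_self _

/-- The inequality `height_le` holds for `i` and for the positive root `-w₀ i`. Since `w₀` is an
involution, the two inequalities are opposite. -/
lemma IsLongestWord.height_weylPerm (hw : IsLongestWord w) (i : ι) :
    b.height (weylPerm w i) = -b.height i := by
  have key : ∀ i, b.IsPos i → b.height (weylPerm w i) = -b.height i := by
    intro i hi
    have h1 := hw.height_le hi
    have h2 : b.IsPos (P.reflectionPerm (weylPerm w i) (weylPerm w i)) := by
      rw [isPos_neg_iff, hw.isPos_iff, not_not]; exact hi
    have h3 := hw.height_le h2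
    rw [weylPerm_neg, height_neg, height_neg, hw.weylPerm_weylPerm] at h3
    omega
  by_cases hi : b.IsPos i
  · exact key i hi
  · have := key _ ((isPos_neg_iff i).mpr hi)
    rw [weylPerm_neg, height_neg, height_neg] at this
    omega

lemma mem_support_of_height_eq_one {i : ι} (hi : b.height i = 1) : i ∈ b.support := by
  have hp : b.IsPos i := by rw [Base.isPos_iff]; omega
  have aux : ∀ i, b.IsPos i → 1 ≤ b.height i := fun i h => h
  refine (Base.IsPos.induction_on_add (p := fun i => b.IsPos i ∧ (b.height i = 1 → i ∈ b.support))
    hp ?_ ?_).2 hi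
  · exact fun i h => ⟨b.isPos_of_mem_support h, fun _ => h⟩
  · intro i j k hk hi hj
    have h1 := b.height_add hk
    have h2 := aux i hi.1
    rw [Base.height_one_of_mem_support hj] at h1
    refine ⟨?_, fun h => ?_⟩
    · rw [Base.isPos_iff]; omega
    · omega

/-- The involution of the simple roots given by `-w₀`. -/
lemma IsLongestWord.exists_star (hw : IsLongestWord w) (s : b.support) :
    ∃ t : b.support, weylPerm w s = P.reflectionPerm t t := by
  have h : b.height (P.reflectionPerm (weylPerm w s) (weylPerm w s)) = 1 := by
    rw [height_neg, hw.height_weylPerm, neg_neg, Base.height_one_of_mem_support s.2]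
  exact ⟨⟨_, mem_support_of_height_eq_one h⟩, (neg_neg_index _).symm⟩

def IsLongestWord.star (hw : IsLongestWord w) (s : b.support) : b.support := (hw.exists_star s).choose

lemma IsLongestWord.weylPerm_simple (hw : IsLongestWord w) (s : b.support) :
    weylPerm w s = P.reflectionPerm (hw.star s) (hw.star s) := (hw.exists_star s).choose_spec

lemma IsLongestWord.star_star (hw : IsLongestWord w) (s : b.support) :
    hw.star (hw.star s) = s := by
  have h1 := hw.weylPerm_simple (hw.star s)
  have h2 := congrArg (weylPerm w) (hw.weylPerm_simple s)
  rw [hw.weylPerm_weylPerm, weylPerm_neg, h1, neg_neg_index] at h2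
  exact Subtype.ext h2.symm

end Weyl

/-! ### A parity count along root strings -/

section Parity

variable {w : List b.support}

lemma chainTopCoeff_reflectionPerm (l i j : ι) :
    P.chainTopCoeff (P.reflectionPerm l i) (P.reflectionPerm l j) = P.chainTopCoeff i j := by
  have hr : ∀ x, P.reflection l x ∈ Set.range P.root ↔ x ∈ Set.range P.root := fun x => by
    constructor
    · rintro ⟨k, hk⟩
      exact ⟨P.reflectionPerm l k, by rw [root_reflectionPerm, hk, reflection_same]⟩
    · rintro ⟨k, rfl⟩
      exact ⟨P.reflectionPerm l k, root_reflectionPerm ..⟩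
  have hli : LinearIndependent ℂ ![P.root (P.reflectionPerm l i), P.root (P.reflectionPerm l j)] ↔
      LinearIndependent ℂ ![P.root i, P.root j] := by
    rw [LinearIndependent.pair_iff, LinearIndependent.pair_iff]
    refine forall₂_congr fun s t => ?_
    have h : s • P.root (P.reflectionPerm l i) + t • P.root (P.reflectionPerm l j) =
        P.reflection l (s • P.root i + t • P.root j) := by
      simp only [root_reflectionPerm, LinearEquiv.map_add, LinearEquiv.map_smul]
    rw [h, LinearEquiv.map_eq_zero_iff]
  by_cases h : LinearIndependent ℂ ![P.root i, P.root j]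
  · refine eq_of_forall_le_iff fun n => ?_
    rw [← root_add_nsmul_mem_range_iff_le_chainTopCoeff h,
      ← root_add_nsmul_mem_range_iff_le_chainTopCoeff (hli.mpr h), root_reflectionPerm,
      root_reflectionPerm, ← map_nsmul, ← map_add, hr]
  · rw [chainTopCoeff_of_not_linearIndependent h,
      chainTopCoeff_of_not_linearIndependent (hli.not.mpr h)]

lemma chainBotCoeff_reflectionPerm (l i j : ι) :
    P.chainBotCoeff (P.reflectionPerm l i) (P.reflectionPerm l j) = P.chainBotCoeff i j := by
  rw [← chainTopCoeff_reflectionPerm_left, ← chainTopCoeff_reflectionPerm_left,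
    ← chainTopCoeff_reflectionPerm l]
  congr 1
  · apply P.root.injective
    rw [root_reflectionPerm, root_neg, root_reflectionPerm, map_neg, reflection_same, root_neg]
  · simp

/-- The length of the string of weights of the adjoint representation through the root `j` in
the direction of the root `i`. -/
def stringLength (P : RootPairing ι ℂ M N) [P.IsCrystallographic] (i j : ι) : ℤ :=
  -- The string through a root in its own direction is `-α, 0, α`; it passes through the zero
  -- weight, which chain coefficients do not see.
  if j = i ∨ j = P.reflectionPerm i i then 2 else P.chainBotCoeff i j + P.chainTopCoeff i j

/-- The number of steps from the root `j` to the top of its string in the direction of `i`. -/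
def stringTop (P : RootPairing ι ℂ M N) [P.IsCrystallographic] (i j : ι) : ℤ :=
  if j = i then 0 else if j = P.reflectionPerm i i then 2 else P.chainTopCoeff i j

/-- The length of a string is the sum of the distances to its top and bottom, and the pairing is
bottom minus top. -/
lemma two_mul_stringTop (i j : ι) :
    2 * stringTop P i j = stringLength P i j - P.pairingIn ℤ j i := by
  unfold stringTop stringLength
  by_cases h1 : j = i
  · simp [h1]
  by_cases h2 : j = P.reflectionPerm i i
  · subst h2
    simp [h1]
  · have hli : LinearIndependent ℂ ![P.root i, P.root j] := by
      rw [IsReduced.linearIndependent_iff]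
      refine ⟨fun h => h1 h.symm, fun h => h2 ?_⟩
      apply P.root.injective
      rw [root_neg, h, neg_neg]
    have := chainBotCoeff_sub_chainTopCoeff hli
    simp only [h1, h2, or_self, if_false]
    omega

lemma stringLength_reflectionPerm (l i j : ι) :
    stringLength P (P.reflectionPerm l i) (P.reflectionPerm l j) = stringLength P i j := by
  have h : P.reflectionPerm (P.reflectionPerm l i) (P.reflectionPerm l i) =
      P.reflectionPerm l (P.reflectionPerm i i) := by
    apply P.root.injective
    rw [root_neg, root_reflectionPerm, root_reflectionPerm, root_neg, map_neg]
  simp only [stringLength, chainBotCoeff_reflectionPerm, chainTopCoeff_reflectionPerm, h,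
    EmbeddingLike.apply_eq_iff_eq]

lemma stringLength_neg (i j : ι) :
    stringLength P (P.reflectionPerm i i) j = stringLength P i j := by
  simp only [stringLength, chainTopCoeff_reflectionPerm_left, chainBotCoeff_reflectionPerm_left,
    neg_neg_index, or_comm, add_comm]

lemma stringLength_weylPerm (w : List b.support) (i j : ι) :
    stringLength P (weylPerm w i) (weylPerm w j) = stringLength P i j := by
  induction w with
  | nil => rfl
  | cons s w ih => rw [weylPerm_cons, weylPerm_cons, stringLength_reflectionPerm, ih]

/-- The sum of `c s j` over the successive reflections `s` of a word and the roots `j` to which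
they are applied. -/
def pathSum (c : ι → ι → ℤ) : List b.support → ι → ℤ
  | [], _ => 0
  | s :: w, i => pathSum c w i + c s (weylPerm w i)

/-- The sum telescopes: each reflection in a simple root lowers the height by the pairing. -/
lemma pathSum_pairing (w : List b.support) (i : ι) :
    pathSum (fun s j => P.pairingIn ℤ j s) w i = b.height i - b.height (weylPerm w i) := by
  induction w with
  | nil => simp [pathSum]
  | cons s w ih =>
    have : P.root (weylPerm (s :: w) i) = P.root (weylPerm w i) +
        (-P.pairingIn ℤ (weylPerm w i) s) • P.root s := by
      rw [weylPerm_cons, root_reflectionPerm, neg_smul, reflection_apply_root' ℤ, sub_eq_add_neg]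
    rw [pathSum, ih, b.height_add_zsmul this, Base.height_one_of_mem_support s.2]
    simp only [smul_eq_mul]
    ring

lemma two_mul_pathSum_stringTop (w : List b.support) (i : ι) :
    2 * pathSum (stringTop P) w i =
      pathSum (stringLength P) w i - pathSum (fun s j => P.pairingIn ℤ j s) w i := by
  induction w with
  | nil => simp [pathSum]
  | cons s w ih =>
    have := two_mul_stringTop (P := P) s (weylPerm w i)
    simp only [pathSum]
    omega

open Classical in
-- String lengths are invariant under the Weyl group, so the contribution of a letter can be moved
-- back to the starting root. It becomes the length in the direction of the inversion of `w`
-- belonging to that letter, and a reduced word meets each inversion exactly once.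
lemma pathSum_stringLength {w : List b.support} (hw : IsReducedWord w) (i : ι) :
    pathSum (stringLength P) w i =
      ∑ j with b.IsPos j ∧ ¬ b.IsPos (weylPerm w j), stringLength P j i := by
  induction w with
  | nil => simp [pathSum]
  | cons s w ih =>
    have hs := hw.isPos_of_cons
    set t := weylPerm w.reverse s with ht
    have hwt : weylPerm w t = s := weylPerm_reverse w s
    have hset : (Finset.univ.filter fun j => b.IsPos j ∧ ¬ b.IsPos (weylPerm (s :: w) j)) =
        insert t (Finset.univ.filter fun j => b.IsPos j ∧ ¬ b.IsPos (weylPerm w j)) := by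
      ext j
      rw [Finset.mem_filter, Finset.mem_insert, Finset.mem_filter, weylPerm_cons]
      simp only [Finset.mem_univ, true_and]
      by_cases hj : weylPerm w j = s
      · have : j = t := (weylPerm w).injective (hj.trans hwt.symm)
        subst this
        simp [hj, isPos_neg_iff, isPos_simple, hs]
      · have hjt : j ≠ t := fun h => hj (h ▸ hwt)
        simp only [hjt, false_or, and_congr_right_iff]
        intro hpj
        rw [not_iff_not]
        constructor
        · intro h
          by_contra hn
          have h1 : b.IsPos (P.reflectionPerm (weylPerm w j) (weylPerm w j)) :=
            (isPos_neg_iff _).mpr hn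
          by_cases h2 : P.reflectionPerm (weylPerm w j) (weylPerm w j) = s
          · have h3 : j = P.reflectionPerm t t := by
              apply (weylPerm w).injective
              rw [weylPerm_neg, hwt, ← h2, neg_neg_index]
            rw [h3, isPos_neg_iff] at hpj
            exact hpj hs
          · have h3 := h1.reflectionPerm s.2 h2
            have h4 : P.reflectionPerm s (P.reflectionPerm (weylPerm w j) (weylPerm w j)) =
              P.reflectionPerm (P.reflectionPerm s (weylPerm w j))
                (P.reflectionPerm s (weylPerm w j)) := by
              apply P.root.injective
              rw [root_reflectionPerm, root_neg, root_neg, map_neg, root_reflectionPerm]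
            rw [h4, isPos_neg_iff] at h3
            exact h3 h
        · exact fun h => h.reflectionPerm s.2 hj
    rw [hset, Finset.sum_insert (by simp [hwt, isPos_simple]), pathSum, ih hw.of_cons,
      ← stringLength_weylPerm w t i, hwt, add_comm]

open Classical in
lemma two_mul_sum_stringLength (i : ι) :
    2 * ∑ j with b.IsPos j, stringLength P j i = ∑ j, stringLength P j i := by
  rw [← Finset.sum_filter_add_sum_filter_not Finset.univ (fun j => b.IsPos j), two_mul]
  congr 1
  refine Finset.sum_bij' (fun j _ => P.reflectionPerm j j) (fun j _ => P.reflectionPerm j j)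
    ?_ ?_ ?_ ?_ ?_
  · intro j hj
    simpa [isPos_neg_iff] using hj
  · intro j hj
    simpa [isPos_neg_iff] using hj
  · exact fun j _ => neg_neg_index j
  · exact fun j _ => neg_neg_index j
  · exact fun j _ => (stringLength_neg j i).symm

/-- For `w₀` the inversions are all positive roots, so the total string length is half a sum over
all roots and takes the same value at `i` and at `w₀ i`. Twice the path sums are this common value
minus and plus twice the height of `i`. Hence the path sums differ by twice the height, and their
sum is even. -/
lemma IsLongestWord.even_pathSum [P.IsRootSystem] (hw : IsLongestWord w) (i : ι) :
    Even (pathSum (stringTop P) w i + pathSum (stringTop P) w (weylPerm w i)) := by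
  classical
  have hL : ∀ i, pathSum (stringLength P) w i = ∑ j with b.IsPos j, stringLength P j i := by
    intro i
    rw [pathSum_stringLength hw.1]
    refine Finset.sum_congr (Finset.filter_congr fun j _ => ?_) fun _ _ => rfl
    rw [hw.isPos_iff]
    simp
  have h1 := two_mul_pathSum_stringTop w i
  have h2 := two_mul_pathSum_stringTop w (weylPerm w i)
  rw [pathSum_pairing, hw.height_weylPerm] at h1
  rw [pathSum_pairing, hw.weylPerm_weylPerm, hw.height_weylPerm] at h2
  have h3 : pathSum (stringLength P) w (weylPerm w i) = pathSum (stringLength P) w i := by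
    have e1 := two_mul_sum_stringLength (b := b) i
    have e2 := two_mul_sum_stringLength (b := b) (weylPerm w i)
    rw [← hL] at e1 e2
    have e3 : ∑ j, stringLength P j (weylPerm w i) = ∑ j, stringLength P j i := by
      rw [← Equiv.sum_comp (weylPerm w)]
      exact Finset.sum_congr rfl fun j _ => stringLength_weylPerm w j i
    omega
  exact ⟨pathSum (stringTop P) w i + b.height i, by omega⟩


end Parity

/-! ### Matrices of group elements and root subgroups -/

section Mat

/-- The matrix of an element of `G`. -/
def mat : adjointGroup b →* Matrix (b.support ⊕ ι) (b.support ⊕ ι) ℂ :=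
  (Units.coeHom _).comp (adjointGroup b).subtype

lemma mat_injective : Function.Injective (mat (b := b)) :=
  Units.val_injective.comp Subtype.val_injective

lemma entries_eq_mat (g : adjointGroup b) (i j : b.support ⊕ ι) : entries g (i, j) = mat g i j := rfl

@[simp] lemma mat_mul_inv (g : adjointGroup b) : mat g * mat g⁻¹ = 1 := by
  rw [← map_mul, mul_inv_cancel, map_one]

@[simp] lemma mat_inv_mul (g : adjointGroup b) : mat g⁻¹ * mat g = 1 := by
  rw [← map_mul, inv_mul_cancel, map_one]

lemma mat_xG (s : b.support) (t : ℂ) :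
    mat (xG b s t) = IsNilpotent.exp (t • GeckConstruction.e s) := rfl

lemma mat_yG (s : b.support) (t : ℂ) :
    mat (yG b s t) = IsNilpotent.exp (t • GeckConstruction.f s) := rfl

lemma mat_torG (χ : Multiplicative (P.rootSpan ℤ) →* ℂˣ) :
    mat (torG b χ) = Matrix.diagonal fun i => (χ (.ofAdd (wt b i)) : ℂ) := rfl

lemma mat_conj_exp (g : adjointGroup b) {a : Matrix (b.support ⊕ ι) (b.support ⊕ ι) ℂ}
    (ha : IsNilpotent a) :
    mat g * IsNilpotent.exp a * mat g⁻¹ = IsNilpotent.exp (mat g * a * mat g⁻¹) := by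
  simpa [mat] using conj_exp (g : GLn b) ha

/-- Conjugation of root subgroups, from conjugation of root vectors. -/
lemma conj_xG_eq_yG (g : adjointGroup b) (s t : b.support) (c a : ℂ)
    (h : mat g * GeckConstruction.e s = c • GeckConstruction.f t * mat g) :
    g * xG b s a * g⁻¹ = yG b t (c * a) := by
  apply mat_injective
  rw [map_mul, map_mul, mat_xG, mat_conj_exp g ((GeckConstruction.isNilpotent_e s).smul a), mat_yG,
    mul_smul_comm, h, smul_mul_assoc, mul_assoc, mat_mul_inv, mul_one, smul_smul, mul_comm a]

lemma conj_yG_eq_xG (g : adjointGroup b) (s t : b.support) (c a : ℂ)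
    (h : mat g * GeckConstruction.f s = c • GeckConstruction.e t * mat g) :
    g * yG b s a * g⁻¹ = xG b t (c * a) := by
  apply mat_injective
  rw [map_mul, map_mul, mat_yG, mat_conj_exp g ((GeckConstruction.isNilpotent_f s).smul a), mat_xG,
    mul_smul_comm, h, smul_mul_assoc, mul_assoc, mat_mul_inv, mul_one, smul_smul, mul_comm a]

lemma xG_add (s : b.support) (a c : ℂ) : xG b s (a + c) = xG b s a * xG b s c := by
  apply mat_injective
  rw [map_mul, mat_xG, mat_xG, mat_xG, add_smul]
  exact IsNilpotent.exp_add_of_commute (((Commute.refl _).smul_left _).smul_right _)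
    ((GeckConstruction.isNilpotent_e s).smul a) ((GeckConstruction.isNilpotent_e s).smul c)

lemma yG_add (s : b.support) (a c : ℂ) : yG b s (a + c) = yG b s a * yG b s c := by
  apply mat_injective
  rw [map_mul, mat_yG, mat_yG, mat_yG, add_smul]
  exact IsNilpotent.exp_add_of_commute (((Commute.refl _).smul_left _).smul_right _)
    ((GeckConstruction.isNilpotent_f s).smul a) ((GeckConstruction.isNilpotent_f s).smul c)

@[simp] lemma xG_zero (s : b.support) : xG b s 0 = 1 := by
  simpa using xG_add (b := b) s 0 0

@[simp] lemma yG_zero (s : b.support) : yG b s 0 = 1 := by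
  simpa using yG_add (b := b) s 0 0

lemma xG_inv (s : b.support) (a : ℂ) : (xG b s a)⁻¹ = xG b s (-a) := by
  rw [inv_eq_iff_mul_eq_one, ← xG_add, add_neg_cancel, xG_zero]

lemma yG_inv (s : b.support) (a : ℂ) : (yG b s a)⁻¹ = yG b s (-a) := by
  rw [inv_eq_iff_mul_eq_one, ← yG_add, add_neg_cancel, yG_zero]

end Mat

/-! ### Lifts of simple reflections and the transposition -/

section SimpleReflection

variable (s : b.support)

lemma mat_nBar : mat (nBar b s) = IsNilpotent.exp (-GeckConstruction.e s) *
    IsNilpotent.exp (GeckConstruction.f s) * IsNilpotent.exp (-GeckConstruction.e s) := by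
  simp [nBar, mat_xG, mat_yG]

lemma e_mul_h : (GeckConstruction.e s : Matrix _ _ ℂ) * GeckConstruction.h s =
    GeckConstruction.h s * GeckConstruction.e s - (2 : ℂ) • GeckConstruction.e s := by
  rw [h_eq_dMat, e_mul_dMat]; simp

lemma f_mul_h : (GeckConstruction.f s : Matrix _ _ ℂ) * GeckConstruction.h s =
    GeckConstruction.h s * GeckConstruction.f s + (2 : ℂ) • GeckConstruction.f s := by
  rw [h_eq_dMat, f_mul_dMat]; simp

lemma f_mul_e : (GeckConstruction.f s : Matrix _ _ ℂ) * GeckConstruction.e s =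
    GeckConstruction.e s * GeckConstruction.f s - GeckConstruction.h s := by
  have := GeckConstruction.lie_e_f_same (R := ℂ) s
  rw [Ring.lie_def] at this
  rw [← this]; abel

/-- A computation in `sl₂`: the vector is carried through the three exponentials one at a time, and
every bracket series stops after the second term, as `exp_mul_of_lie` requires. -/
lemma nBar_mul_e : mat (nBar b s) * GeckConstruction.e s =
    (-GeckConstruction.f s) * mat (nBar b s) := by
  rw [mat_nBar]
  have eh := e_mul_h s
  have fh := f_mul_h s
  have ef := f_mul_e s
  have ne : IsNilpotent (-(GeckConstruction.e s : Matrix _ _ ℂ)) :=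
    (GeckConstruction.isNilpotent_e s).neg
  have nf : IsNilpotent (GeckConstruction.f s : Matrix _ _ ℂ) := GeckConstruction.isNilpotent_f s
  set e : Matrix _ _ ℂ := GeckConstruction.e s
  set f : Matrix _ _ ℂ := GeckConstruction.f s
  set h : Matrix _ _ ℂ := GeckConstruction.h s
  have A1 : IsNilpotent.exp (-e) * e = (e + 0 + 0) * IsNilpotent.exp (-e) :=
    exp_mul_of_lie ne (by simp) (by simp) (by simp)
  have A2 : IsNilpotent.exp f * e = (e + (-h) + (-f)) * IsNilpotent.exp f :=
    exp_mul_of_lie nf (by rw [ef]; abel) (by rw [mul_neg, fh, neg_mul]; module) (by simp)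
  have A3 : IsNilpotent.exp (-e) * (e + (-h) + (-f)) =
      ((e + (-h) + (-f)) + (h - (2 : ℂ) • e) + e) * IsNilpotent.exp (-e) :=
    exp_mul_of_lie ne
      (by simp only [mul_add, add_mul, neg_mul, mul_neg, eh, ef]; module)
      (by simp only [mul_sub, sub_mul, neg_mul, mul_smul_comm, smul_mul_assoc, mul_neg, eh]; module)
      (by simp)
  have e3 : (e + (-h) + (-f)) + (h - (2 : ℂ) • e) + e = -f := by module
  rw [e3] at A3
  rw [add_zero, add_zero] at A1
  rw [mul_assoc, A1, ← mul_assoc, mul_assoc (IsNilpotent.exp (-e)), A2, ← mul_assoc, A3]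
  simp only [mul_assoc]

lemma nBar_mul_f : mat (nBar b s) * GeckConstruction.f s =
    (-GeckConstruction.e s) * mat (nBar b s) := by
  rw [mat_nBar]
  have eh := e_mul_h s
  have fh := f_mul_h s
  have ef := f_mul_e s
  have ne : IsNilpotent (-(GeckConstruction.e s : Matrix _ _ ℂ)) :=
    (GeckConstruction.isNilpotent_e s).neg
  have nf : IsNilpotent (GeckConstruction.f s : Matrix _ _ ℂ) := GeckConstruction.isNilpotent_f s
  set e : Matrix _ _ ℂ := GeckConstruction.e s
  set f : Matrix _ _ ℂ := GeckConstruction.f s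
  set h : Matrix _ _ ℂ := GeckConstruction.h s
  have A1 : IsNilpotent.exp (-e) * f = (f + (-h) + (-e)) * IsNilpotent.exp (-e) :=
    exp_mul_of_lie ne (by rw [mul_neg, ef, neg_mul]; abel)
      (by simp only [neg_mul, mul_neg, neg_neg, eh]; module) (by simp)
  have A2 : IsNilpotent.exp f * (f + (-h) + (-e)) =
      ((f + (-h) + (-e)) + (h - (2 : ℂ) • f) + f) * IsNilpotent.exp f :=
    exp_mul_of_lie nf
      (by simp only [mul_add, add_mul, neg_mul, mul_neg, fh, ef]; module)
      (by simp only [mul_sub, sub_mul, mul_smul_comm, smul_mul_assoc, fh]; module)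
      (by simp)
  have e2 : (f + (-h) + (-e)) + (h - (2 : ℂ) • f) + f = -e := by module
  have A3 : IsNilpotent.exp (-e) * (-e) = ((-e) + 0 + 0) * IsNilpotent.exp (-e) :=
    exp_mul_of_lie ne (by simp) (by simp) (by simp)
  rw [e2] at A2
  rw [add_zero, add_zero] at A3
  rw [mul_assoc, A1, ← mul_assoc, mul_assoc (IsNilpotent.exp (-e)), A2, ← mul_assoc, A3]
  simp only [mul_assoc]

lemma nBar_conj_xG (a : ℂ) : nBar b s * xG b s a * (nBar b s)⁻¹ = yG b s (-a) := by
  rw [conj_xG_eq_yG _ s s (-1) a (by rw [nBar_mul_e]; simp), neg_one_mul]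

lemma nBar_conj_yG (a : ℂ) : nBar b s * yG b s a * (nBar b s)⁻¹ = xG b s (-a) := by
  rw [conj_yG_eq_xG _ s s (-1) a (by rw [nBar_mul_f]; simp), neg_one_mul]

/-- Conjugating the definition of the lift by the lift itself leaves it unchanged and exchanges the
two root subgroups. -/
lemma nBar_eq : nBar b s = yG b s 1 * xG b s (-1) * yG b s 1 := by
  calc nBar b s = nBar b s * nBar b s * (nBar b s)⁻¹ := by group
    _ = nBar b s * (xG b s (-1) * yG b s 1 * xG b s (-1)) * (nBar b s)⁻¹ := rfl
    _ = (nBar b s * xG b s (-1) * (nBar b s)⁻¹) * (nBar b s * yG b s 1 * (nBar b s)⁻¹) *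
        (nBar b s * xG b s (-1) * (nBar b s)⁻¹) := by group
    _ = _ := by rw [nBar_conj_xG, nBar_conj_yG, neg_neg]

/-- Transposing `x(-1) y(1) x(-1)` gives `y(-1) x(1) y(-1)`, the inverse of the second expression
for the lift. -/
lemma transpose_nBar : transpose b (nBar b s) = (nBar b s)⁻¹ := by
  conv_rhs => rw [nBar_eq]
  rw [nBar, transpose_mul, transpose_mul, transpose_xG, transpose_yG]
  simp only [mul_inv_rev, xG_inv, yG_inv, neg_neg, mul_assoc]

lemma transpose_one : transpose b (1 : adjointGroup b) = 1 := by
  simp [transpose]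

lemma transpose_inv (g : adjointGroup b) : transpose b g⁻¹ = (transpose b g)⁻¹ := by
  rw [eq_inv_iff_mul_eq_one, ← transpose_mul, mul_inv_cancel, transpose_one]

lemma wBar_cons (w : List b.support) : wBar (s :: w) = nBar b s * wBar w := by
  simp [wBar]

lemma transpose_wBar (w : List b.support) : transpose b (wBar w) = (wBar w)⁻¹ := by
  induction w with
  | nil => simp [wBar, transpose_one]
  | cons s w ih => rw [wBar_cons, transpose_mul, ih, transpose_nBar, mul_inv_rev]

lemma transpose_transpose (g : adjointGroup b) : transpose b (transpose b g) = g := by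
  have hg := g.2
  have key : ∀ (g : GLn b) (hg : g ∈ adjointGroup b),
      transpose b (transpose b ⟨g, hg⟩) = ⟨g, hg⟩ := by
    intro g hg
    induction hg using Subgroup.closure_induction with
    | mem g h =>
      rcases h with (⟨s, t, rfl⟩ | ⟨s, t, rfl⟩) | ⟨χ, rfl⟩
      · exact (congrArg _ (transpose_xG b s t)).trans (transpose_yG b s t)
      · exact (congrArg _ (transpose_yG b s t)).trans (transpose_xG b s t)
      · exact (congrArg _ (transpose_torG b χ)).trans (transpose_torG b χ)
    | one => exact (congrArg _ transpose_one).trans transpose_one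
    | mul x y hx hy ihx ihy =>
      have : (⟨x * y, mul_mem hx hy⟩ : adjointGroup b) = ⟨x, hx⟩ * ⟨y, hy⟩ := rfl
      refine (congrArg (fun z => transpose b (transpose b z)) this).trans ?_
      rw [transpose_mul, transpose_mul, ihx, ihy, this]
    | inv x hx ih =>
      have : (⟨x⁻¹, inv_mem hx⟩ : adjointGroup b) = (⟨x, hx⟩)⁻¹ := rfl
      refine (congrArg (fun z => transpose b (transpose b z)) this).trans ?_
      rw [transpose_inv, transpose_inv, ih, this]
  exact key g hg

end SimpleReflection

section Height

variable [P.IsRootSystem]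

variable (b) in
/-- The height function on the root lattice. -/
def ht : P.rootSpan ℤ →+ ℤ where
  toFun x := ∑ s, b.toWeightBasisInt.repr x s
  map_zero' := by simp
  map_add' x y := by simp [Finset.sum_add_distrib]

@[simp] lemma ht_simple (s : b.support) : ht b (P.rootSpanMem ℤ s) = 1 := by
  have : P.rootSpanMem ℤ s = b.toWeightBasisInt s := by ext; simp
  simp [ht, this, Finsupp.single_apply]

end Height

/-! ### The Lie algebra of the group and conjugation by the lift of the longest element -/

section Brackets

/-- Conjugation by `exp a` is the exponential of the nilpotent operator `ad a`, the sum of the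
commuting left and right multiplications. Every power of `ad a` preserves the subspace. -/
lemma conj_exp_mem {n : Type*} [Fintype n] [DecidableEq n] {a X : Matrix n n ℂ}
    (ha : IsNilpotent a) (V : Submodule ℂ (Matrix n n ℂ))
    (hV : ∀ Y ∈ V, a * Y - Y * a ∈ V) (hX : X ∈ V) :
    IsNilpotent.exp a * X * IsNilpotent.exp (-a) ∈ V := by
  set L : Module.End ℂ (Matrix n n ℂ) := LinearMap.mulLeft ℂ a
  set R : Module.End ℂ (Matrix n n ℂ) := LinearMap.mulRight ℂ (-a)
  have hL : IsNilpotent L := ha.map (Algebra.lmul ℂ (Matrix n n ℂ))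
  have hR : IsNilpotent R := by
    obtain ⟨k, hk⟩ := ha
    exact ⟨k, by rw [LinearMap.pow_mulRight, neg_pow, hk]; simp⟩
  have hc : Commute L R := LinearMap.commute_mulLeft_right ..
  have hLR : IsNilpotent (L + R) := hc.isNilpotent_add hL hR
  have key : IsNilpotent.exp (L + R) = IsNilpotent.exp R * IsNilpotent.exp L := by
    rw [add_comm, IsNilpotent.exp_add_of_commute hc.symm hR hL]
  have eL : ∀ W, IsNilpotent.exp L W = IsNilpotent.exp a * W := by
    intro W
    have := IsNilpotent.map_exp ha (Algebra.lmul ℂ (Matrix n n ℂ))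
    change _ = IsNilpotent.exp L at this
    rw [← this]; rfl
  have eR : ∀ W, IsNilpotent.exp R W = W * IsNilpotent.exp (-a) := by
    intro W
    obtain ⟨k, hk⟩ := ha.neg
    have hk' : R ^ k = 0 := by rw [LinearMap.pow_mulRight, hk]; simp
    rw [IsNilpotent.exp_eq_sum hk, IsNilpotent.exp_eq_sum hk', Finset.mul_sum,
      LinearMap.sum_apply]
    refine Finset.sum_congr rfl fun i _ => ?_
    rw [LinearMap.smul_apply, LinearMap.pow_mulRight]
    simp
  have h1 : IsNilpotent.exp a * X * IsNilpotent.exp (-a) = IsNilpotent.exp (L + R) X := by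
    rw [key, Module.End.mul_apply, eL, eR]
  have hpow : ∀ k : ℕ, ((L + R) ^ k) X ∈ V := by
    intro k
    induction k with
    | zero => simpa using hX
    | succ k ih =>
      rw [pow_succ', Module.End.mul_apply]
      have : (L + R) (((L + R) ^ k) X) = a * (((L + R) ^ k) X) - (((L + R) ^ k) X) * a := by
        simp [L, R, sub_eq_add_neg]
      rw [this]
      exact hV _ ih
  obtain ⟨k, hk⟩ := hLR
  rw [h1, IsNilpotent.exp_eq_sum hk, LinearMap.sum_apply]
  refine sum_mem fun i _ => ?_
  have : ((i.factorial : ℚ)⁻¹ • (L + R) ^ i) X = (((i.factorial : ℚ)⁻¹ : ℚ) : ℂ) • ((L + R) ^ i) X := by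
    ext k l
    simp [Rat.smul_def]
  rw [this]
  exact V.smul_mem _ (hpow i)

/-- The iterated commutator `[x_{l₁}, [x_{l₂}, …, [x_{lₖ}, x_s]]]`. -/
def iterBracket {A β : Type*} [Ring A] (x : β → A) (s : β) : List β → A
  | [] => x s
  | t :: l => x t * iterBracket x s l - iterBracket x s l * x t

/-- The span of the iterated commutators. -/
def bracketSpan {A β : Type*} [Ring A] [Algebra ℂ A] (x : β → A) : Submodule ℂ A :=
  Submodule.span ℂ {y | ∃ s l, y = iterBracket x s l}

section

variable {A β : Type*} [Ring A] [Algebra ℂ A] {x y h : β → A}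

lemma bracketSpan_induction {p : A → Prop} (h0 : p 0) (ha : ∀ a c, p a → p c → p (a + c))
    (hs : ∀ (r : ℂ) a, p a → p (r • a)) (hx : ∀ s, p (x s))
    (hb : ∀ t s l, p (iterBracket x s l) → p (iterBracket x s (t :: l))) {a : A} 
    (haV : a ∈ bracketSpan x) : p a := by
  induction haV using Submodule.span_induction with
  | mem a h =>
    obtain ⟨s, l, rfl⟩ := h
    induction l with
    | nil => exact hx s
    | cons t l ih => exact hb t s l ih
  | zero => exact h0
  | add a c _ _ h1 h2 => exact ha a c h1 h2
  | smul r a _ h1 => exact hs r a h1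

lemma bracket_mem_bracketSpan (t : β) {a : A} (ha : a ∈ bracketSpan x) :
    x t * a - a * x t ∈ bracketSpan x := by
  induction ha using Submodule.span_induction with
  | mem a h =>
    obtain ⟨s, l, rfl⟩ := h
    exact Submodule.subset_span ⟨s, t :: l, rfl⟩
  | zero => simp
  | add a c _ _ h1 h2 =>
    have : x t * (a + c) - (a + c) * x t = (x t * a - a * x t) + (x t * c - c * x t) := by
      rw [mul_add, add_mul]; abel
    exact this ▸ add_mem h1 h2
  | smul r a _ h1 =>
    have : x t * (r • a) - (r • a) * x t = r • (x t * a - a * x t) := by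
      rw [mul_smul_comm, smul_mul_assoc, smul_sub]
    exact this ▸ Submodule.smul_mem _ _ h1

lemma iterBracket_weight (hhx : ∀ t s, ∃ c : ℂ, h t * x s - x s * h t = c • x s) (t s : β)
    (l : List β) :
    ∃ c : ℂ, h t * iterBracket x s l - iterBracket x s l * h t = c • iterBracket x s l := by
  induction l with
  | nil => exact hhx t s
  | cons r l ih =>
    obtain ⟨c, hc⟩ := ih
    obtain ⟨d, hd⟩ := hhx t r
    refine ⟨d + c, ?_⟩
    simp only [iterBracket]
    have e1 : h t * (x r * iterBracket x s l - iterBracket x s l * x r) -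
        (x r * iterBracket x s l - iterBracket x s l * x r) * h t =
        ((h t * x r - x r * h t) * iterBracket x s l - iterBracket x s l * (h t * x r - x r * h t)) +
        (x r * (h t * iterBracket x s l - iterBracket x s l * h t) -
          (h t * iterBracket x s l - iterBracket x s l * h t) * x r) := by noncomm_ring
    rw [e1, hc, hd]
    simp only [mul_smul_comm, smul_mul_assoc]
    module

/-- By the Jacobi identity `[y, [x, Z]]` is `[[y, x], Z] + [x, [y, Z]]`. The first term is a
combination of `[h, Z]`, which are multiples of `Z`; the second is handled by induction. No Serre
relations are needed. -/
lemma lie_mem_bracketSpan_sup (hhx : ∀ t s, ∃ c : ℂ, h t * x s - x s * h t = c • x s)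
    (hyx : ∀ t s, y t * x s - x s * y t ∈ Submodule.span ℂ (Set.range h)) (t : β) {a : A}
    (ha : a ∈ bracketSpan x) :
    y t * a - a * y t ∈ bracketSpan x ⊔ Submodule.span ℂ (Set.range h) := by
  have hh : ∀ u ∈ Submodule.span ℂ (Set.range h), ∀ s l,
      u * iterBracket x s l - iterBracket x s l * u ∈ bracketSpan x := by
    intro u hu s l
    induction hu using Submodule.span_induction with
    | mem u h' =>
      obtain ⟨t, rfl⟩ := h'
      obtain ⟨c, hc⟩ := iterBracket_weight hhx t s l
      rw [hc]
      exact Submodule.smul_mem _ _ (Submodule.subset_span ⟨s, l, rfl⟩)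
    | zero => simp
    | add a c _ _ h1 h2 =>
      have : ∀ z, (a + c) * z - z * (a + c) = (a * z - z * a) + (c * z - z * c) := by
        intro z; rw [mul_add, add_mul]; abel
      rw [this]
      exact add_mem h1 h2
    | smul r a _ h1 =>
      rw [mul_smul_comm, smul_mul_assoc, ← smul_sub]
      exact Submodule.smul_mem _ _ h1
  have hx : ∀ r, ∀ u ∈ bracketSpan x ⊔ Submodule.span ℂ (Set.range h),
      x r * u - u * x r ∈ bracketSpan x := by
    intro r u hu
    obtain ⟨p, hp, q, hq, rfl⟩ := Submodule.mem_sup.mp hu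
    have : x r * (p + q) - (p + q) * x r = (x r * p - p * x r) - (q * x r - x r * q) := by
      rw [mul_add, add_mul]; abel
    rw [this]
    exact sub_mem (bracket_mem_bracketSpan r hp) (hh q hq r [])
  refine bracketSpan_induction (p := fun a => y t * a - a * y t ∈ _) ?_ ?_ ?_ ?_ ?_ ha
  · simp
  · intro a c h1 h2
    have : y t * (a + c) - (a + c) * y t = (y t * a - a * y t) + (y t * c - c * y t) := by
      rw [mul_add, add_mul]; abel
    exact this ▸ add_mem h1 h2
  · intro r a h1
    rw [mul_smul_comm, smul_mul_assoc, ← smul_sub]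
    exact Submodule.smul_mem _ _ h1
  · exact fun s => Submodule.mem_sup_right (hyx t s)
  · intro r s l ih
    simp only [iterBracket]
    have e1 : y t * (x r * iterBracket x s l - iterBracket x s l * x r) -
        (x r * iterBracket x s l - iterBracket x s l * x r) * y t =
        ((y t * x r - x r * y t) * iterBracket x s l - iterBracket x s l * (y t * x r - x r * y t)) +
        (x r * (y t * iterBracket x s l - iterBracket x s l * y t) -
          (y t * iterBracket x s l - iterBracket x s l * y t) * x r) := by noncomm_ring
    rw [e1]
    exact Submodule.mem_sup_left (add_mem (hh _ (hyx t r) s l) (hx r _ ih))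

lemma lie_mem_sup (hhx : ∀ t s, ∃ c : ℂ, h t * x s - x s * h t = c • x s)
    (hhy : ∀ t s, ∃ c : ℂ, h t * y s - y s * h t = c • y s)
    (hxy : ∀ t s, x t * y s - y s * x t ∈ Submodule.span ℂ (Set.range h)) (t : β) {a : A}
    (ha : a ∈ bracketSpan x ⊔ Submodule.span ℂ (Set.range h) ⊔ bracketSpan y) :
    x t * a - a * x t ∈ bracketSpan x ⊔ Submodule.span ℂ (Set.range h) ⊔ bracketSpan y := by
  set D : A →ₗ[ℂ] A := LinearMap.mulLeft ℂ (x t) - LinearMap.mulRight ℂ (x t)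
  suffices bracketSpan x ⊔ Submodule.span ℂ (Set.range h) ⊔ bracketSpan y ≤
      (bracketSpan x ⊔ Submodule.span ℂ (Set.range h) ⊔ bracketSpan y).comap D from this ha
  refine sup_le (sup_le ?_ ?_) ?_
  · exact fun a ha => Submodule.mem_sup_left (Submodule.mem_sup_left (bracket_mem_bracketSpan t ha))
  · refine Submodule.span_le.mpr ?_
    rintro _ ⟨s, rfl⟩
    obtain ⟨c, hc⟩ := hhx s t
    refine Submodule.mem_sup_left (Submodule.mem_sup_left ?_)
    change x t * h s - h s * x t ∈ _
    rw [← neg_sub, hc]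
    exact neg_mem (Submodule.smul_mem _ _ (Submodule.subset_span ⟨t, [], rfl⟩))
  · intro a ha
    have := lie_mem_bracketSpan_sup hhy hxy t ha
    have hle : bracketSpan y ⊔ Submodule.span ℂ (Set.range h) ≤
        bracketSpan x ⊔ Submodule.span ℂ (Set.range h) ⊔ bracketSpan y :=
      sup_le le_sup_right (le_sup_of_le_left le_sup_right)
    exact hle this

end

variable [P.IsRootSystem]

lemma lie_e_f_mem (s t : b.support) :
    (GeckConstruction.e s * GeckConstruction.f t - GeckConstruction.f t * GeckConstruction.e s :
      Matrix (b.support ⊕ ι) (b.support ⊕ ι) ℂ) ∈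
      Submodule.span ℂ (Set.range (GeckConstruction.h (b := b))) := by
  by_cases h : s = t
  · subst h
    have := GeckConstruction.lie_e_f_same (R := ℂ) s
    rw [Ring.lie_def] at this
    rw [this]
    exact Submodule.subset_span ⟨s, rfl⟩
  · have := RootPairing.GeckConstruction.lie_e_f_of_ne (K := ℂ) h
    rw [Ring.lie_def] at this
    rw [this]
    exact zero_mem _

variable (b) in
/-- The Lie algebra of `G`. -/
def lieSpan : Submodule ℂ (Matrix (b.support ⊕ ι) (b.support ⊕ ι) ℂ) :=
  bracketSpan (GeckConstruction.e (b := b)) ⊔ Submodule.span ℂ (Set.range GeckConstruction.h) ⊔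
    bracketSpan (GeckConstruction.f (b := b))

lemma h_e_weight (t s : b.support) : ∃ c : ℂ, (GeckConstruction.h t * GeckConstruction.e s -
    GeckConstruction.e s * GeckConstruction.h t : Matrix _ _ ℂ) = c • GeckConstruction.e s :=
  ⟨P.coroot' t (P.root s), by rw [h_eq_dMat, e_mul_dMat, sub_sub_cancel]⟩

lemma h_f_weight (t s : b.support) : ∃ c : ℂ, (GeckConstruction.h t * GeckConstruction.f s -
    GeckConstruction.f s * GeckConstruction.h t : Matrix _ _ ℂ) = c • GeckConstruction.f s :=
  ⟨-P.coroot' t (P.root s), by rw [h_eq_dMat, f_mul_dMat]; module⟩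

lemma e_bracket_mem_lieSpan (t : b.support) {X : Matrix (b.support ⊕ ι) (b.support ⊕ ι) ℂ}
    (hX : X ∈ lieSpan b) :
    GeckConstruction.e t * X - X * GeckConstruction.e t ∈ lieSpan b :=
  lie_mem_sup h_e_weight h_f_weight lie_e_f_mem t hX

lemma f_bracket_mem_lieSpan (t : b.support) {X : Matrix (b.support ⊕ ι) (b.support ⊕ ι) ℂ}
    (hX : X ∈ lieSpan b) :
    GeckConstruction.f t * X - X * GeckConstruction.f t ∈ lieSpan b := by
  have hfe : ∀ t s : b.support, (GeckConstruction.f t * GeckConstruction.e s -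
      GeckConstruction.e s * GeckConstruction.f t : Matrix (b.support ⊕ ι) (b.support ⊕ ι) ℂ) ∈
      Submodule.span ℂ (Set.range (GeckConstruction.h (b := b))) := fun t s => by
    rw [← neg_sub]
    exact neg_mem (lie_e_f_mem s t)
  rw [lieSpan, sup_assoc, sup_comm, sup_comm (Submodule.span ℂ _)] at hX ⊢
  exact lie_mem_sup h_f_weight h_e_weight hfe t hX

lemma conj_xG_mem_lieSpan (t : b.support) (a : ℂ) {X : Matrix (b.support ⊕ ι) (b.support ⊕ ι) ℂ}
    (hX : X ∈ lieSpan b) : mat (xG b t a) * X * mat (xG b t a)⁻¹ ∈ lieSpan b := by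
  rw [xG_inv, mat_xG, mat_xG, neg_smul]
  refine conj_exp_mem ((GeckConstruction.isNilpotent_e t).smul a) _ (fun Y hY => ?_) hX
  rw [smul_mul_assoc, mul_smul_comm, ← smul_sub]
  exact Submodule.smul_mem _ _ (e_bracket_mem_lieSpan t hY)

lemma conj_yG_mem_lieSpan (t : b.support) (a : ℂ) {X : Matrix (b.support ⊕ ι) (b.support ⊕ ι) ℂ}
    (hX : X ∈ lieSpan b) : mat (yG b t a) * X * mat (yG b t a)⁻¹ ∈ lieSpan b := by
  rw [yG_inv, mat_yG, mat_yG, neg_smul]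
  refine conj_exp_mem ((GeckConstruction.isNilpotent_f t).smul a) _ (fun Y hY => ?_) hX
  rw [smul_mul_assoc, mul_smul_comm, ← smul_sub]
  exact Submodule.smul_mem _ _ (f_bracket_mem_lieSpan t hY)

lemma conj_mul_mem_lieSpan {g g' : adjointGroup b}
    (hg : ∀ X ∈ lieSpan b, mat g * X * mat g⁻¹ ∈ lieSpan b)
    (hg' : ∀ X ∈ lieSpan b, mat g' * X * mat g'⁻¹ ∈ lieSpan b) :
    ∀ X ∈ lieSpan b, mat (g * g') * X * mat (g * g')⁻¹ ∈ lieSpan b := fun X hX => by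
  have := hg _ (hg' X hX)
  simpa [mul_assoc] using this

/-- The lift is a product of exponentials of the generators `e` and `f`, and brackets with these
preserve the Lie algebra. -/
lemma conj_wBar_mem_lieSpan (w : List b.support) :
    ∀ X ∈ lieSpan b, mat (wBar w) * X * mat (wBar w)⁻¹ ∈ lieSpan b := by
  induction w with
  | nil => intro X hX; simpa [wBar] using hX
  | cons s w ih =>
    rw [wBar_cons]
    refine conj_mul_mem_lieSpan ?_ ih
    exact conj_mul_mem_lieSpan (conj_mul_mem_lieSpan (fun X => conj_xG_mem_lieSpan s _)
      (fun X => conj_yG_mem_lieSpan s _)) (fun X => conj_xG_mem_lieSpan s _)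

/-- `X` has weight `σ` for the adjoint action of the Cartan subalgebra. -/
def HasWeight (X : Matrix (b.support ⊕ ι) (b.support ⊕ ι) ℂ) (σ : M) : Prop :=
  ∀ φ : Module.Dual ℂ M, dMat b φ * X = X * dMat b φ + φ σ • X

lemma HasWeight.wt_eq {X : Matrix (b.support ⊕ ι) (b.support ⊕ ι) ℂ} {σ : M} (h : HasWeight X σ)
    {i j : b.support ⊕ ι} (hij : X i j ≠ 0) : (wt b i : M) = wt b j + σ := by
  rw [← sub_eq_zero, ← Module.forall_dual_apply_eq_zero_iff ℂ]
  intro φ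
  have := congr_fun (congr_fun (h φ) i) j
  rw [dMat, Matrix.diagonal_mul, Matrix.add_apply, Matrix.mul_diagonal, Matrix.smul_apply,
    smul_eq_mul, mul_comm (X i j), ← add_mul] at this
  have := mul_right_cancel₀ hij this
  simp [this]

lemma hasWeight_e (s : b.support) : HasWeight (GeckConstruction.e s) (P.root s) := fun φ => by
  rw [e_mul_dMat]; abel

/-- The lift intertwines the diagonal operators of `φ` and of its reflection, so weights are
reflected. -/
lemma HasWeight.conj_nBar {X : Matrix (b.support ⊕ ι) (b.support ⊕ ι) ℂ} {σ : M}
    (h : HasWeight X σ) (s : b.support) :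
    HasWeight (mat (nBar b s) * X * mat (nBar b s)⁻¹) (P.reflection s σ) := by
  have key : ∀ φ : Module.Dual ℂ M,
      dMat b (φ - φ (P.root s) • P.coroot' s) = dMat b φ - φ (P.root s) • GeckConstruction.h s := by
    intro φ
    rw [h_eq_dMat]
    ext i j
    by_cases hij : i = j
    · subst hij; simp [dMat]
    · simp [dMat, hij]
  have key2 : ∀ φ : Module.Dual ℂ M, mat (nBar b s) * dMat b φ =
      dMat b (φ - φ (P.root s) • P.coroot' s) * mat (nBar b s) := fun φ => by
    rw [key]; exact nBar_mul_dMat b s φ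
  have key3 : ∀ φ : Module.Dual ℂ M, dMat b φ * mat (nBar b s) =
      mat (nBar b s) * dMat b (φ - φ (P.root s) • P.coroot' s) := fun φ => by
    rw [key2]
    congr 2
    ext x
    simp
    ring
  have key4 : ∀ φ : Module.Dual ℂ M, mat (nBar b s)⁻¹ * dMat b φ =
      dMat b (φ - φ (P.root s) • P.coroot' s) * mat (nBar b s)⁻¹ := fun φ => by
    have h1 := congrArg (fun Z => mat (nBar b s)⁻¹ * Z * mat (nBar b s)⁻¹) (key3 φ)
    simp only [← mul_assoc, mat_inv_mul, one_mul] at h1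
    rw [mul_assoc, mul_assoc, mat_mul_inv, mul_one] at h1
    exact h1
  intro φ
  have h1 := h (φ - φ (P.root s) • P.coroot' s)
  have h2 : φ (P.reflection s σ) = (φ - φ (P.root s) • P.coroot' s) σ := by
    simp [reflection_apply, mul_comm]
  calc _ = mat (nBar b s) * (dMat b (φ - φ (P.root s) • P.coroot' s) * X) * mat (nBar b s)⁻¹ := by
        rw [← mul_assoc, ← mul_assoc, key3, mul_assoc (mat (nBar b s))]
    _ = _ := by
        rw [h1, h2, mul_add, add_mul, mul_assoc _ _ (dMat b φ), key4, mul_smul_comm, smul_mul_assoc]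
        simp only [mul_assoc]

lemma HasWeight.conj_wBar {X : Matrix (b.support ⊕ ι) (b.support ⊕ ι) ℂ} {σ : M}
    (h : HasWeight X σ) (w : List b.support) :
    HasWeight (mat (wBar w) * X * mat (wBar w)⁻¹) (weylWord w σ) := by
  induction w with
  | nil => simpa [wBar] using h
  | cons s w ih =>
    have := ih.conj_nBar s
    rw [wBar_cons, weylWord_cons]
    simpa [mul_assoc] using this

lemma iterBracket_e_apply_ne_zero (s : b.support) (l : List b.support) {i j : b.support ⊕ ι}
    (h : iterBracket (GeckConstruction.e (R := ℂ) (b := b)) s l i j ≠ 0) :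
    ht b (wt b i) = ht b (wt b j) + (l.length + 1) := by
  induction l generalizing i j with
  | nil => simp [e_apply_ne_zero b s h]
  | cons t l ih =>
    rw [iterBracket, Matrix.sub_apply] at h
    have h' : (GeckConstruction.e (R := ℂ) t * iterBracket GeckConstruction.e s l) i j ≠ 0 ∨
        (iterBracket GeckConstruction.e s l * GeckConstruction.e (R := ℂ) t) i j ≠ 0 := by
      by_contra! h'
      simp [h'] at h
    rcases h' with h' | h'
    · obtain ⟨k, -, hk⟩ := Finset.exists_ne_zero_of_sum_ne_zero h'
      rw [e_apply_ne_zero b t (left_ne_zero_of_mul hk), map_add, ih (right_ne_zero_of_mul hk),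
        ht_simple, List.length_cons]
      push_cast; ring
    · obtain ⟨k, -, hk⟩ := Finset.exists_ne_zero_of_sum_ne_zero h'
      rw [ih (left_ne_zero_of_mul hk), e_apply_ne_zero b t (right_ne_zero_of_mul hk), map_add,
        ht_simple, List.length_cons]
      push_cast; ring

lemma iterBracket_f_apply_ne_zero (s : b.support) (l : List b.support) {i j : b.support ⊕ ι}
    (h : iterBracket (GeckConstruction.f (R := ℂ) (b := b)) s l i j ≠ 0) :
    ht b (wt b j) = ht b (wt b i) + (l.length + 1) := by
  induction l generalizing i j with
  | nil => simp [f_apply_ne_zero b s h]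
  | cons t l ih =>
    rw [iterBracket, Matrix.sub_apply] at h
    have h' : (GeckConstruction.f (R := ℂ) t * iterBracket GeckConstruction.f s l) i j ≠ 0 ∨
        (iterBracket GeckConstruction.f s l * GeckConstruction.f (R := ℂ) t) i j ≠ 0 := by
      by_contra! h'
      simp [h'] at h
    rcases h' with h' | h'
    · obtain ⟨k, -, hk⟩ := Finset.exists_ne_zero_of_sum_ne_zero h'
      rw [ih (right_ne_zero_of_mul hk), f_apply_ne_zero b t (left_ne_zero_of_mul hk), map_add,
        ht_simple, List.length_cons]
      push_cast; ring
    · obtain ⟨k, -, hk⟩ := Finset.exists_ne_zero_of_sum_ne_zero h'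
      rw [f_apply_ne_zero b t (right_ne_zero_of_mul hk), map_add, ih (left_ne_zero_of_mul hk),
        ht_simple, List.length_cons]
      push_cast; ring

/-- The component of weight `-σ`. -/
def weightProj (σ : P.rootSpan ℤ) :
    Matrix (b.support ⊕ ι) (b.support ⊕ ι) ℂ →ₗ[ℂ] Matrix (b.support ⊕ ι) (b.support ⊕ ι) ℂ where
  toFun X := open Classical in .of fun i j => if wt b j = wt b i + σ then X i j else 0
  map_add' X Y := by ext i j; by_cases h : wt b j = wt b i + σ <;> simp [h]
  map_smul' r X := by ext i j; by_cases h : wt b j = wt b i + σ <;> simp [h]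

lemma weightProj_eq_zero {σ : P.rootSpan ℤ} {X : Matrix (b.support ⊕ ι) (b.support ⊕ ι) ℂ}
    (h : ∀ i j, X i j ≠ 0 → wt b j ≠ wt b i + σ) : weightProj σ X = 0 := by
  ext i j
  by_cases hij : X i j = 0
  · simp [weightProj, hij]
  · simp [weightProj, h i j hij]

/-- The weight space of `-α_t` is a line. Among the spanning brackets, height excludes the Cartan
part, the brackets of the `e` and all brackets of at least two of the `f`, and the weight then
selects `f_t`. -/
lemma mem_span_f_of_hasWeight {X : Matrix (b.support ⊕ ι) (b.support ⊕ ι) ℂ} (hX : X ∈ lieSpan b)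
    (t : b.support) (hw : HasWeight X (-P.root t)) :
    ∃ c : ℂ, X = c • GeckConstruction.f t := by
  have h1 : weightProj (P.rootSpanMem ℤ t) X = X := by
    ext i j
    by_cases hij : X i j = 0
    · simp [weightProj, hij]
    · have : wt b j = wt b i + P.rootSpanMem ℤ t := by
        ext; simp [hw.wt_eq hij]
      simp [weightProj, this]
  suffices lieSpan b ≤ (Submodule.span ℂ {GeckConstruction.f t}).comap
      (weightProj (P.rootSpanMem ℤ t)) by
    have := this hX
    rw [Submodule.mem_comap, h1, Submodule.mem_span_singleton] at this
    obtain ⟨c, hc⟩ := this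
    exact ⟨c, hc.symm⟩
  refine sup_le (sup_le ?_ ?_) ?_ <;> refine Submodule.span_le.mpr ?_
  · rintro _ ⟨s, l, rfl⟩
    have : weightProj (P.rootSpanMem ℤ t) (iterBracket (GeckConstruction.e (R := ℂ) (b := b)) s l) = 0 := by
      refine weightProj_eq_zero fun i j hij h => ?_
      have h2 := iterBracket_e_apply_ne_zero s l hij
      rw [h, map_add, ht_simple] at h2
      omega
    simp [this]
  · rintro _ ⟨s, rfl⟩
    have : weightProj (P.rootSpanMem ℤ t) (GeckConstruction.h (R := ℂ) s) = 0 := by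
      refine weightProj_eq_zero fun i j hij h => ?_
      have hij' : i = j := by
        by_contra hne
        exact hij (by simp [h_eq_dMat, dMat, hne])
      subst hij'
      have := congrArg (ht b) h
      simp at this
    simp [this]
  · rintro _ ⟨s, l, rfl⟩
    by_cases hl : l = [] ∧ s = t
    · obtain ⟨rfl, rfl⟩ := hl
      simp only [Submodule.comap_coe, Set.mem_preimage, SetLike.mem_coe]
      have : weightProj (P.rootSpanMem ℤ s) (iterBracket (GeckConstruction.f (R := ℂ) (b := b)) s []) =
          GeckConstruction.f s := by
        ext i j
        by_cases hij : (GeckConstruction.f (R := ℂ) s) i j = 0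
        · simp [weightProj, iterBracket, hij]
        · simp [weightProj, iterBracket, f_apply_ne_zero b s hij]
      rw [this]
      exact Submodule.mem_span_singleton_self _
    · have : weightProj (P.rootSpanMem ℤ t) (iterBracket (GeckConstruction.f (R := ℂ) (b := b)) s l) = 0 := by
        refine weightProj_eq_zero fun i j hij h => hl ?_
        have h2 := iterBracket_f_apply_ne_zero s l hij
        rw [h, map_add, ht_simple] at h2
        have hl : l = [] := by
          rw [← List.length_eq_zero_iff]; omega
        subst hl
        refine ⟨rfl, ?_⟩
        have h3 := f_apply_ne_zero b s hij
        rw [h] at h3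
        have h4 := congrArg (fun x : P.rootSpan ℤ => (x : M)) (add_left_cancel h3)
        exact Subtype.ext (P.root.injective h4.symm)
      simp [this]

variable {w : List b.support}

/-- Conjugating `e_s` gives an element of the Lie algebra whose weight is the negative of a simple
root, and such elements form a line. The scalar is not needed to see that `w̄₀` exchanges `U⁺` and
`U⁻`. -/
lemma IsLongestWord.wBar_mul_e (hw : IsLongestWord w) (s : b.support) :
    ∃ c : ℂ, mat (wBar w) * GeckConstruction.e s = c • GeckConstruction.f (hw.star s) * mat (wBar w) := by
  have h1 := conj_wBar_mem_lieSpan w (GeckConstruction.e s)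
    (Submodule.mem_sup_left (Submodule.mem_sup_left (Submodule.subset_span ⟨s, [], rfl⟩)))
  have h2 := (hasWeight_e s).conj_wBar w
  rw [← root_weylPerm, hw.weylPerm_simple, root_neg] at h2
  obtain ⟨c, hc⟩ := mem_span_f_of_hasWeight h1 _ h2
  refine ⟨c, ?_⟩
  rw [← hc, mul_assoc, mat_inv_mul, mul_one]

lemma IsLongestWord.wBar_conj_xG (hw : IsLongestWord w) (s : b.support) :
    ∃ c : ℂ, ∀ a, wBar w * xG b s a * (wBar w)⁻¹ = yG b (hw.star s) (c * a) := by
  obtain ⟨c, hc⟩ := hw.wBar_mul_e s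
  exact ⟨c, fun a => conj_xG_eq_yG _ _ _ _ _ hc⟩

lemma IsLongestWord.wBar_conj_yG (hw : IsLongestWord w) (s : b.support) :
    ∃ c : ℂ, ∀ a, wBar w * yG b s a * (wBar w)⁻¹ = xG b (hw.star s) (c * a) := by
  obtain ⟨c, hc⟩ := hw.wBar_conj_xG s
  refine ⟨c, fun a => ?_⟩
  have := congrArg (transpose b) (hc a)
  rw [transpose_mul, transpose_mul, transpose_inv, transpose_wBar, transpose_xG, transpose_yG,
    inv_inv, ← mul_assoc] at this
  exact this

lemma IsLongestWord.wBar_conj_mem_unipNeg (hw : IsLongestWord w) {u : adjointGroup b}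
    (hu : u ∈ unipPos b) : wBar w * u * (wBar w)⁻¹ ∈ unipNeg b := by
  suffices unipPos b ≤ (unipNeg b).comap (MulAut.conj (wBar w)).toMonoidHom from this hu
  refine (Subgroup.closure_le _).mpr ?_
  rintro _ ⟨s, a, rfl⟩
  obtain ⟨c, hc⟩ := hw.wBar_conj_xG s
  exact Subgroup.subset_closure ⟨_, _, hc a⟩

lemma IsLongestWord.wBar_conj_mem_unipPos (hw : IsLongestWord w) {u : adjointGroup b}
    (hu : u ∈ unipNeg b) : wBar w * u * (wBar w)⁻¹ ∈ unipPos b := by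
  suffices unipNeg b ≤ (unipPos b).comap (MulAut.conj (wBar w)).toMonoidHom from this hu
  refine (Subgroup.closure_le _).mpr ?_
  rintro _ ⟨s, a, rfl⟩
  obtain ⟨c, hc⟩ := hw.wBar_conj_yG s
  exact Subgroup.subset_closure ⟨_, _, hc a⟩

end Brackets

/-! ### The lift of the longest element is an involution -/

section Involution

open Matrix GeckConstruction

lemma exp_mulVec_of_eq_zero {n : Type*} [Fintype n] [DecidableEq n] {a : Matrix n n ℂ}
    (ha : IsNilpotent a) {x : n → ℂ} (hx : a *ᵥ x = 0) : IsNilpotent.exp a *ᵥ x = x := by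
  obtain ⟨k, hk⟩ := ha
  have hk' : a ^ (k + 1) = 0 := by rw [pow_succ, hk, zero_mul]
  rw [IsNilpotent.exp_eq_sum hk', Finset.sum_range_succ', Matrix.add_mulVec, Matrix.sum_mulVec,
    Finset.sum_eq_zero]
  · simp
  · intro i _
    rw [pow_succ, Matrix.smul_mulVec, ← Matrix.mulVec_mulVec, hx]
    simp

lemma vecMul_exp_of_eq_zero {n : Type*} [Fintype n] [DecidableEq n] {a : Matrix n n ℂ}
    (ha : IsNilpotent a) {x : n → ℂ} (hx : x ᵥ* a = 0) : x ᵥ* IsNilpotent.exp a = x := by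
  obtain ⟨k, hk⟩ := ha
  have hk' : a ^ (k + 1) = 0 := by rw [pow_succ, hk, zero_mul]
  rw [IsNilpotent.exp_eq_sum hk', Finset.sum_range_succ', Matrix.vecMul_add, Matrix.vecMul_sum,
    Finset.sum_eq_zero]
  · simp
  · intro i _
    rw [pow_succ', Matrix.vecMul_smul, ← Matrix.vecMul_vecMul, hx]
    simp

variable (s : b.support)

lemma e_mulVec_u (t : b.support) :
    (e s : Matrix _ _ ℂ) *ᵥ u t = |b.cartanMatrix s t| • v b s := e_lie_u s t

lemma f_mulVec_u (t : b.support) :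
    (f s : Matrix _ _ ℂ) *ᵥ u t = |b.cartanMatrix s t| • v b (P.reflectionPerm s s) := by
  ext (k | k)
  · simp [f]
  · simp [f, Pi.single_apply]

lemma e_mulVec_v {i j : ι} (h : P.root j = P.root s + P.root i) :
    (e s : Matrix _ _ ℂ) *ᵥ v b i = (P.chainBotCoeff s i + 1 : ℂ) • v b j := e_lie_v_ne h

lemma f_mulVec_v {i j : ι} (h : P.root i = P.root j + P.root s) :
    (f s : Matrix _ _ ℂ) *ᵥ v b i = (P.chainTopCoeff s i + 1 : ℂ) • v b j := f_lie_v_ne h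

lemma f_mulVec_v_self : (f s : Matrix _ _ ℂ) *ᵥ v b s = u s := f_lie_v_same s

lemma e_mulVec_v_neg : (e s : Matrix _ _ ℂ) *ᵥ v b (P.reflectionPerm s s) = u s := by
  ext (k | k)
  · simp [e, Pi.single_apply]
  · simp [e, P.ne_zero]

lemma f_pow_apply_ne_zero (k : ℕ) {i j : b.support ⊕ ι}
    (h : ((f s : Matrix _ _ ℂ) ^ k) i j ≠ 0) : wt b j = wt b i + k • P.rootSpanMem ℤ s := by
  induction k generalizing i with
  | zero =>
    have : i = j := by
      by_contra hij
      simp [hij] at h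
    simp [this]
  | succ k ih =>
    rw [pow_succ', Matrix.mul_apply] at h
    obtain ⟨l, -, hl⟩ := Finset.exists_ne_zero_of_sum_ne_zero h
    rw [ih (right_ne_zero_of_mul hl), f_apply_ne_zero b s (left_ne_zero_of_mul hl), succ_nsmul]
    abel

lemma wt_reflect (k : b.support ⊕ ι) :
    ∃ i, (wt b i : M) = P.reflection s (wt b k) := by
  rcases k with k | k
  · exact ⟨.inl k, by simp [wt]⟩
  · exact ⟨.inr (P.reflectionPerm s k), by simp [wt]⟩

/-- The action of the lift of a simple reflection on the root vectors, up to scalar. -/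
lemma nBar_mulVec_v (j : ι) :
    mat (nBar b s) *ᵥ v b j =
      mat (nBar b s) (.inr (P.reflectionPerm s j)) (.inr j) • v b (P.reflectionPerm s j) := by
  rw [v, Matrix.mulVec_single_one]
  ext i
  by_cases hi : i = .inr (P.reflectionPerm s j)
  · subst hi; simp
  · simp only [Matrix.col_apply, Pi.smul_apply, Pi.single_apply, hi, if_false, smul_zero]
    by_contra hne
    have h1 : wt b (Sum.inr j) = _ := nBar_apply_ne_zero b s hne
    have h2 : P.root j = P.reflection s (wt b i) := by
      have h4 : P.root j = _ := congrArg (fun x : P.rootSpan ℤ => (x : M)) h1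
      have h3 := P.algebraMap_coroot'In_apply ℤ s (wt b i)
      rw [h4, reflection_apply, ← h3]
      simp [Int.cast_smul_eq_zsmul]
    rcases i with i | i
    · simp [wt, P.ne_zero] at h2
    · simp only [wt, Sum.elim_inr] at h2
      have h3 : P.root j = P.root (P.reflectionPerm s i) := by
        rw [h2, root_reflectionPerm]
      exact hi (by rw [P.root.injective h3]; simp)

/-- At the top of a string `e` kills the vector, and dually the coordinate at the reflected, bottom
weight vanishes on the image of `e`. Both outer exponentials thus act trivially, and only the term
`f ^ L / L!` of the middle one connects the two weights. -/
lemma nBar_mulVec_v_top {j : ι} {L : ℕ} (h1 : ∀ i, (wt b i : M) ≠ P.root j + P.root s)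
    (h2 : P.root (P.reflectionPerm s j) = P.root j - L • P.root s)
    (h3 : (f s : Matrix _ _ ℂ) ^ L *ᵥ v b j = (L.factorial : ℂ) • v b (P.reflectionPerm s j)) :
    mat (nBar b s) *ᵥ v b j = v b (P.reflectionPerm s j) := by
  have ne : IsNilpotent (-(e s : Matrix _ _ ℂ)) := (isNilpotent_e s).neg
  have e1 : -(e s : Matrix _ _ ℂ) *ᵥ v b j = 0 := by
    ext i
    rw [v, Matrix.mulVec_single_one, Matrix.col_apply, Matrix.neg_apply, Pi.zero_apply, neg_eq_zero]
    by_contra hne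
    refine h1 i ?_
    simpa [wt] using congrArg (fun x : P.rootSpan ℤ => (x : M)) (e_apply_ne_zero b s hne)
  have e2 : v b (P.reflectionPerm s j) ᵥ* -(e s : Matrix _ _ ℂ) = 0 := by
    ext i
    rw [v, Matrix.single_one_vecMul, Matrix.row_apply, Matrix.neg_apply, Pi.zero_apply, neg_eq_zero]
    by_contra hne
    obtain ⟨i', hi'⟩ := wt_reflect s i
    refine h1 i' ?_
    have h4 : P.root (P.reflectionPerm s j) = (wt b i : M) + P.root s :=
      congrArg (fun x : P.rootSpan ℤ => (x : M)) (e_apply_ne_zero b s hne)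
    have h5 : P.reflection s (P.root (P.reflectionPerm s j)) = P.root j := by
      rw [root_reflectionPerm, reflection_same]
    rw [hi', ← h5, h4, map_add, reflection_apply_self, neg_add_cancel_right]
  rw [nBar_mulVec_v]
  have hentry : mat (nBar b s) (.inr (P.reflectionPerm s j)) (.inr j) =
      IsNilpotent.exp (f s : Matrix _ _ ℂ) (.inr (P.reflectionPerm s j)) (.inr j) := by
    have : ∀ A : Matrix (b.support ⊕ ι) (b.support ⊕ ι) ℂ, ∀ i k,
        A i k = (Pi.single i (1 : ℂ)) ⬝ᵥ (A *ᵥ Pi.single k (1 : ℂ)) := by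
      intro A i k; simp
    refine (this _ _ _).trans ?_
    rw [mat_nBar, ← Matrix.mulVec_mulVec, exp_mulVec_of_eq_zero ne e1, ← Matrix.mulVec_mulVec,
      Matrix.dotProduct_mulVec, vecMul_exp_of_eq_zero ne e2]
    exact (this _ _ _).symm
  rw [hentry]
  obtain ⟨N, hN⟩ := isNilpotent_f (R := ℂ) s
  have hfL : ((f s : Matrix _ _ ℂ) ^ L) (.inr (P.reflectionPerm s j)) (.inr j) = L.factorial := by
    have := congr_fun h3 (.inr (P.reflectionPerm s j))
    rw [v, Matrix.mulVec_single_one, Matrix.col_apply] at this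
    simpa using this
  have hLN : L < N := by
    by_contra hle
    have : (f s : Matrix (b.support ⊕ ι) (b.support ⊕ ι) ℂ) ^ L = 0 := by
      rw [← Nat.sub_add_cancel (not_lt.mp hle), pow_add, hN, mul_zero]
    rw [this] at hfL
    simp [eq_comm, Nat.factorial_ne_zero] at hfL
  rw [IsNilpotent.exp_eq_sum hN, Matrix.sum_apply, Finset.sum_eq_single L]
  · rw [Matrix.smul_apply, hfL, Rat.smul_def]
    push_cast
    rw [inv_mul_cancel₀ (by exact_mod_cast Nat.factorial_ne_zero L), one_smul]
  · intro k _ hk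
    rw [Matrix.smul_apply]
    by_cases h0 : ((f s : Matrix _ _ ℂ) ^ k) (.inr (P.reflectionPerm s j)) (.inr j) = 0
    · rw [h0, smul_zero]
    · exfalso
      have h4 := congrArg (fun x : P.rootSpan ℤ => (x : M)) (f_pow_apply_ne_zero s k h0)
      simp only [wt, Sum.elim_inr, Submodule.coe_add] at h4
      have h5 : ((k : ℤ) - L) • P.root s = 0 := by
        have : P.root j = P.root (P.reflectionPerm s j) + k • P.root s := by simpa using h4
        rw [h2] at this
        rw [sub_smul, natCast_zsmul, natCast_zsmul, sub_eq_zero]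
        have h6 : P.root j + L • P.root s = P.root j + k • P.root s := by
          conv_lhs => rw [this]
          abel
        exact (add_left_cancel h6).symm
      have h6 := (smul_eq_zero.mp h5).resolve_right (P.ne_zero s)
      omega
  · intro h; exact absurd (Finset.mem_range.mpr hLN) h

/-- Going down a string from its top, the structure constants of the Chevalley basis are 1, 2, 3 and
so on; their product is the factorial. -/
lemma f_pow_mulVec_v {j : ι} (hli : LinearIndependent ℂ ![P.root s, P.root j])
    (h0 : P.chainTopCoeff s j = 0) {k : ℕ} {i : ι} (hi : P.root i = P.root j - k • P.root s) :
    (f s : Matrix _ _ ℂ) ^ k *ᵥ v b j = (k.factorial : ℂ) • v b i ∧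
      LinearIndependent ℂ ![P.root s, P.root i] ∧ P.chainTopCoeff s i = k := by
  induction k generalizing i with
  | zero =>
    have : i = j := P.root.injective (by simpa using hi)
    subst this
    exact ⟨by rw [pow_zero, Matrix.one_mulVec]; simp, hli, h0⟩
  | succ k ih =>
    have hk : k + 1 ≤ P.chainBotCoeff s j := by
      rw [← root_sub_nsmul_mem_range_iff_le_chainBotCoeff hli]
      exact ⟨i, hi⟩
    obtain ⟨l, hl⟩ := (root_sub_nsmul_mem_range_iff_le_chainBotCoeff hli (n := k)).mpr (by omega)
    obtain ⟨h1, h2, h3⟩ := ih hl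
    have h4 : P.root i = P.root l - P.root s := by rw [hi, hl, succ_nsmul]; abel
    refine ⟨?_, ?_, ?_⟩
    · rw [pow_succ', ← Matrix.mulVec_mulVec, h1, Matrix.mulVec_smul,
        f_mulVec_v s (j := i) (by rw [h4]; abel), h3, smul_smul, Nat.factorial_succ]
      congr 1
      push_cast; ring
    · rw [h4]
      rw [LinearIndependent.pair_iff] at h2 ⊢
      intro x y hxy
      have := h2 (x - y) y (by rw [← hxy]; module)
      exact ⟨by rw [← sub_add_cancel x y, this.1, this.2, add_zero], this.2⟩
    · rw [chainTopCoeff_of_sub h2 h4, h3]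

lemma chainBotCoeff_reflect (i j : ι) : P.chainBotCoeff i (P.reflectionPerm i j) = P.chainTopCoeff i j := by
  rw [← chainTopCoeff_reflectionPerm i, chainTopCoeff_reflectionPerm_left]

/-- The descent starts from the top of the string. One step down by `f` becomes one step up by `-e`
after conjugation, with the same integer coefficient, so each step contributes a factor `-1`. -/
lemma nBar_mulVec_v_of_linearIndependent {j : ι}
    (hli : LinearIndependent ℂ ![P.root s, P.root j]) :
    mat (nBar b s) *ᵥ v b j = (-1 : ℂ) ^ P.chainTopCoeff s j • v b (P.reflectionPerm s j) := by
  induction hk : P.chainTopCoeff s j generalizing j with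
  | zero =>
    rw [pow_zero, one_smul]
    have hs : P.root (P.reflectionPerm s j) = P.root j - P.chainBotCoeff s j • P.root s := by
      have h1 := chainBotCoeff_sub_chainTopCoeff hli
      rw [hk, Nat.cast_zero, sub_zero] at h1
      rw [root_reflectionPerm, reflection_apply_root' ℤ, ← h1, natCast_zsmul]
    refine nBar_mulVec_v_top s ?_ hs (f_pow_mulVec_v s hli hk hs).1
    rintro (i | i) h
    · have h' : (1 : ℂ) • P.root s + (1 : ℂ) • P.root j = 0 := by
        rw [one_smul, one_smul, add_comm, ← h]; simp [wt]
      exact one_ne_zero (LinearIndependent.pair_iff.mp hli _ _ h').1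
    · have h' := (chainTopCoeff_eq_zero_iff.mp hk).resolve_left (not_not.mpr hli)
      exact h' ⟨i, by simpa [wt] using h⟩
  | succ k ih =>
    obtain ⟨l, hl⟩ := (root_add_nsmul_mem_range_iff_le_chainTopCoeff hli (n := 1)).mpr (by omega)
    rw [one_smul] at hl
    have hli' : LinearIndependent ℂ ![P.root s, P.root l] := by
      rw [hl]
      rw [LinearIndependent.pair_iff] at hli ⊢
      intro x y hxy
      have := hli (x + y) y (by rw [← hxy]; module)
      exact ⟨by rw [← add_sub_cancel_right x y, this.1, this.2, sub_zero], this.2⟩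
    have hk' : P.chainTopCoeff s l = k := by
      have := chainTopCoeff_of_add hli hl
      omega
    have h1 := ih hli' hk'
    have h2 : P.root (P.reflectionPerm s j) = P.root s + P.root (P.reflectionPerm s l) := by
      rw [root_reflectionPerm, root_reflectionPerm, hl, map_add]
      simp
    have h3 := congrArg (· *ᵥ v b l) (nBar_mul_f s)
    simp only [← Matrix.mulVec_mulVec] at h3
    rw [h1, f_mulVec_v s hl, Matrix.mulVec_smul, Matrix.mulVec_smul, Matrix.neg_mulVec,
      e_mulVec_v s h2, hk', chainBotCoeff_reflect, hk'] at h3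
    have hk0 : (k + 1 : ℂ) ≠ 0 := by exact_mod_cast Nat.succ_ne_zero k
    refine smul_right_injective _ hk0 ?_
    simp only
    rw [h3, pow_succ]
    module

lemma nBar_mulVec_v_self : mat (nBar b s) *ᵥ v b s = v b (P.reflectionPerm s s) := by
  refine nBar_mulVec_v_top s (L := 2) ?_ ?_ ?_
  · rintro (i | i) h
    · have : (2 : ℂ) • P.root s = 0 := by rw [two_smul, ← h]; simp [wt]
      exact P.ne_zero s ((smul_eq_zero.mp this).resolve_left two_ne_zero)
    · refine P.nsmul_notMem_range_root (n := 2) (i := s) ⟨i, ?_⟩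
      rw [two_nsmul, ← h]; simp [wt]
  · rw [root_neg, two_smul]; abel
  · rw [sq, ← Matrix.mulVec_mulVec, f_mulVec_v_self, f_mulVec_u]
    ext x
    simp

/-- Conjugation turns `f²` into `e²`, since the two signs cancel. On the string `-α, 0, α` both
squares map one end to twice the other. -/
lemma nBar_mulVec_v_neg : mat (nBar b s) *ᵥ v b (P.reflectionPerm s s) = v b s := by
  have h3 : mat (nBar b s) *ᵥ (f s *ᵥ (f s *ᵥ v b s)) = e s *ᵥ (e s *ᵥ (mat (nBar b s) *ᵥ v b s)) := by
    simp only [Matrix.mulVec_mulVec, ← mul_assoc]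
    rw [nBar_mul_f, mul_assoc (-e s), nBar_mul_f, ← mul_assoc, neg_mul_neg]
  rw [nBar_mulVec_v_self, f_mulVec_v_self, e_mulVec_v_neg, f_mulVec_u, e_mulVec_u,
    Matrix.mulVec_smul] at h3
  ext x
  simpa using congr_fun h3 x

lemma nBar_mulVec (j : ι) :
    mat (nBar b s) *ᵥ v b j = (-1 : ℂ) ^ stringTop P s j • v b (P.reflectionPerm s j) := by
  unfold stringTop
  by_cases h1 : j = s
  · rw [if_pos h1, h1, nBar_mulVec_v_self, zpow_zero, one_smul]
  by_cases h2 : j = P.reflectionPerm s s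
  · have h3 : P.reflectionPerm s (P.reflectionPerm s s) = s := by simp
    rw [if_neg h1, if_pos h2, h2, nBar_mulVec_v_neg, h3]
    norm_num
  · rw [if_neg h1, if_neg h2, zpow_natCast]
    refine nBar_mulVec_v_of_linearIndependent s ?_
    rw [IsReduced.linearIndependent_iff]
    refine ⟨fun h => h1 h.symm, fun h => h2 ?_⟩
    apply P.root.injective
    rw [root_neg, h, neg_neg]

lemma wBar_mulVec (w : List b.support) (j : ι) :
    mat (wBar w) *ᵥ v b j = (-1 : ℂ) ^ pathSum (stringTop P) w j • v b (weylPerm w j) := by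
  induction w with
  | nil =>
    rw [wBar, List.map_nil, List.prod_nil, map_one, Matrix.one_mulVec]
    simp [pathSum]
  | cons s w ih =>
    rw [wBar_cons, map_mul, ← Matrix.mulVec_mulVec, ih, Matrix.mulVec_smul, nBar_mulVec, smul_smul,
      pathSum, zpow_add₀ (by norm_num), weylPerm_cons]

/-- The Chevalley involution on root vectors, as an identity of matrices. -/
lemma chevalley_mul_e : ((omegaGL b * torGL b (signHom b) : GLn b) : Matrix _ _ ℂ) * e s =
    -(f s * ((omegaGL b * torGL b (signHom b) : GLn b) : Matrix _ _ ℂ)) := by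
  have h2 := torGL_mul_e b (signHom b) s
  have h3 : (omegaGL b : Matrix _ _ ℂ) * e s = f s * (omegaGL b : Matrix _ _ ℂ) := ω_mul_e s
  rw [signHom_simple] at h2
  rw [Units.val_mul, mul_assoc, h2, mul_smul_comm, ← mul_assoc, h3]
  simp [mul_assoc]

lemma chevalley_mul_f : ((omegaGL b * torGL b (signHom b) : GLn b) : Matrix _ _ ℂ) * f s =
    -(e s * ((omegaGL b * torGL b (signHom b) : GLn b) : Matrix _ _ ℂ)) := by
  have h2 := torGL_mul_f b (signHom b) s
  have h3 : (omegaGL b : Matrix _ _ ℂ) * f s = e s * (omegaGL b : Matrix _ _ ℂ) := ω_mul_f s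
  rw [signHom_simple] at h2
  simp only [Units.val_neg, Units.val_one, neg_smul, one_smul] at h2
  rw [neg_eq_iff_eq_neg] at h2
  rw [Units.val_mul, mul_assoc, h2, mul_neg, ← mul_assoc, h3]
  simp [mul_assoc]

/-- Since the transpose of the lift is its inverse, the lift commutes with the matrix of the
Chevalley involution. That involution turns the relation for `e` into the one for `f` with the same
scalar. -/
lemma wBar_mul_f_of_mul_e {w : List b.support} {s t : b.support} {c : ℂ}
    (h : mat (wBar w) * e s = c • f t * mat (wBar w)) :
    mat (wBar w) * f s = c • e t * mat (wBar w) := by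
  set T : GLn b := omegaGL b * torGL b (signHom b) with hT
  have h1 : chevalley b (wBar w : GLn b) = wBar w := by
    have := transpose_wBar w
    have := congrArg (fun g : adjointGroup b => (g : GLn b)) this
    simpa [transpose] using this
  rw [chevalley, MulAut.conj_apply, mul_inv_eq_iff_eq_mul] at h1
  have hc : (T : Matrix _ _ ℂ) * mat (wBar w) = mat (wBar w) * (T : Matrix _ _ ℂ) :=
    congrArg Units.val h1
  have e1 := chevalley_mul_e (b := b) s
  have e2 := chevalley_mul_f (b := b) t
  rw [← hT] at e1 e2
  have h2 := congrArg ((T : Matrix _ _ ℂ) * ·) h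
  rw [← mul_assoc, hc, mul_assoc, e1, smul_mul_assoc, mul_smul_comm, ← mul_assoc, e2] at h2
  simp only [mul_neg, neg_mul, smul_neg, neg_inj, mul_assoc, hc] at h2
  have h3 := congrArg (· * ((T⁻¹ : GLn b) : Matrix _ _ ℂ)) h2
  simpa [mul_assoc] using h3

variable [P.IsRootSystem] {w : List b.support}

lemma IsLongestWord.wBar_mul_wBar_mulVec_v (hw : IsLongestWord w) (j : ι) :
    mat (wBar w * wBar w) *ᵥ v b j = v b j := by
  rw [map_mul, ← Matrix.mulVec_mulVec, wBar_mulVec, Matrix.mulVec_smul, wBar_mulVec, smul_smul,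
    ← zpow_add₀ (by norm_num), (hw.even_pathSum j).neg_one_zpow, one_smul, hw.weylPerm_weylPerm]

lemma IsLongestWord.wBar_mul_wBar_mul_f (hw : IsLongestWord w) :
    ∃ c : ℂ, mat (wBar w * wBar w) * f s = c • f s * mat (wBar w * wBar w) := by
  obtain ⟨c, hc⟩ := hw.wBar_mul_e s
  obtain ⟨d, hd⟩ := hw.wBar_mul_e (hw.star s)
  refine ⟨c * d, ?_⟩
  rw [map_mul, mul_assoc, wBar_mul_f_of_mul_e hc, ← mul_assoc, mul_smul_comm, hd, hw.star_star]
  simp only [smul_mul_assoc, smul_smul, mul_assoc]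

lemma nBar_mulVec_u_self : mat (nBar b s) *ᵥ u s = -u s := by
  rw [← f_mulVec_v_self, Matrix.mulVec_mulVec, nBar_mul_f, ← Matrix.mulVec_mulVec,
    nBar_mulVec_v_self, Matrix.neg_mulVec, e_mulVec_v_neg, f_mulVec_v_self]

lemma nBar_mulVec_u_of_eq_zero {s t : b.support} (h : b.cartanMatrix s t = 0) :
    mat (nBar b s) *ᵥ u t = u t := by
  have h1 : -(e s : Matrix _ _ ℂ) *ᵥ u t = 0 := by
    rw [Matrix.neg_mulVec, e_mulVec_u, h]; simp
  have h2 : (f s : Matrix _ _ ℂ) *ᵥ u t = 0 := by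
    rw [f_mulVec_u, h]; simp
  rw [mat_nBar, ← Matrix.mulVec_mulVec, ← Matrix.mulVec_mulVec,
    exp_mulVec_of_eq_zero (isNilpotent_e s).neg h1, exp_mulVec_of_eq_zero (isNilpotent_f s) h2,
    exp_mulVec_of_eq_zero (isNilpotent_e s).neg h1]

/-- The square multiplies `f_s` by a scalar under conjugation. If `s` has a neighbour `r` in the
Dynkin diagram, `f_s` maps the vector of `r + s` to a nonzero multiple of that of `r`. Both are
fixed, so the scalar is 1 and `u_s = f_s v_s` is fixed. If `s` is isolated, every simple lift fixes
`u_s` up to sign, and the sign of `w̄₀` is squared. -/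
lemma IsLongestWord.wBar_mul_wBar_mulVec_u (hw : IsLongestWord w) :
    mat (wBar w * wBar w) *ᵥ u s = u s := by
  obtain ⟨c, hc⟩ := hw.wBar_mul_wBar_mul_f s
  by_cases h : ∃ r : b.support, r ≠ s ∧ b.cartanMatrix r s ≠ 0
  · obtain ⟨r, hrs, hA⟩ := h
    have hneg : P.pairingIn ℤ r s < 0 :=
      lt_of_le_of_ne (b.cartanMatrix_le_zero_of_ne r s hrs) hA
    have hne : P.root r ≠ -P.root s :=
      b.root_ne_neg_of_ne r.2 s.2 (fun h => hrs (Subtype.ext h))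
    obtain ⟨j, hj⟩ := P.root_add_root_mem_of_pairingIn_neg hneg hne
    have h1 := congrArg (· *ᵥ v b j) hc
    simp only [← Matrix.mulVec_mulVec] at h1
    rw [hw.wBar_mul_wBar_mulVec_v, Matrix.smul_mulVec, f_mulVec_v s hj, Matrix.mulVec_smul,
      hw.wBar_mul_wBar_mulVec_v] at h1
    have h2 := congr_fun h1 (.inr r)
    simp only [Pi.smul_apply, Pi.single_eq_same, smul_eq_mul, mul_one] at h2
    have h3 : (P.chainTopCoeff s j + 1 : ℂ) ≠ 0 := Nat.cast_add_one_ne_zero _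
    have hc1 : c = 1 := by
      have : (c - 1) * (P.chainTopCoeff s j + 1 : ℂ) = 0 := by rw [sub_mul, ← h2]; ring
      exact sub_eq_zero.mp ((mul_eq_zero.mp this).resolve_right h3)
    rw [← f_mulVec_v_self, Matrix.mulVec_mulVec, hc, hc1, one_smul, ← Matrix.mulVec_mulVec,
      hw.wBar_mul_wBar_mulVec_v]
  · push Not at h
    have key : ∀ l : List b.support, mat (wBar l) *ᵥ u s = u s ∨ mat (wBar l) *ᵥ u s = -u s := by
      intro l
      induction l with
      | nil => exact .inl (by rw [wBar, List.map_nil, List.prod_nil, map_one, Matrix.one_mulVec])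
      | cons r l ih =>
        have hr : mat (nBar b r) *ᵥ u s = u s ∨ mat (nBar b r) *ᵥ u s = -u s := by
          by_cases hrs : r = s
          · subst hrs; exact .inr (nBar_mulVec_u_self r)
          · exact .inl (nBar_mulVec_u_of_eq_zero (h r hrs))
        rw [wBar_cons, map_mul, ← Matrix.mulVec_mulVec]
        rcases ih with ih | ih <;> rw [ih]
        · exact hr
        · rw [Matrix.mulVec_neg]
          rcases hr with hr | hr <;> simp [hr]
    rw [map_mul, ← Matrix.mulVec_mulVec]
    rcases key w with hk | hk <;> rw [hk]
    · exact hk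
    · rw [Matrix.mulVec_neg, hk, neg_neg]

/-- This uses the adjoint type: for a general semisimple group the square is a central element,
possibly nontrivial. -/
theorem IsLongestWord.wBar_mul_self (hw : IsLongestWord w) : wBar w * wBar w = 1 := by
  apply mat_injective
  refine Matrix.ext_of_mulVec_single fun i => ?_
  rw [map_one, Matrix.one_mulVec]
  rcases i with i | i
  · exact hw.wBar_mul_wBar_mulVec_u i
  · exact hw.wBar_mul_wBar_mulVec_v i

lemma IsLongestWord.wBar_inv (hw : IsLongestWord w) : (wBar w)⁻¹ = wBar w :=
  inv_eq_of_mul_eq_one_left hw.wBar_mul_self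

end Involution

/-! ### Unitriangular matrices for a grading -/

section Unitriangular

variable {n : Type*} [Fintype n] [DecidableEq n] (c : n → ℤ)

/-- `A` is unitriangular with respect to the order given by the values of `c`. -/
def IsUnitri (A : Matrix n n ℂ) : Prop := ∀ i j, c i ≤ c j → A i j = (1 : Matrix n n ℂ) i j

lemma isUnitri_one : IsUnitri c (1 : Matrix n n ℂ) := fun _ _ _ => rfl

variable {c}

lemma IsUnitri.mul {A B : Matrix n n ℂ} (hA : IsUnitri c A) (hB : IsUnitri c B) :
    IsUnitri c (A * B) := by
  intro i j hij
  rw [Matrix.mul_apply, Finset.sum_eq_single i]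
  · rw [hA i i le_rfl, hB i j hij, Matrix.one_apply_eq, one_mul]
  · intro k _ hk
    rcases le_or_gt (c i) (c k) with h | h
    · rw [hA i k h, Matrix.one_apply_ne' hk, zero_mul]
    · have hkj : k ≠ j := by rintro rfl; omega
      rw [hB k j (by omega), Matrix.one_apply_ne hkj, mul_zero]
  · simp

lemma isUnitri_exp {a : Matrix n n ℂ} (hn : IsNilpotent a) (ha : ∀ i j, c i ≤ c j → a i j = 0) :
    IsUnitri c (IsNilpotent.exp a) := by
  have hpow : ∀ k : ℕ, ∀ i j, c i ≤ c j → (a ^ (k + 1)) i j = 0 := by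
    intro k
    induction k with
    | zero => simpa using ha
    | succ k ih =>
      intro i j hij
      rw [pow_succ', Matrix.mul_apply]
      refine Finset.sum_eq_zero fun l _ => ?_
      rcases le_or_gt (c i) (c l) with h | h
      · rw [ha i l h, zero_mul]
      · rw [ih l j (by omega), mul_zero]
  obtain ⟨k, hk⟩ := hn
  have hk' : a ^ (k + 1) = 0 := by rw [pow_succ, hk, zero_mul]
  intro i j hij
  rw [IsNilpotent.exp_eq_sum hk', Matrix.sum_apply, Finset.sum_range_succ', Finset.sum_eq_zero]
  · simp
  · intro l _
    rw [Matrix.smul_apply, hpow l i j hij, smul_zero]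

end Unitriangular

/-! ### Borel subgroups and uniqueness of the triangular decomposition -/

section Group

variable (b) in
/-- The height of the weight of a basis vector. -/
def wtHt [P.IsRootSystem] (i : b.support ⊕ ι) : ℤ := ht b (wt b i)

lemma torG_mul_xG (χ : Multiplicative (P.rootSpan ℤ) →* ℂˣ) (s : b.support) (a : ℂ) :
    torG b χ * xG b s a * (torG b χ)⁻¹ = xG b s (χ (.ofAdd (P.rootSpanMem ℤ s)) * a) := by
  apply mat_injective
  have h : mat (torG b χ) * GeckConstruction.e s =
      (χ (.ofAdd (P.rootSpanMem ℤ s)) : ℂ) • (GeckConstruction.e s * mat (torG b χ)) :=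
    torGL_mul_e b χ s
  rw [map_mul, map_mul, mat_xG, mat_conj_exp _ ((GeckConstruction.isNilpotent_e s).smul a), mat_xG,
    mul_smul_comm, h, smul_smul, smul_mul_assoc, mul_assoc, mat_mul_inv, mul_one, mul_comm a]

lemma torG_mul_yG (χ : Multiplicative (P.rootSpan ℤ) →* ℂˣ) (s : b.support) (a : ℂ) :
    torG b χ * yG b s a * (torG b χ)⁻¹ = yG b s ((χ (.ofAdd (P.rootSpanMem ℤ s)) : ℂ)⁻¹ * a) := by
  apply mat_injective
  have h : (χ (.ofAdd (P.rootSpanMem ℤ s)) : ℂ) • (mat (torG b χ) * GeckConstruction.f s) =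
      GeckConstruction.f s * mat (torG b χ) :=
    torGL_mul_f b χ s
  rw [← eq_inv_smul_iff₀ (Units.ne_zero _)] at h
  rw [map_mul, map_mul, mat_yG, mat_conj_exp _ ((GeckConstruction.isNilpotent_f s).smul a), mat_yG,
    mul_smul_comm, h, smul_smul, smul_mul_assoc, mul_assoc, mat_mul_inv, mul_one, mul_comm a]

lemma cartan_mul_comm {h k : adjointGroup b} (hh : h ∈ cartan b) (hk : k ∈ cartan b) :
    h * k = k * h := by
  obtain ⟨χ, rfl⟩ := hh
  obtain ⟨χ', rfl⟩ := hk
  exact ((Commute.all χ χ').map (torG b)).eq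

lemma cartan_conj_mem_unipPos {h u : adjointGroup b} (hh : h ∈ cartan b) (hu : u ∈ unipPos b) :
    h * u * h⁻¹ ∈ unipPos b := by
  suffices unipPos b ≤ (unipPos b).comap (MulAut.conj h).toMonoidHom from this hu
  refine (Subgroup.closure_le _).mpr ?_
  rintro _ ⟨s, a, rfl⟩
  obtain ⟨χ, rfl⟩ := hh
  exact Subgroup.subset_closure ⟨_, _, torG_mul_xG χ s a⟩

lemma cartan_conj_mem_unipNeg {h u : adjointGroup b} (hh : h ∈ cartan b) (hu : u ∈ unipNeg b) :
    h * u * h⁻¹ ∈ unipNeg b := by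
  suffices unipNeg b ≤ (unipNeg b).comap (MulAut.conj h).toMonoidHom from this hu
  refine (Subgroup.closure_le _).mpr ?_
  rintro _ ⟨s, a, rfl⟩
  obtain ⟨χ, rfl⟩ := hh
  exact Subgroup.subset_closure ⟨_, _, torG_mul_yG χ s a⟩

lemma mem_sup_iff_of_conj {G : Type*} [Group G] {A B : Subgroup G}
    (h : ∀ a ∈ A, ∀ x ∈ B, a * x * a⁻¹ ∈ B) {g : G} :
    g ∈ A ⊔ B ↔ ∃ a ∈ A, ∃ x ∈ B, g = a * x := by
  constructor
  · intro hg
    rw [Subgroup.sup_eq_closure_mul] at hg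
    induction hg using Subgroup.closure_induction with
    | mem g hg =>
      obtain ⟨a, ha, x, hx, rfl⟩ := Set.mem_mul.mp hg
      exact ⟨a, ha, x, hx, rfl⟩
    | one => exact ⟨1, one_mem _, 1, one_mem _, by simp⟩
    | mul g g' _ _ ih ih' =>
      obtain ⟨a, ha, x, hx, rfl⟩ := ih
      obtain ⟨a', ha', x', hx', rfl⟩ := ih'
      refine ⟨a * a', mul_mem ha ha', a'⁻¹ * x * a' * x', mul_mem ?_ hx', by group⟩
      simpa using h a'⁻¹ (inv_mem ha') x hx
    | inv g _ ih =>
      obtain ⟨a, ha, x, hx, rfl⟩ := ih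
      exact ⟨a⁻¹, inv_mem ha, a * x⁻¹ * a⁻¹, h a ha _ (inv_mem hx), by group⟩
  · rintro ⟨a, ha, x, hx, rfl⟩
    exact Subgroup.mul_mem_sup ha hx

lemma mem_borelPos {g : adjointGroup b} :
    g ∈ borelPos b ↔ ∃ h ∈ cartan b, ∃ u ∈ unipPos b, g = h * u :=
  mem_sup_iff_of_conj fun _ hh _ hu => cartan_conj_mem_unipPos hh hu

lemma mem_borelNeg {g : adjointGroup b} :
    g ∈ borelNeg b ↔ ∃ h ∈ cartan b, ∃ u ∈ unipNeg b, g = h * u :=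
  mem_sup_iff_of_conj fun _ hh _ hu => cartan_conj_mem_unipNeg hh hu

lemma transpose_mem_unipNeg {u : adjointGroup b} (hu : u ∈ unipPos b) :
    transpose b u ∈ unipNeg b := by
  induction hu using Subgroup.closure_induction with
  | mem g h =>
    obtain ⟨s, t, rfl⟩ := h
    exact Subgroup.subset_closure ⟨s, t, transpose_xG b s t⟩
  | one => rw [transpose_one]; exact one_mem _
  | mul x y _ _ hx hy => rw [transpose_mul]; exact mul_mem hy hx
  | inv x _ hx => rw [transpose_inv]; exact inv_mem hx

lemma transpose_mem_unipPos {u : adjointGroup b} (hu : u ∈ unipNeg b) :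
    transpose b u ∈ unipPos b := by
  induction hu using Subgroup.closure_induction with
  | mem g h =>
    obtain ⟨s, t, rfl⟩ := h
    exact Subgroup.subset_closure ⟨s, t, transpose_yG b s t⟩
  | one => rw [transpose_one]; exact one_mem _
  | mul x y _ _ hx hy => rw [transpose_mul]; exact mul_mem hy hx
  | inv x _ hx => rw [transpose_inv]; exact inv_mem hx

variable [P.IsRootSystem]

lemma isUnitri_xG (s : b.support) (a : ℂ) : IsUnitri (wtHt b) (mat (xG b s a)) := by
  refine isUnitri_exp ((GeckConstruction.isNilpotent_e s).smul a) fun i j hij => ?_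
  by_contra hne
  have h := e_apply_ne_zero b s (right_ne_zero_of_mul hne)
  rw [wtHt, wtHt, h, map_add, ht_simple] at hij
  omega

lemma isUnitri_yG (s : b.support) (a : ℂ) : IsUnitri (-wtHt b) (mat (yG b s a)) := by
  refine isUnitri_exp ((GeckConstruction.isNilpotent_f s).smul a) fun i j hij => ?_
  by_contra hne
  have h := f_apply_ne_zero b s (right_ne_zero_of_mul hne)
  rw [Pi.neg_apply, Pi.neg_apply, wtHt, wtHt, h, map_add, ht_simple] at hij
  omega

lemma isUnitri_of_mem_unipPos {u : adjointGroup b} (hu : u ∈ unipPos b) :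
    IsUnitri (wtHt b) (mat u) := by
  induction hu using Subgroup.closure_induction_left with
  | one => rw [map_one]; exact isUnitri_one _
  | mul_left x hx y _ ih =>
    obtain ⟨s, a, rfl⟩ := hx
    rw [map_mul]
    exact (isUnitri_xG s a).mul ih
  | inv_mul_cancel x hx y _ ih =>
    obtain ⟨s, a, rfl⟩ := hx
    rw [map_mul, xG_inv]
    exact (isUnitri_xG s _).mul ih

lemma isUnitri_of_mem_unipNeg {u : adjointGroup b} (hu : u ∈ unipNeg b) :
    IsUnitri (-wtHt b) (mat u) := by
  induction hu using Subgroup.closure_induction_left with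
  | one => rw [map_one]; exact isUnitri_one _
  | mul_left x hx y _ ih =>
    obtain ⟨s, a, rfl⟩ := hx
    rw [map_mul]
    exact (isUnitri_yG s a).mul ih
  | inv_mul_cancel x hx y _ ih =>
    obtain ⟨s, a, rfl⟩ := hx
    rw [map_mul, yG_inv]
    exact (isUnitri_yG s _).mul ih

lemma mat_cartan_mul {h : adjointGroup b} (hh : h ∈ cartan b) (g : adjointGroup b)
    (i j : b.support ⊕ ι) : mat (h * g) i j = mat h i i * mat g i j := by
  obtain ⟨χ, rfl⟩ := hh
  rw [map_mul, mat_torG, Matrix.diagonal_mul, Matrix.diagonal_apply_eq]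

lemma mat_cartan_apply_ne {h : adjointGroup b} (hh : h ∈ cartan b) {i j : b.support ⊕ ι} (hij : i ≠ j) :
    mat h i j = 0 := by
  obtain ⟨χ, rfl⟩ := hh
  rw [mat_torG, Matrix.diagonal_apply_ne _ hij]

/-- With basis vectors ordered by height, the left side is unitriangular in one direction and the
right side is triangular in the other. Both are then diagonal, and the unit diagonal forces the
torus factor to be trivial. -/
lemma eq_one_of_unipNeg_eq_cartan_mul_unipPos {v h u : adjointGroup b} (hv : v ∈ unipNeg b)
    (hh : h ∈ cartan b) (hu : u ∈ unipPos b) (heq : v = h * u) : v = 1 ∧ h = 1 ∧ u = 1 := by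
  have hv' := isUnitri_of_mem_unipNeg hv
  have hu' := isUnitri_of_mem_unipPos hu
  have hv1 : v = 1 := by
    apply mat_injective
    ext i j
    rw [map_one]
    rcases le_total (wtHt b j) (wtHt b i) with h1 | h1
    · exact hv' i j (by simpa using h1)
    · by_cases hij : i = j
      · subst hij; exact hv' i i le_rfl
      · rw [heq, mat_cartan_mul hh, hu' i j h1, Matrix.one_apply_ne hij, mul_zero]
  have hh1 : h = 1 := by
    apply mat_injective
    ext i j
    rw [map_one]
    by_cases hij : i = j
    · subst hij
      have : mat v i i = mat h i i := by
        rw [heq, mat_cartan_mul hh, hu' i i le_rfl, Matrix.one_apply_eq, mul_one]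
      rw [← this, hv1, map_one]
    · rw [mat_cartan_apply_ne hh hij, Matrix.one_apply_ne hij]
  refine ⟨hv1, hh1, ?_⟩
  rw [hv1, hh1, one_mul] at heq
  exact heq.symm

lemma triangular_unique {v h u v' h' u' : adjointGroup b} (hv : v ∈ unipNeg b)
    (hh : h ∈ cartan b) (hu : u ∈ unipPos b) (hv' : v' ∈ unipNeg b)
    (hh' : h' ∈ cartan b) (hu' : u' ∈ unipPos b) (heq : v * h * u = v' * h' * u') :
    v = v' ∧ h = h' ∧ u = u' := by
  have h1 : v'⁻¹ * v = (h' * h⁻¹) * (h * (u' * u⁻¹) * h⁻¹) := by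
    have : v = v' * h' * u' * u⁻¹ * h⁻¹ := by rw [← heq]; group
    rw [this]; group
  obtain ⟨e1, e2, e3⟩ := eq_one_of_unipNeg_eq_cartan_mul_unipPos (mul_mem (inv_mem hv') hv)
    (mul_mem hh' (inv_mem hh)) (cartan_conj_mem_unipPos hh (mul_mem hu' (inv_mem hu))) h1
  have a1 : v = v' := (inv_mul_eq_one.mp e1).symm
  have a2 : h = h' := (mul_inv_eq_one.mp e2).symm
  refine ⟨a1, a2, ?_⟩
  rw [a1, a2] at heq
  exact mul_left_cancel heq

lemma existsUnique_isTriangular {g : adjointGroup b} (hg : g ∈ G₀ b) : ∃! t, IsTriangular g t := by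
  obtain ⟨t, ht⟩ := hg
  refine ⟨t, ht, fun t' ht' => ?_⟩
  obtain ⟨a1, a2, a3⟩ := triangular_unique t'.1.2 t'.2.1.2 t'.2.2.2 t.1.2 t.2.1.2 t.2.2.2
    (ht'.symm.trans ht)
  exact Prod.ext (Subtype.ext a1) (Prod.ext (Subtype.ext a2) (Subtype.ext a3))

lemma triang_eq {g : adjointGroup b} {t} (h : IsTriangular g t) : triang g = t := by
  have hg : g ∈ G₀ b := ⟨t, h⟩
  rw [triang, dif_pos hg]
  exact (existsUnique_isTriangular hg).unique hg.choose_spec h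

lemma bracketZero_eq {v k n : adjointGroup b} (hv : v ∈ unipNeg b) (hk : k ∈ cartan b)
    (hn : n ∈ unipPos b) : bracketZero (v * k * n) = ⟨k, hk⟩ := by
  rw [bracketZero, triang_eq (t := (⟨v, hv⟩, ⟨k, hk⟩, ⟨n, hn⟩)) rfl]

lemma bracketPos_eq {v k n : adjointGroup b} (hv : v ∈ unipNeg b) (hk : k ∈ cartan b)
    (hn : n ∈ unipPos b) : bracketPos (v * k * n) = n := by
  rw [bracketPos, triang_eq (t := (⟨v, hv⟩, ⟨k, hk⟩, ⟨n, hn⟩)) rfl]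

end Group

/-! ### The open cell and the twist -/

section Cell

variable [P.IsRootSystem] {w : List b.support}

namespace IsLongestWord

lemma wBar_mul_wBar_mul (hw : IsLongestWord w) (g : adjointGroup b) :
    wBar w * (wBar w * g) = g := by
  rw [← mul_assoc, hw.wBar_mul_self, one_mul]

lemma transpose_wBar_eq (hw : IsLongestWord w) : transpose b (wBar w) = wBar w := by
  rw [transpose_wBar, hw.wBar_inv]

lemma conj_unipNeg (hw : IsLongestWord w) {v : adjointGroup b} (hv : v ∈ unipNeg b) :
    wBar w * v * wBar w ∈ unipPos b := by
  simpa [hw.wBar_inv] using hw.wBar_conj_mem_unipPos hv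

lemma conj_unipPos (hw : IsLongestWord w) {v : adjointGroup b} (hv : v ∈ unipPos b) :
    wBar w * v * wBar w ∈ unipNeg b := by
  simpa [hw.wBar_inv] using hw.wBar_conj_mem_unipNeg hv

lemma conj_cartan (hw : IsLongestWord w) {h : adjointGroup b} (hh : h ∈ cartan b) :
    wBar w * h * wBar w ∈ cartan b := by
  simpa [hw.wBar_inv] using wBar_conj_mem w hh

lemma starG_apply (hw : IsLongestWord w) (g : adjointGroup b) :
    starG w g = wBar w * transpose b g⁻¹ * wBar w := by
  change wBar w * transpose b g⁻¹ * (wBar w)⁻¹ = _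
  rw [hw.wBar_inv]

lemma starH_coe (hw : IsLongestWord w) (h : cartan b) :
    (starH w h : adjointGroup b) = wBar w * (h : adjointGroup b)⁻¹ * wBar w := by
  change starG w h = _
  rw [hw.starG_apply, transpose_of_mem_cartan (inv_mem h.2)]

lemma w₀H_coe (hw : IsLongestWord w) (h : cartan b) :
    (w₀H w h : adjointGroup b) = wBar w * (h : adjointGroup b) * wBar w := by
  change wBar w * (h : adjointGroup b) * (wBar w)⁻¹ = _
  rw [hw.wBar_inv]

lemma starH_inv (hw : IsLongestWord w) (h : cartan b) : starH w h⁻¹ = w₀H w h := by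
  apply Subtype.ext
  rw [hw.starH_coe, hw.w₀H_coe]
  simp

lemma conj_borelNeg (hw : IsLongestWord w) {g : adjointGroup b} (hg : g ∈ borelNeg b) :
    wBar w * g * wBar w ∈ borelPos b := by
  obtain ⟨h, hh, v, hv, rfl⟩ := mem_borelNeg.mp hg
  refine mem_borelPos.mpr ⟨_, hw.conj_cartan hh, _, hw.conj_unipNeg hv, ?_⟩
  simp only [mul_assoc, hw.wBar_mul_wBar_mul]

lemma conj_borelPos (hw : IsLongestWord w) {g : adjointGroup b} (hg : g ∈ borelPos b) :
    wBar w * g * wBar w ∈ borelNeg b := by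
  obtain ⟨h, hh, v, hv, rfl⟩ := mem_borelPos.mp hg
  refine mem_borelNeg.mpr ⟨_, hw.conj_cartan hh, _, hw.conj_unipPos hv, ?_⟩
  simp only [mul_assoc, hw.wBar_mul_wBar_mul]

end IsLongestWord

/-- `u` lies in the open cell and `u w̄₀ = v k n` is the triangular decomposition. -/
structure CellData (w : List b.support) (u v k n : adjointGroup b) : Prop where
  u_mem : u ∈ unipPos b
  v_mem : v ∈ unipNeg b
  k_mem : k ∈ cartan b
  n_mem : n ∈ unipPos b
  eq : u * wBar w = v * k * n

lemma mul_mem_of_borelNeg_mul_borelPos {c d : adjointGroup b} (hc : c ∈ borelNeg b)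
    (hd : d ∈ borelPos b) : ∃ v ∈ unipNeg b, ∃ k ∈ cartan b, ∃ n ∈ unipPos b, c * d = v * k * n := by
  obtain ⟨h, hh, v, hv, rfl⟩ := mem_borelNeg.mp hc
  obtain ⟨h', hh', n, hn, rfl⟩ := mem_borelPos.mp hd
  exact ⟨h * v * h⁻¹, cartan_conj_mem_unipNeg hh hv, h * h', mul_mem hh hh', n, hn, by group⟩

lemma exists_cellData (hw : IsLongestWord w) {u : adjointGroup b} (hu : u ∈ cellPos w) :
    ∃ v k n, CellData w u v k n := by
  obtain ⟨hu, c, hc, c', hc', rfl⟩ := hu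
  obtain ⟨v, hv, k, hk, n, hn, h⟩ := mul_mem_of_borelNeg_mul_borelPos hc (hw.conj_borelNeg hc')
  exact ⟨v, k, n, hu, hv, hk, hn, by rw [← h]; group⟩

namespace CellData

variable {u v k n : adjointGroup b}

lemma mem_cellPos (hw : IsLongestWord w) (h : CellData w u v k n) : u ∈ cellPos w := by
  refine ⟨h.u_mem, v * k, ?_, wBar w * n * wBar w, ?_, ?_⟩
  · exact mul_mem (Subgroup.mem_sup_right h.v_mem) (Subgroup.mem_sup_left h.k_mem)
  · exact Subgroup.mem_sup_right (hw.conj_unipPos h.n_mem)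
  · have := congrArg (· * wBar w) h.eq
    simp only [mul_assoc, hw.wBar_mul_self, mul_one] at this
    rw [this]
    simp only [mul_assoc, hw.wBar_mul_wBar_mul]

lemma v_mem_cellNeg (h : CellData w u v k n) : v ∈ cellNeg w := by
  refine ⟨h.v_mem, u, Subgroup.mem_sup_right h.u_mem, n⁻¹ * k⁻¹, ?_, ?_⟩
  · exact mul_mem (Subgroup.mem_sup_right (inv_mem h.n_mem)) (Subgroup.mem_sup_left (inv_mem h.k_mem))
  · rw [h.eq]; group

lemma eq_u (hw : IsLongestWord w) (h : CellData w u v k n) : u = v * k * n * wBar w := by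
  rw [← h.eq, mul_assoc, hw.wBar_mul_self, mul_one]

/-- The data of the twisted element. -/
lemma twist (hw : IsLongestWord w) (h : CellData w u v k n) :
    CellData w (transpose b v) (k⁻¹ * (transpose b n)⁻¹ * k) k⁻¹ (wBar w * transpose b u * wBar w) where
  u_mem := transpose_mem_unipPos h.v_mem
  v_mem := by
    simpa using cartan_conj_mem_unipNeg (inv_mem h.k_mem) (inv_mem (transpose_mem_unipNeg h.n_mem))
  k_mem := inv_mem h.k_mem
  n_mem := hw.conj_unipNeg (transpose_mem_unipNeg h.u_mem)
  eq := by
    have h1 : v = u * wBar w * n⁻¹ * k⁻¹ := by rw [h.eq]; group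
    rw [h1]
    simp only [transpose_mul, transpose_inv, hw.transpose_wBar_eq, transpose_of_mem_cartan h.k_mem]
    group

lemma wBar_mul_transpose (hw : IsLongestWord w) (h : CellData w u v k n) :
    wBar w * transpose b u = transpose b n * k * transpose b v := by
  have := congrArg (transpose b) h.eq
  simpa only [transpose_mul, hw.transpose_wBar_eq, transpose_of_mem_cartan h.k_mem, mul_assoc]
    using this

lemma bracketZero_eq (h : CellData w u v k n) : bracketZero (u * wBar w) = ⟨k, h.k_mem⟩ := by
  rw [h.eq, AdjointPinned.bracketZero_eq h.v_mem h.k_mem h.n_mem]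

lemma mem_G₀ (h : CellData w u v k n) : u * wBar w ∈ G₀ b :=
  ⟨(⟨v, h.v_mem⟩, ⟨k, h.k_mem⟩, ⟨n, h.n_mem⟩), h.eq⟩

lemma bracketPos_eq (hw : IsLongestWord w) (h : CellData w u v k n) :
    bracketPos (wBar w * transpose b u) = transpose b v := by
  rw [h.wBar_mul_transpose hw, AdjointPinned.bracketPos_eq (transpose_mem_unipNeg h.n_mem) h.k_mem
    (transpose_mem_unipPos h.v_mem)]

lemma mem_G₀' (hw : IsLongestWord w) (h : CellData w u v k n) : wBar w * transpose b u ∈ G₀ b :=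
  ⟨(⟨_, transpose_mem_unipNeg h.n_mem⟩, ⟨k, h.k_mem⟩, ⟨_, transpose_mem_unipPos h.v_mem⟩),
    h.wBar_mul_transpose hw⟩

end CellData

lemma coe_twist (hw : IsLongestWord w) {u : cellPos w} {v k n : adjointGroup b}
    (h : CellData w u v k n) : (twist w u : adjointGroup b) = transpose b v := by
  have h1 : bracketPos (wBar w * transpose b u) ∈ cellPos w := by
    rw [h.bracketPos_eq hw]
    exact (h.twist hw).mem_cellPos hw
  rw [AdjointPinned.twist, dif_pos h1]
  exact h.bracketPos_eq hw

/-- The fourth power of the twist. -/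
lemma coe_twist_iterate_four (hw : IsLongestWord w) {u : cellPos w} {v k n : adjointGroup b}
    (h : CellData w u v k n) :
    ((AdjointPinned.twist w)^[4] u : adjointGroup b) = k * starG w (twist w u) * k⁻¹ := by
  -- A twist replaces `(u, v, k, n)` by `(vᵀ, k⁻¹ (nᵀ)⁻¹ k, k⁻¹, w̄₀ uᵀ w̄₀)`. With `u₁` the first
  -- twist of `u`, the third application has `v`-component `k⁻¹ w̄₀ u₁⁻¹ w̄₀ k`; the fourth twist is
  -- the transpose of this element.
  have h1 := h.twist hw
  rw [← coe_twist hw h] at h1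
  have h2 := h1.twist hw
  rw [← coe_twist hw h1] at h2
  have h3 := h2.twist hw
  rw [← coe_twist hw h2] at h3
  change ((twist w (twist w (twist w (twist w u))) : cellPos w) : adjointGroup b) = _
  rw [coe_twist hw h3, hw.starG_apply]
  simp only [transpose_mul, transpose_inv, transpose_transpose, hw.transpose_wBar_eq,
    mul_inv_rev, inv_inv, hw.wBar_inv, transpose_of_mem_cartan h.k_mem]
  simp only [mul_assoc]

lemma conj_mem_cellPos {u h : adjointGroup b} (hu : u ∈ cellPos w)
    (hh : h ∈ cartan b) : h * u * h⁻¹ ∈ cellPos w := by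
  obtain ⟨hu, c, hc, c', hc', rfl⟩ := hu
  refine ⟨cartan_conj_mem_unipPos hh hu, h * c, mul_mem (Subgroup.mem_sup_left hh) hc, c' * h⁻¹,
    mul_mem hc' (Subgroup.mem_sup_left (inv_mem hh)), by group⟩

lemma smul_flagPos_eq_iff {g g' : adjointGroup b} :
    g • flagPos b = g' • flagPos b ↔ g⁻¹ * g' ∈ borelPos b := by
  change ((g * 1 : adjointGroup b) : Flag b) = ((g' * 1 : adjointGroup b) : Flag b) ↔ _
  rw [mul_one, mul_one, QuotientGroup.eq]

lemma flagNeg_eq : flagNeg w = wBar w • flagPos b := by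
  change ((wBar w : adjointGroup b) : Flag b) = ((wBar w * 1 : adjointGroup b) : Flag b)
  rw [mul_one]

lemma CellData.smul_flagPos {u v k n : adjointGroup b} (h : CellData w u v k n) :
    v • flagPos b = u • flagNeg w := by
  rw [flagNeg_eq, smul_smul, smul_flagPos_eq_iff, h.eq]
  exact mem_borelPos.mpr ⟨k, h.k_mem, n, h.n_mem, by group⟩

lemma eq_of_smul_flagPos_eq {v v' : adjointGroup b} (hv : v ∈ unipNeg b) (hv' : v' ∈ unipNeg b)
    (h : v • flagPos b = v' • flagPos b) : v = v' := by
  rw [smul_flagPos_eq_iff] at h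
  obtain ⟨a, ha, x, hx, h1⟩ := mem_borelPos.mp h
  exact inv_mul_eq_one.mp
    (eq_one_of_unipNeg_eq_cartan_mul_unipPos (mul_mem (inv_mem hv) hv') ha hx h1).1

/-- An element of `U⁺` with `u.B⁻ = v.B⁺` lies in the open cell. -/
lemma exists_cellData_of_smul_eq {u v : adjointGroup b} (hu : u ∈ unipPos b)
    (hv : v ∈ unipNeg b) (h : v • flagPos b = u • flagNeg w) : ∃ k n, CellData w u v k n := by
  rw [flagNeg_eq, smul_smul, smul_flagPos_eq_iff] at h
  obtain ⟨k, hk, n, hn, h1⟩ := mem_borelPos.mp h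
  exact ⟨k, n, hu, hv, hk, hn, by rw [mul_assoc, ← h1]; group⟩

lemma existsUnique_cellNeg (hw : IsLongestWord w) (u : cellPos w) :
    ∃! v : adjointGroup b, v ∈ cellNeg w ∧ v • flagPos b = (u : adjointGroup b) • flagNeg w := by
  obtain ⟨v, k, n, h⟩ := exists_cellData hw u.2
  exact ⟨v, ⟨h.v_mem_cellNeg, h.smul_flagPos⟩, fun v' hv' =>
    eq_of_smul_flagPos_eq hv'.1.1 h.v_mem (hv'.2.trans h.smul_flagPos.symm)⟩

end Cell

/-! ### Configurations as triples of group elements, and the cyclic shift -/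

section Configuration

variable {w : List b.support} [P.IsRootSystem]

lemma pinning_one_smul (p : Pinning w) : (1 : adjointGroup b) • p = p := by
  cases p; exact (Pinning.mk.injEq ..).mpr ⟨one_smul _ _, one_smul _ _⟩

lemma pinning_mul_smul (g g' : adjointGroup b) (p : Pinning w) : (g * g') • p = g • g' • p := by
  cases p; exact (Pinning.mk.injEq ..).mpr ⟨mul_smul _ _ _, mul_smul _ _ _⟩

lemma pinning_ext {p q : Pinning w} (h1 : p.dec = q.dec) (h2 : p.minus = q.minus) : p = q := by
  cases p; cases q; exact (Pinning.mk.injEq ..).mpr ⟨h1, h2⟩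

lemma plus_smul_pStd (g : adjointGroup b) : (g • pStd w).plus = g • flagPos b :=
  plus_smul g (pStd w)

lemma minus_smul_pStd (g : adjointGroup b) : (g • pStd w).minus = g • flagNeg w := rfl

lemma dec_smul_pStd (g : adjointGroup b) : (g • pStd w).dec = (g : DecoratedFlag b) := by
  change ((g * 1 : adjointGroup b) : DecoratedFlag b) = _
  rw [mul_one]

lemma smul_flagPos_of_mem {g : adjointGroup b} (hg : g ∈ borelPos b) :
    g • flagPos b = flagPos b := by
  have : g • flagPos b = (1 : adjointGroup b) • flagPos b := by
    rw [smul_flagPos_eq_iff, mul_one]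
    exact inv_mem hg
  rwa [one_smul] at this

lemma smul_flagNeg_of_mem (hw : IsLongestWord w) {g : adjointGroup b} (hg : g ∈ borelNeg b) :
    g • flagNeg w = flagNeg w := by
  rw [flagNeg_eq, smul_smul, smul_flagPos_eq_iff, mul_inv_rev, hw.wBar_inv]
  exact hw.conj_borelNeg (inv_mem hg)

lemma wBar_smul_flagNeg (hw : IsLongestWord w) : wBar w • flagNeg w = flagPos b := by
  rw [flagNeg_eq, smul_smul, hw.wBar_mul_self, one_smul]

/-- The stabiliser of the standard pinning is the intersection of `U⁺` and `B⁻`, which is trivial.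
-/
lemma smul_pStd_injective (hw : IsLongestWord w) {g g' : adjointGroup b}
    (h : g • pStd w = g' • pStd w) : g = g' := by
  have h1 := congrArg Pinning.dec h
  rw [dec_smul_pStd, dec_smul_pStd, QuotientGroup.eq] at h1
  have h2 := congrArg Pinning.minus h
  rw [minus_smul_pStd, minus_smul_pStd, flagNeg_eq, smul_smul, smul_smul, smul_flagPos_eq_iff] at h2
  have h3 := hw.conj_borelPos h2
  rw [mul_inv_rev, hw.wBar_inv] at h3
  have h4 : g⁻¹ * g' ∈ borelNeg b := by
    simpa only [mul_assoc, hw.wBar_mul_self, mul_one, hw.wBar_mul_wBar_mul] using h3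
  obtain ⟨k, hk, v, hv, h5⟩ := mem_borelNeg.mp h4
  have h6 : k * v * k⁻¹ = k⁻¹ * (k * (g⁻¹ * g') * k⁻¹) := by rw [h5]; group
  obtain ⟨-, h7, h8⟩ := eq_one_of_unipNeg_eq_cartan_mul_unipPos (cartan_conj_mem_unipNeg hk hv)
    (inv_mem hk) (cartan_conj_mem_unipPos hk h1) h6
  rw [inv_eq_one] at h7
  rw [h7, one_mul, inv_one, mul_one] at h8
  exact inv_mul_eq_one.mp h8

/-- Genericity moves the pair of flags to the standard one. The remaining freedom in the decorated
flag is a torus element, and the torus fixes `B⁻`. -/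
lemma exists_smul_pStd (hw : IsLongestWord w) (p : Pinning w) : ∃ g : adjointGroup b, p = g • pStd w := by
  obtain ⟨g, h1, h2⟩ := p.generic
  rw [← underlying_smul] at h1
  obtain ⟨a, ha⟩ : ∃ a : adjointGroup b, (a : DecoratedFlag b) = g • p.dec :=
    QuotientGroup.mk_surjective _
  rw [← ha] at h1
  have h3 : a ∈ borelPos b := by
    have : a • flagPos b = flagPos b := by
      rw [← plus_smul_pStd (w := w), Pinning.plus, dec_smul_pStd]; exact h1
    have h4 : a • flagPos b = (1 : adjointGroup b) • flagPos b := by rw [this, one_smul]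
    rw [smul_flagPos_eq_iff, mul_one] at h4
    exact inv_mem_iff.mp h4
  obtain ⟨k, hk, u, hu, rfl⟩ := mem_borelPos.mp h3
  refine ⟨g⁻¹ * k, ?_⟩
  rw [pinning_mul_smul]
  have h5 : g • p = k • pStd w := by
    refine pinning_ext ?_ ?_
    · change g • p.dec = _
      rw [← ha, dec_smul_pStd, QuotientGroup.eq]
      simpa using hu
    · change g • p.minus = _
      rw [h2, minus_smul_pStd, smul_flagNeg_of_mem hw (Subgroup.mem_sup_left hk)]
  rw [← h5, ← pinning_mul_smul, inv_mul_cancel, pinning_one_smul]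

lemma exists_atlas (hw : IsLongestWord w) (d : PinnedTriple w) : ∃ g : PinAtlas w, g.toTriple = d := by
  choose g hg using fun i => exists_smul_pStd hw (d.pin i)
  refine ⟨⟨g, fun i => ?_⟩, ?_⟩
  · rw [← hg, ← hg, d.minus_eq, d.plus_eq]
  · refine PinnedTriple.ext (funext fun i => ?_) (funext fun i => (hg i).symm)
    exact (congrArg Pinning.plus (hg i).symm).trans (d.plus_eq i)

lemma mk_toTriple_eq_iff (hw : IsLongestWord w) (g g' : PinAtlas w) :
    (Quotient.mk _ g.toTriple : Conf₃ w) = Quotient.mk _ g'.toTriple ↔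
      ∃ a : adjointGroup b, ∀ i, g.1 i = a * g'.1 i := by
  rw [Quotient.eq]
  constructor
  · rintro ⟨a, ha⟩
    refine ⟨a, fun i => smul_pStd_injective hw ?_⟩
    have := congrArg (fun d => PinnedTriple.pin d i) ha
    change a • (g'.1 i • pStd w) = g.1 i • pStd w at this
    rw [pinning_mul_smul, this]
  · rintro ⟨a, ha⟩
    refine ⟨a, PinnedTriple.ext (funext fun i => ?_) (funext fun i => ?_)⟩
    · change a • (g'.1 i • pStd w).plus = (g.1 i • pStd w).plus
      rw [ha, pinning_mul_smul, plus_smul a]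
    · change a • (g'.1 i • pStd w) = g.1 i • pStd w
      rw [ha, pinning_mul_smul]

/-- The element `φ'(u)` of `U⁻_*` with `φ'(u).B⁺ = u.B⁻`. -/
def phi (hw : IsLongestWord w) (u : cellPos w) : adjointGroup b := (existsUnique_cellNeg hw u).choose

lemma phi_mem (hw : IsLongestWord w) (u : cellPos w) : phi hw u ∈ cellNeg w :=
  (existsUnique_cellNeg hw u).choose_spec.1.1

lemma phi_smul (hw : IsLongestWord w) (u : cellPos w) :
    phi hw u • flagPos b = (u : adjointGroup b) • flagNeg w :=
  (existsUnique_cellNeg hw u).choose_spec.1.2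

lemma eq_phi (hw : IsLongestWord w) (u : cellPos w) {v : adjointGroup b} (hv : v ∈ unipNeg b)
    (h : v • flagPos b = (u : adjointGroup b) • flagNeg w) : v = phi hw u :=
  eq_of_smul_flagPos_eq hv (phi_mem hw u).1 (h.trans (phi_smul hw u).symm)

lemma exists_cellData_phi (hw : IsLongestWord w) (u : cellPos w) :
    ∃ k n, CellData w u (phi hw u) k n :=
  exists_cellData_of_smul_eq u.2.1 (phi_mem hw u).1 (phi_smul hw u)

/-- The lift of the standard configuration to triples of group elements. -/
def stdAtlas (hw : IsLongestWord w) (x : HHU w) : PinAtlas w :=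
  ⟨![1, phi hw x.2.2 * x.1 * wBar w, (x.2.2 : adjointGroup b) * x.2.1 * wBar w], by
    have hv : phi hw x.2.2 ∈ borelNeg b := Subgroup.mem_sup_right (phi_mem hw x.2.2).1
    have hu : (x.2.2 : adjointGroup b) ∈ borelPos b := Subgroup.mem_sup_right x.2.2.2.1
    have h1 : (x.1 : adjointGroup b) ∈ borelNeg b := Subgroup.mem_sup_left x.1.2
    have h1' : (x.1 : adjointGroup b) ∈ borelPos b := Subgroup.mem_sup_left x.1.2
    have h2 : (x.2.1 : adjointGroup b) ∈ borelNeg b := Subgroup.mem_sup_left x.2.1.2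
    have h2' : (x.2.1 : adjointGroup b) ∈ borelPos b := Subgroup.mem_sup_left x.2.1.2
    intro i
    rw [minus_smul_pStd, plus_smul_pStd]
    fin_cases i
    · change (1 : adjointGroup b) • flagNeg w = (phi hw x.2.2 * x.1 * wBar w) • flagPos b
      rw [one_smul, mul_smul, ← flagNeg_eq, smul_flagNeg_of_mem hw (mul_mem hv h1)]
    · change (phi hw x.2.2 * x.1 * wBar w) • flagNeg w =
        ((x.2.2 : adjointGroup b) * x.2.1 * wBar w) • flagPos b
      rw [mul_smul, wBar_smul_flagNeg hw, mul_smul, smul_flagPos_of_mem h1', phi_smul, mul_smul,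
        ← flagNeg_eq, mul_smul, smul_flagNeg_of_mem hw h2]
    · change ((x.2.2 : adjointGroup b) * x.2.1 * wBar w) • flagNeg w = (1 : adjointGroup b) • flagPos b
      rw [one_smul, mul_smul, wBar_smul_flagNeg hw, smul_flagPos_of_mem (mul_mem hu h2')]⟩

lemma stdAtlas_zero (hw : IsLongestWord w) (x : HHU w) : (stdAtlas hw x).1 0 = 1 := rfl

lemma stdAtlas_one (hw : IsLongestWord w) (x : HHU w) :
    (stdAtlas hw x).1 1 = phi hw x.2.2 * x.1 * wBar w := rfl

lemma stdAtlas_two (hw : IsLongestWord w) (x : HHU w) :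
    (stdAtlas hw x).1 2 = (x.2.2 : adjointGroup b) * x.2.1 * wBar w := rfl

lemma stdAtlas_injective (hw : IsLongestWord w) {x x' : HHU w} {a : adjointGroup b}
    (h : ∀ i, (stdAtlas hw x).1 i = a * (stdAtlas hw x').1 i) : x = x' := by
  have ha : a = 1 := by simpa [stdAtlas_zero] using (h 0).symm
  subst ha
  have h1 := h 1
  have h2 := h 2
  rw [one_mul, stdAtlas_one, stdAtlas_one] at h1
  rw [one_mul, stdAtlas_two, stdAtlas_two] at h2
  have h1' := mul_right_cancel h1
  have h2' := mul_right_cancel h2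
  obtain ⟨-, e1, -⟩ := triangular_unique (phi_mem hw x.2.2).1 x.1.2 (one_mem _)
    (phi_mem hw x'.2.2).1 x'.1.2 (one_mem _) (by rw [h1'])
  obtain ⟨-, e2, e3⟩ := triangular_unique (one_mem _) x.2.1.2
    (cartan_conj_mem_unipPos (inv_mem x.2.1.2) x.2.2.2.1) (one_mem _) x'.2.1.2
    (cartan_conj_mem_unipPos (inv_mem x'.2.1.2) x'.2.2.2.1) (by
      simp only [one_mul, inv_inv]
      have : ∀ p q : adjointGroup b, p * (p⁻¹ * q * p) = q * p := fun p q => by group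
      rw [this, this, h2'])
  have e4 : (x.2.2 : adjointGroup b) = x'.2.2 := by
    rw [e2] at h2'
    exact mul_right_cancel h2'
  exact Prod.ext (Subtype.ext e1) (Prod.ext (Subtype.ext e2) (Subtype.ext e4))

/-- After translating by the inverse of the first element, the matching conditions at the first flag
put the second element times `w̄₀` in `B⁻` and the third times `w̄₀` in `B⁺`. Their torus parts are
`h₁` and `h₂`. The remaining condition says that the unipotent parts `v` and `u` satisfy `v.B⁺ =
u.B⁻`, so `u` is in the cell and `v` is `φ'(u)`. -/
lemma exists_stdAtlas (hw : IsLongestWord w) (g : PinAtlas w) :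
    ∃ x : HHU w, ∀ i, g.1 i = g.1 0 * (stdAtlas hw x).1 i := by
  have h0 : g.1 0 • flagNeg w = g.1 1 • flagPos b := (g.2 0).trans (plus_smul_pStd _)
  have h1 : g.1 1 • flagNeg w = g.1 2 • flagPos b := (g.2 1).trans (plus_smul_pStd _)
  have h2 : g.1 2 • flagNeg w = g.1 0 • flagPos b := (g.2 2).trans (plus_smul_pStd _)
  rw [flagNeg_eq, smul_smul, smul_flagPos_eq_iff, mul_inv_rev, hw.wBar_inv] at h0
  rw [eq_comm, flagNeg_eq, smul_smul, smul_flagPos_eq_iff, ← mul_assoc] at h2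
  have h3 : (g.1 0)⁻¹ * g.1 1 * wBar w ∈ borelNeg b := by
    have := hw.conj_borelPos h0
    simpa only [mul_assoc, hw.wBar_mul_wBar_mul] using this
  obtain ⟨k1, hk1, v, hv, e1⟩ := mem_borelNeg.mp h3
  obtain ⟨k2, hk2, u, hu, e2⟩ := mem_borelPos.mp h2
  have g1 : g.1 1 = g.1 0 * (k1 * v * wBar w) := by
    rw [← e1]; simp only [mul_assoc, hw.wBar_mul_self, mul_one, mul_inv_cancel_left]
  have g2 : g.1 2 = g.1 0 * (k2 * u * wBar w) := by
    rw [← e2]; simp only [mul_assoc, hw.wBar_mul_self, mul_one, mul_inv_cancel_left]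
  have hv' := cartan_conj_mem_unipNeg hk1 hv
  have hu' := cartan_conj_mem_unipPos hk2 hu
  have hflag : (k1 * v * k1⁻¹) • flagPos b = (k2 * u * k2⁻¹) • flagNeg w := by
    rw [g1, g2, mul_smul, mul_smul (g.1 0), smul_left_cancel_iff, mul_smul, wBar_smul_flagNeg hw,
      mul_smul _ (wBar w), ← flagNeg_eq] at h1
    rw [mul_smul (k1 * v), smul_flagPos_of_mem (Subgroup.mem_sup_left (inv_mem hk1)), h1,
      mul_smul (k2 * u), smul_flagNeg_of_mem hw (Subgroup.mem_sup_left (inv_mem hk2))]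
  obtain ⟨k, n, hd⟩ := exists_cellData_of_smul_eq hu' hv' hflag
  refine ⟨(⟨k1, hk1⟩, ⟨k2, hk2⟩, ⟨_, hd.mem_cellPos hw⟩), fun i => ?_⟩
  fin_cases i
  · exact (mul_one _).symm
  · refine g1.trans (congrArg (g.1 0 * ·) ?_)
    change k1 * v * wBar w = phi hw ⟨_, hd.mem_cellPos hw⟩ * k1 * wBar w
    rw [← eq_phi hw ⟨_, hd.mem_cellPos hw⟩ hv' hflag, inv_mul_cancel_right]
  · refine g2.trans (congrArg (g.1 0 * ·) ?_)
    change k2 * u * wBar w = k2 * u * k2⁻¹ * k2 * wBar w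
    rw [inv_mul_cancel_right]

/-- The standard configuration `C₃`. -/
def stdConf (hw : IsLongestWord w) : HHU w ≃ Conf₃ w :=
  Equiv.ofBijective (fun x => Quotient.mk _ (stdAtlas hw x).toTriple) (by
    constructor
    · intro x x' h
      obtain ⟨a, ha⟩ := (mk_toTriple_eq_iff hw _ _).mp h
      exact stdAtlas_injective hw ha
    · intro c
      induction c using Quotient.inductionOn with
      | h d =>
        obtain ⟨g, rfl⟩ := exists_atlas hw d
        obtain ⟨x, hx⟩ := exists_stdAtlas hw g
        exact ⟨x, ((mk_toTriple_eq_iff hw _ _).mpr ⟨_, hx⟩).symm⟩)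

lemma stdConf_eq_of_forall (hw : IsLongestWord w) {x : HHU w} {g : PinAtlas w} {a : adjointGroup b}
    (h : ∀ i, g.1 i = a * (stdAtlas hw x).1 i) : stdConf hw x = Quotient.mk _ g.toTriple :=
  ((mk_toTriple_eq_iff hw _ _).mpr ⟨a, h⟩).symm

lemma isStdConf_stdConf (hw : IsLongestWord w) (x : HHU w) : IsStdConf w x (stdConf hw x) := by
  refine ⟨phi hw x.2.2, phi_mem hw _, phi_smul hw _, (stdAtlas hw x).toTriple, ?_, ?_, rfl⟩
  · have h := (stdAtlas hw x).2
    funext i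
    fin_cases i
    · change ((1 : adjointGroup b) • pStd w).plus = flagPos b
      rw [plus_smul_pStd, one_smul]
    · exact (h 0).symm.trans (one_smul _ _)
    · change (((x.2.2 : adjointGroup b) * x.2.1 * wBar w) • pStd w).plus = _
      rw [plus_smul_pStd, mul_smul, ← flagNeg_eq, mul_smul,
        smul_flagNeg_of_mem hw (Subgroup.mem_sup_left x.2.1.2)]
      rfl
  · funext i
    fin_cases i
    · exact pinning_one_smul _
    · rfl
    · rfl

lemma IsStdConf.eq (hw : IsLongestWord w) {x : HHU w} {c : Conf₃ w} (h : IsStdConf w x c) :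
    c = stdConf hw x := by
  obtain ⟨v, hv, hvu, d, hd1, hd2, rfl⟩ := h
  obtain ⟨v', hv', hvu', d', hd1', hd2', h'⟩ := isStdConf_stdConf hw x
  rw [h']
  have : v = v' := eq_of_smul_flagPos_eq hv.1 hv'.1 (hvu.trans hvu'.symm)
  subst this
  rw [PinnedTriple.ext (hd1.trans hd1'.symm) (hd2.trans hd2'.symm)]

/-- The cyclic shift on the atlas. -/
def PinAtlas.rotate (m : Fin 3) (g : PinAtlas w) : PinAtlas w :=
  ⟨fun i => g.1 (m + i), fun i => by rw [g.2, add_assoc]⟩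

lemma starG_mem_unipPos (hw : IsLongestWord w) {u : adjointGroup b} (hu : u ∈ unipPos b) :
    starG w u ∈ unipPos b := by
  rw [hw.starG_apply]
  exact hw.conj_unipNeg (transpose_mem_unipNeg (inv_mem hu))

lemma starG_twist_mem (hw : IsLongestWord w) (u : cellPos w) : starG w (twist w u) ∈ cellPos w := by
  obtain ⟨v, k, n, h⟩ := exists_cellData hw u.2
  have h1 := coe_twist_iterate_four hw h
  have h2 : starG w (twist w u) = k⁻¹ * ((twist w)^[4] u : adjointGroup b) * k⁻¹⁻¹ := by
    rw [h1]; group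
  rw [h2]
  exact conj_mem_cellPos (Subtype.property _) (inv_mem h.k_mem)

/-- The cyclic shift in the coordinates given by the standard configuration. -/
def shiftHHU (hw : IsLongestWord w) (x : HHU w) : HHU w :=
  (starH w x.1 * x.2.1 * w₀H w (bracketZero ((x.2.2 : adjointGroup b) * wBar w)), starH w x.1,
    ⟨starH w x.1 * starG w (twist w x.2.2) * (starH w x.1 : adjointGroup b)⁻¹,
      conj_mem_cellPos (starG_twist_mem hw _) (starH w x.1).2⟩)

/-- The shifted triple has a unique normal form, obtained by dividing by its first element. Its
coordinates are found by comparing triangular factors of its other two elements. -/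
lemma S₃_stdConf (hw : IsLongestWord w) (x : HHU w) :
    S₃ w (stdConf hw x) = stdConf hw (shiftHHU hw x) := by
  obtain ⟨x', hx'⟩ := exists_stdAtlas hw ((stdAtlas hw x).rotate 1)
  refine (stdConf_eq_of_forall hw hx').symm.trans (congrArg _ ?_)
  obtain ⟨k, n, hd⟩ := exists_cellData_phi hw x.2.2
  have e1 : (x.2.2 : adjointGroup b) * x.2.1 * wBar w =
    phi hw x.2.2 * x.1 * wBar w * (phi hw x'.2.2 * x'.1 * wBar w) := hx' 1
  have e2 : 1 = phi hw x.2.2 * x.1 * wBar w * ((x'.2.2 : adjointGroup b) * x'.2.1 * wBar w) := hx' 2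
  have hs := hw.starH_coe x.1
  have hstar : starG w (twist w x.2.2) = wBar w * (phi hw x.2.2)⁻¹ * wBar w := by
    rw [hw.starG_apply, coe_twist hw hd, transpose_inv, transpose_transpose]
  -- The last element of the shifted triple is the old first one, namely 1. This equation determines
  -- both `u'` and `h₂'`.
  have d2 : (x'.2.2 : adjointGroup b) * x'.2.1 = starH w x.1 * starG w (twist w x.2.2) := by
    rw [hstar, hs]
    have := congrArg (fun g => wBar w * (x.1 : adjointGroup b)⁻¹ * (phi hw x.2.2)⁻¹ * g * wBar w) e2
    simp only [mul_assoc, hw.wBar_mul_self, hw.wBar_mul_wBar_mul, mul_one,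
      inv_mul_cancel_left] at this ⊢
    exact this.symm
  -- Substituting `u = v k n w̄₀` cancels `v = φ'(u)` and leaves a torus element times `w̄₀ n w̄₀ ∈
  -- U⁻` times `h₂`.
  have d1 : phi hw x'.2.2 * x'.1 = (starH w x.1 * w₀H w ⟨k, hd.k_mem⟩ : cartan b) *
      (wBar w * n * wBar w) * (x.2.1 : adjointGroup b) := by
    rw [Subgroup.coe_mul, hw.w₀H_coe, hs]
    have := congrArg (fun g => wBar w * (x.1 : adjointGroup b)⁻¹ * (phi hw x.2.2)⁻¹ * g * wBar w) e1
    rw [hd.eq_u hw] at this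
    simp only [mul_assoc, hw.wBar_mul_self, hw.wBar_mul_wBar_mul, mul_one,
      inv_mul_cancel_left] at this ⊢
    exact this.symm
  set K := starH w x.1 * w₀H w ⟨k, hd.k_mem⟩ with hK
  -- Only the torus factor matters here: the `U⁻` factor is `φ'(u')`, which `u'` already determines.
  obtain ⟨-, f1, -⟩ := triangular_unique (phi_mem hw x'.2.2).1 x'.1.2 (one_mem _)
    (cartan_conj_mem_unipNeg K.2 (hw.conj_unipPos hd.n_mem)) (K * x.2.1).2 (one_mem _) (by
      rw [d1, Subgroup.coe_mul (cartan b) K x.2.1]; group)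
  obtain ⟨-, f2, f3⟩ := triangular_unique (one_mem _) x'.2.1.2
    (cartan_conj_mem_unipPos (inv_mem x'.2.1.2) x'.2.2.2.1) (one_mem _) (starH w x.1).2
    (starG_mem_unipPos hw (twist w x.2.2).2.1) (by
      rw [one_mul, one_mul, ← d2]; group)
  refine Prod.ext (Subtype.ext ?_) (Prod.ext (Subtype.ext f2) (Subtype.ext ?_))
  · change _ = ((starH w x.1 * x.2.1 * w₀H w (bracketZero ((x.2.2 : adjointGroup b) * wBar w)) :
      cartan b) : adjointGroup b)
    have hb : bracketZero ((x.2.2 : adjointGroup b) * wBar w) = ⟨k, hd.k_mem⟩ := hd.bracketZero_eq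
    rw [f1, hb, hK]
    simp only [Subgroup.coe_mul]
    rw [mul_assoc, mul_assoc, cartan_mul_comm x.2.1.2 (w₀H w ⟨k, hd.k_mem⟩).2]
  · change _ = (starH w x.1 : adjointGroup b) * starG w (twist w x.2.2) * (starH w x.1 : adjointGroup b)⁻¹
    rw [← d2, ← f2, mul_inv_cancel_right]

end Configuration

/-! ### Rank one identities and translation of the open cell -/

section RankOne

variable [P.IsRootSystem]

/-- The homomorphism on the root lattice with prescribed values at the simple roots. -/
def cochar (c : b.support → ℂˣ) : Multiplicative (P.rootSpan ℤ) →* ℂˣ where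
  toFun x := ∏ s, c s ^ b.toWeightBasisInt.repr x.toAdd s
  map_one' := by simp
  map_mul' x y := by simp [zpow_add, Finset.prod_mul_distrib]

@[simp] lemma cochar_simple (c : b.support → ℂˣ) (s : b.support) :
    cochar c (.ofAdd (P.rootSpanMem ℤ s)) = c s := by
  have : P.rootSpanMem ℤ s = b.toWeightBasisInt s := by ext; simp
  change ∏ t, c t ^ b.toWeightBasisInt.repr (P.rootSpanMem ℤ s) t = _
  rw [this, Module.Basis.repr_self, Finset.prod_eq_single s]
  · simp
  · intro t _ ht
    rw [Finsupp.single_eq_of_ne ht, zpow_zero]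
  · exact fun h => absurd (Finset.mem_univ s) h

lemma hom_apply (χ : Multiplicative (P.rootSpan ℤ) →* ℂˣ) (x : P.rootSpan ℤ) :
    χ (.ofAdd x) = ∏ s : b.support, χ (.ofAdd (P.rootSpanMem ℤ s)) ^ b.toWeightBasisInt.repr x s := by
  have : ∀ s : b.support, P.rootSpanMem ℤ s = b.toWeightBasisInt s := fun s => by ext; simp
  conv_lhs => rw [← b.toWeightBasisInt.sum_repr x]
  rw [ofAdd_sum, map_prod]
  refine Finset.prod_congr rfl fun s _ => ?_
  rw [ofAdd_zsmul, map_zpow, this]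

lemma cochar_eq (χ : Multiplicative (P.rootSpan ℤ) →* ℂˣ) :
    cochar (fun s : b.support => χ (.ofAdd (P.rootSpanMem ℤ s))) = χ :=
  MonoidHom.ext fun x => (hom_apply χ x.toAdd).symm

lemma torG_conj_nBar (χ : Multiplicative (P.rootSpan ℤ) →* ℂˣ) (s : b.support) :
    torG b χ * nBar b s * (torG b χ)⁻¹ =
      (coroot s (χ (.ofAdd (P.rootSpanMem ℤ s))) : adjointGroup b) * nBar b s := by
  have h1 : reflectHom b s χ⁻¹ = χ⁻¹ * corootHom s (χ (.ofAdd (P.rootSpanMem ℤ s))) := by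
    ext x
    simp [reflectHom, corootHom]
  have h2 := nBar_mul_torG b s χ⁻¹
  rw [h1, map_mul, (torG b).map_inv] at h2
  rw [mul_assoc, h2]
  simp only [← mul_assoc, mul_inv_cancel, one_mul]
  rfl

/-- For `c = 1` this rearranges the definition of the lift. The general case follows on conjugating
by a torus element with value `c` at all simple roots, which multiplies the lift by the coroot
value. -/
lemma yG_inv_eq (s : b.support) (c : ℂˣ) :
    yG b s (c : ℂ)⁻¹ = xG b s c * coroot s c * nBar b s * xG b s c := by
  have h1 : yG b s 1 = xG b s 1 * nBar b s * xG b s 1 := by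
    rw [nBar, ← mul_assoc, ← mul_assoc, ← xG_add, mul_assoc, ← xG_add]
    simp
  have h2 := torG_mul_yG (b := b) (cochar (b := b) fun _ => c) s 1
  have h3 := torG_mul_xG (b := b) (cochar (b := b) fun _ => c) s 1
  have h4 := torG_conj_nBar (b := b) (cochar (b := b) fun _ => c) s
  simp only [cochar_simple, mul_one] at h2 h3 h4
  rw [← h2, h1, mul_assoc _ (coroot s c : adjointGroup b), ← h4, ← h3]
  group

lemma nBar_mul_cartan {h : adjointGroup b} (hh : h ∈ cartan b) (s : b.support) :
    ∃ h' ∈ cartan b, h * nBar b s = nBar b s * h' := by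
  obtain ⟨χ, rfl⟩ := hh
  refine ⟨torG b (reflectHom b s χ), ⟨_, rfl⟩, ?_⟩
  have h1 : P.coroot'In ℤ s (P.rootSpanMem ℤ s) = 2 := by
    have := P.algebraMap_coroot'In_apply ℤ s (P.rootSpanMem ℤ s)
    have h2 : P.coroot' s (P.rootSpanMem ℤ s : M) = 2 := by simp
    rw [h2] at this
    exact (algebraMap ℤ ℂ).injective_int (this.trans (by simp))
  have h2 : reflectHom b s (reflectHom b s χ) = χ := by
    refine MonoidHom.ext fun x => ?_
    have h3 : reflectHom b s χ (.ofAdd (P.rootSpanMem ℤ s)) =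
        (χ (.ofAdd (P.rootSpanMem ℤ s)))⁻¹ := by
      change χ (.ofAdd (P.rootSpanMem ℤ s)) * χ (.ofAdd (P.rootSpanMem ℤ s)) ^
        (-(P.coroot'In ℤ s (P.rootSpanMem ℤ s))) = _
      rw [h1, ← zpow_one_add, ← zpow_neg_one]
      norm_num
    change reflectHom b s χ x * (reflectHom b s χ (.ofAdd (P.rootSpanMem ℤ s))) ^
      (-(P.coroot'In ℤ s x.toAdd)) = _
    rw [h3]
    change χ x * χ (.ofAdd (P.rootSpanMem ℤ s)) ^ (-(P.coroot'In ℤ s x.toAdd)) * _ = _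
    rw [mul_assoc, inv_zpow, mul_inv_cancel, mul_one]
  rw [nBar_mul_torG, h2]

/-- The action of `x_s(a)` on the flags `y_s(1/c).B⁺`. -/
lemma xG_mul_yG_inv (s : b.support) {a c : ℂ} (hc : c ≠ 0) (hac : a + c ≠ 0) :
    ∃ β ∈ borelPos b, xG b s a * yG b s c⁻¹ = yG b s (a + c)⁻¹ * β := by
  lift c to ℂˣ using hc.isUnit
  obtain ⟨d, hd⟩ := hac.isUnit
  obtain ⟨h', hh', e⟩ := nBar_mul_cartan (mul_mem (inv_mem (coroot s d).2) (coroot s c).2) s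
  refine ⟨xG b s (-d) * h' * xG b s c, ?_, ?_⟩
  · have hx : ∀ a, xG b s a ∈ borelPos b := fun a =>
      Subgroup.mem_sup_right (Subgroup.subset_closure ⟨s, a, rfl⟩)
    exact mul_mem (mul_mem (hx _) (Subgroup.mem_sup_left hh')) (hx _)
  · rw [← hd, yG_inv_eq, yG_inv_eq, ← xG_inv]
    simp only [← mul_assoc, ← xG_add, ← hd, mul_inv_cancel_right]
    congr 1
    simp only [mul_assoc] at e ⊢
    rw [← e]
    simp

lemma xG_mul_yG_of_ne {s t : b.support} (h : t ≠ s) (a c : ℂ) :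
    xG b t a * yG b s c = yG b s c * xG b t a := by
  apply mat_injective
  have h0 := GeckConstruction.lie_e_f_of_ne (K := ℂ) h
  rw [Ring.lie_def, sub_eq_zero] at h0
  rw [map_mul, map_mul, mat_xG, mat_yG]
  have h1 : Commute (a • GeckConstruction.e t : Matrix (b.support ⊕ ι) (b.support ⊕ ι) ℂ)
    (c • GeckConstruction.f s) := ((show Commute _ _ from h0).smul_left a).smul_right c
  have he := (GeckConstruction.isNilpotent_e (R := ℂ) t).smul a
  have hf := (GeckConstruction.isNilpotent_f (R := ℂ) s).smul c
  rw [← IsNilpotent.exp_add_of_commute h1 he hf, add_comm, IsNilpotent.exp_add_of_commute h1.symm hf he]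

/-- On the line of flags `y_s(1/c).B⁺` the subgroup `x_s` acts by translating `c`, and the other
simple root subgroups act trivially because they commute with `y_s`. Hence `u` acts by one
translation; the finite set excludes the values of `c` for which an intermediate flag leaves the
chart. -/
lemma exists_mul_yG_mem {u : adjointGroup b} (hu : u ∈ unipPos b) (s : b.support) :
    ∃ (A : ℂ) (E : Finset ℂ), ∀ c ∉ E, c ≠ 0 ∧ c + A ≠ 0 ∧
      ∃ β ∈ borelPos b, u * yG b s c⁻¹ = yG b s (c + A)⁻¹ * β := by
  have step : ∀ (t : b.support) (a : ℂ) (u : adjointGroup b),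
      (∃ (A : ℂ) (E : Finset ℂ), ∀ c ∉ E, c ≠ 0 ∧ c + A ≠ 0 ∧
        ∃ β ∈ borelPos b, u * yG b s c⁻¹ = yG b s (c + A)⁻¹ * β) →
      ∃ (A : ℂ) (E : Finset ℂ), ∀ c ∉ E, c ≠ 0 ∧ c + A ≠ 0 ∧
        ∃ β ∈ borelPos b, xG b t a * u * yG b s c⁻¹ = yG b s (c + A)⁻¹ * β := by
    rintro t a u ⟨A, E, h⟩
    by_cases hts : t = s
    · subst hts
      refine ⟨A + a, insert (-(A + a)) E, fun c hc => ?_⟩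
      rw [Finset.mem_insert, not_or] at hc
      obtain ⟨h0, h1, β, hβ, e⟩ := h c hc.2
      have h2 : a + (c + A) ≠ 0 := fun h2 => hc.1 (by linear_combination h2)
      obtain ⟨β', hβ', e'⟩ := xG_mul_yG_inv t h1 h2
      refine ⟨h0, fun h3 => h2 (by linear_combination h3), β' * β, mul_mem hβ' hβ, ?_⟩
      rw [mul_assoc, e, ← mul_assoc, e', mul_assoc]
      ring_nf
    · refine ⟨A, E, fun c hc => ?_⟩
      obtain ⟨h0, h1, β, hβ, e⟩ := h c hc
      refine ⟨h0, h1, xG b t a * β,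
        mul_mem (Subgroup.mem_sup_right (Subgroup.subset_closure ⟨t, a, rfl⟩)) hβ, ?_⟩
      rw [mul_assoc, e, ← mul_assoc, xG_mul_yG_of_ne hts, mul_assoc]
  induction hu using Subgroup.closure_induction_left with
  | one =>
    exact ⟨0, {0}, fun c hc => ⟨by simpa using hc, by simpa using hc, 1, one_mem _, by simp⟩⟩
  | mul_left x hx y _ ih =>
    obtain ⟨t, a, rfl⟩ := hx
    exact step t a y ih
  | inv_mul_cancel x hx y _ ih =>
    obtain ⟨t, a, rfl⟩ := hx
    rw [xG_inv]
    exact step t (-a) y ih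

lemma mem_G₀_iff {g : adjointGroup b} :
    g ∈ G₀ b ↔ ∃ v ∈ unipNeg b, ∃ β ∈ borelPos b, g = v * β := by
  constructor
  · rintro ⟨⟨v, h, u⟩, e⟩
    exact ⟨v, v.2, h * u, mem_borelPos.mpr ⟨h, h.2, u, u.2, rfl⟩, by rw [e, mul_assoc]⟩
  · rintro ⟨v, hv, β, hβ, rfl⟩
    obtain ⟨h, hh, u, hu, rfl⟩ := mem_borelPos.mp hβ
    exact ⟨(⟨v, hv⟩, ⟨h, hh⟩, ⟨u, hu⟩), (mul_assoc _ _ _).symm⟩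

lemma mul_yG_mem_G₀ {g : adjointGroup b} (hg : g ∈ G₀ b) (s : b.support) :
    ∃ E : Finset ℂ, ∀ t ∉ E, g * yG b s t ∈ G₀ b := by
  classical
  obtain ⟨⟨v, h, u⟩, rfl⟩ := hg
  obtain ⟨A, E, H⟩ := exists_mul_yG_mem u.2 s
  refine ⟨insert 0 (E.image (·⁻¹)), fun t ht => ?_⟩
  rw [Finset.mem_insert, not_or] at ht
  have h1 : t⁻¹ ∉ E := fun h1 => ht.2 (Finset.mem_image.mpr ⟨_, h1, inv_inv t⟩)
  obtain ⟨-, -, β, hβ, e⟩ := H _ h1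
  rw [inv_inv] at e
  refine mem_G₀_iff.mpr ⟨v * (h * yG b s (t⁻¹ + A)⁻¹ * (h : adjointGroup b)⁻¹),
    mul_mem v.2 (cartan_conj_mem_unipNeg h.2 (Subgroup.subset_closure ⟨s, _, rfl⟩)), h * β,
    mul_mem (Subgroup.mem_sup_left h.2) hβ, ?_⟩
  rw [mul_assoc, e]
  group

end RankOne

/-! ### Density of the open cell -/

section Density

/-- The algebra of polynomial functions in the matrix entries. -/
def polyFun (b : P.Base) : Subalgebra ℂ (adjointGroup b → ℂ) :=
  Algebra.adjoin ℂ (Set.range fun i g => entries g i)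

lemma entries_mem_polyFun (i) : (fun g : adjointGroup b => entries g i) ∈ polyFun b :=
  Algebra.subset_adjoin ⟨i, rfl⟩

lemma mat_mem_polyFun (i j) : (fun g : adjointGroup b => mat g i j) ∈ polyFun b :=
  entries_mem_polyFun (i, j)

lemma eval_entries_mem_polyFun (p : MvPolynomial _ ℂ) :
    (fun g : adjointGroup b => MvPolynomial.eval (entries g) p) ∈ polyFun b := by
  induction p using MvPolynomial.induction_on with
  | C a =>
    have : (fun g : adjointGroup b => MvPolynomial.eval (entries g) (MvPolynomial.C a)) =
        algebraMap ℂ _ a := by ext; simp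
    exact this ▸ (polyFun b).algebraMap_mem a
  | add p q hp hq =>
    have : (fun g : adjointGroup b => MvPolynomial.eval (entries g) (p + q)) =
        (fun g => MvPolynomial.eval (entries g) p) + fun g => MvPolynomial.eval (entries g) q := by
      ext; simp
    exact this ▸ add_mem hp hq
  | mul_X p i hp =>
    have : (fun g : adjointGroup b => MvPolynomial.eval (entries g) (p * MvPolynomial.X i)) =
        (fun g => MvPolynomial.eval (entries g) p) * fun g => entries g i := by
      ext; simp
    exact this ▸ mul_mem hp (entries_mem_polyFun i)

lemma polyFun_isRegular {F : adjointGroup b → ℂ} (hF : F ∈ polyFun b) : IsRegular entries F := by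
  have : polyFun b ≤ regularFunctions entries := by
    refine Algebra.adjoin_le ?_
    rintro _ ⟨i, rfl⟩
    change IsRegular entries fun g => entries g i
    simpa using IsRegular.eval_comp (entries (b := b)) (MvPolynomial.X i)
  exact this hF

lemma polyFun_comp_mul {F : adjointGroup b → ℂ} (hF : F ∈ polyFun b) (g g' : adjointGroup b) :
    (fun x => F (g * x * g')) ∈ polyFun b := by
  induction hF using Algebra.adjoin_induction with
  | mem F hF =>
    obtain ⟨⟨i, j⟩, rfl⟩ := hF
    have : (fun x : adjointGroup b => entries (g * x * g') (i, j)) =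
        ∑ l, ∑ k, (mat g i k * mat g' l j) • fun x => mat x k l := by
      ext x
      simp only [entries_eq_mat, map_mul, Matrix.mul_apply, Finset.sum_apply, Pi.smul_apply,
        smul_eq_mul, Finset.sum_mul]
      exact Finset.sum_congr rfl fun l _ => Finset.sum_congr rfl fun k _ => by ring
    change (fun x => entries (g * x * g') (i, j)) ∈ polyFun b
    rw [this]
    exact sum_mem fun l _ => sum_mem fun k _ => Subalgebra.smul_mem _ (mat_mem_polyFun k l) _
  | algebraMap r => exact (polyFun b).algebraMap_mem r
  | add F F' _ _ h h' => exact add_mem h h'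
  | mul F F' _ _ h h' => exact mul_mem h h'

/-- The restriction of a polynomial function to a curve with polynomial matrix entries. -/
lemma polyFun_comp_curve {F : adjointGroup b → ℂ} (hF : F ∈ polyFun b) {γ : ℂ → adjointGroup b}
    (hγ : ∀ i j, ∃ q : Polynomial ℂ, ∀ t, mat (γ t) i j = q.eval t) :
    ∃ q : Polynomial ℂ, ∀ t, F (γ t) = q.eval t := by
  induction hF using Algebra.adjoin_induction with
  | mem F hF =>
    obtain ⟨⟨i, j⟩, rfl⟩ := hF
    exact hγ i j
  | algebraMap r => exact ⟨.C r, fun t => by simp [Pi.algebraMap_apply]⟩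
  | add F F' _ _ h h' =>
    obtain ⟨q, hq⟩ := h
    obtain ⟨q', hq'⟩ := h'
    exact ⟨q + q', fun t => by simp [hq, hq']⟩
  | mul F F' _ _ h h' =>
    obtain ⟨q, hq⟩ := h
    obtain ⟨q', hq'⟩ := h'
    exact ⟨q * q', fun t => by simp [hq, hq']⟩

lemma exists_polynomial_exp {n : Type*} [Fintype n] [DecidableEq n] {a : Matrix n n ℂ}
    (ha : IsNilpotent a) (i j : n) :
    ∃ q : Polynomial ℂ, ∀ t : ℂ, IsNilpotent.exp (t • a) i j = q.eval t := by
  obtain ⟨k, hk⟩ := ha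
  refine ⟨∑ m ∈ Finset.range k, Polynomial.C (((m.factorial : ℚ)⁻¹ • (a ^ m)) i j) * Polynomial.X ^ m,
    fun t => ?_⟩
  have hk' : (t • a) ^ k = 0 := by rw [smul_pow, hk, smul_zero]
  rw [IsNilpotent.exp_eq_sum hk', Matrix.sum_apply, Polynomial.eval_finsetSum]
  refine Finset.sum_congr rfl fun m _ => ?_
  simp [smul_pow, Rat.smul_def]
  ring

lemma exists_polynomial_mul {γ : ℂ → adjointGroup b}
    (hγ : ∀ i j, ∃ q : Polynomial ℂ, ∀ t, mat (γ t) i j = q.eval t) (g : adjointGroup b) (i j) :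
    ∃ q : Polynomial ℂ, ∀ t, mat (g * γ t) i j = q.eval t := by
  choose q hq using hγ
  refine ⟨∑ k, Polynomial.C (mat g i k) * q k j, fun t => ?_⟩
  simp [Matrix.mul_apply, Polynomial.eval_finsetSum, hq]

lemma eq_zero_of_polynomial {q : Polynomial ℂ} {E : Finset ℂ} (h : ∀ t ∉ E, q.eval t = 0) : q = 0 := by
  refine Polynomial.eq_zero_of_infinite_isRoot q ((E.finite_toSet.infinite_compl).mono fun t ht => ?_)
  exact h t (by simpa using ht)

lemma adjointGroup_induction {p : adjointGroup b → Prop} (one : p 1)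
    (x : ∀ g s t, p g → p (g * xG b s t)) (y : ∀ g s t, p g → p (g * yG b s t))
    (tor : ∀ g χ, p g → p (g * torG b χ)) (g : adjointGroup b) : p g := by
  obtain ⟨g, hg⟩ := g
  induction hg using Subgroup.closure_induction_right with
  | one => exact one
  | mul_right g hg z hz ih =>
    rcases hz with (⟨s, t, rfl⟩ | ⟨s, t, rfl⟩) | ⟨χ, rfl⟩
    · exact x _ s t ih
    · exact y _ s t ih
    · exact tor _ χ ih
  | mul_inv_cancel g hg z hz ih =>
    rcases hz with (⟨s, t, rfl⟩ | ⟨s, t, rfl⟩) | ⟨χ, rfl⟩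
    · have := x _ s (-t) ih
      rw [← xG_inv] at this
      exact this
    · have := y _ s (-t) ih
      rw [← yG_inv] at this
      exact this
    · have := tor _ χ⁻¹ ih
      rw [(torG b).map_inv] at this
      exact this

variable [P.IsRootSystem]

lemma one_mem_G₀ : (1 : adjointGroup b) ∈ G₀ b := ⟨1, by simp [IsTriangular]⟩

lemma mul_mem_G₀ {g β : adjointGroup b} (hg : g ∈ G₀ b) (hβ : β ∈ borelPos b) : g * β ∈ G₀ b := by
  obtain ⟨v, hv, β', hβ', rfl⟩ := mem_G₀_iff.mp hg
  exact mem_G₀_iff.mpr ⟨v, hv, β' * β, mul_mem hβ' hβ, mul_assoc _ _ _⟩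

/-- The open cell `G₀` is Zariski dense. -/
lemma polyFun_eq_zero {F : adjointGroup b → ℂ} (hF : F ∈ polyFun b) (h : ∀ g ∈ G₀ b, F g = 0)
    (g : adjointGroup b) : F g = 0 := by
  -- The induction is over generators of `G` on the right, with `F` arbitrary so that it can absorb
  -- a right translation.
  suffices ∀ F ∈ polyFun b, (∀ g ∈ G₀ b, F g = 0) → ∀ x ∈ G₀ b, F (x * g) = 0 by
    simpa using this F hF h 1 one_mem_G₀
  have hB : ∀ g β : adjointGroup b, β ∈ borelPos b →
      (∀ F ∈ polyFun b, (∀ g ∈ G₀ b, F g = 0) → ∀ x ∈ G₀ b, F (x * g) = 0) →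
      ∀ F ∈ polyFun b, (∀ g ∈ G₀ b, F g = 0) → ∀ x ∈ G₀ b, F (x * (g * β)) = 0 := by
    intro g β hβ ih F hF h0 x hx
    have := ih (fun x => F (x * β)) (by simpa using polyFun_comp_mul hF 1 β)
      (fun g hg => h0 _ (mul_mem_G₀ hg hβ)) x hx
    simpa only [mul_assoc] using this
  induction g using adjointGroup_induction with
  | one => exact fun F _ h0 x hx => by simpa using h0 x hx
  | x g s t ih => exact hB g _ (Subgroup.mem_sup_right (Subgroup.subset_closure ⟨s, t, rfl⟩)) ih
  | tor g χ ih => exact hB g _ (Subgroup.mem_sup_left ⟨χ, rfl⟩) ih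
  | y g s t ih =>
    intro F hF h0 x hx
    have := ih (fun x => F (x * yG b s t)) (by simpa using polyFun_comp_mul hF 1 (yG b s t))
      (fun g hg => ?_) x hx
    · simpa only [mul_assoc] using this
    -- Along the curve `t ↦ g y_s(t)` the function is polynomial in `t`, and all but finitely many
    -- points lie in `G₀`; so it vanishes identically.
    · obtain ⟨E, hE⟩ := mul_yG_mem_G₀ hg s
      obtain ⟨q, hq⟩ := polyFun_comp_curve hF
        (exists_polynomial_mul (γ := fun t => yG b s t)
          (fun i j => exists_polynomial_exp (GeckConstruction.isNilpotent_f s) i j) g)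
      have hq0 : q = 0 := eq_zero_of_polynomial (E := E) fun t ht => by
        rw [← hq, h0 _ (hE t ht)]
      simp [hq, hq0]

/-- Near the given point the function is a quotient `p / q`. The product `p q` vanishes on all of
`G₀`, also where `q` does, so the density for polynomials applies to it. -/
lemma isRegular_eq_zero {F : adjointGroup b → ℂ} (hF : IsRegular entries F)
    (h : ∀ g ∈ G₀ b, F g = 0) (g : adjointGroup b) : F g = 0 := by
  obtain ⟨p, q, hq, hp⟩ := hF g
  have := polyFun_eq_zero (eval_entries_mem_polyFun (p * q)) (fun x hx => by
    rw [map_mul]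
    by_cases hx' : MvPolynomial.eval (entries x) q = 0
    · rw [hx', mul_zero]
    · have := hp x hx'
      rw [h x hx, eq_comm, div_eq_zero_iff] at this
      rw [this.resolve_right hx', zero_mul]) g
  rw [map_mul, mul_eq_zero] at this
  rw [hp g hq, this.resolve_right hq, zero_div]

lemma isRegular_ext {F F' : adjointGroup b → ℂ} (hF : IsRegular entries F)
    (hF' : IsRegular entries F') (h : ∀ g ∈ G₀ b, F g = F' g) : F = F' := by
  ext g
  have h1 : IsRegular entries (F - F') := (regularFunctions entries).sub_mem hF hF'
  have := isRegular_eq_zero h1 (fun g hg => by simp [h g hg]) g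
  exact sub_eq_zero.mp this

end Density

/-! ### Principal submatrices of unitriangular matrices -/

section Minors

variable {n : Type*} [Fintype n] [DecidableEq n] {c : n → ℤ}

lemma IsUnitri.det_eq_one {A : Matrix n n ℂ} (h : IsUnitri c A) : A.det = 1 := by
  have hb : A.BlockTriangular (-c) := fun i j hij => by
    have hij' : c i < c j := by simpa using hij
    rw [h i j hij'.le, Matrix.one_apply_ne (by rintro rfl; exact lt_irrefl _ hij')]
  rw [hb.det]
  refine Finset.prod_eq_one fun a _ => ?_
  have : A.toSquareBlock (-c) a = 1 := by
    ext ⟨i, hi⟩ ⟨j, hj⟩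
    have hij : c i = c j := neg_injective (hi.trans hj.symm)
    rw [Matrix.toSquareBlock_def, Matrix.of_apply, h i j hij.le]
    simp [Matrix.one_apply, Subtype.ext_iff]
  rw [this, Matrix.det_one]

/-- The principal submatrix with index set `J`. -/
def principalBlock (J : n → Prop) (A : Matrix n n ℂ) : Matrix (Subtype J) (Subtype J) ℂ :=
  .of fun i j => A i j

@[simp] lemma principalBlock_apply (J : n → Prop) (A : Matrix n n ℂ) (i j : Subtype J) :
    principalBlock J A i j = A i j := rfl

lemma IsUnitri.principalBlock {A : Matrix n n ℂ} (h : IsUnitri c A) (J : n → Prop) :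
    IsUnitri (fun i : Subtype J => c i) (principalBlock J A) := fun i j hij => by
  rw [principalBlock_apply, h i j hij]
  simp [Matrix.one_apply, Subtype.ext_iff]

lemma principalBlock_mul (A B : Matrix n n ℂ) (J : n → Prop) [DecidablePred J]
    (h : ∀ i l j, J i → ¬ J l → J j → A i l * B l j = 0) :
    principalBlock J (A * B) = principalBlock J A * principalBlock J B := by
  ext ⟨i, hi⟩ ⟨j, hj⟩
  simp only [principalBlock_apply, Matrix.mul_apply]
  rw [← Finset.sum_filter_add_sum_filter_not _ J, Finset.sum_subtype (p := J) _ (by simp), add_eq_left]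
  exact Finset.sum_eq_zero fun l hl => h i l j hi (by simpa using hl) hj

end Minors

/-! ### Regularity of the triangular factors -/

section Regularity

open Classical in
/-- The principal minor with index set `J`. -/
def principalMinor (J : b.support ⊕ ι → Prop) (g : adjointGroup b) : ℂ :=
  (principalBlock J (mat g)).det

lemma principalMinor_eq_det (J : b.support ⊕ ι → Prop) [Fintype (Subtype J)] [DecidableEq (Subtype J)]
    (g : adjointGroup b) : principalMinor J g = (principalBlock J (mat g)).det := by
  unfold principalMinor
  congr!

variable [P.IsRootSystem]

variable (b) in
/-- Sets of indices closed under increasing the height. -/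
def IsUpperIndex (J : b.support ⊕ ι → Prop) : Prop := ∀ i j, J i → wtHt b i < wtHt b j → J j

variable {J : b.support ⊕ ι → Prop}

/-- Row `i` of an element of `U⁻` involves, apart from `i`, only indices of larger height. For `i`
in `J` these lie in `J`, so the block of the product is the product of blocks. -/
lemma principalMinor_unipNeg_mul (hJ : IsUpperIndex b J) {v : adjointGroup b} (hv : v ∈ unipNeg b)
    (g : adjointGroup b) : principalMinor J (v * g) = principalMinor J g := by
  classical
  have h := isUnitri_of_mem_unipNeg hv
  rw [principalMinor, map_mul, principalBlock_mul, Matrix.det_mul, (h.principalBlock J).det_eq_one,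
    one_mul, principalMinor]
  intro i l j hi hl _
  have hil : ¬ wtHt b i < wtHt b l := fun hlt => hl (hJ i l hi hlt)
  rw [h i l (by simpa using hil), Matrix.one_apply_ne (by rintro rfl; exact hl hi), zero_mul]

lemma principalMinor_mul_unipPos (hJ : IsUpperIndex b J) {u : adjointGroup b} (hu : u ∈ unipPos b)
    (g : adjointGroup b) : principalMinor J (g * u) = principalMinor J g := by
  classical
  have h := isUnitri_of_mem_unipPos hu
  rw [principalMinor, map_mul, principalBlock_mul, Matrix.det_mul, (h.principalBlock J).det_eq_one,
    mul_one, principalMinor]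
  intro i l j _ hl hj
  have hjl : ¬ wtHt b j < wtHt b l := fun hlt => hl (hJ j l hj hlt)
  rw [h l j (by simpa using hjl), Matrix.one_apply_ne (by rintro rfl; exact hl hj), mul_zero]

open Classical in
lemma principalMinor_torG (χ : Multiplicative (P.rootSpan ℤ) →* ℂˣ) :
    principalMinor J (torG b χ) = (χ (.ofAdd (∑ i with J i, wt b i)) : ℂ) := by
  have : principalBlock J (mat (torG b χ)) =
      Matrix.diagonal fun i : Subtype J => (χ (.ofAdd (wt b i)) : ℂ) := by
    ext i j
    rw [mat_torG, principalBlock_apply]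
    simp [Matrix.diagonal_apply, Subtype.ext_iff]
  rw [principalMinor, this, Matrix.det_diagonal, ofAdd_sum, map_prod, Units.coe_prod,
    Finset.prod_subtype (p := J) _ (by simp)]

lemma principalMinor_of_mem_cartan_ne_zero {h : adjointGroup b} (hh : h ∈ cartan b) :
    principalMinor J h ≠ 0 := by
  obtain ⟨χ, rfl⟩ := hh
  rw [principalMinor_torG]
  exact Units.ne_zero _

lemma principalMinor_triangular (hJ : IsUpperIndex b J) {v h u : adjointGroup b} (hv : v ∈ unipNeg b)
    (hu : u ∈ unipPos b) : principalMinor J (v * h * u) = principalMinor J h := by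
  rw [principalMinor_mul_unipPos hJ hu, principalMinor_unipNeg_mul hJ hv]

lemma principalMinor_ne_zero (hJ : IsUpperIndex b J) {g : adjointGroup b} (hg : g ∈ G₀ b) :
    principalMinor J g ≠ 0 := by
  obtain ⟨t, ht⟩ := hg
  rw [ht, principalMinor_triangular hJ t.1.2 t.2.2.2]
  exact principalMinor_of_mem_cartan_ne_zero t.2.1.2

section RegMap

variable {Y σ : Type*} {c : Y → σ → ℂ}

/-- A map to `G` with regular matrix entries. -/
def RegMap (c : Y → σ → ℂ) (g : Y → adjointGroup b) : Prop :=
  ∀ i j, IsRegular c fun y => mat (g y) i j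

lemma det_mem {R : Subalgebra ℂ (Y → ℂ)} {m : Type*} [Fintype m] [DecidableEq m] {A : Y → Matrix m m ℂ}
    (h : ∀ i j, (fun y => A y i j) ∈ R) : (fun y => (A y).det) ∈ R := by
  have : (fun y => (A y).det) =
      ∑ σ : Equiv.Perm m, ((Equiv.Perm.sign σ : ℤ) : ℂ) • ∏ i, fun y => A y (σ i) i := by
    ext y
    simp [Matrix.det_apply', Finset.sum_apply, Finset.prod_apply]
  rw [this]
  exact sum_mem fun σ _ => Subalgebra.smul_mem _ (prod_mem fun i _ => h _ _) _

lemma adjugate_mem {R : Subalgebra ℂ (Y → ℂ)} {m : Type*} [Fintype m] [DecidableEq m] {A : Y → Matrix m m ℂ}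
    (h : ∀ i j, (fun y => A y i j) ∈ R) (i j : m) : (fun y => (A y).adjugate i j) ∈ R := by
  simp only [Matrix.adjugate_apply]
  refine det_mem fun k l => ?_
  by_cases hk : k = j
  · subst hk
    simp only [Matrix.updateRow_self]
    exact R.algebraMap_mem (Pi.single (M := fun _ => ℂ) i 1 l)
  · simp only [Matrix.updateRow_ne hk]
    exact h k l

lemma inv_mem_regularFunctions {m : Type*} [Fintype m] [DecidableEq m] {A : Y → Matrix m m ℂ}
    (h : ∀ i j, IsRegular c fun y => A y i j) (h0 : ∀ y, (A y).det ≠ 0) (i j : m) :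
    IsRegular c fun y => (A y)⁻¹ i j := by
  have : (fun y => (A y)⁻¹ i j) = (fun y => (A y).adjugate i j) / fun y => (A y).det := by
    ext y
    simp [Matrix.inv_def, div_eq_inv_mul]
  rw [this]
  exact IsRegular.div (adjugate_mem (R := regularFunctions c) h i j)
    (det_mem (R := regularFunctions c) h) h0

lemma RegMap.mul {g g' : Y → adjointGroup b} (h : RegMap c g) (h' : RegMap c g') :
    RegMap c fun y => g y * g' y := fun i j => by
  have : (fun y => mat (g y * g' y) i j) = ∑ k, (fun y => mat (g y) i k) * fun y => mat (g' y) k j := by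
    ext y
    simp [Matrix.mul_apply, Finset.sum_apply]
  rw [this]
  exact (regularFunctions c).sum_mem fun k _ => IsRegular.mul (h i k) (h' k j)

lemma regMap_const (g : adjointGroup b) : RegMap c fun _ => g := fun i j =>
  (regularFunctions c).algebraMap_mem (mat g i j)

lemma mat_inv (g : adjointGroup b) : mat g⁻¹ = (mat g)⁻¹ :=
  (Matrix.inv_eq_left_inv (mat_inv_mul g)).symm

lemma det_mat_ne_zero (g : adjointGroup b) : (mat g).det ≠ 0 := fun h => by
  have := congrArg Matrix.det (mat_mul_inv g)
  rw [Matrix.det_mul, h, zero_mul, Matrix.det_one] at this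
  exact zero_ne_one this

lemma RegMap.inv {g : Y → adjointGroup b} (h : RegMap c g) : RegMap c fun y => (g y)⁻¹ := fun i j => by
  simp only [mat_inv]
  exact inv_mem_regularFunctions h (fun y => det_mat_ne_zero _) i j

lemma RegMap.isRegular_comp {g : Y → adjointGroup b} (h : RegMap c g) {F : adjointGroup b → ℂ}
    (hF : IsRegular entries F) : IsRegular c fun y => F (g y) :=
  hF.comp g fun i => h i.1 i.2

lemma principalMinor_mem_polyFun (J : b.support ⊕ ι → Prop) : principalMinor J ∈ polyFun b := by
  classical
  exact det_mem fun i j => mat_mem_polyFun i.1 j.1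

lemma RegMap.transpose {g : Y → adjointGroup b} (h : RegMap c g) :
    RegMap c fun y => AdjointPinned.transpose b (g y) := fun i j => by
  set Ω : GLn b := omegaGL b * torGL b (signHom b)
  have : (fun y => mat (AdjointPinned.transpose b (g y)) i j) =
      ∑ l, ∑ k, ((Ω : Matrix _ _ ℂ) i k * (Ω⁻¹ : GLn b) l j) • fun y => mat (g y)⁻¹ k l := by
    ext y
    have h1 : (AdjointPinned.transpose b (g y)).1 = Ω * ((g y)⁻¹ : adjointGroup b).1 * Ω⁻¹ := by
      change (Ω * (g y : GLn b) * Ω⁻¹)⁻¹ = _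
      rw [Subgroup.coe_inv]
      group
    have h2 : mat (AdjointPinned.transpose b (g y)) = Ω * mat (g y)⁻¹ * (Ω⁻¹ : GLn b) := by
      change ((AdjointPinned.transpose b (g y)).1 : GLn b).1 = _
      rw [h1]
      rfl
    rw [h2]
    simp only [Matrix.mul_apply, Finset.sum_apply, Pi.smul_apply, smul_eq_mul, Finset.sum_mul]
    exact Finset.sum_congr rfl fun l _ => Finset.sum_congr rfl fun k _ => by ring
  rw [this]
  exact (regularFunctions c).sum_mem fun l _ => (regularFunctions c).sum_mem fun k _ =>
    (regularFunctions c).smul_mem (h.inv k l) _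

/-- The rows of `v⁻¹` in terms of the product `v * β`. -/
lemma vecMul_principalBlock {v β : adjointGroup b} (hv : v ∈ unipNeg b) (hβ : β ∈ borelPos b)
    (i : b.support ⊕ ι) (J : b.support ⊕ ι → Prop) [DecidablePred J]
    (hJ : ∀ j, J j ↔ wtHt b i < wtHt b j) :
    Matrix.vecMul (fun k : Subtype J => mat v⁻¹ i k) (principalBlock J (mat (v * β))) =
      fun k : Subtype J => - mat (v * β) i k := by
  ext ⟨l, hl⟩
  have h1 : mat v⁻¹ * mat (v * β) = mat β := by
    rw [← map_mul, inv_mul_cancel_left]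
  have hl' := (hJ l).mp hl
  -- Row `i` of `β = v⁻¹ (v β)` vanishes at all columns higher than `i`. This is a linear system for
  -- the entries of `v⁻¹` in that row.
  have h2 : mat β i l = 0 := by
    obtain ⟨k, hk, u, hu, e⟩ := mem_borelPos.mp hβ
    rw [e, mat_cartan_mul hk, isUnitri_of_mem_unipPos hu i l hl'.le,
      Matrix.one_apply_ne (by rintro rfl; exact lt_irrefl _ hl'), mul_zero]
  have h3 := congr_fun (congr_fun h1 i) l
  have huni := isUnitri_of_mem_unipNeg (inv_mem hv)
  rw [h2, Matrix.mul_apply, ← Finset.sum_filter_add_sum_filter_not _ J,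
    Finset.sum_subtype (p := J) _ (by simp)] at h3
  have h4 : ∑ k with ¬ J k, mat v⁻¹ i k * mat (v * β) k l = mat (v * β) i l := by
    rw [Finset.sum_eq_single i]
    · rw [huni i i le_rfl, Matrix.one_apply_eq, one_mul]
    · intro k hk hki
      have hk' : ¬ wtHt b i < wtHt b k := by rw [← hJ]; simpa using hk
      rw [huni i k (by simpa using hk'), Matrix.one_apply_ne' hki, zero_mul]
    · intro h
      simp [hJ] at h
  rw [h4] at h3
  exact eq_neg_of_add_eq_zero_left h3

/-- The components of the decomposition `U⁻ B⁺` depend regularly on the product. -/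
lemma RegMap.unipNeg_inv {v β : Y → adjointGroup b} (hv : ∀ y, v y ∈ unipNeg b)
    (hβ : ∀ y, β y ∈ borelPos b) (h : RegMap c fun y => v y * β y) : RegMap c fun y => (v y)⁻¹ := by
  classical
  intro i j
  -- Cramer's rule recovers row `i` of `v⁻¹` from the block of indices higher than `i`. Its
  -- determinant has no zeros because the index set is upper and the product lies in `G₀`.
  set J : b.support ⊕ ι → Prop := fun j => wtHt b i < wtHt b j with hJ
  have hJ' : IsUpperIndex b J := fun k l hk hkl => lt_trans hk hkl
  have hdet : ∀ y, (principalBlock J (mat (v y * β y))).det ≠ 0 := fun y =>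
    principalMinor_eq_det J (v y * β y) ▸ principalMinor_ne_zero hJ' (mem_G₀_iff.mpr ⟨_, hv y, _, hβ y, rfl⟩)
  have hreg : ∀ k l, IsRegular c fun y => (principalBlock J (mat (v y * β y)))⁻¹ k l :=
    inv_mem_regularFunctions (fun k l => h k l) hdet
  have huni : ∀ y, IsUnitri (-wtHt b) (mat (v y)⁻¹) := fun y =>
    isUnitri_of_mem_unipNeg (inv_mem (hv y))
  by_cases hij : J j
  · have hrow : ∀ y, (fun k : Subtype J => mat (v y)⁻¹ i k) =
        Matrix.vecMul (fun k : Subtype J => - mat (v y * β y) i k)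
          (principalBlock J (mat (v y * β y)))⁻¹ := by
      intro y
      rw [← vecMul_principalBlock (hv y) (hβ y) i J fun _ => Iff.rfl, Matrix.vecMul_vecMul,
        Matrix.mul_nonsing_inv _ (hdet y).isUnit, Matrix.vecMul_one]
    have : (fun y => mat (v y)⁻¹ i j) = ∑ k : Subtype J, (fun y => - mat (v y * β y) i k) *
        fun y => (principalBlock J (mat (v y * β y)))⁻¹ k ⟨j, hij⟩ := by
      ext y
      have := congr_fun (hrow y) ⟨j, hij⟩
      rw [Finset.sum_apply]
      exact this
    rw [this]
    exact (regularFunctions c).sum_mem fun k _ =>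
      IsRegular.mul ((regularFunctions c).neg_mem (h i k)) (hreg k _)
  · have : (fun y => mat (v y)⁻¹ i j) = fun _ => (1 : Matrix _ _ ℂ) i j := by
      ext y
      exact huni y i j (by simpa [hJ] using hij)
    rw [this]
    exact (regularFunctions c).algebraMap_mem ((1 : Matrix _ _ ℂ) i j)

lemma RegMap.unipNeg {v β : Y → adjointGroup b} (hv : ∀ y, v y ∈ AdjointPinned.unipNeg b)
    (hβ : ∀ y, β y ∈ borelPos b) (h : RegMap c fun y => v y * β y) : RegMap c v := by
  simpa using (h.unipNeg_inv hv hβ).inv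

lemma RegMap.borelPos {v β : Y → adjointGroup b} (hv : ∀ y, v y ∈ AdjointPinned.unipNeg b)
    (hβ : ∀ y, β y ∈ AdjointPinned.borelPos b) (h : RegMap c fun y => v y * β y) : RegMap c β := by
  simpa using (h.unipNeg_inv hv hβ).mul h

lemma RegMap.cartan {k u : Y → adjointGroup b} (hk : ∀ y, k y ∈ AdjointPinned.cartan b)
    (hu : ∀ y, u y ∈ unipPos b) (h : RegMap c fun y => k y * u y) : RegMap c k := fun i j => by
  by_cases hij : i = j
  · subst hij
    have : (fun y => mat (k y) i i) = fun y => mat (k y * u y) i i := by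
      ext y
      rw [mat_cartan_mul (hk y), isUnitri_of_mem_unipPos (hu y) i i le_rfl, Matrix.one_apply_eq, mul_one]
    rw [this]
    exact h i i
  · have : (fun y => mat (k y) i j) = fun _ => 0 := by
      ext y
      exact mat_cartan_apply_ne (hk y) hij
    rw [this]
    exact (regularFunctions c).zero_mem

end RegMap

section CellRegularity

variable {w : List b.support}

lemma regMap_cellPos : RegMap (fun u : cellPos w => entries (u : adjointGroup b)) fun u => (u : adjointGroup b) :=
  fun i j => by
    have := IsRegular.eval_comp (fun u : cellPos w => entries (u : adjointGroup b)) (MvPolynomial.X (i, j))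
    simp only [MvPolynomial.eval_X] at this
    exact this

lemma regMap_phi (hw : IsLongestWord w) :
    RegMap (fun u : cellPos w => entries (u : adjointGroup b)) fun u => phi hw u := by
  choose k n h using exists_cellData_phi hw
  refine RegMap.unipNeg (β := fun u => k u * n u) (fun u => (h u).v_mem)
    (fun u => mem_borelPos.mpr ⟨_, (h u).k_mem, _, (h u).n_mem, rfl⟩) ?_
  have : (fun u => phi hw u * (k u * n u)) = fun u : cellPos w => (u : adjointGroup b) * wBar w := by
    ext1 u
    rw [(h u).eq, mul_assoc]
  rw [this]
  exact regMap_cellPos.mul (regMap_const _)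

lemma regMap_bracketZero (hw : IsLongestWord w) :
    RegMap (fun u : cellPos w => entries (u : adjointGroup b))
      fun u => (bracketZero ((u : adjointGroup b) * wBar w) : adjointGroup b) := by
  choose k n h using exists_cellData_phi hw
  have hk : (fun u : cellPos w => (bracketZero ((u : adjointGroup b) * wBar w) : adjointGroup b)) = k := by
    ext1 u
    rw [(h u).bracketZero_eq]
  rw [hk]
  refine RegMap.cartan (u := n) (fun u => (h u).k_mem) (fun u => (h u).n_mem) ?_
  refine RegMap.borelPos (v := fun u => phi hw u) (fun u => (h u).v_mem)
    (fun u => mem_borelPos.mpr ⟨_, (h u).k_mem, _, (h u).n_mem, rfl⟩) ?_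
  have : (fun u => phi hw u * (k u * n u)) = fun u : cellPos w => (u : adjointGroup b) * wBar w := by
    ext1 u
    rw [(h u).eq, mul_assoc]
  rw [this]
  exact regMap_cellPos.mul (regMap_const _)

end CellRegularity

end Regularity

/-! ### The character lattice is the root lattice -/

section Characters

variable [P.IsRootSystem]

lemma torG_injective : Function.Injective (torG b) := fun χ χ' h => by
  rw [← cochar_eq (b := b) χ, ← cochar_eq (b := b) χ']
  congr 1
  ext s
  have := congr_fun (congr_fun (congrArg mat h) (.inr s)) (.inr s)
  rw [mat_torG, mat_torG, Matrix.diagonal_apply_eq, Matrix.diagonal_apply_eq] at this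
  exact this

variable (b) in
/-- The Cartan subgroup is the group of homomorphisms from the root lattice. -/
def cartanEquiv : (Multiplicative (P.rootSpan ℤ) →* ℂˣ) ≃* cartan b :=
  MonoidHom.ofInjective torG_injective

lemma cartanEquiv_coe (χ : Multiplicative (P.rootSpan ℤ) →* ℂˣ) :
    (cartanEquiv b χ : adjointGroup b) = torG b χ := rfl

variable (b) in
/-- The character of `H` given by an element of the root lattice. -/
def rootCharHom : Multiplicative (P.rootSpan ℤ) →* cartan b →* ℂˣ where
  toFun x :=
    { toFun h := (cartanEquiv b).symm h x
      map_one' := by simp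
      map_mul' h h' := by simp }
  map_one' := by ext; simp
  map_mul' x y := by ext; simp

lemma rootCharHom_cartanEquiv (x : Multiplicative (P.rootSpan ℤ)) (χ) :
    rootCharHom b x (cartanEquiv b χ) = χ x := by
  simp [rootCharHom]

lemma rootCharHom_wt (i : b.support ⊕ ι) (h : cartan b) :
    (rootCharHom b (.ofAdd (wt b i)) h : ℂ) = mat (h : adjointGroup b) i i := by
  obtain ⟨χ, rfl⟩ := (cartanEquiv b).surjective h
  rw [rootCharHom_cartanEquiv, cartanEquiv_coe, mat_torG, Matrix.diagonal_apply_eq]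

lemma rootCharHom_wt_mem (i : b.support ⊕ ι) : rootCharHom b (.ofAdd (wt b i)) ∈ charGroup b := by
  change IsRegular _ _
  simp only [rootCharHom_wt]
  have := IsRegular.eval_comp (fun h : cartan b => entries (h : adjointGroup b)) (MvPolynomial.X (i, i))
  simp only [MvPolynomial.eval_X] at this
  exact this

lemma rootCharHom_mem (x : P.rootSpan ℤ) : rootCharHom b (.ofAdd x) ∈ charGroup b := by
  have : ∀ s : b.support, b.toWeightBasisInt s = wt b (.inr s) := fun s => by ext; simp [wt]
  rw [← b.toWeightBasisInt.sum_repr x, ofAdd_sum, map_prod]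
  refine prod_mem fun s _ => ?_
  rw [ofAdd_zsmul, map_zpow, this]
  exact zpow_mem (rootCharHom_wt_mem _) _

variable (b) in
/-- The root lattice as a group of characters of `H`. -/
def rootChar : P.rootSpan ℤ →+ CharLattice b where
  toFun x := .ofMul ⟨rootCharHom b (.ofAdd x), rootCharHom_mem x⟩
  map_zero' := by
    apply Additive.toMul.injective
    exact Subtype.ext (map_one (rootCharHom b))
  map_add' x y := by
    apply Additive.toMul.injective
    exact Subtype.ext ((rootCharHom b).map_mul (.ofAdd x) (.ofAdd y))

lemma ev_rootChar (x : P.rootSpan ℤ) (h : cartan b) :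
    ev (rootChar b x) h = (rootCharHom b (.ofAdd x) h : ℂ) := rfl

lemma ev_rootChar_torG (x : P.rootSpan ℤ) (χ) :
    ev (rootChar b x) ⟨torG b χ, ⟨χ, rfl⟩⟩ = (χ (.ofAdd x) : ℂ) :=
  congrArg Units.val (rootCharHom_cartanEquiv (.ofAdd x) χ)

lemma ev_add (μ ν : CharLattice b) (h : cartan b) : ev (μ + ν) h = ev μ h * ev ν h := rfl

lemma ev_zero (h : cartan b) : ev (0 : CharLattice b) h = 1 := rfl

lemma ev_mul (μ : CharLattice b) (h h' : cartan b) : ev μ (h * h') = ev μ h * ev μ h' := by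
  simp [ev]

lemma ev_one (μ : CharLattice b) : ev μ 1 = 1 := by simp [ev]

lemma ev_ne_zero (μ : CharLattice b) (h : cartan b) : ev μ h ≠ 0 := Units.ne_zero _

lemma ev_neg (μ : CharLattice b) (h : cartan b) : ev (-μ) h = (ev μ h)⁻¹ :=
  Units.val_inv_eq_inv_val _

lemma ev_inv (μ : CharLattice b) (h : cartan b) : ev μ h⁻¹ = (ev μ h)⁻¹ := by
  refine eq_inv_of_mul_eq_one_left ?_
  rw [← ev_mul, inv_mul_cancel, ev_one]

lemma charLattice_ext {μ ν : CharLattice b} (h : ∀ x, ev μ x = ev ν x) : μ = ν := by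
  apply Additive.toMul.injective
  exact Subtype.ext (MonoidHom.ext fun x => Units.ext (h x))

lemma ev_mul_mem_span (μ : CharLattice b) {F : cartan b → ℂ}
    (hF : F ∈ Submodule.span ℂ (Set.range fun x : P.rootSpan ℤ => ev (rootChar b x))) :
    (fun h => F h * ev μ h) ∈
      Submodule.span ℂ (Set.range fun x : P.rootSpan ℤ => ev (μ + rootChar b x)) := by
  induction hF using Submodule.span_induction with
  | mem F hF =>
    obtain ⟨x, rfl⟩ := hF
    refine Submodule.subset_span ⟨x, ?_⟩
    ext h
    simp only [ev_add, mul_comm]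
  | zero =>
    simp only [Pi.zero_apply, zero_mul]
    exact zero_mem (Submodule.span ℂ _)
  | add F F' _ _ h h' =>
    simp only [Pi.add_apply, add_mul]
    exact add_mem h h'
  | smul r F _ h =>
    simp only [Pi.smul_apply, smul_eq_mul, mul_assoc]
    exact Submodule.smul_mem _ r h

/-- The restrictions of polynomial functions to `H` are combinations of the characters in the root
lattice. -/
lemma eval_entries_cartan_mem_span (p : MvPolynomial ((b.support ⊕ ι) × (b.support ⊕ ι)) ℂ) :
    (fun h : cartan b => MvPolynomial.eval (entries (h : adjointGroup b)) p) ∈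
      Submodule.span ℂ (Set.range fun x : P.rootSpan ℤ => ev (rootChar b x)) := by
  induction p using MvPolynomial.induction_on with
  | C a =>
    have : (fun h : cartan b => MvPolynomial.eval (entries (h : adjointGroup b)) (MvPolynomial.C a)) =
        a • ev (rootChar b 0) := by
      ext h
      simp [ev_zero]
    rw [this]
    exact Submodule.smul_mem _ _ (Submodule.subset_span ⟨0, rfl⟩)
  | add p q hp hq =>
    simp only [map_add]
    exact add_mem hp hq
  | mul_X p i hp =>
    obtain ⟨i, j⟩ := i
    simp only [map_mul, MvPolynomial.eval_X]
    by_cases hij : i = j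
    · subst hij
      have h2 := ev_mul_mem_span (rootChar b (wt b i)) hp
      simp only [ev_rootChar, rootCharHom_wt] at h2
      refine Submodule.span_mono ?_ h2
      rintro _ ⟨x, rfl⟩
      exact ⟨wt b i + x, by simp only [map_add]⟩
    · have : (fun h : cartan b => MvPolynomial.eval (entries (h : adjointGroup b)) p *
          entries (h : adjointGroup b) (i, j)) = 0 := by
        ext h
        rw [entries_eq_mat, mat_cartan_apply_ne h.2 hij, mul_zero, Pi.zero_apply]
      rw [this]
      exact zero_mem _

lemma linearIndependent_ev : LinearIndependent ℂ fun μ : CharLattice b => ev μ := by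
  have h := linearIndependent_monoidHom (cartan b) ℂ
  refine h.comp (fun μ : CharLattice b => (Units.coeHom ℂ).comp (μ.toMul : cartan b →* ℂˣ)) fun μ ν hμν => ?_
  exact charLattice_ext fun x => DFunLike.congr_fun hμν x

lemma exists_ev_eq_div (μ : CharLattice b) :
    ∃ p q : MvPolynomial ((b.support ⊕ ι) × (b.support ⊕ ι)) ℂ,
      MvPolynomial.eval (entries (1 : adjointGroup b)) q ≠ 0 ∧ ∀ h : cartan b,
      MvPolynomial.eval (entries (h : adjointGroup b)) q * ev μ h =
        MvPolynomial.eval (entries (h : adjointGroup b)) p := by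
  have hμ : IsRegular (fun h : cartan b => entries (h : adjointGroup b)) (ev μ) := μ.toMul.2
  obtain ⟨p, q, hq, hp⟩ := hμ 1
  -- The extra factor `q` makes the identity hold where `q` vanishes as well.
  refine ⟨p * q, q * q, by rw [map_mul]; exact mul_self_ne_zero.mpr hq, fun h => ?_⟩
  rw [map_mul, map_mul]
  by_cases h0 : MvPolynomial.eval (entries (h : adjointGroup b)) q = 0
  · rw [h0, zero_mul, zero_mul, mul_zero]
  · rw [hp h h0]
    field_simp

/-- Distinct characters are linearly independent, and the coset of `μ` is disjoint from the root
lattice. -/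
lemma disjoint_span_ev {μ : CharLattice b} (hμ : μ ∉ Set.range (rootChar b)) :
    Disjoint (Submodule.span ℂ (Set.range fun x : P.rootSpan ℤ => ev (μ + rootChar b x)))
      (Submodule.span ℂ (Set.range fun x : P.rootSpan ℤ => ev (rootChar b x))) := by
  have hdis : Disjoint (Set.range fun x : P.rootSpan ℤ => μ + rootChar b x) (Set.range (rootChar b)) := by
    rw [Set.disjoint_left]
    rintro _ ⟨x, rfl⟩ ⟨y, hy⟩
    exact hμ ⟨y - x, by rw [map_sub, hy, add_sub_cancel_right]⟩
  have h2 := linearIndependent_ev.disjoint_span_image hdis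
  rwa [← Set.range_comp, ← Set.range_comp] at h2

/-- Regularity gives `q μ = p`, where `p` and `q` are combinations of root lattice characters. If
`μ` were outside the lattice, both sides would lie in spans meeting only in zero, contradicting
`q(1) ≠ 0`. -/
lemma rootChar_surjective : Function.Surjective (rootChar b) := fun μ => by
  obtain ⟨p, q, hq, hp⟩ := exists_ev_eq_div μ
  by_contra hμ
  have h4 := ev_mul_mem_span μ (eval_entries_cartan_mem_span (b := b) q)
  have h5 := eval_entries_cartan_mem_span (b := b) p
  simp only [hp] at h4
  have h7 := congr_fun ((Submodule.disjoint_def.mp (disjoint_span_ev hμ)) _ h4 h5) 1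
  rw [← hp, ev_one, mul_one, Pi.zero_apply] at h7
  exact hq h7

lemma isRegular_ev (μ : CharLattice b) : IsRegular (fun h : cartan b => entries (h : adjointGroup b)) (ev μ) :=
  μ.toMul.2

end Characters

/-! ### Spherical functions and dominance of their weights -/

section Spherical

variable [P.IsRootSystem]

/-- Polynomial functions on `G` with `f(v h u) = h^μ` for `v ∈ U⁻`, `h ∈ H`, `u ∈ U⁺`. -/
structure IsSpherical (μ : CharLattice b) (f : adjointGroup b → ℂ) : Prop where
  poly : f ∈ polyFun b
  triangular : ∀ v ∈ unipNeg b, ∀ h : cartan b, ∀ u ∈ unipPos b, f (v * h * u) = ev μ h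

namespace IsSpherical

variable {μ : CharLattice b} {f : adjointGroup b → ℂ}

lemma mul {ν : CharLattice b} {f' : adjointGroup b → ℂ} (hf : IsSpherical μ f) (hf' : IsSpherical ν f') :
    IsSpherical (μ + ν) (f * f') where
  poly := mul_mem hf.poly hf'.poly
  triangular v hv h u hu := by
    rw [Pi.mul_apply, hf.triangular v hv h u hu, hf'.triangular v hv h u hu, ev_add]

lemma one : IsSpherical (0 : CharLattice b) (1 : adjointGroup b → ℂ) where
  poly := one_mem _
  triangular _ _ _ _ _ := rfl

lemma apply_one (hf : IsSpherical μ f) : f 1 = 1 := by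
  simpa [ev_one] using hf.triangular 1 (one_mem _) 1 1 (one_mem _)

lemma comp_mul_left (hf : IsSpherical μ f) (g : adjointGroup b) : (fun x => f (g * x)) ∈ polyFun b := by
  simpa only [mul_one] using polyFun_comp_mul hf.poly g 1

lemma comp_mul_right (hf : IsSpherical μ f) (g : adjointGroup b) : (fun x => f (x * g)) ∈ polyFun b := by
  simpa only [one_mul] using polyFun_comp_mul hf.poly 1 g

lemma eqOn {F F' : adjointGroup b → ℂ} (hF : F ∈ polyFun b) (hF' : F' ∈ polyFun b)
    (h : ∀ v ∈ unipNeg b, ∀ a : cartan b, ∀ u ∈ unipPos b, F (v * a * u) = F' (v * a * u)) : F = F' := by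
  refine isRegular_ext (polyFun_isRegular hF) (polyFun_isRegular hF') ?_
  rintro _ ⟨⟨v, a, u⟩, rfl⟩
  exact h v v.2 a u u.2

lemma mul_unipPos (hf : IsSpherical μ f) {u : adjointGroup b} (hu : u ∈ unipPos b) (g : adjointGroup b) :
    f (g * u) = f g := by
  refine congr_fun (eqOn (hf.comp_mul_right u) hf.poly fun v hv a u' hu' => ?_) g
  rw [mul_assoc, hf.triangular v hv a _ (mul_mem hu' hu), hf.triangular v hv a u' hu']

lemma unipNeg_mul (hf : IsSpherical μ f) {v : adjointGroup b} (hv : v ∈ unipNeg b) (g : adjointGroup b) :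
    f (v * g) = f g := by
  refine congr_fun (eqOn (hf.comp_mul_left v) hf.poly fun v' hv' a u hu => ?_) g
  rw [← mul_assoc, ← mul_assoc, hf.triangular _ (mul_mem hv hv') a u hu, hf.triangular v' hv' a u hu]

lemma cartan_mul (hf : IsSpherical μ f) (h : cartan b) (g : adjointGroup b) :
    f (h * g) = ev μ h * f g := by
  refine congr_fun (eqOn (F' := fun g => ev μ h * f g) (hf.comp_mul_left h)
    ((polyFun b).smul_mem hf.poly _) fun v hv a u hu => ?_) g
  have : (h : adjointGroup b) * (v * a * u) =
      (h * v * (h : adjointGroup b)⁻¹) * ((h * a : cartan b) : adjointGroup b) * u := by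
    rw [Subgroup.coe_mul]
    group
  rw [this, hf.triangular _ (cartan_conj_mem_unipNeg h.2 hv) _ u hu, hf.triangular v hv a u hu, ev_mul]

lemma mul_cartan (hf : IsSpherical μ f) (h : cartan b) (g : adjointGroup b) :
    f (g * h) = ev μ h * f g := by
  refine congr_fun (eqOn (F' := fun g => ev μ h * f g) (hf.comp_mul_right h)
    ((polyFun b).smul_mem hf.poly _) fun v hv a u hu => ?_) g
  have : v * a * u * h = v * ((a * h : cartan b) : adjointGroup b) *
      ((h : adjointGroup b)⁻¹ * u * (h : adjointGroup b)⁻¹⁻¹) := by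
    rw [Subgroup.coe_mul]
    group
  rw [this, hf.triangular v hv _ _ (cartan_conj_mem_unipPos (inv_mem h.2) hu), hf.triangular v hv a u hu,
    ev_mul, mul_comm]

lemma regMap_id : RegMap (entries (b := b)) fun g => g := fun i j => by
  have := IsRegular.eval_comp (entries (b := b)) (MvPolynomial.X (i, j))
  simp only [MvPolynomial.eval_X] at this
  exact this

lemma transpose (hf : IsSpherical μ f) (g : adjointGroup b) : f (AdjointPinned.transpose b g) = f g := by
  refine congr_fun (isRegular_ext (F := fun g => f (AdjointPinned.transpose b g))
    (regMap_id.transpose.isRegular_comp (polyFun_isRegular hf.poly)) (polyFun_isRegular hf.poly) ?_) g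
  rintro _ ⟨⟨v, a, u⟩, rfl⟩
  change f (AdjointPinned.transpose b (v * a * u)) = f (v * a * u)
  rw [transpose_mul, transpose_mul, transpose_of_mem_cartan a.2, ← mul_assoc,
    hf.triangular _ (transpose_mem_unipNeg u.2) a _ (transpose_mem_unipPos v.2),
    hf.triangular _ v.2 a _ u.2]

/-- The function has value 1 at `y_s(t)`. Writing this element as `x_s(t⁻¹) α_s^∨(t⁻¹) n̄_s
x_s(t⁻¹)`, dropping the right factor and moving the torus element to the left expresses 1 as a
product of a character value and the value on the right. -/
lemma ev_coroot (hf : IsSpherical μ f) (s : b.support) (t : ℂˣ) :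
    ev μ (coroot s t) = f (xG b s t * nBar b s) := by
  have h1 := yG_inv_eq s t⁻¹
  have h2 := torG_mul_xG (corootHom s t⁻¹ : Multiplicative (P.rootSpan ℤ) →* ℂˣ) s t
  have h3 : ((corootHom s t⁻¹ : Multiplicative (P.rootSpan ℤ) →* ℂˣ)
      (.ofAdd (P.rootSpanMem ℤ s)) : ℂ) * t = (t : ℂ)⁻¹ := by
    have h4 : P.coroot'In ℤ s (P.rootSpanMem ℤ s) = 2 := by
      have := P.algebraMap_coroot'In_apply ℤ s (P.rootSpanMem ℤ s)
      have h2 : P.coroot' s (P.rootSpanMem ℤ s : M) = 2 := by simp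
      rw [h2] at this
      exact (algebraMap ℤ ℂ).injective_int (this.trans (by simp))
    change (((t⁻¹ : ℂˣ) ^ (P.coroot'In ℤ s (P.rootSpanMem ℤ s)) : ℂˣ) : ℂ) * t = _
    rw [h4]
    have := t.ne_zero
    simp
    field_simp
  rw [h3] at h2
  have h5 : f (yG b s ((t⁻¹ : ℂˣ) : ℂ)⁻¹) = 1 := by
    have := hf.triangular (yG b s ((t⁻¹ : ℂˣ) : ℂ)⁻¹) (Subgroup.subset_closure ⟨_, _, rfl⟩) 1 1 (one_mem _)
    simpa [ev_one] using this
  have h6 : xG b s ((t⁻¹ : ℂˣ) : ℂ) * coroot s t⁻¹ =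
      (coroot s t⁻¹ : adjointGroup b) * xG b s t := by
    rw [Units.val_inv_eq_inv_val, ← h2]
    change torG b (corootHom s t⁻¹) * xG b s t * (torG b (corootHom s t⁻¹))⁻¹ * torG b (corootHom s t⁻¹) = _
    rw [inv_mul_cancel_right]
    rfl
  have hinv : coroot s t⁻¹ = (coroot s t)⁻¹ := by
    apply Subtype.ext
    change torG b (corootHom s t⁻¹) = (torG b (corootHom s t))⁻¹
    rw [← (torG b).map_inv]
    congr 1
    ext x
    simp [corootHom]
  rw [h1, hf.mul_unipPos (Subgroup.subset_closure ⟨_, _, rfl⟩), h6, mul_assoc, hf.cartan_mul, hinv,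
    ev_inv, inv_mul_eq_one₀ (ev_ne_zero _ _)] at h5
  exact h5

/-- The character along a simple coroot is a power of `t`. By `ev_coroot` it is also a polynomial in
`t`, so the exponent cannot be negative. -/
lemma isDominant (hf : IsSpherical μ f) : IsDominant μ := fun s => by
  obtain ⟨x, rfl⟩ := rootChar_surjective μ
  obtain ⟨q, hq⟩ := polyFun_comp_curve (hf.comp_mul_right (nBar b s)) (γ := fun t => xG b s t)
    (fun i j => exists_polynomial_exp (GeckConstruction.isNilpotent_e s) i j)
  have h1 : ∀ t : ℂˣ, ev (rootChar b x) (coroot s t) = (t : ℂ) ^ (P.coroot'In ℤ s x) := fun t => by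
    have := ev_rootChar_torG (b := b) x (corootHom s t)
    refine this.trans ?_
    change ((t ^ (P.coroot'In ℤ s x) : ℂˣ) : ℂ) = _
    rw [Units.val_zpow_eq_zpow_val]
  have h2 : ∀ t : ℂˣ, (t : ℂ) ^ (P.coroot'In ℤ s x) = q.eval (t : ℂ) := fun t => by
    rw [← h1, hf.ev_coroot, ← hq]
  obtain ⟨n, hn | hn⟩ := Int.eq_nat_or_neg (P.coroot'In ℤ s x)
  · exact ⟨n, fun t => by rw [h1, hn, zpow_natCast]⟩
  · by_cases hn0 : n = 0
    · exact ⟨0, fun t => by rw [h1, hn, hn0]; simp⟩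
    · exfalso
      -- A negative exponent `-n` would give `X ^ n * q = 1`, which fails at zero.
      have h3 : Polynomial.X ^ n * q - 1 = 0 := by
        refine eq_zero_of_polynomial (E := {0}) fun t ht => ?_
        have ht0 : t ≠ 0 := by simpa using ht
        have := h2 (Units.mk0 t ht0)
        rw [hn, zpow_neg, zpow_natCast, Units.val_mk0] at this
        simp only [Polynomial.eval_sub, Polynomial.eval_mul, Polynomial.eval_pow, Polynomial.eval_X,
          Polynomial.eval_one, ← this]
        field_simp
        simp
      have := congrArg (Polynomial.eval 0) h3
      simp [hn0] at this

end IsSpherical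

end Spherical

/-! ### Finite-dimensional spaces of translates -/

section FunctionModule

variable [P.IsRootSystem]

/-- Right translation of functions. -/
def rightTranslate (k : adjointGroup b) : (adjointGroup b → ℂ) →ₐ[ℂ] (adjointGroup b → ℂ) where
  toFun F x := F (x * k)
  map_one' := rfl
  map_mul' _ _ := rfl
  map_zero' := rfl
  map_add' _ _ := rfl
  commutes' _ := rfl

/-- Polynomial functions lie in finite-dimensional subspaces stable under right translations. -/
lemma exists_stable_of_mem_polyFun {F : adjointGroup b → ℂ} (hF : F ∈ polyFun b) :
    ∃ W : Submodule ℂ (adjointGroup b → ℂ), W.FG ∧ F ∈ W ∧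
      ∀ k, W.map (rightTranslate k).toLinearMap ≤ W := by
  induction hF using Algebra.adjoin_induction with
  | mem F hF =>
    obtain ⟨⟨i, j⟩, rfl⟩ := hF
    -- Right translation mixes the entries of one row among themselves.
    refine ⟨Submodule.span ℂ (Set.range fun j g => mat g i j), Submodule.fg_span (Set.finite_range _),
      Submodule.subset_span ⟨j, rfl⟩, fun k => ?_⟩
    rw [Submodule.map_span_le]
    rintro _ ⟨l, rfl⟩
    have : (rightTranslate k).toLinearMap (fun g => mat g i l) =
        ∑ m, mat k m l • fun g : adjointGroup b => mat g i m := by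
      ext g
      change mat (g * k) i l = _
      simp [Matrix.mul_apply, mul_comm]
    rw [this]
    exact sum_mem fun m _ => Submodule.smul_mem _ _ (Submodule.subset_span ⟨m, rfl⟩)
  | algebraMap r =>
    refine ⟨Submodule.span ℂ {1}, Submodule.fg_span_singleton 1,
      Submodule.mem_span_singleton.mpr ⟨r, by rw [Algebra.algebraMap_eq_smul_one]⟩, fun k => ?_⟩
    rw [Submodule.map_span_le]
    rintro _ rfl
    exact Submodule.mem_span_singleton_self _
  | add F F' _ _ h h' =>
    obtain ⟨W, hW, hF, hk⟩ := h
    obtain ⟨W', hW', hF', hk'⟩ := h'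
    refine ⟨W ⊔ W', hW.sup hW', add_mem (Submodule.mem_sup_left hF) (Submodule.mem_sup_right hF'),
      fun k => ?_⟩
    rw [Submodule.map_sup]
    exact sup_le_sup (hk k) (hk' k)
  | mul F F' _ _ h h' =>
    obtain ⟨W, hW, hF, hk⟩ := h
    obtain ⟨W', hW', hF', hk'⟩ := h'
    refine ⟨W * W', hW.mul hW', Submodule.mul_mem_mul hF hF', fun k => ?_⟩
    rw [Submodule.map_mul]
    exact mul_le_mul' (hk k) (hk' k)

lemma span_codRestrict_eq_top {E K : Type*} [AddCommGroup E] [Module ℂ E] (x : K → E) :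
    Submodule.span ℂ (Set.range fun k =>
      (⟨x k, Submodule.subset_span ⟨k, rfl⟩⟩ : Submodule.span ℂ (Set.range x))) = ⊤ := by
  have h := Submodule.span_span_coe_preimage (R := ℂ) (s := Set.range x)
  rw [← h]
  congr 1
  ext ⟨F, hF⟩
  simp [Subtype.ext_iff]

lemma span_range_equiv {E E' K : Type*} [AddCommGroup E] [Module ℂ E] [AddCommGroup E'] [Module ℂ E']
    (e : E ≃ₗ[ℂ] E') {x : K → E} (h : Submodule.span ℂ (Set.range x) = ⊤) :
    Submodule.span ℂ (Set.range fun k => e (x k)) = ⊤ := by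
  have h2 := congrArg (Submodule.map e.toLinearMap) h
  rw [Submodule.map_span, Submodule.map_top, LinearEquiv.range, ← Set.range_comp] at h2
  exact h2

/-- A representation on the span of the right translates of `f`: the vector `a k` corresponds to the
translate by `k`. -/
structure FunctionModel (f : adjointGroup b → ℂ) where
  n : ℕ
  ρ : Representation ℂ (adjointGroup b) (Fin n → ℂ)
  ψ : (Fin n → ℂ) →ₗ[ℂ] (adjointGroup b → ℂ)
  a : adjointGroup b → Fin n → ℂ
  injective : Function.Injective ψ
  ψ_ρ : ∀ g x y, ψ (ρ g x) y = ψ x (y * g)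
  ψ_a : ∀ k y, ψ (a k) y = f (y * k)
  span_eq : Submodule.span ℂ (Set.range a) = ⊤

lemma nonempty_functionModel {f : adjointGroup b → ℂ} (hf : f ∈ polyFun b) :
    Nonempty (FunctionModel f) := by
  obtain ⟨W, hW, hfW, hk⟩ := exists_stable_of_mem_polyFun hf
  set V : Submodule ℂ (adjointGroup b → ℂ) := Submodule.span ℂ (Set.range fun k => rightTranslate k f)
  have hVW : V ≤ W := Submodule.span_le.mpr (by
    rintro _ ⟨k, rfl⟩
    exact hk k (Submodule.mem_map_of_mem hfW))
  have : FiniteDimensional ℂ W := Module.Finite.iff_fg.mpr hW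
  have : FiniteDimensional ℂ V := Submodule.finiteDimensional_of_le hVW
  have hstab : ∀ g, ∀ F ∈ V, rightTranslate g F ∈ V := by
    intro g F hF
    have : V ≤ V.comap (rightTranslate g).toLinearMap := Submodule.span_le.mpr (by
      rintro _ ⟨k, rfl⟩
      refine Submodule.subset_span ⟨g * k, ?_⟩
      ext x
      exact congrArg f (mul_assoc _ _ _).symm)
    exact this hF
  let e : V ≃ₗ[ℂ] (Fin (Module.finrank ℂ V) → ℂ) := (Module.finBasis ℂ V).equivFun
  let R : adjointGroup b → Module.End ℂ V := fun g => (rightTranslate g).toLinearMap.restrict (hstab g)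
  let ρ : Representation ℂ (adjointGroup b) (Fin (Module.finrank ℂ V) → ℂ) :=
    { toFun g := e.conj (R g)
      map_one' := by
        have : R 1 = 1 := by
          ext F x
          exact congrArg F.1 (mul_one x)
        rw [this]
        exact e.conj_id
      map_mul' g h := by
        have : R (g * h) = R g * R h := by
          ext F x
          exact congrArg F.1 (mul_assoc x g h).symm
        rw [this]
        exact LinearEquiv.conj_comp e _ _ }
  refine ⟨⟨_, ρ, V.subtype ∘ₗ e.symm.toLinearMap,
    fun k => e ⟨rightTranslate k f, Submodule.subset_span ⟨k, rfl⟩⟩,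
    Subtype.val_injective.comp e.symm.injective, fun g x y => ?_, fun k y => ?_, ?_⟩⟩
  · change (e.symm (e (R g (e.symm x)))).1 y = _
    rw [e.symm_apply_apply]
    rfl
  · change (e.symm (e _)).1 y = _
    rw [e.symm_apply_apply]
    rfl
  · exact span_range_equiv e (span_codRestrict_eq_top fun k => rightTranslate k f)

end FunctionModule

/-! ### Irreducible representations from spherical functions -/

section HighestWeight

variable [P.IsRootSystem] {μ : CharLattice b} {f : adjointGroup b → ℂ}

namespace FunctionModel

variable (X : FunctionModel f)

lemma induction {p : (Fin X.n → ℂ) → Prop} (zero : p 0) (add : ∀ x y, p x → p y → p (x + y))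
    (smul : ∀ (r : ℂ) x, p x → p (r • x)) (a : ∀ k, p (X.a k)) (x : Fin X.n → ℂ) : p x := by
  have hx : x ∈ Submodule.span ℂ (Set.range X.a) := X.span_eq ▸ Submodule.mem_top
  induction hx using Submodule.span_induction with
  | mem x h =>
    obtain ⟨k, rfl⟩ := h
    exact a k
  | zero => exact zero
  | add x y _ _ hx hy => exact add x y hx hy
  | smul r x _ hx => exact smul r x hx

lemma ρ_a (g k : adjointGroup b) : X.ρ g (X.a k) = X.a (g * k) := by
  apply X.injective
  ext y
  rw [X.ψ_ρ, X.ψ_a, X.ψ_a, mul_assoc]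

lemma ψ_mem_polyFun (hf : IsSpherical μ f) (x : Fin X.n → ℂ) : X.ψ x ∈ polyFun b := by
  induction x using X.induction with
  | zero => rw [map_zero]; exact zero_mem _
  | add x y hx hy => rw [map_add]; exact add_mem hx hy
  | smul r x hx => rw [map_smul]; exact (polyFun b).smul_mem hx r
  | a k =>
    have : X.ψ (X.a k) = fun y => f (y * k) := funext fun y => X.ψ_a k y
    rw [this]
    exact hf.comp_mul_right k

lemma ψ_triangular (hf : IsSpherical μ f) (x : Fin X.n → ℂ) {v : adjointGroup b} (hv : v ∈ unipNeg b)
    (h : cartan b) (g : adjointGroup b) : X.ψ x (v * h * g) = ev μ h * X.ψ x g := by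
  induction x using X.induction with
  | zero => simp
  | add x y hx hy => simp only [map_add, Pi.add_apply, hx, hy, mul_add]
  | smul r x hx =>
    simp only [map_smul, Pi.smul_apply, smul_eq_mul, hx]
    ring
  | a k => rw [X.ψ_a, X.ψ_a, mul_assoc, mul_assoc, hf.unipNeg_mul hv, hf.cartan_mul]

/-- The linear functionals are combinations of evaluations. -/
lemma span_eval : Submodule.span ℂ (Set.range fun k => LinearMap.proj k ∘ₗ X.ψ) =
    (⊤ : Submodule ℂ (Module.Dual ℂ (Fin X.n → ℂ))) := by
  set W := Submodule.span ℂ (Set.range fun k => (LinearMap.proj k ∘ₗ X.ψ : Module.Dual ℂ (Fin X.n → ℂ)))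
  have h : W.dualCoannihilator = ⊥ := by
    rw [eq_bot_iff]
    intro x hx
    rw [Submodule.mem_dualCoannihilator] at hx
    rw [Submodule.mem_bot]
    apply X.injective
    rw [map_zero]
    ext k
    exact hx _ (Submodule.subset_span ⟨k, rfl⟩)
  rw [← Subspace.dualCoannihilator_dualAnnihilator_eq (W := W), h, Submodule.dualAnnihilator_bot]

/-- A coordinate is a combination of evaluations, and the evaluation of `ρ g x` at `k` is the value
of the polynomial function `ψ x` at `k g`. -/
lemma rational (hf : IsSpherical μ f) (x : Fin X.n → ℂ) (i : Fin X.n) :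
    IsRegular entries fun g => X.ρ g x i := by
  have hℓ : (LinearMap.proj i : Module.Dual ℂ (Fin X.n → ℂ)) ∈
      Submodule.span ℂ (Set.range fun k => LinearMap.proj k ∘ₗ X.ψ) := by
    rw [X.span_eval]
    exact Submodule.mem_top
  have key : ∀ ℓ ∈ Submodule.span ℂ (Set.range fun k =>
      (LinearMap.proj k ∘ₗ X.ψ : Module.Dual ℂ (Fin X.n → ℂ))),
      (fun g => ℓ (X.ρ g x)) ∈ polyFun b := by
    intro ℓ hℓ
    induction hℓ using Submodule.span_induction with
    | mem ℓ h =>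
      obtain ⟨k, rfl⟩ := h
      have : (fun g => (LinearMap.proj k ∘ₗ X.ψ : Module.Dual ℂ (Fin X.n → ℂ)) (X.ρ g x)) =
          fun g => X.ψ x (k * g) := funext fun g => X.ψ_ρ g x k
      rw [this]
      simpa only [mul_one] using polyFun_comp_mul (X.ψ_mem_polyFun hf x) k 1
    | zero => exact zero_mem (polyFun b)
    | add ℓ ℓ' _ _ h h' => exact add_mem h h'
    | smul r ℓ _ h => exact (polyFun b).smul_mem h r
  exact polyFun_isRegular (key _ hℓ)

/-- The combinations of evaluations at transposed elements. -/
def pairing : (adjointGroup b →₀ ℂ) →ₗ[ℂ] (Fin X.n → ℂ) →ₗ[ℂ] ℂ :=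
  Finsupp.linearCombination ℂ fun k => LinearMap.proj (transpose b k) ∘ₗ X.ψ

lemma pairing_apply (c : adjointGroup b →₀ ℂ) (x : Fin X.n → ℂ) :
    X.pairing c x = c.sum fun k r => r * X.ψ x (transpose b k) := by
  rw [pairing, Finsupp.linearCombination_apply, Finsupp.sum, Finsupp.sum, LinearMap.sum_apply]
  rfl

/-- The invariance of `f` under transposition exchanges the roles of the two arguments. On the
spanning vectors the pairing is thus a function of the combination `∑ c_k a_k` alone, which makes
the contravariant form well defined. -/
lemma pairing_a (hf : IsSpherical μ f) (c : adjointGroup b →₀ ℂ) (l : adjointGroup b) :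
    X.pairing c (X.a l) = X.ψ (Finsupp.linearCombination ℂ X.a c) (transpose b l) := by
  rw [pairing_apply, Finsupp.linearCombination_apply, Finsupp.sum, Finsupp.sum, map_sum, Finset.sum_apply]
  refine Finset.sum_congr rfl fun k _ => ?_
  rw [map_smul, Pi.smul_apply, smul_eq_mul, X.ψ_a, X.ψ_a, ← hf.transpose, transpose_mul,
    transpose_transpose]

/-- The contravariant form, `(a k, x) = ψ x (kᵀ)`. -/
lemma exists_form (hf : IsSpherical μ f) : ∃ B : LinearMap.BilinForm ℂ (Fin X.n → ℂ),
    ∀ k x, B (X.a k) x = X.ψ x (transpose b k) := by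
  have hsurj : LinearMap.range (Finsupp.linearCombination ℂ X.a) = ⊤ := by
    rw [Finsupp.range_linearCombination, X.span_eq]
  obtain ⟨σ, hσ⟩ := LinearMap.exists_rightInverse_of_surjective _ hsurj
  refine ⟨X.pairing ∘ₗ σ, fun k x => ?_⟩
  -- The form is defined through a chosen section `σ`; this shows that its values do not depend on
  -- how a vector is written as a combination of the `a k`.
  have h0 : ∀ c, Finsupp.linearCombination ℂ X.a c = 0 → X.pairing c = 0 := by
    intro c hc
    refine LinearMap.ext fun x => ?_
    induction x using X.induction with
    | zero => simp
    | add x y hx hy => rw [map_add, hx, hy]; simp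
    | smul r x hx => rw [map_smul, hx]; simp
    | a l => rw [X.pairing_a hf, hc]; simp
  have h1 := h0 (σ (X.a k) - Finsupp.single k 1) (by
    rw [map_sub, Finsupp.linearCombination_single, one_smul, sub_eq_zero]
    exact LinearMap.congr_fun hσ (X.a k))
  rw [map_sub, sub_eq_zero] at h1
  rw [LinearMap.comp_apply, h1, pairing, Finsupp.linearCombination_single, one_smul]
  rfl

end FunctionModel

/-- The cocharacter of `H` taking the value `t ^ ht x` at `x`. -/
def htHom (b : P.Base) (t : ℂˣ) : Multiplicative (P.rootSpan ℤ) →* ℂˣ where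
  toFun x := t ^ ht b x.toAdd
  map_one' := by simp
  map_mul' x y := by simp [zpow_add]

lemma mat_htHom_conj (t : ℂˣ) (u : adjointGroup b) (i j : b.support ⊕ ι) :
    mat (torG b (htHom b t) * u * (torG b (htHom b t))⁻¹) i j =
      (t : ℂ) ^ (wtHt b i - wtHt b j) * mat u i j := by
  rw [← (torG b).map_inv, map_mul, map_mul, mat_torG, mat_torG, Matrix.mul_diagonal, Matrix.diagonal_mul]
  have h1 : ((htHom b t (.ofAdd (wt b i)) : ℂˣ) : ℂ) = (t : ℂ) ^ wtHt b i := Units.val_zpow_eq_zpow_val t _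
  have h2 : (((htHom b t)⁻¹ (.ofAdd (wt b j)) : ℂˣ) : ℂ) = ((t : ℂ) ^ wtHt b j)⁻¹ := by
    rw [MonoidHom.inv_apply, Units.val_inv_eq_inv_val]
    exact congrArg _ (Units.val_zpow_eq_zpow_val t _)
  rw [h1, h2, zpow_sub₀ t.ne_zero]
  ring

open Classical in
/-- The contraction of `u ∈ U⁺` to the identity by a one-parameter subgroup of `H`. -/
def contraction (u : adjointGroup b) (t : ℂ) : adjointGroup b :=
  if h : t = 0 then 1 else torG b (htHom b (Units.mk0 t h)) * u * (torG b (htHom b (Units.mk0 t h)))⁻¹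

lemma contraction_zero (u : adjointGroup b) : contraction u 0 = 1 := dif_pos rfl

lemma contraction_polynomial {u : adjointGroup b} (hu : u ∈ unipPos b) (i j : b.support ⊕ ι) :
    ∃ q : Polynomial ℂ, ∀ t, mat (contraction u t) i j = q.eval t := by
  have huni := isUnitri_of_mem_unipPos hu
  by_cases hij : wtHt b i ≤ wtHt b j
  · refine ⟨.C ((1 : Matrix _ _ ℂ) i j), fun t => ?_⟩
    rw [Polynomial.eval_C]
    by_cases ht : t = 0
    · rw [ht, contraction_zero, map_one]
    · rw [contraction, dif_neg ht, mat_htHom_conj, huni i j hij]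
      by_cases h : i = j
      · simp [h]
      · simp [h]
  · push Not at hij
    obtain ⟨m, hm⟩ := Int.eq_ofNat_of_zero_le (sub_nonneg.mpr hij.le)
    have hm0 : m ≠ 0 := by omega
    refine ⟨.C (mat u i j) * .X ^ m, fun t => ?_⟩
    by_cases ht : t = 0
    · rw [ht, contraction_zero, map_one, Matrix.one_apply_ne (by rintro rfl; exact lt_irrefl _ hij)]
      simp [hm0]
    · rw [contraction, dif_neg ht, mat_htHom_conj, hm]
      rw [zpow_natCast, Units.val_mk0, Polynomial.eval_mul, Polynomial.eval_C,
        Polynomial.eval_pow, Polynomial.eval_X, mul_comm]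

namespace FunctionModel

variable (X : FunctionModel f)

lemma weight (hf : IsSpherical μ f) (h : cartan b) : X.ρ h (X.a 1) = ev μ h • X.a 1 := by
  apply X.injective
  ext y
  rw [X.ψ_ρ, map_smul, Pi.smul_apply, X.ψ_a, X.ψ_a, mul_one, mul_one, hf.mul_cartan, smul_eq_mul]

lemma unip (hf : IsSpherical μ f) {u : adjointGroup b} (hu : u ∈ unipPos b) : X.ρ u (X.a 1) = X.a 1 := by
  apply X.injective
  ext y
  rw [X.ψ_ρ, X.ψ_a, X.ψ_a, mul_one, mul_one, hf.mul_unipPos hu]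

open Filter Topology in
/-- A nonzero stable subspace contains the highest weight vector. -/
lemma a_one_mem (hf : IsSpherical μ f) (W : Submodule ℂ (Fin X.n → ℂ))
    (hW : ∀ g, ∀ x ∈ W, X.ρ g x ∈ W) {x : Fin X.n → ℂ} (hx : x ∈ W) (hx1 : X.ψ x 1 ≠ 0) :
    X.a 1 ∈ W := by
  -- Vectors are viewed as functions on `G₀`, which is faithful by density. There the topology is
  -- pointwise convergence, and images of finite-dimensional subspaces are closed.
  let r : (Fin X.n → ℂ) →ₗ[ℂ] (G₀ b → ℂ) := LinearMap.funLeft ℂ ℂ Subtype.val ∘ₗ X.ψ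
  have hr : ∀ y z, r y = r z → y = z := fun y z h => by
    apply X.injective
    exact isRegular_ext (polyFun_isRegular (X.ψ_mem_polyFun hf y))
      (polyFun_isRegular (X.ψ_mem_polyFun hf z)) fun g hg => congr_fun h ⟨g, hg⟩
  have hcl : IsClosed (W.map r : Set (G₀ b → ℂ)) := Submodule.closed_of_finiteDimensional _
  -- At `g = v h u`, a translate of `x` by the torus, divided by its character value, equals `h^μ`
  -- times the value of `ψ x` at the contraction of `u`. As `t` tends to 0 the contraction tends to
  -- 1, so the limit is a multiple of the highest weight vector.
  have hlim : Tendsto (fun t : ℂˣ => r ((ev μ (cartanEquiv b (htHom b t)⁻¹))⁻¹ •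
      X.ρ (cartanEquiv b (htHom b t)⁻¹) x)) (comap Units.val (𝓝 0)) (𝓝 (r (X.ψ x 1 • X.a 1))) := by
    rw [tendsto_pi_nhds]
    rintro ⟨g, ⟨v, h, u⟩, hg⟩
    obtain ⟨q, hq⟩ := polyFun_comp_curve (X.ψ_mem_polyFun hf x) (contraction_polynomial u.2)
    have h1 : ∀ t : ℂˣ, r ((ev μ (cartanEquiv b (htHom b t)⁻¹))⁻¹ •
        X.ρ (cartanEquiv b (htHom b t)⁻¹) x) ⟨g, ⟨v, h, u⟩, hg⟩ = ev μ h * q.eval (t : ℂ) := by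
      intro t
      set a : cartan b := cartanEquiv b (htHom b t)⁻¹ with ha
      have h2 : contraction (u : adjointGroup b) t = (a : adjointGroup b)⁻¹ * u * a := by
        have : (a : adjointGroup b) = (torG b (htHom b t))⁻¹ := (torG b).map_inv _
        rw [contraction, dif_neg t.ne_zero, Units.mk0_val, this, inv_inv]
      have h3 : g * a = v * ((h * a : cartan b) : adjointGroup b) * contraction (u : adjointGroup b) t := by
        have hg' : g = v * h * u := hg
        rw [h2, hg', Subgroup.coe_mul]
        group
      change X.ψ _ g = _
      rw [map_smul, Pi.smul_apply, X.ψ_ρ, h3, X.ψ_triangular hf _ v.2, hq, ev_mul, smul_eq_mul]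
      have := ev_ne_zero μ a
      field_simp
    have h4 : r (X.ψ x 1 • X.a 1) ⟨g, ⟨v, h, u⟩, hg⟩ = ev μ h * q.eval 0 := by
      change X.ψ _ g = _
      have hg' : g = v * h * u := hg
      rw [map_smul, Pi.smul_apply, X.ψ_a, mul_one, hg', hf.triangular v v.2 h u u.2, ← hq, contraction_zero,
        smul_eq_mul, mul_comm]
    rw [h4]
    simp only [h1]
    refine Tendsto.const_mul _ ?_
    exact (q.continuous.tendsto 0).comp tendsto_comap
  -- Zero is a limit of nonzero numbers, so the limit along units is not vacuous.
  have hne : (comap Units.val (𝓝 (0 : ℂ)) : Filter ℂˣ).NeBot := by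
    rw [comap_neBot_iff]
    intro s hs
    obtain ⟨z, hz, hz0⟩ := ((mem_nhdsWithin_of_mem_nhds hs : s ∈ 𝓝[≠] (0 : ℂ)) |> fun h =>
      (inter_mem h self_mem_nhdsWithin : s ∩ {0}ᶜ ∈ 𝓝[≠] (0 : ℂ)) |> nonempty_of_mem)
    exact ⟨Units.mk0 z hz0, hz⟩
  have hmem := hcl.mem_of_tendsto hlim (Eventually.of_forall fun t =>
    Submodule.mem_map_of_mem (W.smul_mem _ (hW _ _ hx)))
  obtain ⟨y, hy, hy'⟩ := hmem
  rw [hr _ _ hy'] at hy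
  exact (W.smul_mem_iff hx1).mp hy

/-- A nonzero vector of a stable subspace has a translate whose function is nonzero at 1. The
subspace then contains the highest weight vector by `a_one_mem`, and the translates of the latter
span. -/
lemma isIrreducible (hf : IsSpherical μ f) : X.ρ.IsIrreducible := by
  have h1 : X.a 1 ≠ 0 := fun h => by
    have := X.ψ_a 1 1
    rw [h, mul_one, hf.apply_one] at this
    simp at this
  refine { exists_pair_ne := ⟨⊥, ⊤, fun h => ?_⟩, eq_bot_or_eq_top := fun W => ?_ }
  · have h2 : X.a 1 ∈ (⊤ : Subrepresentation X.ρ) := trivial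
    rw [← h] at h2
    exact h1 h2
  · by_cases hW : W.toSubmodule = ⊥
    · exact Or.inl (Subrepresentation.toSubmodule_injective hW)
    · right
      apply Subrepresentation.toSubmodule_injective
      obtain ⟨x, hx, hx0⟩ := (Submodule.ne_bot_iff _).mp hW
      have h2 : X.ψ x ≠ 0 := fun h => hx0 (X.injective (by rw [h, map_zero]))
      obtain ⟨g, hg⟩ := Function.ne_iff.mp h2
      have h3 := X.a_one_mem hf W.toSubmodule (fun g x hx => W.apply_mem_toSubmodule g hx)
        (W.apply_mem_toSubmodule g hx) (by rwa [X.ψ_ρ, one_mul])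
      change W.toSubmodule = ⊤
      rw [eq_top_iff, ← X.span_eq, Submodule.span_le]
      rintro _ ⟨k, rfl⟩
      have := W.apply_mem_toSubmodule k h3
      rwa [X.ρ_a, mul_one] at this

end FunctionModel

/-- The irreducible representation attached to a spherical function. -/
lemma IsSpherical.nonempty_highestWeightModule (hf : IsSpherical μ f) :
    Nonempty (HighestWeightModule μ) := by
  obtain ⟨X⟩ := nonempty_functionModel hf.poly
  obtain ⟨B, hB⟩ := X.exists_form hf
  have hsymm : ∀ x y, B x y = B y x := by
    intro x y
    induction x using X.induction with
    | zero => simp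
    | add x x' hx hx' => simp [hx, hx']
    | smul r x hx => simp [hx]
    | a k =>
      induction y using X.induction with
      | zero => simp
      | add x x' hx hx' => simp [hx, hx']
      | smul r x hx => simp [hx]
      | a l =>
        rw [hB, hB, X.ψ_a, X.ψ_a, ← hf.transpose, AdjointPinned.transpose_mul, transpose_transpose]
  have hnd : ∀ x, (∀ y, B x y = 0) → x = 0 := fun x hx => by
    apply X.injective
    rw [map_zero]
    ext k
    have := hB (AdjointPinned.transpose b k) x
    rw [transpose_transpose, hsymm, hx] at this
    exact this.symm
  exact ⟨{
    n := X.n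
    ρ := X.ρ
    rational := X.rational hf
    irreducible := X.isIrreducible hf
    v := X.a 1
    weight := X.weight hf
    unip := fun u hu => X.unip hf hu
    form := B
    symm := ⟨fun x y => by simp [hsymm x y]⟩
    nondegenerate := by
      refine ⟨fun x hx => hnd x hx, fun x hx => hnd x fun y => by rw [hsymm]; exact hx y⟩
    form_self := by rw [hB, X.ψ_a, mul_one, hf.transpose, hf.apply_one]
    contravariant := fun g x y => by
      induction x using X.induction with
      | zero => simp
      | add x x' hx hx' => simp [hx, hx']
      | smul r x hx => simp [hx]
      | a k => rw [X.ρ_a, hB, hB, X.ψ_ρ, AdjointPinned.transpose_mul] }⟩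

end HighestWeight

/-! ### Generalised minors as characters of the torus part -/

section GeneralisedMinors

variable [P.IsRootSystem]

open Classical in
lemma isSpherical_principalMinor {J : b.support ⊕ ι → Prop} (hJ : IsUpperIndex b J) :
    IsSpherical (rootChar b (∑ i with J i, wt b i)) (principalMinor J) where
  poly := principalMinor_mem_polyFun J
  triangular v hv h u hu := by
    obtain ⟨χ, hχ⟩ := h.2
    rw [principalMinor_triangular hJ hv hu, ← hχ, principalMinor_torG, ← ev_rootChar_torG]
    congr 1
    exact Subtype.ext hχ

lemma wtHt_inr (s : b.support) : wtHt b (.inr s) = 1 := ht_simple s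

lemma sum_filter_eq_add {A B : Type*} [Fintype A] [DecidableEq A] [AddCommMonoid B] (g : A → B)
    {J J' : A → Prop} [DecidablePred J] [DecidablePred J'] {a : A} (h : ¬ J a)
    (h' : ∀ i, J' i ↔ i = a ∨ J i) : ∑ i with J' i, g i = g a + ∑ i with J i, g i := by
  have h3 : Finset.univ.filter J' = insert a (Finset.univ.filter J) := by
    ext i
    simp [h']
  rw [h3, Finset.sum_insert (by simp [h])]

open Classical in
-- The indices of height at least two form an upper set, and adjoining the single index of `s`, of
-- height one, keeps it upper. The weights of the two principal minors differ by the simple root of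
-- `s`.
lemma exists_isSpherical_simple (s : b.support) : ∃ (μ₁ μ₂ : CharLattice b) (f₁ f₂ : adjointGroup b → ℂ),
    IsSpherical μ₁ f₁ ∧ IsSpherical μ₂ f₂ ∧ -μ₁ + μ₂ = rootChar b (P.rootSpanMem ℤ s) := by
  obtain ⟨J, hJ⟩ : ∃ J : b.support ⊕ ι → Prop, ∀ i, J i ↔ 2 ≤ wtHt b i := ⟨_, fun _ => Iff.rfl⟩
  obtain ⟨J', hJ'⟩ : ∃ J' : b.support ⊕ ι → Prop, ∀ i, J' i ↔ i = .inr (s : ι) ∨ J i :=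
    ⟨_, fun _ => Iff.rfl⟩
  have h1 : IsUpperIndex b J := fun i j hi hij => (hJ j).mpr (((hJ i).mp hi).trans hij.le)
  have h2 : IsUpperIndex b J' := by
    intro i j hi hij
    rw [hJ'] at hi ⊢
    rcases hi with rfl | hi
    · rw [wtHt_inr] at hij
      exact Or.inr ((hJ j).mpr hij)
    · exact Or.inr (h1 i j hi hij)
  have h3 : ¬ J (.inr (s : ι)) := by rw [hJ, wtHt_inr]; norm_num
  have h4 := isSpherical_principalMinor h2
  rw [sum_filter_eq_add (wt b) h3 hJ', map_add] at h4
  exact ⟨_, _, _, _, isSpherical_principalMinor h1, h4, neg_add_eq_of_eq_add (add_comm _ _)⟩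

/-- Differences of weights of spherical functions form a subgroup, since products of spherical
functions are spherical. It contains the simple roots, and these generate the character lattice. -/
lemma exists_isSpherical_sub (ξ : CharLattice b) : ∃ (μ₁ μ₂ : CharLattice b) (f₁ f₂ : adjointGroup b → ℂ),
    IsSpherical μ₁ f₁ ∧ IsSpherical μ₂ f₂ ∧ -μ₁ + μ₂ = ξ := by
  let D : AddSubgroup (CharLattice b) :=
    { carrier := {ξ | ∃ (μ₁ μ₂ : CharLattice b) (f₁ f₂ : adjointGroup b → ℂ),
        IsSpherical μ₁ f₁ ∧ IsSpherical μ₂ f₂ ∧ -μ₁ + μ₂ = ξ}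
      zero_mem' := ⟨0, 0, 1, 1, .one, .one, by simp⟩
      add_mem' := by
        rintro _ _ ⟨μ₁, μ₂, f₁, f₂, h1, h2, rfl⟩ ⟨ν₁, ν₂, f₁', f₂', h1', h2', rfl⟩
        exact ⟨_, _, _, _, h1.mul h1', h2.mul h2', by abel⟩
      neg_mem' := by
        rintro _ ⟨μ₁, μ₂, f₁, f₂, h1, h2, rfl⟩
        exact ⟨_, _, _, _, h2, h1, by abel⟩ }
  obtain ⟨x, rfl⟩ := rootChar_surjective ξ
  have hs : ∀ s : b.support, b.toWeightBasisInt s = P.rootSpanMem ℤ s := fun s => by ext; simp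
  have : rootChar b x ∈ D := by
    rw [← b.toWeightBasisInt.sum_repr x, map_sum]
    refine sum_mem fun s _ => ?_
    rw [map_zsmul, hs]
    exact zsmul_mem (exists_isSpherical_simple s) _
  exact this

variable {w : List b.support}

/-- Applied to the highest weight vector, `u w̄₀ = v k n` loses `n` and turns `k` into a scalar.
Contravariance moves `v` to the other argument as an element of `U⁺`, which fixes the vector. -/
lemma HighestWeightModule.minor_eq {μ : CharLattice b} (V : HighestWeightModule μ)
    {u v k n : adjointGroup b} (h : CellData w u v k n) : V.minor w u = ev μ ⟨k, h.k_mem⟩ := by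
  have h1 : V.ρ u (V.ρ (wBar w) V.v) = V.ρ v (ev μ ⟨k, h.k_mem⟩ • V.v) := by
    have h2 := V.weight ⟨k, h.k_mem⟩
    rw [← h2, ← Module.End.mul_apply, ← map_mul, h.eq, map_mul, Module.End.mul_apply, V.unip n h.n_mem,
      map_mul, Module.End.mul_apply]
  have h3 : V.form V.v (V.ρ v V.v) = 1 := by
    have := V.contravariant (transpose b v) V.v V.v
    rw [transpose_transpose, V.unip _ (transpose_mem_unipPos h.v_mem)] at this
    rw [← this, V.form_self]
  rw [HighestWeightModule.minor, h1, map_smul, map_smul, h3, smul_eq_mul, mul_one]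

/-- Uniqueness is immediate from `minor_eq`: any quotient of minors is the character `ξ` of `[u
w̄₀]₀`. Existence needs the representations, which the spherical functions supply. -/
lemma isDelta_iff (hw : IsLongestWord w) (ξ : CharLattice b) (D : cellPos w → ℂ) :
    IsDelta w ξ D ↔ D = fun u : cellPos w => ev ξ (bracketZero ((u : adjointGroup b) * wBar w)) := by
  have key : ∀ (μ : CharLattice b) (V : HighestWeightModule μ) (u : cellPos w),
      V.minor w u = ev μ (bracketZero ((u : adjointGroup b) * wBar w)) := fun μ V u => by
    obtain ⟨v, k, n, h⟩ := exists_cellData hw u.2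
    rw [V.minor_eq h, h.bracketZero_eq]
  constructor
  · rintro ⟨μ₁, μ₂, -, -, rfl, V₁, V₂, h⟩
    ext u
    rw [(h u).2, key, key, ev_add, ev_neg]
  · rintro rfl
    obtain ⟨μ₁, μ₂, f₁, f₂, h1, h2, rfl⟩ := exists_isSpherical_sub ξ
    obtain ⟨V₁⟩ := h1.nonempty_highestWeightModule
    obtain ⟨V₂⟩ := h2.nonempty_highestWeightModule
    refine ⟨μ₁, μ₂, h1.isDominant, h2.isDominant, rfl, V₁, V₂, fun u => ⟨?_, ?_⟩⟩
    · rw [key]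
      exact ev_ne_zero _ _
    · rw [key, key, ← ev_neg, ← ev_add]

lemma delta_eq (hw : IsLongestWord w) (ξ : CharLattice b) :
    Delta w ξ = fun u : cellPos w => ev ξ (bracketZero ((u : adjointGroup b) * wBar w)) := by
  rw [← isDelta_iff hw]
  exact Classical.epsilon_spec (p := IsDelta w ξ) ⟨_, (isDelta_iff hw ξ _).mpr rfl⟩

lemma existsUnique_isDelta (hw : IsLongestWord w) (ξ : CharLattice b) : ∃! D, IsDelta w ξ D := by
  simp only [isDelta_iff hw]
  exact existsUnique_eq

lemma delta_mem_coordCell (hw : IsLongestWord w) (ξ : CharLattice b) : Delta w ξ ∈ coordCell w := by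
  rw [delta_eq hw]
  exact (isRegular_ev ξ).comp (fun u : cellPos w => bracketZero ((u : adjointGroup b) * wBar w))
    fun i => regMap_bracketZero hw i.1 i.2

lemma ev_charStar (μ : CharLattice b) (h : cartan b) :
    ev (charStar w μ) h = ev μ (starH w h) := rfl

end GeneralisedMinors

/-! ### Regular functions on a product with a torus -/

section TorusFactors

open Polynomial

/-- One of the quotients is reduced to lowest terms `p' / q'`. All the other quotients agree with
it, and together their denominators have no common zero on `ℂˣ`, so `q'` has no zero there and is a
monomial. The degree bound depends only on `D`. -/
lemma exists_polynomial_mul_pow_eq {γ : ℂˣ → ℂ} {T : Set (ℂ[X] × ℂ[X])} {D : ℕ}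
    (hD : ∀ t ∈ T, t.1.natDegree ≤ D ∧ t.2.natDegree ≤ D)
    (hT : ∀ t ∈ T, ∀ z : ℂˣ, γ z * t.2.eval (z : ℂ) = t.1.eval (z : ℂ))
    (h : ∀ z : ℂˣ, ∃ t ∈ T, t.2.eval (z : ℂ) ≠ 0) :
    ∃ r : ℂ[X], r.natDegree ≤ 2 * D ∧ ∀ z : ℂˣ, γ z * (z : ℂ) ^ D = r.eval (z : ℂ) := by
  obtain ⟨⟨p, q⟩, hpq, hq1⟩ := h 1
  have hq : q ≠ 0 := by rintro rfl; simp at hq1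
  obtain ⟨p', hp'⟩ := EuclideanDomain.gcd_dvd_left p q
  obtain ⟨q', hq'⟩ := EuclideanDomain.gcd_dvd_right p q
  set d := EuclideanDomain.gcd p q with hd
  have hd0 : d ≠ 0 := by rintro h0; rw [h0, zero_mul] at hq'; exact hq hq'
  have hcop : IsCoprime p' q' := by
    refine ⟨EuclideanDomain.gcdA p q, EuclideanDomain.gcdB p q, mul_left_cancel₀ hd0 ?_⟩
    have := EuclideanDomain.gcd_eq_gcd_ab p q
    rw [← hd] at this
    linear_combination (-EuclideanDomain.gcdA p q) * hp' - EuclideanDomain.gcdB p q * hq' - this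
  have hq'0 : q' ≠ 0 := by rintro rfl; rw [mul_zero] at hq'; exact hq hq'
  have hcross : ∀ t ∈ T, p' * t.2 = t.1 * q' := fun t ht => by
    refine mul_left_cancel₀ hd0 (sub_eq_zero.mp (eq_zero_of_polynomial (E := {0}) fun z hz => ?_))
    lift z to ℂˣ using isUnit_iff_ne_zero.mpr (by simpa using hz)
    have h1 := hT t ht z
    have h2 := hT _ hpq z
    rw [hp', hq'] at h2
    simp only [eval_mul, eval_sub] at h2 ⊢
    linear_combination (-t.2.eval (z : ℂ)) * h2 + d.eval (z : ℂ) * q'.eval (z : ℂ) * h1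
  -- At a zero of `q'` some other denominator is nonzero. Cross-multiplication would make `p'`
  -- vanish too, against coprimality.
  have hroot : ∀ z : ℂˣ, q'.eval (z : ℂ) ≠ 0 := fun z hz => by
    obtain ⟨t, ht, htz⟩ := h z
    have h1 := congr_arg (eval (z : ℂ)) (hcross t ht)
    rw [eval_mul, eval_mul, hz, mul_zero, mul_eq_zero, or_iff_left htz] at h1
    obtain ⟨a, c, hac⟩ := hcop
    have := congr_arg (eval (z : ℂ)) hac
    simp [h1, hz] at this
  have hγ : ∀ z : ℂˣ, γ z * q'.eval (z : ℂ) = p'.eval (z : ℂ) := fun z => by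
    obtain ⟨t, ht, htz⟩ := h z
    have h1 := congr_arg (eval (z : ℂ)) (hcross t ht)
    rw [eval_mul, eval_mul] at h1
    refine mul_right_cancel₀ htz ?_
    linear_combination q'.eval (z : ℂ) * hT t ht z - h1
  obtain ⟨r, hr, hr0⟩ := exists_eq_pow_rootMultiplicity_mul_and_not_dvd q' hq'0 0
  set m := q'.rootMultiplicity 0
  rw [C_0, sub_zero] at hr hr0
  have hrdeg : r.degree = 0 := by
    by_contra hdeg
    obtain ⟨z, hz⟩ := IsAlgClosed.exists_root r hdeg
    by_cases hz0 : z = 0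
    · subst hz0
      exact hr0 (X_dvd_iff.mpr (by rwa [coeff_zero_eq_eval_zero]))
    · refine hroot (Units.mk0 z hz0) ?_
      rw [hr, eval_mul, Units.val_mk0, hz.eq_zero, mul_zero]
  obtain ⟨a, ha⟩ : ∃ a, r = C a := ⟨_, eq_C_of_degree_eq_zero hrdeg⟩
  have ha0 : a ≠ 0 := by rintro rfl; simp [ha] at hrdeg
  have hle : ∀ {f g : ℂ[X]}, f = d * g → f.natDegree ≤ D → g ≠ 0 → g.natDegree ≤ D := fun hf hle hg => by
    rw [hf, natDegree_mul hd0 hg] at hle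
    omega
  have hmD : m ≤ D := by
    have := hle hq' (hD _ hpq).2 hq'0
    rw [hr, ha, mul_comm, natDegree_C_mul_X_pow _ _ ha0] at this
    exact this
  have hpD : p'.natDegree ≤ D := by
    by_cases hp0 : p' = 0
    · simp [hp0]
    · exact hle hp' (hD _ hpq).1 hp0
  refine ⟨C a⁻¹ * p' * X ^ (D - m), ?_, fun z => ?_⟩
  · refine natDegree_mul_le.trans ?_
    have := natDegree_C_mul_le a⁻¹ p'
    rw [natDegree_X_pow]
    omega
  · have h1 := hγ z
    rw [hr, ha] at h1
    simp only [eval_mul, eval_pow, eval_X, eval_C] at h1 ⊢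
    rw [← h1]
    have : (z : ℂ) ^ D = z ^ m * z ^ (D - m) := by rw [← pow_add, Nat.add_sub_cancel' hmD]
    rw [this]
    field_simp

variable {Y σ : Type*} {c : Y → σ → ℂ}

/-- The denominators of a function which is regular with respect to the coordinates `c`. -/
def denominators (c : Y → σ → ℂ) (f : Y → ℂ) : Ideal (MvPolynomial σ ℂ) where
  carrier := {q | ∃ p, ∀ y, f y * MvPolynomial.eval (c y) q = MvPolynomial.eval (c y) p}
  zero_mem' := ⟨0, by simp⟩
  add_mem' := by
    rintro q q' ⟨p, hp⟩ ⟨p', hp'⟩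
    exact ⟨p + p', fun y => by rw [map_add, map_add, mul_add, hp, hp']⟩
  smul_mem' := by
    rintro r q ⟨p, hp⟩
    refine ⟨r * p, fun y => ?_⟩
    rw [smul_eq_mul, map_mul, map_mul, ← hp]
    ring

/-- The denominators form an ideal, finitely generated by Hilbert's basis theorem. A common zero of
the generators would be a zero of every denominator, including the one supplied by regularity at
that point. -/
lemma IsRegular.exists_finset_denominators [Finite σ] {f : Y → ℂ} (hf : IsRegular c f) :
    ∃ T : Finset (MvPolynomial σ ℂ × MvPolynomial σ ℂ),
      (∀ t ∈ T, ∀ y, f y * MvPolynomial.eval (c y) t.2 = MvPolynomial.eval (c y) t.1) ∧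
      ∀ y, ∃ t ∈ T, MvPolynomial.eval (c y) t.2 ≠ 0 := by
  classical
  obtain ⟨S, hS⟩ := (isNoetherian_def.mp (inferInstanceAs (IsNoetherianRing (MvPolynomial σ ℂ))))
    (denominators c f)
  have hmem : ∀ q : S, ∃ p, ∀ y, f y * MvPolynomial.eval (c y) q.1 = MvPolynomial.eval (c y) p := fun q =>
    (hS ▸ Submodule.subset_span q.2 : q.1 ∈ denominators c f)
  choose p hp using hmem
  refine ⟨Finset.univ.image fun q : S => (p q, q.1), fun t ht => ?_, fun y => ?_⟩
  · obtain ⟨q, -, rfl⟩ := Finset.mem_image.mp ht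
    exact hp q
  · by_contra! hy
    obtain ⟨p₀, q₀, hq₀, hpq⟩ := hf y
    -- The square is taken because `f q₀ = p₀` may fail where `q₀` vanishes, whereas `f q₀² = p₀ q₀`
    -- holds everywhere.
    have h1 : q₀ * q₀ ∈ denominators c f := by
      refine ⟨p₀ * q₀, fun z => ?_⟩
      rw [map_mul, map_mul]
      by_cases hz : MvPolynomial.eval (c z) q₀ = 0
      · simp [hz]
      · rw [hpq z hz]
        field_simp
    have h2 : denominators c f ≤ RingHom.ker (MvPolynomial.eval (c y)) := by
      rw [← hS]
      refine Submodule.span_le.mpr fun q hq => ?_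
      exact hy (p ⟨q, hq⟩, q) (Finset.mem_image.mpr ⟨⟨q, hq⟩, Finset.mem_univ _, rfl⟩)
    have h3 := h2 h1
    rw [RingHom.mem_ker, map_mul] at h3
    exact hq₀ (mul_self_eq_zero.mp h3)

/-- The coordinates on `ℂˣ × Y`. -/
def unitsCoord (c : Y → σ → ℂ) (p : ℂˣ × Y) (o : Option σ) : ℂ := o.elim (p.1 : ℂ) (c p.2)

lemma eval_unitsCoord (p : ℂˣ × Y) (q : MvPolynomial (Option σ) ℂ) :
    MvPolynomial.eval (unitsCoord c p) q =
      (MvPolynomial.aeval (fun o : Option σ => o.elim (X : ℂ[X]) fun i => C (c p.2 i)) q).eval (p.1 : ℂ) := by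
  induction q using MvPolynomial.induction_on with
  | C a => simp
  | add q q' h h' => simp [h, h']
  | mul_X q i h =>
    rw [map_mul, map_mul, eval_mul, h, MvPolynomial.eval_X, MvPolynomial.aeval_X]
    cases i <;> simp [unitsCoord]

/-- A regular function on `ℂˣ × Y` is determined by its restrictions to finitely many points of `ℂˣ`,
by interpolation with Laurent polynomials. -/
lemma IsRegular.exists_interpolation [Finite σ] {g : ℂˣ × Y → ℂ} (hg : IsRegular (unitsCoord c) g) :
    ∃ (s : Finset ℂˣ) (l : ℂˣ → ℂˣ → ℂ),
      (∀ a, l a ∈ Submodule.span ℂ (Set.range fun (k : ℤ) (z : ℂˣ) => ((z ^ k : ℂˣ) : ℂ))) ∧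
      ∀ z y, g (z, y) = ∑ a ∈ s, l a z * g (a, y) := by
  classical
  obtain ⟨T, hT, hT'⟩ := hg.exists_finset_denominators
  let D := T.sup fun t => max t.1.totalDegree t.2.totalDegree
  let φ : Y → MvPolynomial (Option σ) ℂ → ℂ[X] := fun y =>
    MvPolynomial.aeval (fun o : Option σ => o.elim (X : ℂ[X]) fun i => C (c y i))
  have hφ : ∀ y q, (φ y q).natDegree ≤ q.totalDegree := fun y q => by
    refine (MvPolynomial.aeval_natDegree_le q le_rfl _ (n := 1) fun o => ?_).trans (by rw [mul_one])
    cases o <;> simp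
  have key : ∀ y, ∃ r : ℂ[X], r.natDegree ≤ 2 * D ∧ ∀ z : ℂˣ, g (z, y) * (z : ℂ) ^ D = r.eval (z : ℂ) := by
    intro y
    refine exists_polynomial_mul_pow_eq (T := (fun t : MvPolynomial (Option σ) ℂ × MvPolynomial (Option σ) ℂ => (φ y t.1, φ y t.2)) ''
      (T : Set (MvPolynomial (Option σ) ℂ × MvPolynomial (Option σ) ℂ))) ?_ ?_ fun z => ?_
    · rintro _ ⟨t, ht, rfl⟩
      have := Finset.le_sup (f := fun t : MvPolynomial (Option σ) ℂ × MvPolynomial (Option σ) ℂ =>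
        max t.1.totalDegree t.2.totalDegree) ht
      exact ⟨(hφ y _).trans ((le_max_left _ _).trans this), (hφ y _).trans ((le_max_right _ _).trans this)⟩
    · rintro _ ⟨t, ht, rfl⟩ z
      have := hT t ht (z, y)
      rwa [eval_unitsCoord, eval_unitsCoord] at this
    · obtain ⟨t, ht, htz⟩ := hT' (z, y)
      rw [eval_unitsCoord] at htz
      exact ⟨_, ⟨t, ht, rfl⟩, htz⟩
  choose r hr hrz using key
  have : Infinite ℂˣ := Set.infinite_coe_iff.mpr (Set.infinite_univ (α := ℂ) |>.sdiff (Set.finite_singleton 0)) |>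
    fun (h : Infinite ↥((Set.univ : Set ℂ) \ {0})) =>
      Infinite.of_injective (fun z : ↥((Set.univ : Set ℂ) \ {0}) => Units.mk0 z.1 z.2.2) fun z z' hzz =>
        Subtype.ext (congr_arg Units.val hzz)
  -- The polynomials `z ^ D g(z, y)` have degree at most `2 D` for all `y`, so the same `2 D + 1`
  -- nodes serve for Lagrange interpolation throughout.
  obtain ⟨s, hs⟩ := Infinite.exists_subset_card_eq ℂˣ (2 * D + 1)
  refine ⟨s, fun a z => (((z ^ (-(D : ℤ)) : ℂˣ)) : ℂ) *
    ((a : ℂ) ^ D * (Lagrange.basis s (fun a : ℂˣ => (a : ℂ)) a).eval (z : ℂ)), fun a => ?_, fun z y => ?_⟩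
  · beta_reduce
    generalize Lagrange.basis s (fun a : ℂˣ => (a : ℂ)) a = B
    have h0 : (fun z : ℂˣ => (((z ^ (-(D : ℤ)) : ℂˣ)) : ℂ) * ((a : ℂ) ^ D * B.eval (z : ℂ))) =
        ∑ i ∈ Finset.range (B.natDegree + 1), ((a : ℂ) ^ D * B.coeff i) •
          fun z : ℂˣ => ((z ^ (-(D : ℤ) + i) : ℂˣ) : ℂ) := by
      ext z
      rw [eval_eq_sum_range, Finset.sum_apply, Finset.mul_sum, Finset.mul_sum]
      refine Finset.sum_congr rfl fun i _ => ?_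
      rw [Pi.smul_apply, zpow_add, Units.val_mul, smul_eq_mul, zpow_natCast z i, Units.val_pow_eq_pow_val]
      ring
    change (fun z : ℂˣ => (((z ^ (-(D : ℤ)) : ℂˣ)) : ℂ) * ((a : ℂ) ^ D * B.eval (z : ℂ))) ∈ _
    rw [h0]
    exact Submodule.sum_mem _ fun i _ => Submodule.smul_mem _ _ (Submodule.subset_span ⟨_, rfl⟩)
  · have h1 := Lagrange.eq_interpolate (s := s) (v := fun a : ℂˣ => (a : ℂ)) (f := r y)
      (fun a _ a' _ h => Units.ext h)
      (lt_of_le_of_lt (degree_le_of_natDegree_le (hr y)) (by rw [hs]; exact_mod_cast Nat.lt_succ_self _))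
    have h2 := hrz y z
    rw [h1, Lagrange.interpolate_apply, eval_finsetSum] at h2
    have h3 : g (z, y) = (((z ^ (-(D : ℤ)) : ℂˣ)) : ℂ) * (g (z, y) * (z : ℂ) ^ D) := by
      rw [zpow_neg, zpow_natCast, mul_left_comm, ← Units.val_pow_eq_pow_val, Units.inv_mul, mul_one]
    rw [h3, h2, Finset.mul_sum]
    refine Finset.sum_congr rfl fun a _ => ?_
    rw [eval_mul, eval_C, ← hrz y a]
    ring

/-- The coordinates on `(ℂˣ)^A × Y`. -/
def torusCoord {A : Type*} (c : Y → σ → ℂ) (p : (A → ℂˣ) × Y) : A ⊕ σ → ℂ :=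
  Sum.elim (fun a => (p.1 a : ℂ)) (c p.2)

/-- The products of a Laurent monomial and a regular function. -/
def torusMonomials (A : Type*) [Fintype A] (c : Y → σ → ℂ) : Set ((A → ℂˣ) × Y → ℂ) :=
  {f | ∃ k : A → ℤ, ∃ F, IsRegular c F ∧
    f = fun p : (A → ℂˣ) × Y => ((∏ a, p.1 a ^ k a : ℂˣ) : ℂ) * F p.2}

lemma zpow_mul_mem_span_torusMonomials {A : Type*} [Fintype A] (i : A) (k : ℤ)
    {f : (A → ℂˣ) × Y → ℂ} (hf : f ∈ Submodule.span ℂ (torusMonomials A c)) :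
    (fun p => ((p.1 i ^ k : ℂˣ) : ℂ) * f p) ∈ Submodule.span ℂ (torusMonomials A c) := by
  classical
  induction hf using Submodule.span_induction with
  | mem f hf =>
    obtain ⟨l, F, hF, rfl⟩ := hf
    refine Submodule.subset_span ⟨l + Pi.single i k, F, hF, funext fun p => ?_⟩
    have : (∏ a, p.1 a ^ (l + Pi.single i k : A → ℤ) a) = p.1 i ^ k * ∏ a, p.1 a ^ l a := by
      simp only [Pi.add_apply, zpow_add, Finset.prod_mul_distrib]
      rw [mul_comm, Finset.prod_eq_single i (fun a _ ha => by rw [Pi.single_eq_of_ne ha, zpow_zero])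
        (fun h => absurd (Finset.mem_univ _) h), Pi.single_eq_same]
    rw [this, Units.val_mul, mul_assoc]
  | zero =>
    simp only [Pi.zero_apply, mul_zero]
    exact Submodule.zero_mem _
  | add f g _ _ h h' =>
    simp only [Pi.add_apply, mul_add]
    exact add_mem h h'
  | smul r f _ h =>
    simp only [Pi.smul_apply, smul_eq_mul, mul_left_comm _ r]
    exact Submodule.smul_mem _ r h

lemma isRegular_torusCoord_update {A : Type*} [DecidableEq A] (i : A) (j : A ⊕ σ) :
    IsRegular (unitsCoord (torusCoord (A := A) c)) fun p : ℂˣ × (A → ℂˣ) × Y =>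
      torusCoord c (Function.update p.2.1 i p.1, p.2.2) j := by
  by_cases hj : j = .inl i
  · have := IsRegular.eval_comp (unitsCoord (torusCoord (A := A) c)) (MvPolynomial.X none)
    simp only [MvPolynomial.eval_X] at this
    convert this using 2 with p
    subst hj
    simp [torusCoord, unitsCoord]
  · have := IsRegular.eval_comp (unitsCoord (torusCoord (A := A) c)) (MvPolynomial.X (some j))
    simp only [MvPolynomial.eval_X] at this
    convert this using 2 with p
    cases j with
    | inl a => simp [torusCoord, unitsCoord, Function.update_of_ne fun h : a = i => hj (h ▸ rfl)]
    | inr a => simp [torusCoord, unitsCoord]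

lemma isRegular_torusCoord_update_const {A : Type*} [DecidableEq A] (i : A) (a : ℂˣ) (j : A ⊕ σ) :
    IsRegular (torusCoord (A := A) c) fun p : (A → ℂˣ) × Y =>
      torusCoord c (Function.update p.1 i a, p.2) j := by
  refine (isRegular_torusCoord_update i j).comp (fun p => (a, p)) fun o => ?_
  cases o with
  | none =>
    have := IsRegular.eval_comp (torusCoord (A := A) c) (MvPolynomial.C (a : ℂ))
    simp only [MvPolynomial.eval_C] at this
    exact this
  | some j =>
    have := IsRegular.eval_comp (torusCoord (A := A) c) (MvPolynomial.X j)
    simp only [MvPolynomial.eval_X] at this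
    exact this

/-- A regular function on `(ℂˣ)^A × Y` is a combination of products of Laurent monomials and regular
functions. -/
lemma IsRegular.mem_span_torusMonomials {A : Type*} [Fintype A] [Finite σ] {g : (A → ℂˣ) × Y → ℂ}
    (hg : IsRegular (torusCoord c) g) : g ∈ Submodule.span ℂ (torusMonomials A c) := by
  classical
  -- The induction is on the set of torus coordinates on which the function depends.
  suffices H : ∀ (T : Finset A) (g : (A → ℂˣ) × Y → ℂ), IsRegular (torusCoord c) g →
      (∀ x x' y, (∀ i ∈ T, x i = x' i) → g (x, y) = g (x', y)) →
      g ∈ Submodule.span ℂ (torusMonomials A c) from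
    H Finset.univ g hg fun x x' y h => by rw [funext fun i => h i (Finset.mem_univ i)]
  clear hg g
  intro T
  induction T using Finset.induction_on with
  | empty =>
    intro g hg h
    refine Submodule.subset_span ⟨0, fun y => g (1, y), hg.comp (fun y => (1, y)) fun j => ?_, ?_⟩
    · cases j with
      | inl a => simpa [torusCoord] using IsRegular.eval_comp c (MvPolynomial.C 1)
      | inr i => simpa [torusCoord] using IsRegular.eval_comp c (MvPolynomial.X i)
    · ext ⟨x, y⟩
      simp [h x 1 y (by simp)]
  | insert i T hi ih =>
    intro g hg h
    obtain ⟨s, l, hl, hs⟩ := (hg.comp (fun p : ℂˣ × (A → ℂˣ) × Y => (Function.update p.2.1 i p.1, p.2.2))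
      (isRegular_torusCoord_update i)).exists_interpolation
    -- Interpolation in the coordinate `i` separates it off: the remaining factors are restrictions
    -- to fixed values of that coordinate and no longer depend on it.
    have h1 : g = ∑ a ∈ s, fun p : (A → ℂˣ) × Y => l a (p.1 i) * g (Function.update p.1 i a, p.2) := by
      ext p
      have := hs (p.1 i) p
      simpa using this
    rw [h1]
    refine Submodule.sum_mem _ fun a _ => ?_
    have h2 : (fun p : (A → ℂˣ) × Y => g (Function.update p.1 i a, p.2)) ∈
        Submodule.span ℂ (torusMonomials A c) := by
      refine ih _ (hg.comp (fun p : (A → ℂˣ) × Y => (Function.update p.1 i a, p.2))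
        (isRegular_torusCoord_update_const i a)) fun x x' y hx => h _ _ _ fun j hj => ?_
      obtain rfl | hj := Finset.mem_insert.mp hj
      · simp
      · have : j ≠ i := fun e => hi (e ▸ hj)
        simp [Function.update_of_ne this, hx j hj]
    have h3 := hl a
    generalize l a = L at h3
    induction h3 using Submodule.span_induction with
    | mem L hL =>
      obtain ⟨k, rfl⟩ := hL
      exact zpow_mul_mem_span_torusMonomials i k h2
    | zero =>
      simp only [Pi.zero_apply, zero_mul]
      exact Submodule.zero_mem _
    | add f g _ _ h h' =>
      simp only [Pi.add_apply, add_mul]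
      exact add_mem h h'
    | smul r f _ h =>
      simp only [Pi.smul_apply, smul_eq_mul, mul_assoc]
      exact Submodule.smul_mem _ r h

end TorusFactors

/-! ### The coordinate ring of the configuration space -/

section ConfigurationCoordinates

variable [P.IsRootSystem] {w : List b.support}

lemma IsRegular.units_zpow {Y σ : Type*} {c : Y → σ → ℂ} {z : Y → ℂˣ} (hz : IsRegular c fun y => (z y : ℂ))
    (k : ℤ) : IsRegular c fun y => ((z y ^ k : ℂˣ) : ℂ) := by
  have h1 : ∀ n : ℕ, IsRegular c fun y => ((z y ^ n : ℂˣ) : ℂ) := fun n => by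
    have : (fun y => ((z y ^ n : ℂˣ) : ℂ)) = (fun y => (z y : ℂ)) ^ n := by
      ext y
      simp
    rw [this]
    exact (regularFunctions c).pow_mem hz n
  obtain ⟨n, rfl | rfl⟩ := k.eq_nat_or_neg
  · simpa only [zpow_natCast] using h1 n
  · have : (fun y => ((z y ^ (-(n : ℤ)) : ℂˣ) : ℂ)) = 1 / fun y => ((z y ^ n : ℂˣ) : ℂ) := by
      ext y
      simp
    rw [this]
    exact IsRegular.div (regularFunctions c).one_mem (h1 n) fun y => Units.ne_zero _

lemma regMap_cochar {Y σ : Type*} {c : Y → σ → ℂ} {z : Y → b.support → ℂˣ}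
    (hz : ∀ s, IsRegular c fun y => (z y s : ℂ)) :
    RegMap c fun y => (cartanEquiv b (cochar (b := b) (z y)) : adjointGroup b) := fun i j => by
  simp only [cartanEquiv_coe, mat_torG]
  by_cases hij : i = j
  · subst hij
    simp only [Matrix.diagonal_apply_eq]
    have : (fun y => ((cochar (b := b) (z y) (.ofAdd (wt b i)) : ℂˣ) : ℂ)) =
        ∏ s, fun y => ((z y s ^ b.toWeightBasisInt.repr (wt b i) s : ℂˣ) : ℂ) := by
      ext y
      rw [Finset.prod_apply, ← Units.coe_prod]
      rfl
    rw [this]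
    exact (regularFunctions c).prod_mem fun s _ => IsRegular.units_zpow (hz s) _
  · simp only [Matrix.diagonal_apply_ne _ hij]
    exact (regularFunctions c).zero_mem

/-- The coordinates on `H × H × U⁺_*`. -/
abbrev entriesHHU (x : HHU w) : Fin 3 × (b.support ⊕ ι) × (b.support ⊕ ι) → ℂ :=
  entriesPi ![(x.1 : adjointGroup b), (x.2.1 : adjointGroup b), (x.2.2 : adjointGroup b)]

lemma regMap_apply {Y : Type*} {k : ℕ} (g : Y → Fin k → adjointGroup b) (i : Fin k) :
    RegMap (fun y => entriesPi (g y)) fun y => g y i := fun j l => by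
  have := IsRegular.eval_comp (fun y => entriesPi (g y)) (MvPolynomial.X (i, j, l))
  simp only [MvPolynomial.eval_X] at this
  exact this

lemma regMap_fst : RegMap (entriesHHU (w := w)) fun x => (x.1 : adjointGroup b) :=
  regMap_apply (fun x : HHU w => ![(x.1 : adjointGroup b), (x.2.1 : adjointGroup b), (x.2.2 : adjointGroup b)]) 0

lemma regMap_snd : RegMap (entriesHHU (w := w)) fun x => (x.2.1 : adjointGroup b) :=
  regMap_apply (fun x : HHU w => ![(x.1 : adjointGroup b), (x.2.1 : adjointGroup b), (x.2.2 : adjointGroup b)]) 1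

lemma regMap_thd : RegMap (entriesHHU (w := w)) fun x => (x.2.2 : adjointGroup b) :=
  regMap_apply (fun x : HHU w => ![(x.1 : adjointGroup b), (x.2.1 : adjointGroup b), (x.2.2 : adjointGroup b)]) 2

lemma tensor_mem_coordHHU (μ ν : CharLattice b) {F : cellPos w → ℂ} (hF : F ∈ coordCell w) :
    tensor w μ ν F ∈ coordHHU w := by
  have h1 := (isRegular_ev μ).comp (fun x : HHU w => x.1) fun i => regMap_fst i.1 i.2
  have h2 := (isRegular_ev ν).comp (fun x : HHU w => x.2.1) fun i => regMap_snd i.1 i.2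
  have h3 := IsRegular.comp (show IsRegular _ F from hF) (fun x : HHU w => x.2.2)
    fun i => regMap_thd i.1 i.2
  exact (h1.mul h2).mul h3

lemma ev_sum_zsmul (k : b.support → ℤ) (h : cartan b) :
    ev (rootChar b (∑ s : b.support, k s • P.rootSpanMem ℤ (s : ι))) h =
      ((∏ s : b.support, (cartanEquiv b).symm h (.ofAdd (P.rootSpanMem ℤ (s : ι))) ^ k s : ℂˣ) : ℂ) := by
  change (((cartanEquiv b).symm h (.ofAdd (∑ s : b.support, k s • P.rootSpanMem ℤ (s : ι))) : ℂˣ) : ℂ) = _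
  rw [ofAdd_sum, map_prod]
  congr 1
  exact Finset.prod_congr rfl fun s _ => by rw [ofAdd_zsmul, map_zpow]

/-- The values at the simple roots identify the two copies of `H` with powers of `ℂˣ`. Under this
identification Laurent monomials are characters, and `IsRegular.mem_span_torusMonomials` applies. -/
lemma mem_span_tensor {f : HHU w → ℂ} (hf : f ∈ coordHHU w) :
    f ∈ Submodule.span ℂ {f | ∃ μ ν, ∃ F ∈ coordCell w, f = tensor w μ ν F} := by
  let Θ : (b.support ⊕ b.support → ℂˣ) × cellPos w → HHU w := fun p =>
    (cartanEquiv b (cochar (b := b) fun s => p.1 (.inl s)), cartanEquiv b (cochar (b := b) fun s => p.1 (.inr s)), p.2)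
  let Ψ : HHU w → (b.support ⊕ b.support → ℂˣ) × cellPos w := fun x =>
    (Sum.elim (fun s => (cartanEquiv b).symm x.1 (.ofAdd (P.rootSpanMem ℤ (s : ι))))
      fun s => (cartanEquiv b).symm x.2.1 (.ofAdd (P.rootSpanMem ℤ (s : ι))), x.2.2)
  have hΘΨ : ∀ x, Θ (Ψ x) = x := fun x => by
    simp only [Θ, Ψ, Sum.elim_inl, Sum.elim_inr, cochar_eq, MulEquiv.apply_symm_apply]
  let c : cellPos w → _ → ℂ := fun u => entries (u : adjointGroup b)
  have hX : ∀ j, IsRegular (torusCoord (A := b.support ⊕ b.support) c) fun p => torusCoord c p j := fun j => by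
    have := IsRegular.eval_comp (torusCoord (A := b.support ⊕ b.support) c) (MvPolynomial.X j)
    simp only [MvPolynomial.eval_X] at this
    exact this
  have h1 : IsRegular (torusCoord c) (f ∘ Θ) := by
    refine IsRegular.comp (show IsRegular _ f from hf) Θ ?_
    rintro ⟨i, j, l⟩
    fin_cases i
    · exact regMap_cochar (z := fun (p : (b.support ⊕ b.support → ℂˣ) × cellPos w) s => p.1 (.inl s))
        (fun s => hX (.inl (.inl s))) j l
    · exact regMap_cochar (z := fun (p : (b.support ⊕ b.support → ℂˣ) × cellPos w) s => p.1 (.inr s))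
        (fun s => hX (.inl (.inr s))) j l
    · exact hX (.inr (j, l))
  have h2 := h1.mem_span_torusMonomials
  have h3 := Submodule.mem_map_of_mem (f := LinearMap.funLeft ℂ ℂ Ψ) h2
  rw [Submodule.map_span] at h3
  have h4 : LinearMap.funLeft ℂ ℂ Ψ (f ∘ Θ) = f := funext fun x => congrArg f (hΘΨ x)
  rw [h4] at h3
  refine Submodule.span_mono ?_ h3
  rintro _ ⟨_, ⟨k, F, hF, rfl⟩, rfl⟩
  refine ⟨rootChar b (∑ s : b.support, k (.inl s) • P.rootSpanMem ℤ (s : ι)),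
    rootChar b (∑ s : b.support, k (.inr s) • P.rootSpanMem ℤ (s : ι)), F, hF, funext fun x => ?_⟩
  rw [tensor, ev_sum_zsmul, ev_sum_zsmul, ← Units.val_mul]
  simp only [LinearMap.funLeft_apply, Fintype.prod_sum_type, Ψ, Sum.elim_inl, Sum.elim_inr]

lemma linearIndependent_mul {X Z I J : Type*} {v : I → X → ℂ} {u : J → Z → ℂ} (hv : LinearIndependent ℂ v)
    (hu : LinearIndependent ℂ u) :
    LinearIndependent ℂ fun (p : I × J) (x : X × Z) => v p.1 x.1 * u p.2 x.2 := by
  classical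
  rw [linearIndependent_iff'']
  intro s g hg hs p
  rw [linearIndependent_iff'] at hv hu
  by_contra hp
  have hps : p ∈ s := by_contra fun h => hp (hg p h)
  rw [Finset.sum_subset (Finset.subset_product : s ⊆ s.image Prod.fst ×ˢ s.image Prod.snd)
    fun q _ hq => by rw [hg q hq, zero_smul], Finset.sum_product] at hs
  refine hp (hu (s.image Prod.snd) (fun j => g (p.1, j)) (funext fun z => ?_) p.2 (Finset.mem_image_of_mem _ hps))
  have := hv (s.image Prod.fst) (fun i => ∑ j ∈ s.image Prod.snd, g (i, j) * u j z) (funext fun x => ?_) p.1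
    (Finset.mem_image_of_mem _ hps)
  · simpa [Finset.sum_apply] using this
  · have h := congr_fun hs (x, z)
    simp only [Finset.sum_apply, Pi.smul_apply, smul_eq_mul, Pi.zero_apply] at h ⊢
    rw [← h]
    refine Finset.sum_congr rfl fun i _ => ?_
    rw [Finset.sum_mul]
    exact Finset.sum_congr rfl fun j _ => by ring

/-- Independent families in separate variables have independent products, and characters are
independent. Spanning reduces by linearity in `F` to `mem_span_tensor`. -/
lemma isBasisOf_tensor {𝔽 : Set (cellPos w → ℂ)} (h𝔽 : IsBasisOf 𝔽 (Subalgebra.toSubmodule (coordCell w))) :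
    IsBasisOf {f | ∃ μ ν, ∃ F ∈ 𝔽, f = tensor w μ ν F} (Subalgebra.toSubmodule (coordHHU w)) := by
  have h𝔽' : ∀ F ∈ 𝔽, F ∈ coordCell w := fun F hF => by
    rw [← Subalgebra.mem_toSubmodule, ← h𝔽.2]
    exact Submodule.subset_span hF
  refine ⟨?_, le_antisymm (Submodule.span_le.mpr ?_) fun f hf => ?_⟩
  · have h1 := linearIndependent_mul (linearIndependent_ev (b := b))
      (linearIndependent_mul (linearIndependent_ev (b := b)) h𝔽.1)
    have h2 : {f | ∃ μ ν, ∃ F ∈ 𝔽, f = tensor w μ ν F} = Set.range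
        fun (p : CharLattice b × CharLattice b × 𝔽) (x : cartan b × cartan b × cellPos w) =>
          ev p.1 x.1 * (ev p.2.1 x.2.1 * id p.2.2.1 x.2.2) := by
      ext f
      constructor
      · rintro ⟨μ, ν, F, hF, rfl⟩
        exact ⟨(μ, ν, ⟨F, hF⟩), funext fun x => (mul_assoc _ _ _).symm⟩
      · rintro ⟨⟨μ, ν, F, hF⟩, rfl⟩
        exact ⟨μ, ν, F, hF, funext fun x => (mul_assoc _ _ _).symm⟩
    rw [h2]
    exact h1.linearIndepOn_id
  · rintro _ ⟨μ, ν, F, hF, rfl⟩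
    exact tensor_mem_coordHHU μ ν (h𝔽' F hF)
  · refine (Submodule.span_le.mpr ?_) (mem_span_tensor hf)
    rintro _ ⟨μ, ν, F, hF, rfl⟩
    rw [← Subalgebra.mem_toSubmodule, ← h𝔽.2] at hF
    rw [SetLike.mem_coe]
    induction hF using Submodule.span_induction with
    | mem F hF => exact Submodule.subset_span ⟨μ, ν, F, hF, rfl⟩
    | zero =>
      have : tensor w μ ν 0 = 0 := funext fun x => mul_zero _
      rw [this]
      exact zero_mem _
    | add F G _ _ h h' =>
      have : tensor w μ ν (F + G) = tensor w μ ν F + tensor w μ ν G := funext fun x => mul_add _ _ _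
      rw [this]
      exact add_mem h h'
    | smul r F _ h =>
      have : tensor w μ ν (r • F) = r • tensor w μ ν F := funext fun x => mul_left_comm _ _ _
      rw [this]
      exact Submodule.smul_mem _ r h

lemma regMap_stdAtlas (hw : IsLongestWord w) (i : Fin 3) :
    RegMap (entriesHHU (w := w)) fun x => (stdAtlas hw x).1 i := by
  have hphi : RegMap (entriesHHU (w := w)) fun x => phi hw x.2.2 := fun i j =>
    (regMap_phi hw i j).comp (fun x : HHU w => x.2.2) fun i => regMap_thd i.1 i.2
  fin_cases i
  · exact regMap_const 1
  · exact (hphi.mul regMap_fst).mul (regMap_const _)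
  · exact (regMap_thd.mul regMap_snd).mul (regMap_const _)

/-- The standard configuration is an isomorphism of varieties. -/
lemma mem_coordConf₃_iff (hw : IsLongestWord w) (f : Conf₃ w → ℂ) :
    f ∈ coordConf₃ w ↔ f ∘ stdConf hw ∈ coordHHU w := by
  constructor
  · intro hf
    exact IsRegular.comp (show IsRegular _ _ from hf) (stdAtlas hw) fun i => regMap_stdAtlas hw i.1 i.2.1 i.2.2
  · intro hf
    choose x hx using exists_stdAtlas hw
    have h0 : (fun g : PinAtlas w => f (Quotient.mk _ g.toTriple)) = (f ∘ stdConf hw) ∘ x :=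
      funext fun g => congrArg f (stdConf_eq_of_forall hw (hx g)).symm
    have hg : ∀ i, RegMap (fun g : PinAtlas w => entriesPi g.1) fun g => g.1 i := regMap_apply _
    -- Dividing by the first element normalises the triple regularly. The coordinates are then
    -- triangular factors of its entries times `w̄₀`, and those factors are regular.
    have hr : ∀ i, RegMap (fun g : PinAtlas w => entriesPi g.1) fun g => (stdAtlas hw (x g)).1 i * wBar w :=
      fun i => by
        have : (fun g : PinAtlas w => (stdAtlas hw (x g)).1 i * wBar w) = fun g => (g.1 0)⁻¹ * g.1 i * wBar w := by
          ext1 g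
          rw [hx g i, inv_mul_cancel_left]
        rw [this]
        exact ((hg 0).inv.mul (hg i)).mul (regMap_const _)
    have e1 : RegMap (fun g : PinAtlas w => entriesPi g.1) fun g => ((x g).1 : adjointGroup b) := by
      refine RegMap.borelPos (v := fun g => phi hw (x g).2.2) (fun g => (phi_mem hw _).1)
        (fun g => Subgroup.mem_sup_left (x g).1.2) ?_
      have := hr 1
      simp only [stdAtlas_one, mul_assoc, hw.wBar_mul_self, mul_one] at this
      exact this
    have e2 : RegMap (fun g : PinAtlas w => entriesPi g.1)
        fun g => ((x g).2.2 : adjointGroup b) * ((x g).2.1 : adjointGroup b) := by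
      have := hr 2
      simp only [stdAtlas_two, mul_assoc, hw.wBar_mul_self, mul_one] at this
      exact this
    have e3 : RegMap (fun g : PinAtlas w => entriesPi g.1) fun g => ((x g).2.1 : adjointGroup b) := by
      refine RegMap.cartan
        (u := fun g => ((x g).2.1 : adjointGroup b)⁻¹ * (x g).2.2 * ((x g).2.1 : adjointGroup b)⁻¹⁻¹)
        (fun g => (x g).2.1.2)
        (fun g => cartan_conj_mem_unipPos (inv_mem (x g).2.1.2) (x g).2.2.2.1) ?_
      convert e2 using 2 with g
      group
    have e4 : RegMap (fun g : PinAtlas w => entriesPi g.1) fun g => ((x g).2.2 : adjointGroup b) := by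
      convert e2.mul e3.inv using 2 with g
      group
    change IsRegular _ fun g : PinAtlas w => f (Quotient.mk _ g.toTriple)
    rw [h0]
    refine IsRegular.comp (show IsRegular _ _ from hf) x ?_
    rintro ⟨i, j, l⟩
    fin_cases i
    · exact e1 j l
    · exact e3 j l
    · exact e4 j l

end ConfigurationCoordinates

/-! ### The cyclic shift on functions and independence of the marked point -/

section CyclicShift

variable [P.IsRootSystem] {w : List b.support}

/-- The cyclic shift on functions. -/
lemma tensor_comp_shift (hw : IsLongestWord w) {μ ν β : CharLattice b} {F : cellPos w → ℂ}
    (hF : F ∈ homogeneous w β) :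
    tensor w μ ν F ∘ ((stdConf hw).symm ∘ S₃ w ∘ stdConf hw) =
      tensor w (charStar w μ + charStar w ν + charStar w β) μ
        (Delta w (-charStar w μ - β) * F ∘ (twist w)^[4]) := by
  ext x
  obtain ⟨v, k, n, h⟩ := exists_cellData hw x.2.2.2
  have h1 : ((stdConf hw).symm ∘ S₃ w ∘ stdConf hw) x = shiftHHU hw x := by
    simp only [Function.comp_apply, S₃_stdConf, Equiv.symm_apply_apply]
  -- The third coordinate is the conjugate of `η⁴(u)`, the fourth iterate of the twist, by `h₁*
  -- k⁻¹`; homogeneity thus contributes `β*` at `h₁` and `-β` at `k`.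
  have h2 : F (shiftHHU hw x).2.2 =
      ev β (starH w x.1 * (⟨k, h.k_mem⟩ : cartan b)⁻¹) * F ((twist w)^[4] x.2.2) := by
    refine hF.2 _ _ _ ?_
    have h3 : starG w (twist w x.2.2) = k⁻¹ * ((twist w)^[4] x.2.2 : adjointGroup b) * k := by
      rw [coe_twist_iterate_four hw h]
      group
    change (starH w x.1 : adjointGroup b) * starG w (twist w x.2.2) * (starH w x.1 : adjointGroup b)⁻¹ = _
    rw [h3, Subgroup.coe_mul, Subgroup.coe_inv]
    group
  -- Since `w₀(k)` is `(k⁻¹)*`, this factor contributes `-μ*` at `k`, the other half of the index of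
  -- `Delta`.
  have h4 : ev μ (w₀H w ⟨k, h.k_mem⟩) = (ev (charStar w μ) ⟨k, h.k_mem⟩)⁻¹ := by
    rw [← hw.starH_inv, ← ev_charStar, ev_inv]
  have h5 : tensor w μ ν F (shiftHHU hw x) =
      ev μ (starH w x.1 * x.2.1 * w₀H w (bracketZero ((x.2.2 : adjointGroup b) * wBar w))) *
        ev ν (starH w x.1) * F (shiftHHU hw x).2.2 := rfl
  rw [Function.comp_apply, h1, h5, h2, delta_eq hw, tensor, Pi.mul_apply, Function.comp_apply]
  simp only [h.bracketZero_eq, ev_mul, h4, sub_eq_add_neg, ev_add, ev_neg, ev_inv, ev_charStar]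
  ring

lemma fDot_add_one (m : Fin 3) (c : ModuliTriangle w) : fDot w (m + 1) c = S₃ w (fDot w m c) := by
  induction c using Quotient.inductionOn with
  | h d =>
    have : d.rotate (m + 1) = (d.rotate m).rotate 1 := by
      ext i <;> simp [PinnedTriple.rotate, add_assoc]
    exact congrArg (Quotient.mk _) this

lemma mem_coordTriangle_iff (m : Fin 3) (f : ModuliTriangle w → ℂ) :
    f ∈ coordTriangle w ↔ f ∘ (fDot w m).symm ∈ coordConf₃ w := by
  have hrot : ∀ (m : Fin 3) (j : Fin 3 × (b.support ⊕ ι) × (b.support ⊕ ι)),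
      IsRegular (fun g : PinAtlas w => entriesPi g.1) fun g => entriesPi (g.rotate m).1 j := fun m j => by
    have := IsRegular.eval_comp (fun g : PinAtlas w => entriesPi g.1) (MvPolynomial.X (m + j.1, j.2))
    simp only [MvPolynomial.eval_X] at this
    exact this
  constructor
  · intro hf
    exact IsRegular.comp (show IsRegular _ _ from hf) (PinAtlas.rotate (-m)) (hrot (-m))
  · intro hf
    have h1 := IsRegular.comp (show IsRegular _ _ from hf) (PinAtlas.rotate m) (hrot m)
    have h2 : (fun g : PinAtlas w => f (Quotient.mk _ g.toTriple)) =
        (fun g : PinAtlas w => (f ∘ (fDot w m).symm) (Quotient.mk _ g.toTriple)) ∘ PinAtlas.rotate m := by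
      ext g
      exact congrArg f ((fDot w m).symm_apply_apply (Quotient.mk _ g.toTriple)).symm
    change IsRegular _ fun g : PinAtlas w => f (Quotient.mk _ g.toTriple)
    rw [h2]
    exact h1

lemma IsBasisOf.comp_equiv {X Y : Type*} {S : Set (X → ℂ)} {W : Submodule ℂ (X → ℂ)} (h : IsBasisOf S W)
    (e : X ≃ Y) {W' : Submodule ℂ (Y → ℂ)} (hW : ∀ f, f ∈ W' ↔ f ∘ e ∈ W) :
    IsBasisOf {f : Y → ℂ | f ∘ e ∈ S} W' := by
  let E : (X → ℂ) ≃ₗ[ℂ] (Y → ℂ) := LinearEquiv.funCongrLeft ℂ ℂ e.symm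
  have hE : ∀ f : Y → ℂ, E (f ∘ e) = f := fun f => funext fun y => congrArg f (e.apply_symm_apply y)
  have hE' : ∀ f : X → ℂ, E f ∘ e = f := fun f => funext fun x => congrArg f (e.symm_apply_apply x)
  have hS : {f : Y → ℂ | f ∘ e ∈ S} = E '' S := by
    ext f
    constructor
    · exact fun hf => ⟨_, hf, hE f⟩
    · rintro ⟨g, hg, rfl⟩
      rwa [Set.mem_ofPred_eq, hE']
  rw [hS]
  refine ⟨(h.1.map_injOn E.toLinearMap E.injective.injOn).id_image, ?_⟩
  have h1 : Submodule.span ℂ (E '' S) = (Submodule.span ℂ S).map E.toLinearMap :=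
    (Submodule.map_span E.toLinearMap S).symm
  rw [h1, h.2]
  ext f
  rw [hW]
  constructor
  · rintro ⟨g, hg, rfl⟩
    change E g ∘ e ∈ W
    rwa [hE']
  · exact fun hf => ⟨_, hf, hE f⟩

lemma isBasisOf_triangleBasis (hw : IsLongestWord w) (m : Fin 3) {𝔽 : Set (cellPos w → ℂ)}
    (h𝔽 : IsBasisOf 𝔽 (Subalgebra.toSubmodule (coordCell w))) :
    IsBasisOf (triangleBasis w (stdConf hw) m 𝔽) (Subalgebra.toSubmodule (coordTriangle w)) := by
  have hcomp : ∀ f : ModuliTriangle w → ℂ,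
      f ∘ (stdConf hw).trans (fDot w m).symm = f ∘ (fDot w m).symm ∘ stdConf hw := fun f => by
    rw [Equiv.coe_trans]
  have hset : triangleBasis w (stdConf hw) m 𝔽 =
      {f | f ∘ (stdConf hw).trans (fDot w m).symm ∈ {f | ∃ μ ν, ∃ F ∈ 𝔽, f = tensor w μ ν F}} := by
    ext f
    rw [Set.mem_ofPred_eq, hcomp, Set.mem_ofPred_eq, triangleBasis, Set.mem_ofPred_eq]
  rw [hset]
  refine (isBasisOf_tensor h𝔽).comp_equiv _ fun f => ?_
  rw [Subalgebra.mem_toSubmodule, Subalgebra.mem_toSubmodule, mem_coordTriangle_iff m, mem_coordConf₃_iff hw,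
    hcomp, Function.comp_assoc]

/-- The inclusions run around a cycle of length three, so no reverse inclusion has to be proved
separately. -/
lemma eq_of_add_one_subset {E : Type*} {T : Fin 3 → Set E} (h : ∀ m, T (m + 1) ⊆ T m) (m m' : Fin 3) :
    T m = T m' := by
  have H : ∀ m, T m = T 0 := by
    intro m
    fin_cases m
    · rfl
    · exact (h 0).antisymm ((h 2).trans (h 1))
    · exact ((h 1).trans (h 0)).antisymm (h 2)
  rw [H m, H m']

lemma comp_iterate_mem {X Y : Type*} {S : Set (X → Y)} {t : X → X} (ht : ∀ F ∈ S, F ∘ t ∈ S) (n : ℕ)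
    {F : X → Y} (hF : F ∈ S) : F ∘ t^[n] ∈ S := by
  induction n with
  | zero => exact hF
  | succ n ih =>
    rw [Function.iterate_succ]
    exact ht _ ih

/-- Passing from `m` to `m + 1` composes with the cyclic shift, so the formula for the shift
rewrites a basis function for `m + 1` as one for `m`. Homogeneity makes the formula applicable,
stability under the twist is used four times, and stability under `Delta` once. -/
lemma triangleBasis_add_one_subset (hw : IsLongestWord w) (m : Fin 3) {𝔽 : Set (cellPos w → ℂ)}
    (hG : ∀ F ∈ 𝔽, ∃ β, F ∈ homogeneous w β) (hT : ∀ F ∈ 𝔽, F ∘ twist w ∈ 𝔽)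
    (hM : ∀ ξ, ∀ F ∈ 𝔽, Delta w ξ * F ∈ 𝔽) :
    triangleBasis w (stdConf hw) (m + 1) 𝔽 ⊆ triangleBasis w (stdConf hw) m 𝔽 := by
  rintro f ⟨μ, ν, F, hF, hf⟩
  obtain ⟨β, hβ⟩ := hG F hF
  refine ⟨charStar w μ + charStar w ν + charStar w β, μ, Delta w (-charStar w μ - β) * F ∘ (twist w)^[4],
    hM _ _ (comp_iterate_mem hT 4 hF), ?_⟩
  rw [← tensor_comp_shift hw hβ, ← hf]
  ext x
  simp only [Function.comp_apply, Equiv.apply_symm_apply]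
  congr 1
  rw [Equiv.eq_symm_apply, fDot_add_one, Equiv.apply_symm_apply]

lemma triangleBasis_eq (hw : IsLongestWord w) {𝔽 : Set (cellPos w → ℂ)}
    (hG : ∀ F ∈ 𝔽, ∃ β, F ∈ homogeneous w β) (hT : ∀ F ∈ 𝔽, F ∘ twist w ∈ 𝔽)
    (hM : ∀ ξ, ∀ F ∈ 𝔽, Delta w ξ * F ∈ 𝔽) (m m' : Fin 3) :
    triangleBasis w (stdConf hw) m 𝔽 = triangleBasis w (stdConf hw) m' 𝔽 := by
  have h := fun m => triangleBasis_add_one_subset hw m hG hT hM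
  exact eq_of_add_one_subset (T := fun m => triangleBasis w (stdConf hw) m 𝔽) h m m'

end CyclicShift

end

end AdjointPinned

/-! ### The theorem -/

theorem lemma4p4 {ι M N : Type*} [Fintype ι] [DecidableEq ι] [AddCommGroup M] [Module ℂ M]
    [AddCommGroup N] [Module ℂ N] (P : RootPairing ι ℂ M N) [P.IsRootSystem] [P.IsCrystallographic]
    [P.IsReduced] (b : P.Base) (w : List b.support) (hw : IsLongestWord w) :
    -- all objects in the formulas are well defined
    (∀ u : cellPos w,
      wBar w * transpose b u ∈ G₀ b ∧ (twist w u : adjointGroup b) = bracketPos (wBar w * transpose b u) ∧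
      (u : adjointGroup b) * wBar w ∈ G₀ b ∧
      ∃! v : adjointGroup b, v ∈ cellNeg w ∧ v • flagPos b = (u : adjointGroup b) • flagNeg w) ∧
    (∀ g ∈ G₀ b, ∃! t, IsTriangular g t) ∧
    (∀ ξ : CharLattice b, (∃! D, IsDelta w ξ D) ∧ Delta w ξ ∈ coordCell w) ∧
    (∀ x : HHU w, ∃! c, IsStdConf w x c) ∧
    -- the standard configuration is an isomorphism of varieties
    ∃ C₃ : HHU w ≃ Conf₃ w, (∀ x, IsStdConf w x (C₃ x)) ∧
      (∀ f : Conf₃ w → ℂ, f ∈ coordConf₃ w ↔ f ∘ C₃ ∈ coordHHU w) ∧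
      -- the cyclic shift on points
      (∀ (h₁ h₂ : cartan b) (u : cellPos w), ∃ u' : cellPos w,
        (u' : adjointGroup b) =
          starH w h₁ * starG w (twist w u) * (starH w h₁ : adjointGroup b)⁻¹ ∧
        S₃ w (C₃ (h₁, h₂, u)) =
          C₃ (starH w h₁ * h₂ * w₀H w (bracketZero ((u : adjointGroup b) * wBar w)), starH w h₁, u')) ∧
      -- the cyclic shift on functions
      (∀ (μ ν β : CharLattice b) (F : cellPos w → ℂ), F ∈ homogeneous w β →
        tensor w μ ν F ∘ (C₃.symm ∘ S₃ w ∘ C₃) =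
          tensor w (charStar w μ + charStar w ν + charStar w β) μ
            (Delta w (-charStar w μ - β) * F ∘ (twist w)^[4])) ∧
      -- the bases of the coordinate ring of the moduli space of the triangle
      (∀ 𝔽 : Set (cellPos w → ℂ), IsBasisOf 𝔽 (Subalgebra.toSubmodule (coordCell w)) →
        (∀ F ∈ 𝔽, ∃ β, F ∈ homogeneous w β) →
        (∀ F ∈ 𝔽, F ∘ twist w ∈ 𝔽) →
        (∀ ξ, ∀ F ∈ 𝔽, Delta w ξ * F ∈ 𝔽) →
        (∀ m, IsBasisOf (triangleBasis w C₃ m 𝔽) (Subalgebra.toSubmodule (coordTriangle w))) ∧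
        ∀ m m', triangleBasis w C₃ m 𝔽 = triangleBasis w C₃ m' 𝔽) := by
  refine ⟨fun u => ?_, fun g hg => existsUnique_isTriangular hg,
    fun ξ => ⟨existsUnique_isDelta hw ξ, delta_mem_coordCell hw ξ⟩,
    fun x => ⟨stdConf hw x, isStdConf_stdConf hw x, fun c hc => hc.eq hw⟩,
    stdConf hw, isStdConf_stdConf hw, mem_coordConf₃_iff hw,
    fun h₁ h₂ u => ⟨(shiftHHU hw (h₁, h₂, u)).2.2, rfl, S₃_stdConf hw (h₁, h₂, u)⟩,
    fun μ ν β F hF => tensor_comp_shift hw hF,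
    fun 𝔽 h𝔽 hG hT hM => ⟨fun m => isBasisOf_triangleBasis hw m h𝔽, triangleBasis_eq hw hG hT hM⟩⟩
  obtain ⟨v, k, n, h⟩ := exists_cellData hw u.2
  exact ⟨h.mem_G₀' hw, (coe_twist hw h).trans (h.bracketPos_eq hw).symm, h.mem_G₀,
    existsUnique_cellNeg hw u⟩
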